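/- **Setting.** Let $n\ge 0$. A crossingless matching of the points $1,\dots,2n$ on a line is a fixed-point-free involution of these points, drawn as arcs, with no $i<j<k<l$ such that $i$ is matched with $k$ and $j$ with $l$. For crossingless matchings $a,b$ let $W(a)b$ be the closed one-manifold obtained by gluing the mirror image of $a$ to $b$. Let $\beta=\beta_n$ be the finite set of pairs $h=(W(a)b,\sigma)$, with $\sigma$ a labeling of the circles of $W(a)b$ by $\pm$; $a$ is the left and $b$ the right matching of $h$. Put $\deg h=n+\#\{\text{circles labeled }-\}-\#\{\text{circles labeled }+\}$ and $m(h)=(W(b)a,\sigma)$, the mirror of $h$. Let $I_\beta=\prod_{h\in\beta}\mathbb Z$, with elementary idempotents $e_h$. *Arc algebra.* $H^n$ is free over $\mathbb Z$ on $\beta$. The product $h_1h_2$ of $h_1=(W(a)b,\sigma_1)$ and $h_2=(W(b')c,\sigma_2)$ is $0$ if $b\ne b'$; if $b=b'$ it is the image of $\sigma_1\otimes\sigma_2$ under the map assigned by Khovanov's TQFT (merge: $(+,+)\mapsto +$, $(+,-),(-,+)\mapsto -$, $(-,-)\mapsto 0$; split: $+\mapsto(+,-)+(-,+)$, $-\mapsto(-,-)$)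 to the minimal saddle cobordism $W(a)b\sqcup W(b)c\to W(a)c$, with one saddle for each arc of $b$. If $a'$ is obtained from $a$ by surgery on a bridge $\gamma$ (i.e. the two crossingless matchings differ in exactly two arcs), let $h_\gamma=(W(a)a',\text{all }+)$; for an arc $\alpha$ of $a$ let $h_\alpha=(W(a)a,\ -\text{ exactly on the circle of }\alpha)$. *The algebra $B$.* $B=B_R(H^n)$ is the ring generated inside $\mathrm{End}_{\mathbb Z}(H^n)$, with the product $xy=$ ($x$ first, then $y$), by the projections $e_h$ onto basis elements and by the maps $e(h_1,h_2)$ sending $h_1$ to $h_2$ and all other basis elements to $0$, for the pairs $(h_1,h_2)$ such that $h_2$ occurs with nonzero coefficient in $h_1h_\gamma$ for some $\gamma$ (then $e(h_1,h_2)$ is called a bridge generator $b_{\gamma;h_1,h_2}$) or in $h_1h_\alpha$ for some $\alpha$ (then it is a decoration generator $b_{C;h_1,h_2}$, with $C$ the circle whose label changes from $+$ to $-$). Let $V$ be the $I_\beta$-bimodule with $\mathbb Z$-basis these generators, $b=e(h_1,h_2)$ having left idempotent $e_{h_1}$ and right idempotent $e_{h_2}$, and write $B=T(V)/J$ (tensor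 products over $I_\beta$). The generator $e(h_1,h_2)$ has bidegree (intrinsic, homological) $\left(\tfrac12(\deg h_1-\deg h_2),0\right)$. *The quadratic dual.* Let $J_2=J\cap(V\oplus V\otimes V)$, let $I\subset V\otimes V$ be its projection, and let $\varphi:I\to V$ be the map with $\varphi(r)+r\in J_2$. Let $V^*$ have the dual basis $b^*$, where $b^*$ has the same left and right idempotents as $b$, and minus its intrinsic degree and homological degree $1$. Then $B^!=T(V^*)/(I^\perp)$ with $I^\perp\subset V^*\otimes V^*$ the annihilator of $I$, and its differential is induced from $\varphi^*:V^*\to I^*=(V^*\otimes V^*)/I^\perp$ and the Leibniz rule $\mu_1(xy)=(-1)^{\deg_h y}\mu_1(x)y+x\mu_1(y)$. This Leibniz rule and $\deg\mu_1=(0,1)$ are required of all differential bigraded algebras below. The mirror $m(A)$ of an algebra $A$ over $I_\beta$ is the same differential bigraded ring with the idempotent $e_h$ renamed $e_{m(h)}$; elements $x\in A$ are written $m(x)$ in $m(A)$. Thus $m(B)^!=m(B^!)$ has generators $m(b^*)$. *The product algebra.* $B\odot m(B)^!=T(V_{full})/J_{full}$, where $V_{full}$ is the $I_\beta$-bimodule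 with basis all $b$ and all $m(b^*)$, and the two-sided ideal $J_{full}$ is generated by $J_2$, by the mirror $m(I^\perp)$ of $I^\perp$, and by the following elements (whenever all generators written exist, have the idempotents indicated, and the words are composable; $\gamma,\gamma',\eta,\eta'$ are bridges and $C,C',C''$ circles): 1. $b_{\gamma;h_1,h_2}\,m(b^*_{\eta';m(h_2),m(h_3)})-m(b^*_{\eta;m(h_1),m(h_2')})\,b_{\gamma';h_2',h_3}$ for every possible $h_2'$; 2. $b_{C;h_1,h_2}\,m(b^*_{\eta';m(h_2),m(h_3)})-m(b^*_{\eta;m(h_1),m(h_2')})\,b_{C';h_2',h_3}$ for every possible $h_2'$; 3. $b_{\gamma;h_1,h_2}\,m(b^*_{C;m(h_2),m(h_3)})-m(b^*_{C;m(h_1),m(h_2')})\,b_{\gamma';h_2',h_3}$ if $C$ is not involved in the surgery on $\gamma$; 4. $b_{C;h_1,h_2}\,m(b^*_{C';m(h_2),m(h_3)})-m(b^*_{C';m(h_1),m(h_2')})\,b_{C;h_2',h_3}$ for two different circles $C\neq C'$; 5. $b_{\gamma;h_1,h_2}\,m(b^*_{C;m(h_2),m(h_3)})-m(b^*_{C';m(h_1),m(h_2')})\,b_{\gamma;h_2',h_3}-m(b^*_{C'';m(h_1),m(h_2'')})\,b_{\gamma;h_2'',h_3}$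 if $\gamma$ joins $C'$ and $C''$ to form $C$, and $b_{\gamma;h_1,h_2'}\,m(b^*_{C';m(h_2'),m(h_3)})+b_{\gamma;h_1,h_2''}\,m(b^*_{C'';m(h_2''),m(h_3)})-m(b^*_{C;m(h_1),m(h_2)})\,b_{\gamma;h_2,h_3}$ if $\gamma$ splits $C$ into $C'$ and $C''$. The differential is to be $0$ on the generators $b$ and, on the generators $m(b^*)$, that of $m(B)^!$. *The algebra $B\Gamma_n$.* It is the quotient of $B\odot m(B)^!$ by the following relations. Let $\gamma,\gamma'$ be bridges such that surgery on $\gamma$ leads from $h_1$ to $h_2$ and splits a circle $C$ labeled $+$ into two circles $C_1,C_2$, and the subsequent surgery on $\gamma'$ leads from $h_2$ to $h_3$ and joins $C_1,C_2$ to the circle $C$, now labeled $-$, where the right matchings of $h_1$ and $h_3$ are different. Then for every path $h_1\to k_2\to h_3$ along two bridges $\eta,\eta'$ such that the right matchings of $h_2$ and $k_2$ are different, $$m(b^*_{\gamma;h_1,h_2})\,m(b^*_{\gamma';h_2,h_3})+m(b^*_{\eta;h_1,k_2})\,m(b^*_{\eta';k_2,h_3})=0 .$$ *DD bimodules.* Let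 $A,A'$ be differential bigraded algebras with degree-zero part (in the bigrading) equal to $I_\beta$. A rank-one Type DD bimodule over $A$ and $A'$ is given by an $I_\beta$-bilinear map $\delta:I_\beta\to A\otimes_{I_\beta}(A')^{op}$ of bidegree $(0,1)$ which satisfies the Type DD structure relations $$(\mu_1\otimes|\mathrm{id}|)\circ\delta+(\mathrm{id}\otimes\mu_1)\circ\delta+(\mu_2\otimes\mu_2)\circ\sigma\circ(\mathrm{id}\otimes\delta\otimes\mathrm{id})\circ\delta=0,$$ where $|\mathrm{id}|(x)=(-1)^{\deg_h x}x$ and $\sigma$ multiplies $b_1\otimes b_2\otimes b_3^{op}\otimes b_4^{op}$ by $(-1)^{(\deg_h b_2)(\deg_h b_4)}$. Define $I_\beta$-bilinear maps $\delta_1,\delta_2:I_\beta\to (B\odot m(B)^!)\otimes_{I_\beta}\big(m(B\odot m(B)^!)\big)^{op}$ by $$\delta_1(1)=\sum_b b\otimes(b^*)^{op},\qquad \delta_2(1)=\sum_b m(b^*)\otimes m(b)^{op},$$ the sums being over all generators $b$ of $B$, with $b^*=m(m(b^*))$. **Statement.** For every $n$: (i) The prescribed values on generators define a differential on $B\odot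 m(B)^!$, making it a differential bigraded algebra over $I_\beta$ (with bidegree-zero part $I_\beta$). The map $\delta_1+\delta_2$ is $I_\beta$-bilinear of bidegree $(0,1)$ and satisfies the Type DD structure relations; hence it defines a rank-one Type DD bimodule over $B\odot m(B)^!$ and $m(B\odot m(B)^!)$. (ii) This differential and this bigrading descend to $B\Gamma_n$, making it a differential bigraded algebra over $I_\beta$, and the composition of $\delta_1+\delta_2$ with the quotient projections to $B\Gamma_n$ and $m(B\Gamma_n)$ defines a rank-one Type DD bimodule over $B\Gamma_n$ and $m(B\Gamma_n)$. -/

import Mathlib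

open scoped TensorProduct

noncomputable section

/-- The usual module structure of a tensor product, preferred to the `ℤ`-module structure of its
additive group (which is propositionally the same). -/
instance tensorIntModule {M N : Type} [AddCommMonoid M] [AddCommMonoid N] [Module ℤ M]
    [Module ℤ N] : Module ℤ (M ⊗[ℤ] N) := TensorProduct.instModule

/-! ## Crossingless matchings, circles, and the basis of the arc algebra

The `2n` points on the line are the elements of `Fin (2 * n)`, ordered from bottom to top. -/

/-- A crossingless matching of `2n` points; `partner i` is the point matched with `i`. -/
@[ext]
structure Matching (n : ℕ) where
  partner : Fin (2 * n) → Fin (2 * n)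
  invol : ∀ i, partner (partner i) = i
  no_fixed : ∀ i, partner i ≠ i
  noncrossing : ∀ i j, ¬ (i < j ∧ j < partner i ∧ partner i < partner j)

/-- `x` and `y` lie on the same circle of the one-manifold obtained by gluing the arcs
`{x, u x}` and the arcs `{x, v x}` (with `u`, `v` fixed-point-free involutions). -/
def SameCircle {P : Type} (u v : P → P) : P → P → Prop :=
  Relation.ReflTransGen (fun x y => y = u x ∨ y = v x)

/-- A basis element `(W(a)b, σ)` of the arc algebra: `a = left`, `b = right`, and `σ` is recorded
as a function on the points which is constant on the arcs of `a` and `b`, i.e. constant on the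
circles of `W(a)b`.  `minus i = true` means that the circle through `i` is labeled `-`. -/
@[ext]
structure ArcBasis (n : ℕ) where
  left : Matching n
  right : Matching n
  minus : Fin (2 * n) → Bool
  minus_left : ∀ i, minus (left.partner i) = minus i
  minus_right : ∀ i, minus (right.partner i) = minus i

instance (n : ℕ) : DecidableEq (Matching n) := Classical.decEq _

instance (n : ℕ) : Finite (Matching n) :=
  Finite.of_injective Matching.partner (fun _ _ h => Matching.ext h)

instance (n : ℕ) : Finite (ArcBasis n) :=
  Finite.of_injective (fun h : ArcBasis n => (h.left, h.right, h.minus)) (fun x y h => by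
    simp only [Prod.mk.injEq] at h
    exact ArcBasis.ext h.1 h.2.1 h.2.2)

instance (n : ℕ) : Fintype (ArcBasis n) := Fintype.ofFinite _

instance (n : ℕ) : DecidableEq (ArcBasis n) := Classical.decEq _

namespace ArcBasis

variable {n : ℕ}

open Classical in
/-- The circle of `W(a)b` through `i`, as a set of points of the line. -/
def circle (h : ArcBasis n) (i : Fin (2 * n)) : Finset (Fin (2 * n)) :=
  Finset.univ.filter (SameCircle h.left.partner h.right.partner i)

/-- The set of circles of `W(a)b`. -/
def circles (h : ArcBasis n) : Finset (Finset (Fin (2 * n))) :=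
  Finset.univ.image h.circle

open Classical in
/-- The degree in `H^n`: a circle labeled `+` counts `-1`, a circle labeled `-` counts `+1`, and
everything is shifted by `n`. -/
def degree (h : ArcBasis n) : ℤ :=
  n + ∑ C ∈ h.circles, if ∃ i ∈ C, h.minus i = true then 1 else -1

/-- Reflection across the line: `(W(a)b, σ) ↦ (W(b)a, m(σ))`. -/
def mirror (h : ArcBasis n) : ArcBasis n where
  left := h.right
  right := h.left
  minus := h.minus
  minus_left := h.minus_right
  minus_right := h.minus_left

end ArcBasis

/-- Mirroring as an involutive permutation of the basis. -/
def mirrorPerm (n : ℕ) : Equiv.Perm (ArcBasis n) where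
  toFun := ArcBasis.mirror
  invFun := ArcBasis.mirror
  left_inv _ := rfl
  right_inv _ := rfl

/-! ## Multiplication in the arc algebra `H^n` -/

open Classical in
/-- Matrix entry, from the labeling `s` to the labeling `t`, of the map that Khovanov's TQFT
assigns to the saddle which replaces the two arcs `{p, v p}`, `{q, v q}` by the two arcs
`{p, v' p}`, `{q, v' q}` (with `v' p = v q` and `v' q = v p`).  Circles through neither `p` nor
`q` keep their labels.
If `p`, `q` lie on one circle it is split: `+ ↦ (+,-) + (-,+)`, `- ↦ (-,-)`.
If they lie on two circles these are merged: `(+,+) ↦ +`, `(+,-), (-,+) ↦ -`, `(-,-) ↦ 0`. -/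
def saddle {P : Type} (u v v' : P → P) (p q : P) (s t : P → Bool) : ℤ :=
  if (∀ x, t (u x) = t x ∧ t (v' x) = t x) ∧
     (∀ x, ¬ SameCircle u v p x → ¬ SameCircle u v q x → t x = s x) ∧
     (if SameCircle u v p q then
        (if s p = true then t p = true ∧ t q = true else t p ≠ t q)
      else
        ¬ (s p = true ∧ s q = true) ∧ t p = (s p || s q))
  then 1 else 0

/-- The inner arcs after surgery of `W(a)b ⊔ W(b)c` along those arcs of `b` whose endpoints are in
`S`.  The point `(false, i)` is the point `i` of `W(a)b`, and `(true, i)` is the point `i` of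
`W(b)c`. -/
def innerArcs {n : ℕ} (b : Matching n) (S : Finset (Fin (2 * n))) :
    Bool × Fin (2 * n) → Bool × Fin (2 * n) :=
  fun x => if x.2 ∈ S then (!x.1, x.2) else (x.1, b.partner x.2)

/-- Matrix entry of the composition of the saddles along the arcs of `b` with one endpoint in the
list, where the arcs with endpoints in `S` have already been surgered. -/
def saddles {n : ℕ} (u : Bool × Fin (2 * n) → Bool × Fin (2 * n)) (b : Matching n) :
    List (Fin (2 * n)) → Finset (Fin (2 * n)) →
    (Bool × Fin (2 * n) → Bool) → (Bool × Fin (2 * n) → Bool) → ℤ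
  | [], _, s, t => if s = t then 1 else 0
  | i :: l, S, s, t =>
      ∑ r : Bool × Fin (2 * n) → Bool,
        saddle u (innerArcs b S) (innerArcs b (insert i (insert (b.partner i) S)))
          (false, i) (true, b.partner i) s r *
        saddles u b l (insert i (insert (b.partner i) S)) r t

/-- The coefficient of `h₃` in the product `h₁ · h₂` in `H^n`, for `h₁ = (W(a)b, σ₁)` and
`h₂ = (W(b)c, σ₂)`: the map assigned to the minimal cobordism from `W(a)b ⊔ W(b)c` to `W(a)c`,
a composition of one saddle for each arc of `b`. -/
def mulCoeff {n : ℕ} (h₁ h₂ h₃ : ArcBasis n) : ℤ :=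
  if h₁.right = h₂.left ∧ h₃.left = h₁.left ∧ h₃.right = h₂.right then
    saddles
      (fun x => (x.1, if x.1 then h₂.right.partner x.2 else h₁.left.partner x.2))
      h₁.right
      ((List.finRange (2 * n)).filter (fun i => i < h₁.right.partner i)) ∅
      (fun x => if x.1 then h₂.minus x.2 else h₁.minus x.2)
      (fun x => h₃.minus x.2)
  else 0

/-- `b` is obtained from `a` by surgering one pair of arcs along a bridge, that is, the two
crossingless matchings differ in exactly one pair of arcs (four points). -/
def IsSurgery {n : ℕ} (a b : Matching n) : Prop :=
  (Finset.univ.filter (fun i => a.partner i ≠ b.partner i)).card = 4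

/-- The multiplicative generators of `H^n`: the elements `h_γ = (W(a)a', all plus)` with `a'` a
surgery of `a`, and the elements `h_α = (W(a)a, minus exactly on the circle of the arc α)`. -/
def IsMultGen {n : ℕ} (h : ArcBasis n) : Prop :=
  (IsSurgery h.left h.right ∧ ∀ i, h.minus i = false) ∨
  (h.left = h.right ∧ ∃ i, ∀ j, h.minus j = true ↔ (j = i ∨ j = h.left.partner i))

/-! ## The algebra `B = B_R(H^n)` and its generators -/

/-- The multiplicative generators of `B`: the pairs `(h₁, h₂)` such that `h₂` occurs with nonzero
coefficient in `h₁ · h` for some multiplicative generator `h` of `H^n`. -/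
def Gen (n : ℕ) : Type :=
  {p : ArcBasis n × ArcBasis n // ∃ h, IsMultGen h ∧ mulCoeff p.1 h p.2 ≠ 0}

instance (n : ℕ) : Finite (Gen n) := Subtype.finite

instance (n : ℕ) : Fintype (Gen n) := Fintype.ofFinite _

instance (n : ℕ) : DecidableEq (Gen n) := Classical.decEq _

namespace Gen

variable {n : ℕ}

/-- The left idempotent `h₁` of the generator `e(h₁, h₂)`. -/
def src (g : Gen n) : ArcBasis n := g.1.1

/-- The right idempotent `h₂` of the generator `e(h₁, h₂)`. -/
def tgt (g : Gen n) : ArcBasis n := g.1.2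

/-- `g` is a bridge generator `b_γ` (coming from some `h_γ`). -/
def IsBridge (g : Gen n) : Prop := g.src.right ≠ g.tgt.right

/-- `g` is a decoration generator `b_C` (coming from some `h_α`). -/
def IsDecoration (g : Gen n) : Prop := g.src.right = g.tgt.right

/-- For a decoration generator `b_C`: the circle `C`. -/
def flipped (g : Gen n) : Finset (Fin (2 * n)) :=
  Finset.univ.filter (fun i => g.src.minus i ≠ g.tgt.minus i)

open Classical in
/-- For a bridge generator `b_γ`: the four endpoints of the two arcs surgered by `γ`.  The circles
involved in the surgery are those which contain one of these points. -/
def ends (g : Gen n) : Finset (Fin (2 * n)) :=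
  Finset.univ.filter (fun i => g.src.right.partner i ≠ g.tgt.right.partner i)

/-- The surgery splits the circle `C` into `C'` and `C''`. -/
def Splits (g : Gen n) (C C' C'' : Finset (Fin (2 * n))) : Prop :=
  C ∈ g.src.circles ∧ C' ∈ g.tgt.circles ∧ C'' ∈ g.tgt.circles ∧ C' ≠ C'' ∧ C = C' ∪ C''

/-- The surgery joins the circles `C'` and `C''` to `C`. -/
def Joins (g : Gen n) (C' C'' C : Finset (Fin (2 * n))) : Prop :=
  C' ∈ g.src.circles ∧ C'' ∈ g.src.circles ∧ C ∈ g.tgt.circles ∧ C' ≠ C'' ∧ C = C' ∪ C''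

/-- The intrinsic degree `(deg h₁ - deg h₂) / 2` of `e(h₁, h₂)`. -/
def intrinsic (g : Gen n) : ℚ := ((g.src.degree - g.tgt.degree : ℤ) : ℚ) / 2

end Gen

/-- `B = B_R(H^n)`: the subalgebra of `Hom_{I_n}(H^n, H^n)` generated by the idempotents and by
the elements `e(h₁, h₂)` of `Gen n`.  The endomorphism `e(h₁, h₂)`, sending `h₁` to `h₂` and the
other basis elements to `0`, is the matrix unit at `(h₁, h₂)`, matrices acting on row vectors, so
that `e(h₁, h₂) e(h₂, h₃) = e(h₁, h₃)`. -/
def BR (n : ℕ) : Subalgebra ℤ (Matrix (ArcBasis n) (ArcBasis n) ℤ) :=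
  Algebra.adjoin ℤ
    (Set.range (fun h : ArcBasis n => Matrix.single h h (1 : ℤ)) ∪
     Set.range (fun g : Gen n => Matrix.single g.src g.tgt (1 : ℤ)))

/-- A generator as an element of `B`. -/
def Gen.toBR {n : ℕ} (g : Gen n) : BR n :=
  ⟨Matrix.single g.src g.tgt 1, Algebra.subset_adjoin (Or.inr ⟨g, rfl⟩)⟩

/-- Composable pairs of generators.  They index the basis `b_i ⊗ b_j` of `V ⊗_R V`, where `V` is
spanned by the generators of `B` and `R` is the idempotent ring. -/
def GenPair (n : ℕ) : Type := {p : Gen n × Gen n // p.1.tgt = p.2.src}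

instance (n : ℕ) : Finite (GenPair n) := Subtype.finite

instance (n : ℕ) : Fintype (GenPair n) := Fintype.ofFinite _

/-- The linear-quadratic relations `J₂ = J ∩ (V ⊕ V ⊗_R V)` of `B = T(V) / J`. -/
def linQuadRelations (n : ℕ) : Submodule ℤ ((Gen n → ℤ) × (GenPair n → ℤ)) where
  carrier := {z | ∑ g, z.1 g • g.toBR + ∑ p : GenPair n, z.2 p • (p.1.1.toBR * p.1.2.toBR) = 0}
  zero_mem' := by simp
  add_mem' := by
    intro x y hx hy
    simp only [Set.mem_ofPred_eq, Prod.fst_add, Prod.snd_add, Pi.add_apply, add_smul,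
      Finset.sum_add_distrib] at hx hy ⊢
    rw [add_add_add_comm, hx, hy, add_zero]
  smul_mem' := by
    intro c x hx
    simp only [Set.mem_ofPred_eq, Prod.smul_fst, Prod.smul_snd, Pi.smul_apply, smul_assoc,
      ← Finset.smul_sum, ← smul_add] at hx ⊢
    rw [hx, smul_zero]

/-- `I`, the projection of `J₂` to `V ⊗_R V`. -/
def quadPart (n : ℕ) : Submodule ℤ (GenPair n → ℤ) :=
  (linQuadRelations n).map (LinearMap.snd ℤ _ _)

/-- `I^⊥ ⊂ V^* ⊗_R V^*`, the relations of the quadratic dual `B^!`. -/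
def dualRelations (n : ℕ) : Set (GenPair n → ℤ) :=
  {f | ∀ z ∈ quadPart n, ∑ p, f p * z p = 0}

/-- `f ∈ V^* ⊗_R V^*` represents `φ^*(b^*) ∈ I^* = (V^* ⊗_R V^*) / I^⊥`, where `φ : I → V` is the
map with `(φ r, r) ∈ J₂` for `r ∈ I`. -/
def RepresentsDual {n : ℕ} (b : Gen n) (f : GenPair n → ℤ) : Prop :=
  ∀ z ∈ linQuadRelations n, ∑ p, f p * z.2 p = z.1 b

theorem exists_representsDual {n : ℕ} (b : Gen n) : ∃ f, RepresentsDual b f := by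
  classical
  refine ⟨fun p => if p.1.1.src = b.src ∧ p.1.2.tgt = b.tgt then -1 else 0, fun z hz => ?_⟩
  have h0 : ∑ g, z.1 g • g.toBR + ∑ p : GenPair n, z.2 p • (p.1.1.toBR * p.1.2.toBR) = 0 := hz
  have h1 := congrFun (congrFun (congrArg (BR n).val h0) b.src) b.tgt
  have e1 : ∀ g : Gen n,
      (Matrix.single g.src g.tgt (1 : ℤ)) b.src b.tgt = if g = b then 1 else 0 := by
    intro g
    rw [Matrix.single_apply]
    refine if_congr ⟨fun h => Subtype.ext (Prod.ext h.1 h.2), fun h => by rw [h]; simp⟩ rfl rfl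
  have e2 : ∀ p : GenPair n,
      (Matrix.single p.1.1.src p.1.1.tgt (1 : ℤ) * Matrix.single p.1.2.src p.1.2.tgt (1 : ℤ))
        b.src b.tgt = if p.1.1.src = b.src ∧ p.1.2.tgt = b.tgt then 1 else 0 := by
    intro p
    rw [p.2, Matrix.single_mul_single_same, Matrix.single_apply]
    simp
  simp only [map_add, map_sum, map_zsmul, map_mul, Subalgebra.coe_val, Gen.toBR,
    Matrix.add_apply, Matrix.sum_apply, Matrix.smul_apply, e1, e2, map_zero,
    Matrix.zero_apply] at h1
  simp only [smul_eq_mul, mul_ite, mul_one, mul_zero, Finset.sum_ite_eq', Finset.mem_univ,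
    if_true] at h1
  have h2 : ∑ p : GenPair n, (if p.1.1.src = b.src ∧ p.1.2.tgt = b.tgt then (-1 : ℤ) else 0) *
      z.2 p = - ∑ p : GenPair n, (if p.1.1.src = b.src ∧ p.1.2.tgt = b.tgt then z.2 p else 0) := by
    rw [← Finset.sum_neg_distrib]
    refine Finset.sum_congr rfl fun p _ => ?_
    split_ifs <;> simp
  rw [h2]
  linarith

/-- A lift of `φ^*(b^*)` to `V^* ⊗_R V^*`; its class modulo `I^⊥` is the differential of the
generator `b^*` of `B^!`, and does not depend on the lift. -/
def dualDifferential {n : ℕ} (b : Gen n) : GenPair n → ℤ := (exists_representsDual b).choose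

/-! ## The product algebra of `B` and `m(B)^!` -/

/-- The letters: the elementary idempotents, the generators `b` of `B`, and the generators
`m(b^*)` of `m(B)^!`. -/
inductive Letter (n : ℕ) : Type
  | idem (h : ArcBasis n)
  | right (b : Gen n)
  | left (b : Gen n)

namespace Letter

variable {n : ℕ}

/-- The letters in the free ring. -/
def E (h : ArcBasis n) : FreeAlgebra ℤ (Letter n) := FreeAlgebra.ι ℤ (idem h)

/-- The letter `b`. -/
def X (b : Gen n) : FreeAlgebra ℤ (Letter n) := FreeAlgebra.ι ℤ (right b)

/-- The letter `m(b^*)`, going from `m(h₁)` to `m(h₂)` if `b` goes from `h₁` to `h₂`. -/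
def Y (b : Gen n) : FreeAlgebra ℤ (Letter n) := FreeAlgebra.ι ℤ (left b)

/-- The bidegree (intrinsic, homological). -/
def bidegree : Letter n → ℚ × ℤ
  | idem _ => (0, 0)
  | right b => (b.intrinsic, 0)
  | left b => (-b.intrinsic, 1)

end Letter

/-- The words `b m(c^*)` and `m(c'^*) b'` have the same left and the same right idempotents, and
both words are composable. -/
structure IsWordSquare {n : ℕ} (b c c' b' : Gen n) : Prop where
  start : b.src = c'.src.mirror
  mid : b.tgt = c.src.mirror
  mid' : c'.tgt.mirror = b'.src
  finish : c.tgt.mirror = b'.tgt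

open Letter in
/-- The relations `J_extra` between the generators of `B` and of `m(B)^!`. -/
inductive ExtraRel (n : ℕ) : FreeAlgebra ℤ (Letter n) → FreeAlgebra ℤ (Letter n) → Prop
  /-- two bridges commute -/
  | bridge_bridge (b c c' b' : Gen n) (hs : IsWordSquare b c c' b')
      (hb : b.IsBridge) (hc : c.IsBridge) (hc' : c'.IsBridge) (hb' : b'.IsBridge) :
      ExtraRel n (X b * Y c) (Y c' * X b')
  /-- decorations of `B` commute with bridges of `m(B)^!` -/
  | decoration_bridge (b c c' b' : Gen n) (hs : IsWordSquare b c c' b')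
      (hb : b.IsDecoration) (hc : c.IsBridge) (hc' : c'.IsBridge) (hb' : b'.IsDecoration) :
      ExtraRel n (X b * Y c) (Y c' * X b')
  /-- a bridge `γ` of `B` commutes with the decoration of a circle not involved in `γ` -/
  | bridge_decoration (b c c' b' : Gen n) (hs : IsWordSquare b c c' b')
      (hb : b.IsBridge) (hc : c.IsDecoration) (hc' : c'.IsDecoration) (hb' : b'.IsBridge)
      (hC : c.flipped = c'.flipped) (hdisj : Disjoint c.flipped b.ends) :
      ExtraRel n (X b * Y c) (Y c' * X b')
  /-- decorations of two different circles commute -/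
  | decoration_decoration (b c c' b' : Gen n) (hs : IsWordSquare b c c' b')
      (hb : b.IsDecoration) (hc : c.IsDecoration) (hc' : c'.IsDecoration) (hb' : b'.IsDecoration)
      (hB : b.flipped = b'.flipped) (hC : c.flipped = c'.flipped) :
      ExtraRel n (X b * Y c) (Y c' * X b')
  /-- the bridge joins the circles of `c₁` and `c₂` to the circle of `c` -/
  | join (b c c₁ b₁ c₂ b₂ : Gen n) (hs₁ : IsWordSquare b c c₁ b₁) (hs₂ : IsWordSquare b c c₂ b₂)
      (hb : b.IsBridge) (hb₁ : b₁.IsBridge) (hb₂ : b₂.IsBridge)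
      (hc : c.IsDecoration) (hc₁ : c₁.IsDecoration) (hc₂ : c₂.IsDecoration)
      (hj : b.Joins c₁.flipped c₂.flipped c.flipped) :
      ExtraRel n (X b * Y c) (Y c₁ * X b₁ + Y c₂ * X b₂)
  /-- the bridge splits the circle of `c` into the circles of `c₁` and `c₂` -/
  | split (b₁ c₁ b₂ c₂ c b : Gen n) (hs₁ : IsWordSquare b₁ c₁ c b) (hs₂ : IsWordSquare b₂ c₂ c b)
      (hb : b.IsBridge) (hb₁ : b₁.IsBridge) (hb₂ : b₂.IsBridge)
      (hc : c.IsDecoration) (hc₁ : c₁.IsDecoration) (hc₂ : c₂.IsDecoration)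
      (hj : b.Splits c.flipped c₁.flipped c₂.flipped) :
      ExtraRel n (X b₁ * Y c₁ + X b₂ * Y c₂) (Y c * X b)

open Letter in
/-- The defining relations of the product algebra `T(V_full) / J_full`.  The first six families
present the tensor algebra `T(V_full)` over the idempotent ring; the others are the
linear-quadratic relations of `B`, the relations of `m(B)^!`, and `J_extra`. -/
inductive FullRel (n : ℕ) : FreeAlgebra ℤ (Letter n) → FreeAlgebra ℤ (Letter n) → Prop
  | idem_mul (h k : ArcBasis n) : FullRel n (E h * E k) (if h = k then E h else 0)
  | idem_sum : FullRel n (∑ h, E h) 1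
  | right_src (b : Gen n) : FullRel n (E b.src * X b) (X b)
  | right_tgt (b : Gen n) : FullRel n (X b * E b.tgt) (X b)
  | left_src (b : Gen n) : FullRel n (E b.src.mirror * Y b) (Y b)
  | left_tgt (b : Gen n) : FullRel n (Y b * E b.tgt.mirror) (Y b)
  | lin_quad (z : (Gen n → ℤ) × (GenPair n → ℤ)) (hz : z ∈ linQuadRelations n) :
      FullRel n (∑ g, z.1 g • X g + ∑ p : GenPair n, z.2 p • (X p.1.1 * X p.1.2)) 0
  | dual (f : GenPair n → ℤ) (hf : f ∈ dualRelations n) :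
      FullRel n (∑ p : GenPair n, f p • (Y p.1.1 * Y p.1.2)) 0
  | extra (x y : FreeAlgebra ℤ (Letter n)) (h : ExtraRel n x y) : FullRel n x y

/-- The product algebra of `B` and `m(B)^!`. -/
def FullAlg (n : ℕ) : Type := RingQuot (FullRel n)

instance (n : ℕ) : Ring (FullAlg n) := inferInstanceAs (Ring (RingQuot (FullRel n)))

namespace FullAlg

variable {n : ℕ}

/-- The class of an element of the free ring. -/
def mk (n : ℕ) : FreeAlgebra ℤ (Letter n) →+* FullAlg n := RingQuot.mkRingHom (FullRel n)

/-- The elementary idempotents. -/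
def idem (h : ArcBasis n) : FullAlg n := mk n (Letter.E h)

/-- The image of the generator `b` of `B`. -/
def right (b : Gen n) : FullAlg n := mk n (Letter.X b)

/-- The image of the generator `m(b^*)` of `m(B)^!`. -/
def left (b : Gen n) : FullAlg n := mk n (Letter.Y b)

/-- The summand of given bidegree: the span of the words of this total bidegree. -/
def gr (n : ℕ) (p : ℚ × ℤ) : Submodule ℤ (FullAlg n) :=
  Submodule.span ℤ {x | ∃ w : List (Letter n), (w.map Letter.bidegree).sum = p ∧
    x = mk n ((w.map (FreeAlgebra.ι ℤ)).prod)}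

end FullAlg

/-! ## The quotient algebra `BΓ_n` -/

open FullAlg in
/-- The extra relations of `BΓ_n`.  For bridges `γ ≠ η` such that the surgery on `γ` splits a circle
labeled `+` and the following surgery on `η'` joins the two new circles to a circle labeled `-`,
every word doing `γ` first anticommutes with every word doing `η` first. -/
inductive GammaRel (n : ℕ) : FullAlg n → FullAlg n → Prop
  | tetrahedron (b₁ b₂ c₁ c₂ : Gen n) (hb : b₁.tgt = b₂.src) (hc : c₁.tgt = c₂.src)
      (hsrc : b₁.src = c₁.src) (htgt : b₂.tgt = c₂.tgt)
      (hb₁ : b₁.IsBridge) (hb₂ : b₂.IsBridge) (hc₁ : c₁.IsBridge) (hc₂ : c₂.IsBridge)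
      (hdag : b₁.src.right ≠ b₂.tgt.right) (hne : b₁.tgt.right ≠ c₁.tgt.right)
      (C C₁ C₂ : Finset (Fin (2 * n)))
      (hsplit : b₁.Splits C C₁ C₂) (hplus : ∀ i ∈ C, b₁.src.minus i = false)
      (hjoin : b₂.Joins C₁ C₂ C) (hminus : ∀ i ∈ C, b₂.tgt.minus i = true) :
      GammaRel n (left b₁ * left b₂ + left c₁ * left c₂) 0

/-- The algebra `BΓ_n`. -/
def GammaAlg (n : ℕ) : Type := RingQuot (GammaRel n)

instance (n : ℕ) : Ring (GammaAlg n) := inferInstanceAs (Ring (RingQuot (GammaRel n)))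

/-- The quotient projection onto `BΓ_n`. -/
def GammaAlg.proj (n : ℕ) : FullAlg n →+* GammaAlg n := RingQuot.mkRingHom (GammaRel n)

/-! ## Differential bigraded algebras and rank-one Type DD bimodules -/

/-- The structure of a differential bigraded algebra on the ring `A`, over the coefficient ring
`R = ι → ℤ`.  The bigrading is (intrinsic, homological). -/
structure DGStructure (ι A : Type) [Ring A] where
  coeff : (ι → ℤ) →+* A
  coeff_injective : Function.Injective coeff
  gr : ℚ × ℤ → Submodule ℤ A
  internal : DirectSum.IsInternal gr
  mul_mem : ∀ {p q x y}, x ∈ gr p → y ∈ gr q → x * y ∈ gr (p + q)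
  mem_gr_zero : ∀ x, x ∈ gr 0 ↔ ∃ r, coeff r = x
  d : A →ₗ[ℤ] A
  d_coeff_mul : ∀ r x, d (coeff r * x) = coeff r * d x
  d_mul_coeff : ∀ r x, d (x * coeff r) = d x * coeff r
  d_mem : ∀ {p x}, x ∈ gr p → d x ∈ gr (p + (0, 1))
  leibniz : ∀ (x : A) {q : ℚ × ℤ} {y : A}, y ∈ gr q →
    d (x * y) = (q.2.negOnePow : ℤ) • (d x * y) + x * d y
  d_d : ∀ x, d (d x) = 0

namespace DGStructure

variable {ι A A' : Type} [Ring A] [Ring A']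

/-- The mirror of a differential bigraded algebra with respect to a permutation of the elementary
idempotents: the same differential bigraded ring, with mirrored action of the coefficients. -/
def mirror (S : DGStructure ι A) (m : Equiv.Perm ι) : DGStructure ι A where
  coeff := S.coeff.comp (RingEquiv.piCongrLeft (fun _ => ℤ) m).symm.toRingHom
  coeff_injective := S.coeff_injective.comp (RingEquiv.injective _)
  gr := S.gr
  internal := S.internal
  mul_mem := S.mul_mem
  mem_gr_zero x := (S.mem_gr_zero x).trans
    ⟨fun ⟨r, hr⟩ => ⟨RingEquiv.piCongrLeft (fun _ => ℤ) m r, by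
        rw [← hr]
        exact congrArg S.coeff (RingEquiv.symm_apply_apply _ r)⟩,
      fun ⟨r, hr⟩ => ⟨_, hr⟩⟩
  d := S.d
  d_coeff_mul _ := S.d_coeff_mul _
  d_mul_coeff _ := S.d_mul_coeff _
  d_mem := S.d_mem
  leibniz := S.leibniz
  d_d := S.d_d

/-- The linear map on `A` with prescribed values on the homogeneous elements. -/
def ofHomogeneous (S : DGStructure ι A) {M : Type} [AddCommMonoid M]
    [Module ℤ M] (f : ∀ p, S.gr p →ₗ[ℤ] M) : A →ₗ[ℤ] M :=
  DirectSum.toModule ℤ (ℚ × ℤ) M f ∘ₗ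
    (LinearEquiv.ofBijective (DirectSum.coeLinearMap S.gr) S.internal).symm.toLinearMap

/-- `|id|^j`: multiplication by `(-1)^(j * deg_h)`. -/
def absId (S : DGStructure ι A) (j : ℤ) : A →ₗ[ℤ] A :=
  S.ofHomogeneous fun p => ((j * p.2).negOnePow : ℤ) • (S.gr p).subtype

/-- The projection of `A ⊗_ℤ (A')^op` onto `⨁ i, A e_i ⊗_ℤ e_i (A')^op`. -/
def balance [Fintype ι] [DecidableEq ι] (S : DGStructure ι A) (S' : DGStructure ι A') :
    A ⊗[ℤ] A' →ₗ[ℤ] A ⊗[ℤ] A' :=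
  ∑ i, TensorProduct.map (LinearMap.mulRight ℤ (S.coeff (Pi.single i 1)))
    (LinearMap.mulRight ℤ (S'.coeff (Pi.single i 1)))

/-- `A ⊗_R (A')^op`, realized as the direct summand `⨁ i, A e_i ⊗_ℤ e_i (A')^op` of
`A ⊗_ℤ (A')^op`, with `e_i` the elementary idempotents of `R`.  An element `a ⊗ a'` of `A ⊗ A'`
stands for `a ⊗ (a')^op`. -/
def tensorR [Fintype ι] [DecidableEq ι] (S : DGStructure ι A) (S' : DGStructure ι A') :
    Submodule ℤ (A ⊗[ℤ] A') :=
  LinearMap.range (balance S S')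

/-- The summand of `tensorR` is the quotient of `A ⊗_ℤ (A')^op` by the relations
`a r ⊗ (a')^op = a ⊗ r (a')^op` of the tensor product over `R`: `balance` is a projection onto it
and its kernel is spanned by these relations. -/
theorem ker_balance [Fintype ι] [DecidableEq ι] (S : DGStructure ι A) (S' : DGStructure ι A') :
    LinearMap.ker (balance S S') = Submodule.span ℤ
      {t | ∃ (a : A) (r : ι → ℤ) (a' : A'), t = (a * S.coeff r) ⊗ₜ a' - a ⊗ₜ (a' * S'.coeff r)} := by
  have hsingle : ∀ (r : ι → ℤ) (i : ι),
      r * Pi.single i (1 : ℤ) = r i • Pi.single i (1 : ℤ) := by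
    intro r i
    ext j
    by_cases h : j = i
    · subst h; simp
    · simp [h]
  apply le_antisymm
  · intro t ht
    have key : ∀ t : A ⊗[ℤ] A', t - balance S S' t ∈ Submodule.span ℤ
        {t | ∃ (a : A) (r : ι → ℤ) (a' : A'),
          t = (a * S.coeff r) ⊗ₜ[ℤ] a' - a ⊗ₜ (a' * S'.coeff r)} := by
      intro t
      induction t with
      | zero => simp
      | add x y hx hy =>
        rw [map_add, add_sub_add_comm]
        exact add_mem hx hy
      | tmul a a' =>
        have h1 : a ⊗ₜ[ℤ] a' = ∑ i, (a * S.coeff (Pi.single i 1)) ⊗ₜ[ℤ] a' := by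
          rw [← TensorProduct.sum_tmul, ← Finset.mul_sum, ← map_sum,
            Finset.univ_sum_single (fun _ : ι => (1 : ℤ))]
          have : S.coeff (fun _ => 1) = 1 := map_one S.coeff
          rw [this, mul_one]
        have h2 : a ⊗ₜ[ℤ] a' - balance S S' (a ⊗ₜ[ℤ] a') =
            ∑ i, ((a * S.coeff (Pi.single i 1) * S.coeff (Pi.single i 1)) ⊗ₜ[ℤ] a' -
              (a * S.coeff (Pi.single i 1)) ⊗ₜ[ℤ] (a' * S'.coeff (Pi.single i 1))) := by
          rw [Finset.sum_sub_distrib]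
          congr 1
          · rw [h1]
            refine Finset.sum_congr rfl fun i _ => ?_
            rw [mul_assoc, ← map_mul, hsingle]
            simp
          · simp [balance, LinearMap.sum_apply]
        rw [h2]
        exact sum_mem fun i _ => Submodule.subset_span ⟨_, _, _, rfl⟩
    have := key t
    rwa [LinearMap.mem_ker.mp ht, sub_zero] at this
  · rw [Submodule.span_le]
    rintro _ ⟨a, r, a', rfl⟩
    simp only [SetLike.mem_coe, LinearMap.mem_ker, map_sub, sub_eq_zero, balance,
      LinearMap.sum_apply, TensorProduct.map_tmul, LinearMap.mulRight_apply, mul_assoc,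
      ← map_mul, hsingle, map_zsmul, mul_smul_comm, TensorProduct.smul_tmul]

/-- `id ⊗ δ ⊗ id`, for a rank-one map `δ`: the map
`b₁ ⊗ b₄^op ↦ b₁ ⊗ δ(1) ⊗ b₄^op`.  The tensor factors `(A ⊗ A) ⊗ (A' ⊗ A')` are in the order
`b₁ ⊗ b₂ ⊗ b₃^op ⊗ b₄^op`. -/
def idTensorId (t : A ⊗[ℤ] A') : A ⊗[ℤ] A' →ₗ[ℤ] (A ⊗[ℤ] A) ⊗[ℤ] (A' ⊗[ℤ] A') :=
  TensorProduct.lift <| LinearMap.mk₂ ℤ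
    (fun b₁ b₄ => TensorProduct.map (TensorProduct.mk ℤ A A b₁)
      ((TensorProduct.mk ℤ A' A').flip b₄) t)
    (fun x y z => by rw [map_add, TensorProduct.map_add_left, LinearMap.add_apply])
    (fun c x y => by rw [map_smul, TensorProduct.map_smul_left, LinearMap.smul_apply])
    (fun x y z => by rw [map_add, TensorProduct.map_add_right, LinearMap.add_apply])
    (fun c x y => by rw [map_smul, TensorProduct.map_smul_right, LinearMap.smul_apply])

/-- The sign flip `b₁ ⊗ b₂ ⊗ b₃^op ⊗ b₄^op ↦ (-1)^(deg_h b₂ * deg_h b₄)` times itself. -/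
def signFlip (S : DGStructure ι A) (S' : DGStructure ι A') :
    (A ⊗[ℤ] A) ⊗[ℤ] (A' ⊗[ℤ] A') →ₗ[ℤ] (A ⊗[ℤ] A) ⊗[ℤ] (A' ⊗[ℤ] A') :=
  TensorProduct.lift <| LinearMap.flip <| TensorProduct.lift <| LinearMap.flip <|
    S'.ofHomogeneous fun q => LinearMap.mk₂ ℤ
      (fun (b₄ : S'.gr q) (b₃ : A') =>
        (TensorProduct.mk ℤ (A ⊗[ℤ] A) (A' ⊗[ℤ] A')).flip (b₃ ⊗ₜ (b₄ : A')) ∘ₗ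
          TensorProduct.map LinearMap.id (S.absId q.2))
      (fun x y z => by
        rw [Submodule.coe_add, TensorProduct.tmul_add, map_add, LinearMap.add_comp])
      (fun c x y => by
        rw [Submodule.coe_smul, TensorProduct.tmul_smul, map_smul, LinearMap.smul_comp]; rfl)
      (fun x y z => by rw [TensorProduct.add_tmul, map_add, LinearMap.add_comp])
      (fun c x y => by rw [← TensorProduct.smul_tmul', map_smul, LinearMap.smul_comp]; rfl)

/-- `μ₂ ⊗ μ₂`: the map `b₁ ⊗ b₂ ⊗ b₃^op ⊗ b₄^op ↦ b₁ b₂ ⊗ b₃^op b₄^op = b₁ b₂ ⊗ (b₄ b₃)^op`. -/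
def mulTensorMul : (A ⊗[ℤ] A) ⊗[ℤ] (A' ⊗[ℤ] A') →ₗ[ℤ] A ⊗[ℤ] A' :=
  TensorProduct.map (LinearMap.mul' ℤ A)
    (LinearMap.mul' ℤ A' ∘ₗ (TensorProduct.comm ℤ A' A').toLinearMap)

/-- `δ : R → A ⊗_R (A')^op` is the structure map of a rank-one Type DD bimodule over the
differential bigraded algebras `A` and `A'`: an `R`-bilinear map of degree `(0, +1)` satisfying
the Type DD structure relations. -/
structure IsRankOneDD [Fintype ι] [DecidableEq ι] (S : DGStructure ι A) (S' : DGStructure ι A')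
    (δ : (ι → ℤ) →ₗ[ℤ] A ⊗[ℤ] A') : Prop where
  mem_tensorR : ∀ r, δ r ∈ tensorR S S'
  left_linear : ∀ r s, δ (r * s) =
    TensorProduct.map (LinearMap.mulLeft ℤ (S.coeff r)) LinearMap.id (δ s)
  right_linear : ∀ r s, δ (s * r) =
    TensorProduct.map LinearMap.id (LinearMap.mulLeft ℤ (S'.coeff r)) (δ s)
  degree : ∀ r, δ r ∈ Submodule.span ℤ
    {t | ∃ p q x y, x ∈ S.gr p ∧ y ∈ S'.gr q ∧ p + q = (0, 1) ∧ t = x ⊗ₜ[ℤ] y}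
  relation : ∀ r,
    TensorProduct.map S.d (S'.absId 1) (δ r)
      + TensorProduct.map LinearMap.id S'.d (δ r)
      + (mulTensorMul ∘ₗ signFlip S S' ∘ₗ idTensorId (δ 1)) (δ r) = 0

end DGStructure

/-! ## The differential bigraded structures and the DD maps -/

/-- `S` is the differential bigraded algebra structure of the product algebra: the differential
vanishes on the generators of `B` and is induced from that of `m(B)^!` on the others. -/
structure IsFullDG {n : ℕ} (S : DGStructure (ArcBasis n) (FullAlg n)) : Prop where
  coeff_single : ∀ h, S.coeff (Pi.single h 1) = FullAlg.idem h
  gr_eq : S.gr = FullAlg.gr n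
  d_right : ∀ b, S.d (FullAlg.right b) = 0
  d_left : ∀ b, S.d (FullAlg.left b) =
    ∑ p : GenPair n, dualDifferential b p • (FullAlg.left p.1.1 * FullAlg.left p.1.2)

/-- `T` is the differential bigraded algebra structure which `BΓ_n` inherits, as a quotient, from
the structure `S` of the product algebra. -/
structure IsGammaDG {n : ℕ} (S : DGStructure (ArcBasis n) (FullAlg n))
    (T : DGStructure (ArcBasis n) (GammaAlg n)) : Prop where
  coeff_eq : ∀ r, T.coeff r = GammaAlg.proj n (S.coeff r)
  gr_eq : ∀ p, T.gr p = (S.gr p).map (GammaAlg.proj n).toAddMonoidHom.toIntLinearMap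
  d_proj : ∀ x, T.d (GammaAlg.proj n x) = GammaAlg.proj n (S.d x)

/-- `δ₁(e_h) = ∑ b ⊗ (b^*)^op`, the sum over the generators `b` of `B` with left idempotent `h`.
Here `b^* = m(m(b^*))` lies in `B^! = m(m(B)^!)`, which maps to the mirror of the product
algebra. -/
def delta₁ (n : ℕ) : (ArcBasis n → ℤ) →ₗ[ℤ] FullAlg n ⊗[ℤ] FullAlg n :=
  ∑ b : Gen n, (LinearMap.proj b.src).smulRight (FullAlg.right b ⊗ₜ[ℤ] FullAlg.left b)

/-- `δ₂(e_h) = ∑ m(b^*) ⊗ m(b)^op`, the sum over the generators `m(b^*)` of `m(B)^!` with left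
idempotent `h`. -/
def delta₂ (n : ℕ) : (ArcBasis n → ℤ) →ₗ[ℤ] FullAlg n ⊗[ℤ] FullAlg n :=
  ∑ b : Gen n, (LinearMap.proj b.src.mirror).smulRight (FullAlg.left b ⊗ₜ[ℤ] FullAlg.right b)

/-- The tensor product of the quotient projections onto `BΓ_n` and its mirror. -/
def projTensor (n : ℕ) : FullAlg n ⊗[ℤ] FullAlg n →ₗ[ℤ] GammaAlg n ⊗[ℤ] GammaAlg n :=
  TensorProduct.map (GammaAlg.proj n).toAddMonoidHom.toIntLinearMap
    (GammaAlg.proj n).toAddMonoidHom.toIntLinearMap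

end

/-! The proof combines a topological input with a purely algebraic mechanism.

Topological input. Multiplication by `h_γ` is the TQFT map of a single saddle, and multiplication by
`h_α` is multiplication by the variable of one circle. Hence the generators of `B` are the pairs of
basis elements related by one saddle on the right matching (a bridge, raising the degree by 1) or by
turning one circle from plus to minus (a decoration, raising it by 2); this is
`ArcBasis.exists_multGen_iff`. A saddle on the right and a saddle on the left commute, so the
numbers of two-step paths in the two orders agree (`ArcBasis.card_bridge_comm`). Circle variables
commute with saddles (`SaddleStep.relabel_iff`), so a bridge followed by a decoration always sits in
a square of one of three types: the circle is away from the bridge, arises from a join, or arises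
from a split (`ArcBasis.exists_square`).

Algebraic mechanism. In `B` a word depends only on its two end idempotents. Dually, let `Y` be the
matrix of the letters `m(b^*)`, indexed by idempotents. The quadratic relations of the dual say that
an entry of `Y²` vanishes unless a generator has the same ends, and the differential is `dY = -Y²`
(`FullAlg.sum_dualDifferential`). By degrees, `Y²` vanishes at bridges and agrees at decorations
with the square of the bridge part `Y_B`. Let `X_B` be the matrix of the bridge letters `b`, and
`X_z` that of the decoration letters of the circle through a point `z`. The extra relations together
with the path counts say that `X_B` commutes with `Y_B` and with the decoration part of `Y`, and
that `X_z` commutes with `Y_B`. So `X_B` and `X_z` commute with `Y_B²`; since `Y_B²` is supported on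
decorations, its entries give what is needed for the differential to respect the extra relations.
Finally `d² = 0` because `Y` commutes with `Y²`.

No normal form of the algebra is needed: each structure is a ring homomorphism out of the
presentation. The bigrading is a coaction with values in the group ring of bidegrees, the idempotent
ring is split off by an augmentation, and the differential is the lower left entry of `x ↦ (|x|, 0;
dx, x)`.

Type DD relation. Let `R` and `L` be the matrices with entries `b ⊗ b^*` and `m(b^*) ⊗ m(b)`. The
quadratic term of the structure relation is `R² + L² + LR - RL`. As words of `B` depend only on
their ends, `R²` has entries `b ⊗ Y²`, which `id ⊗ μ₁` cancels, and symmetrically `L²` is cancelled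
by `μ₁ ⊗ |id|`. The identity `RL = LR` (`FullAlg.ddRight_mul_ddLeft`) is checked on the four blocks
of bridges and decorations. The relations of `BΓ_n` are homogeneous cycles killed by the
augmentation, so every structure descends, and Type DD structures push forward along homomorphisms
(`DGStructure.IsRankOneDD.map`). -/

/-! ## Saddles between partitions, and the labelings they relate -/

section Saddle

variable {P Q : Type}

/-- The partitions `r` and `r'` differ by a saddle at `p` and `q`: one of them separates `p` from
`q`, and the other one is obtained from it by uniting the classes of `p` and `q`. -/
structure IsSaddle (r r' : Setoid P) (p q : P) : Prop where
  xor : r p q ↔ ¬ r' p q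
  le : ∀ x y, r' x y → r x y ∨ (r x p ∧ r q y) ∨ (r x q ∧ r p y)
  ge : ∀ x y, r x y → r' x y ∨ (r' x p ∧ r' q y) ∨ (r' x q ∧ r' p y)

theorem IsSaddle.symm {r r' : Setoid P} {p q : P} (h : IsSaddle r r' p q) :
    IsSaddle r' r p q :=
  ⟨by have := h.xor; tauto, h.ge, h.le⟩

theorem IsSaddle.comap {r r' : Setoid P} {m : Q → P} {p q : Q}
    (h : IsSaddle r r' (m p) (m q)) : IsSaddle (r.comap m) (r'.comap m) p q :=
  ⟨h.xor, fun x y => h.le (m x) (m y), fun x y => h.ge (m x) (m y)⟩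

/-- The labels `t` on the classes of `r'` occur in the image of the labels `s` on the classes of
`r` under the map that the TQFT assigns to a saddle at `p` and `q`. -/
structure SaddleStep (r r' : Setoid P) (p q : P) (s t : P → Bool) : Prop where
  const : ∀ x y, r x y → s x = s y
  const' : ∀ x y, r' x y → t x = t y
  away : ∀ x, ¬ r p x → ¬ r q x → t x = s x
  split : r p q → if s p = true then t p = true ∧ t q = true else t p ≠ t q
  merge : ¬ r p q → ¬ (s p = true ∧ s q = true) ∧ t p = (s p || s q)

open Classical in
/-- The labeling `s` with the class of `z` relabeled by `b`. -/
noncomputable def relabel (r : Setoid P) (z : P) (b : Bool) (s : P → Bool) : P → Bool :=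
  fun x => if r z x then b else s x

theorem relabel_const {r : Setoid P} {s : P → Bool} (z : P) (b : Bool)
    (hs : ∀ x y, r x y → s x = s y) (x y : P) (h : r x y) :
    relabel r z b s x = relabel r z b s y := by
  have : r z x ↔ r z y := ⟨fun h' => r.trans h' h, fun h' => r.trans h' (r.symm h)⟩
  by_cases hx : r z x
  · simp [relabel, hx, this.1 hx]
  · simp [relabel, hx, mt this.2 hx, hs x y h]

theorem relabel_relabel (r : Setoid P) (z : P) (b c : Bool) (s : P → Bool) :
    relabel r z b (relabel r z c s) = relabel r z b s := by
  funext x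
  by_cases h : r z x <;> simp [relabel, h]

theorem relabel_self {r : Setoid P} {s : P → Bool} {z : P} {b : Bool}
    (hs : ∀ x y, r x y → s x = s y) (h : s z = b) : relabel r z b s = s := by
  funext x
  by_cases hx : r z x
  · simp [relabel, hx, ← h, hs _ _ hx]
  · simp [relabel, hx]

theorem relabel_apply_self (r : Setoid P) (z : P) (b : Bool) (s : P → Bool) :
    relabel r z b s z = b := by
  simp [relabel]

theorem relabel_of_rel {r : Setoid P} {z x : P} (h : r z x) (b : Bool) (s : P → Bool) :
    relabel r z b s x = b := by
  simp [relabel, h]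

theorem relabel_of_not_rel {r : Setoid P} {z x : P} (h : ¬ r z x) (b : Bool) (s : P → Bool) :
    relabel r z b s x = s x := by
  simp [relabel, h]

theorem IsSaddle.class_iff {r r' : Setoid P} {p q : P} (h : IsSaddle r r' p q) (hpq : r p q)
    (x : P) : r p x ↔ r' p x ∨ r' q x := by
  obtain ⟨x1, x2, x3⟩ := h
  have e := r.refl
  have e' := r'.refl
  have f := fun x y => @Setoid.symm' _ r x y
  have f' := fun x y => @Setoid.symm' _ r' x y
  have g := fun x y z => @Setoid.trans' _ r x y z
  have g' := fun x y z => @Setoid.trans' _ r' x y z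
  constructor
  · intro hx
    rcases x3 _ _ hx with h | h | h
    · exact Or.inl h
    · exact Or.inr h.2
    · exact Or.inl h.2
  · rintro (hx | hx)
    · rcases x2 _ _ hx with h | h | h
      · exact h
      · exact g _ _ _ hpq h.2
      · exact h.2
    · rcases x2 _ _ hx with h | h | h
      · exact g _ _ _ hpq h
      · exact g _ _ _ hpq h.2
      · exact h.2

theorem IsSaddle.away_iff {r r' : Setoid P} {p q : P} (h : IsSaddle r r' p q) (hpq : r p q)
    {x : P} (hx : ¬ r p x) (y : P) : r x y ↔ r' x y := by
  have hc := h.class_iff hpq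
  obtain ⟨x1, x2, x3⟩ := h
  have f := fun x y => @Setoid.symm' _ r x y
  have f' := fun x y => @Setoid.symm' _ r' x y
  have g := fun x y z => @Setoid.trans' _ r x y z
  constructor
  · intro hy
    rcases x3 _ _ hy with h | h | h
    · exact h
    · exact absurd ((hc x).2 (Or.inl (f' _ _ h.1))) hx
    · exact absurd ((hc x).2 (Or.inr (f' _ _ h.1))) hx
  · intro hy
    rcases x2 _ _ hy with h | h | h
    · exact h
    · exact absurd (f _ _ h.1) hx
    · exact absurd (g _ _ _ hpq (f _ _ h.1)) hx

/-- The comultiplication as a relabeling (`true` stands for minus): a minus circle splits into two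
minus halves, so the label function does not change, while exactly one half of a plus circle is
turned to minus. -/
theorem SaddleStep.split_iff {r r' : Setoid P} {p q : P} (h : IsSaddle r r' p q) (hpq : r p q)
    (s t : P → Bool) : SaddleStep r r' p q s t ↔ (∀ x y, r x y → s x = s y) ∧
      ((s p = true ∧ t = s) ∨
        (s p = false ∧ (t = relabel r' p true s ∨ t = relabel r' q true s))) := by
  have hc := h.class_iff hpq
  have ha := fun x => @IsSaddle.away_iff _ _ _ _ _ h hpq x
  have hn : ¬ r' p q := h.xor.1 hpq
  have hn' : ¬ r' q p := fun h' => hn (r'.symm h')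
  constructor
  · rintro ⟨a1, a2, a3, a4, -⟩
    refine ⟨a1, ?_⟩
    have a4 := a4 hpq
    have aw : ∀ x, ¬ r p x → t x = s x := fun x hx =>
      a3 x hx fun hq => hx (r.trans hpq hq)
    rcases hs : s p with _ | _
    · refine Or.inr ⟨rfl, ?_⟩
      rw [hs, if_neg (by simp)] at a4
      rcases ht : t p with _ | _
      · right
        funext x
        by_cases hx : r p x
        · rcases (hc x).1 hx with hx' | hx'
          · have : ¬ r' q x := fun h => hn (r'.trans hx' (r'.symm h))
            rw [relabel_of_not_rel this, ← a1 _ _ hx, hs, ← a2 _ _ hx', ht]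
          · rw [relabel_of_rel hx', ← a2 _ _ hx']
            simpa [ht] using a4
        · rw [relabel_of_not_rel (fun h => hx ((hc x).2 (Or.inr h))), aw x hx]
      · left
        funext x
        by_cases hx : r p x
        · rcases (hc x).1 hx with hx' | hx'
          · rw [relabel_of_rel hx', ← a2 _ _ hx', ht]
          · have : ¬ r' p x := fun h => hn (r'.trans h (r'.symm hx'))
            rw [relabel_of_not_rel this, ← a1 _ _ hx, hs, ← a2 _ _ hx']
            simpa [ht] using a4
        · rw [relabel_of_not_rel (fun h => hx ((hc x).2 (Or.inl h))), aw x hx]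
    · refine Or.inl ⟨rfl, ?_⟩
      rw [hs, if_pos rfl] at a4
      funext x
      by_cases hx : r p x
      · rw [← a1 _ _ hx, hs]
        rcases (hc x).1 hx with hx' | hx'
        · rw [← a2 _ _ hx', a4.1]
        · rw [← a2 _ _ hx', a4.2]
      · exact aw x hx
  · have le : ∀ x y, r' x y → r x y := by
      intro x y hxy
      by_cases hx : r p x
      · have : r p y := by
          rcases (hc x).1 hx with hx' | hx'
          · exact (hc y).2 (Or.inl (r'.trans hx' hxy))
          · exact (hc y).2 (Or.inr (r'.trans hx' hxy))
        exact r.trans (r.symm hx) this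
      · exact (ha x hx y).2 hxy
    rintro ⟨a1, ⟨a2, rfl⟩ | ⟨a2, rfl | rfl⟩⟩
    · exact ⟨a1, fun x y h => a1 x y (le x y h), fun _ _ _ => rfl,
        fun _ => by simp [a2, ← a1 _ _ hpq], fun h => absurd hpq h⟩
    · refine ⟨a1, relabel_const _ _ fun x y h => a1 x y (le x y h), fun x hx _ => ?_,
        fun _ => ?_, fun h => absurd hpq h⟩
      · rw [relabel_of_not_rel (fun h => hx (le _ _ h))]
      · rw [relabel_apply_self, relabel_of_not_rel hn, ← a1 _ _ hpq, a2]; simp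
    · refine ⟨a1, relabel_const _ _ fun x y h => a1 x y (le x y h), fun x _ hx => ?_,
        fun _ => ?_, fun h => absurd hpq h⟩
      · rw [relabel_of_not_rel (fun h => hx (le _ _ h))]
      · rw [relabel_apply_self, relabel_of_not_rel hn', a2]; simp

/-- The multiplication as a relabeling: two plus circles merge without changing the label function,
a plus and a minus circle merge to a minus circle, and two minus circles give nothing. -/
theorem SaddleStep.merge_iff {r r' : Setoid P} {p q : P} (h : IsSaddle r r' p q)
    (hpq : ¬ r p q) (s t : P → Bool) : SaddleStep r r' p q s t ↔ (∀ x y, r x y → s x = s y) ∧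
      ((s p = false ∧ s q = false ∧ t = s) ∨ (s p ≠ s q ∧ t = relabel r' p true s)) := by
  have hpq' : r' p q := not_not.1 fun h' => hpq (h.xor.2 h')
  have hc := h.symm.class_iff hpq'
  have ha := fun x => @IsSaddle.away_iff _ _ _ _ _ h.symm hpq' x
  have cst : ∀ {s : P → Bool}, (∀ x y, r x y → s x = s y) → s p = s q →
      ∀ x y, r' x y → s x = s y := by
    intro s hs hsp
    have : ∀ x, r' p x → s x = s p := by
      intro x hx
      rcases (hc x).1 hx with h | h
      · exact (hs _ _ h).symm
      · rw [hsp]; exact (hs _ _ h).symm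
    intro x y hxy
    by_cases hx : r' p x
    · rw [this x hx, this y (r'.trans hx hxy)]
    · exact hs x y ((ha x hx y).1 hxy)
  constructor
  · rintro ⟨a1, a2, a3, -, a5⟩
    refine ⟨a1, ?_⟩
    obtain ⟨a5, a6⟩ := a5 hpq
    have aw : ∀ x, ¬ r' p x → t x = s x := fun x hx =>
      a3 x (fun h => hx ((hc x).2 (Or.inl h))) (fun h => hx ((hc x).2 (Or.inr h)))
    by_cases hs : s p = s q
    · have hp : s p = false := by
        rw [← hs] at a5; simpa using a5
      refine Or.inl ⟨hp, hs ▸ hp, funext fun x => ?_⟩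
      by_cases hx : r' p x
      · rw [← a2 _ _ hx, ← cst a1 hs _ _ hx, a6, ← hs, hp]; rfl
      · exact aw x hx
    · refine Or.inr ⟨hs, funext fun x => ?_⟩
      by_cases hx : r' p x
      · rw [relabel_of_rel hx, ← a2 _ _ hx, a6]
        revert hs; cases s p <;> cases s q <;> simp
      · rw [relabel_of_not_rel hx, aw x hx]
  · have le : ∀ x, ¬ r p x → ¬ r q x → ¬ r' p x := fun x h1 h2 h3 => by
      rcases (hc x).1 h3 with h | h
      · exact h1 h
      · exact h2 h
    rintro ⟨a1, ⟨a2, a3, rfl⟩ | ⟨a2, rfl⟩⟩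
    · exact ⟨a1, cst a1 (a2.trans a3.symm), fun _ _ _ => rfl, fun h => absurd h hpq,
        fun _ => by simp [a2, a3]⟩
    · refine ⟨a1, fun x y hxy => ?_, fun x hx hx' => relabel_of_not_rel (le x hx hx') _ _,
        fun h => absurd h hpq, fun _ => ?_⟩
      · by_cases hx : r' p x
        · rw [relabel_of_rel hx, relabel_of_rel (r'.trans hx hxy)]
        · rw [relabel_of_not_rel hx, relabel_of_not_rel (fun h => hx (r'.trans h (r'.symm hxy)))]
          exact a1 x y ((ha x hx y).1 hxy)
      · rw [relabel_apply_self]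
        revert a2; cases s p <;> cases s q <;> simp

end Saddle

/-! ### Self-duality of saddle maps, and their linearity over circle variables -/

section Saddle

variable {P Q : Type}

/-- The Frobenius algebra of the TQFT is self-dual under the exchange of plus and minus: the
transpose of the merge is the split. -/
theorem SaddleStep.dual {r r' : Setoid P} {p q : P} (h : IsSaddle r r' p q) {s t : P → Bool}
    (hs : SaddleStep r r' p q s t) :
    SaddleStep r' r p q (fun x => !t x) (fun x => !s x) := by
  by_cases hpq : r p q
  · have hn := h.xor.1 hpq
    obtain ⟨a1, a2, a3, a4, a5⟩ := hs
    have hc := h.class_iff hpq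
    refine ⟨fun x y h => by rw [a2 x y h], fun x y h => by rw [a1 x y h], fun x h1 h2 => ?_,
      fun h => absurd h hn, fun _ => ?_⟩
    · have : ¬ r p x := by rw [hc]; tauto
      rw [a3 x this fun h => this (r.trans hpq h)]
    · have := a4 hpq
      revert this
      cases s p <;> cases t p <;> cases t q <;> simp
  · have hn : r' p q := not_not.1 fun h' => hpq (h.xor.2 h')
    obtain ⟨a1, a2, a3, a4, a5⟩ := hs
    have hc := h.symm.class_iff hn
    refine ⟨fun x y h => by rw [a2 x y h], fun x y h => by rw [a1 x y h], fun x h1 h2 => ?_,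
      fun _ => ?_, fun h => absurd hn h⟩
    · rw [hc] at h1
      rw [a3 x (fun h => h1 (Or.inl h)) (fun h => h1 (Or.inr h))]
    · have := a5 hpq
      revert this
      cases s p <;> cases t p <;> cases s q <;> simp

theorem relabel_not (r : Setoid P) (z : P) (b : Bool) (s : P → Bool) :
    relabel r z b (fun x => !s x) = fun x => !relabel r z (!b) s x := by
  funext x
  by_cases h : r z x <;> simp [relabel, h]

theorem relabel_congr {r : Setoid P} {z w : P} (h : r z w) (b : Bool) (s : P → Bool) :
    relabel r z b s = relabel r w b s := by
  have : ∀ x, r z x ↔ r w x := fun x =>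
    ⟨fun h' => r.trans (r.symm h) h', fun h' => r.trans h h'⟩
  funext x
  by_cases hx : r z x
  · simp [relabel, hx, (this x).1 hx]
  · simp [relabel, hx, mt (this x).2 hx]

theorem relabel_comm {r r' : Setoid P} {z w : P} (h : ∀ x, r z x → ¬ r' w x) (b c : Bool)
    (s : P → Bool) : relabel r z b (relabel r' w c s) = relabel r' w c (relabel r z b s) := by
  funext x
  have := h x
  by_cases h1 : r z x <;> by_cases h2 : r' w x <;> simp_all [relabel]

theorem relabel_eq_relabel {r r' : Setoid P} {z : P} (h : ∀ x, r z x ↔ r' z x) (b : Bool)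
    (s : P → Bool) : relabel r z b s = relabel r' z b s := by
  funext x
  by_cases hx : r z x
  · simp [relabel, hx, (h x).1 hx]
  · simp [relabel, hx, mt (h x).2 hx]

/-- One half of the linearity of saddle maps over the variable of the circle through `z`. If `z` is
on a circle taking part in the saddle, this is the bimodule property of merge and split; otherwise
the saddle and the relabeling concern disjoint circles. The converse is obtained from this half by
duality. -/
theorem SaddleStep.relabel_right {r r' : Setoid P} {p q z : P} (h : IsSaddle r r' p q)
    {s t : P → Bool} (hs : ∀ x y, r x y → s x = s y) (hz : s z = false)
    (hst : SaddleStep r r' p q (relabel r z true s) t) :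
    t z = true ∧ SaddleStep r r' p q s (relabel r' z false t) := by
  by_cases hpq : r p q
  · have hn := h.xor.1 hpq
    have hc := h.class_iff hpq
    by_cases hzp : r p z
    · rw [relabel_congr (r.symm hzp)] at hst
      have hsp : s p = false := by rw [hs _ _ hzp, hz]
      rw [split_iff h hpq] at hst ⊢
      obtain ⟨-, ⟨a2, rfl⟩ | ⟨a2, -⟩⟩ := hst
      · refine ⟨relabel_of_rel hzp _ _, hs, Or.inr ⟨hsp, ?_⟩⟩
        have hs' : ∀ x, r p x → s x = false := fun x hx => by rw [← hs _ _ hx, hsp]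
        have hn2 : ∀ x, r' p x → ¬ r' q x := fun x h1 h2 => hn (r'.trans h1 (r'.symm h2))
        rcases (hc z).1 hzp with hz' | hz'
        · right
          rw [relabel_congr (r'.symm hz')]
          funext x
          have := hc x; have := hs' x; have := hn2 x
          by_cases h1 : r' p x <;> by_cases h2 : r' q x <;> simp_all [relabel]
        · left
          rw [relabel_congr (r'.symm hz')]
          funext x
          have := hc x; have := hs' x; have := hn2 x
          by_cases h1 : r' p x <;> by_cases h2 : r' q x <;> simp_all [relabel]
      · simp [relabel_apply_self] at a2
    · have hzz : ∀ x, r z x ↔ r' z x := fun x => h.away_iff hpq hzp x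
      have hzp' : ¬ r z p := fun h => hzp (r.symm h)
      have e : relabel r' z false (relabel r z true s) = s := by
        rw [relabel_eq_relabel hzz, relabel_relabel, relabel_self _ hz]
        · refine fun x y hxy => ?_
          by_cases hx : r p x
          · have : r p y := by
              rcases (hc x).1 hx with hx' | hx'
              · exact (hc y).2 (Or.inl (r'.trans hx' hxy))
              · exact (hc y).2 (Or.inr (r'.trans hx' hxy))
            exact hs _ _ (r.trans (r.symm hx) this)
          · exact hs _ _ ((h.away_iff hpq hx y).2 hxy)
      rw [split_iff h hpq] at hst ⊢
      rw [relabel_of_not_rel hzp'] at hst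
      have d : ∀ w, (r p w) → ∀ x, r' z x → ¬ r' w x := fun w hw x h1 h2 => by
        have := (hzz w).2 (r'.trans h1 (r'.symm h2))
        exact hzp (r.trans hw (r.symm this))
      obtain ⟨-, ⟨a2, rfl⟩ | ⟨a2, rfl | rfl⟩⟩ := hst
      · refine ⟨relabel_apply_self _ _ _ _, hs, Or.inl ⟨a2, e⟩⟩
      · refine ⟨?_, hs, Or.inr ⟨a2, Or.inl ?_⟩⟩
        · rw [relabel_of_not_rel, relabel_apply_self]
          exact fun h => d p (r.refl p) z (r'.refl z) h
        · rw [relabel_comm (d p (r.refl p)), e]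
      · refine ⟨?_, hs, Or.inr ⟨a2, Or.inr ?_⟩⟩
        · rw [relabel_of_not_rel, relabel_apply_self]
          exact fun h => d q hpq z (r'.refl z) h
        · rw [relabel_comm (d q hpq), e]
  · have hn : r' p q := not_not.1 fun h' => hpq (h.xor.2 h')
    have hc := h.symm.class_iff hn
    rw [merge_iff h hpq] at hst ⊢
    by_cases hzp : r' p z
    · rw [relabel_congr (r'.symm hzp)]
      have d : ∀ x, r p x → ¬ r q x := fun x h1 h2 => hpq (r.trans h1 (r.symm h2))
      obtain ⟨-, ⟨a2, a3, rfl⟩ | ⟨a2, rfl⟩⟩ := hst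
      · rcases (hc z).1 hzp with hz' | hz'
        · rw [relabel_of_rel (r.symm hz')] at a2; simp at a2
        · rw [relabel_of_rel (r.symm hz')] at a3; simp at a3
      · refine ⟨relabel_of_rel hzp _ _, hs, Or.inl ?_⟩
        have key : s p = false ∧ s q = false := by
          rcases (hc z).1 hzp with hz' | hz'
          · have : ¬ r z q := fun h => hpq (r.trans hz' h)
            rw [relabel_of_rel (r.symm hz'), relabel_of_not_rel this] at a2
            exact ⟨by rw [hs _ _ hz', hz], by simpa using a2⟩
          · have : ¬ r z p := fun h => hpq (r.symm (r.trans hz' h))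
            rw [relabel_of_rel (r.symm hz'), relabel_of_not_rel this] at a2
            exact ⟨by simpa using a2, by rw [hs _ _ hz', hz]⟩
        refine ⟨key.1, key.2, ?_⟩
        funext x
        rw [relabel_relabel]
        by_cases hx : r' p x
        · rw [relabel_of_rel hx]
          rcases (hc x).1 hx with hx' | hx'
          · rw [← hs _ _ hx', key.1]
          · rw [← hs _ _ hx', key.2]
        · have : ¬ r z x := fun h => hx (by
            rcases (hc z).1 hzp with hz' | hz'
            · exact (hc x).2 (Or.inl (r.trans hz' h))
            · exact (hc x).2 (Or.inr (r.trans hz' h)))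
          rw [relabel_of_not_rel hx, relabel_of_not_rel this]
    · have hzz : ∀ x, r z x ↔ r' z x := fun x => (h.symm.away_iff hn hzp x).symm
      have hp : ¬ r z p := fun h => hzp (r'.symm ((hzz _).1 h))
      have hq : ¬ r z q := fun h => hzp (r'.symm (r'.trans ((hzz _).1 h) (r'.symm hn)))
      have e : relabel r' z false (relabel r z true s) = s := by
        rw [← relabel_eq_relabel hzz, relabel_relabel, relabel_self hs hz]
      rw [relabel_of_not_rel hp, relabel_of_not_rel hq] at hst
      obtain ⟨-, ⟨a2, a3, rfl⟩ | ⟨a2, rfl⟩⟩ := hst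
      · exact ⟨relabel_apply_self _ _ _ _, hs, Or.inl ⟨a2, a3, e⟩⟩
      · have d : ∀ x, r' z x → ¬ r' p x := fun x h1 h2 => hzp (r'.trans h2 (r'.symm h1))
        refine ⟨?_, hs, Or.inr ⟨a2, ?_⟩⟩
        · rw [relabel_of_not_rel hzp, relabel_apply_self]
        · rw [relabel_comm d, e]

/-- Multiplication by the variable of the circle through `z` commutes with saddles. -/
theorem SaddleStep.relabel_iff {r r' : Setoid P} {p q : P} (h : IsSaddle r r' p q)
    {s t : P → Bool} (hs : ∀ x y, r x y → s x = s y) (ht : ∀ x y, r' x y → t x = t y) (z : P) :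
    (s z = false ∧ SaddleStep r r' p q (relabel r z true s) t) ↔
      (t z = true ∧ SaddleStep r r' p q s (relabel r' z false t)) := by
  refine ⟨fun h' => relabel_right h hs h'.1 h'.2, fun h' => ?_⟩
  -- Duality turns removal of a minus into insertion of one, so the converse is the first half
  -- applied to the reversed saddle.
  have h2 := h'.2.dual h
  rw [← Bool.not_true, ← relabel_not] at h2
  have h3 := relabel_right (z := z) h.symm (fun x y hxy => by rw [ht x y hxy])
    (by rw [h'.1]; rfl) h2
  have h4 := h3.2.dual h.symm
  rw [relabel_not] at h4
  simp only [Bool.not_not, Bool.not_false] at h4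
  exact ⟨by simpa using h3.1, h4⟩

end Saddle

/-! ### Finite verification on four marked points -/

section Saddle

variable {P Q : Type}

/-- The list of all labelings of four points. -/
def fourLabels : List (Fin 4 → Bool) :=
  [false, true].flatMap fun a => [false, true].flatMap fun b => [false, true].flatMap fun c =>
    [false, true].map fun d => ![a, b, c, d]

/-- A list of functions on four points, among whose kernels are all partitions. -/
def fourPartitions : List (Fin 4 → Fin 4) :=
  [![0, 0], ![0, 1]].flatMap fun f => [f 0, f 1, 2].dedup.flatMap fun b =>
    [f 0, f 1, b, 3].dedup.map fun c => ![0, f 1, b, c]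

/-- `IsSaddle` for kernels of functions. -/
def kerSaddle (f g : Fin 4 → Fin 4) (p q : Fin 4) : Prop :=
  (f p = f q ↔ ¬ g p = g q) ∧
  (∀ x y, g x = g y → f x = f y ∨ (f x = f p ∧ f q = f y) ∨ (f x = f q ∧ f p = f y)) ∧
  (∀ x y, f x = f y → g x = g y ∨ (g x = g p ∧ g q = g y) ∨ (g x = g q ∧ g p = g y))

instance (f g : Fin 4 → Fin 4) (p q : Fin 4) : Decidable (kerSaddle f g p q) := by
  unfold kerSaddle; infer_instance

/-- `s` is constant on the fibers of `f`. -/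
def kerConst (f : Fin 4 → Fin 4) (s : Fin 4 → Bool) : Prop := ∀ x y, f x = f y → s x = s y

instance (f : Fin 4 → Fin 4) (s : Fin 4 → Bool) : Decidable (kerConst f s) := by
  unfold kerConst; infer_instance

/-- `SaddleStep` for kernels of functions. -/
def kerStep (f g : Fin 4 → Fin 4) (p q : Fin 4) (s t : Fin 4 → Bool) : Prop :=
  (f p = f q → if s p = true then t p = true ∧ t q = true else t p ≠ t q) ∧
  (¬ f p = f q → ¬ (s p = true ∧ s q = true) ∧ t p = (s p || s q)) ∧
  (∀ x, ¬ f p = f x → ¬ f q = f x → t x = s x) ∧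
  (∀ x y, f x = f y → s x = s y) ∧ (∀ x y, g x = g y → t x = t y)

instance (f g : Fin 4 → Fin 4) (p q : Fin 4) (s t : Fin 4 → Bool) :
    Decidable (kerStep f g p q s t) := by
  unfold kerStep; infer_instance

/-- Single saddles have entries 0 and 1, so the entries of a composite count intermediate labelings.
The check runs over all commuting squares of partitions of four points; planarity plays no role in
it. -/
theorem kerStep_comm : ∀ f ∈ fourPartitions, ∀ g ∈ fourPartitions, kerSaddle f g 0 1 →
    ∀ h ∈ fourPartitions, kerSaddle f h 2 3 →
    ∀ k ∈ fourPartitions, kerSaddle g k 2 3 → kerSaddle h k 0 1 →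
    ∀ s ∈ fourLabels, kerConst f s →
    ∀ t ∈ fourLabels, kerConst k t →
    fourLabels.countP (fun u => kerStep f g 0 1 s u ∧ kerStep g k 2 3 u t) =
      fourLabels.countP (fun u => kerStep f h 2 3 s u ∧ kerStep h k 0 1 u t) := by
  set_option synthInstance.maxHeartbeats 100000 in
  set_option synthInstance.maxSize 1000 in
  decide +kernel

end Saddle

/-! ### Composites of two saddles: reduction to the marked points -/

section Saddle

variable {P Q : Type}

theorem IsSaddle.exists_rel {r r' : Setoid P} {m : Q → P} {a b : Q}
    (h : IsSaddle r r' (m a) (m b)) {x : P} (hx : ∃ i, r' (m i) x) : ∃ i, r (m i) x := by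
  obtain ⟨i, hi⟩ := hx
  rcases h.le _ _ hi with h | h | h
  · exact ⟨i, h⟩
  · exact ⟨b, h.2⟩
  · exact ⟨a, h.2⟩

theorem IsSaddle.away_le {r r' : Setoid P} {p q x y : P} (h : IsSaddle r r' p q)
    (hp : ¬ r p y) (hq : ¬ r q y) (hxy : r' x y) : r x y := by
  rcases h.le _ _ hxy with h | h | h
  · exact h
  · exact absurd h.2 hq
  · exact absurd h.2 hp

theorem IsSaddle.away_ge {r r' : Setoid P} {p q x y : P} (h : IsSaddle r r' p q)
    (hp : ¬ r p y) (hq : ¬ r q y) (hxy : r x y) : r' x y := by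
  have key : ¬ r' p y ∧ ¬ r' q y := by
    constructor <;> intro h' <;> rcases h.le _ _ h' with h | h | h
    all_goals first | exact hp h | exact hq h | exact hq h.2 | exact hp h.2
  exact h.symm.away_le key.1 key.2 hxy

/-- The two-step labelings are determined by the labels of the marked points. -/
theorem SaddleStep.card_comap {r₀ r₁ r₂ : Setoid P} {m : Q → P} {a b c d : Q}
    (h₁ : IsSaddle r₀ r₁ (m a) (m b)) (h₂ : IsSaddle r₁ r₂ (m c) (m d)) {s t : P → Bool}
    (hs : ∀ x y, r₀ x y → s x = s y) (ht : ∀ x y, r₂ x y → t x = t y)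
    (hst : ∀ x, (¬ ∃ i, r₀ (m i) x) → t x = s x) :
    Nat.card {u // SaddleStep r₀ r₁ (m a) (m b) s u ∧ SaddleStep r₁ r₂ (m c) (m d) u t} =
      Nat.card {v // SaddleStep (r₀.comap m) (r₁.comap m) a b (s ∘ m) v ∧
        SaddleStep (r₁.comap m) (r₂.comap m) c d v (t ∘ m)} := by
  classical
  -- The union of the classes meeting a marked point is not changed by a saddle at marked points.
  have hM : ∀ x, (∃ i, r₁ (m i) x) ↔ ∃ i, r₀ (m i) x := fun x =>
    ⟨h₁.exists_rel, h₁.symm.exists_rel⟩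
  refine Nat.card_eq_of_bijective (fun u => ⟨u.1 ∘ m, ?_, ?_⟩) ⟨?_, ?_⟩
  · obtain ⟨a1, a2, a3, a4, a5⟩ := u.2.1
    exact ⟨fun x y => a1 (m x) (m y), fun x y => a2 (m x) (m y), fun x => a3 (m x), a4, a5⟩
  · obtain ⟨a1, a2, a3, a4, a5⟩ := u.2.2
    exact ⟨fun x y => a1 (m x) (m y), fun x y => a2 (m x) (m y), fun x => a3 (m x), a4, a5⟩
  · rintro ⟨u, hu⟩ ⟨v, hv⟩ huv
    simp only [Subtype.mk.injEq] at huv ⊢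
    funext x
    by_cases hx : ∃ i, r₁ (m i) x
    · obtain ⟨i, hi⟩ := hx
      rw [← hu.1.const' _ _ hi, ← hv.1.const' _ _ hi]
      exact congrFun huv i
    · rw [hM, not_exists] at hx
      rw [hu.1.away x (hx a) (hx b), hv.1.away x (hx a) (hx b)]
  · rintro ⟨v, hv₁, hv₂⟩
    -- Inverse construction: on classes meeting a marked point the label is dictated by `v`, and on
    -- the others nothing happens, so it is that of `s`.
    let u : P → Bool := fun x => if h : ∃ i, r₁ (m i) x then v h.choose else s x
    have u1 : ∀ i x, r₁ (m i) x → u x = v i := by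
      intro i x hi
      have h : ∃ i, r₁ (m i) x := ⟨i, hi⟩
      simp only [u, dif_pos h]
      exact hv₁.const' _ _ (r₁.trans h.choose_spec (r₁.symm hi))
    have u2 : ∀ x, (¬ ∃ i, r₁ (m i) x) → u x = s x := fun x h => dif_neg h
    have u3 : ∀ i, u (m i) = v i := fun i => u1 i _ (r₁.refl _)
    have uc : ∀ x y, r₁ x y → u x = u y := by
      intro x y hxy
      by_cases hy : ∃ i, r₁ (m i) y
      · obtain ⟨i, hi⟩ := hy
        rw [u1 i y hi, u1 i x (r₁.trans hi (r₁.symm hxy))]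
      · have hx : ¬ ∃ i, r₁ (m i) x := fun ⟨i, hi⟩ => hy ⟨i, r₁.trans hi hxy⟩
        rw [u2 x hx, u2 y hy]
        rw [hM, not_exists] at hy
        exact hs _ _ (h₁.away_le (hy a) (hy b) hxy)
    refine ⟨⟨u, ⟨hs, uc, fun x h1 h2 => ?_, fun h => ?_, fun h => ?_⟩,
      ⟨uc, ht, fun x h1 h2 => ?_, fun h => ?_, fun h => ?_⟩⟩, Subtype.ext (funext u3)⟩
    · by_cases hx : ∃ i, r₁ (m i) x
      · obtain ⟨i, hi⟩ := hx
        have h3 := h₁.away_le h1 h2 hi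
        rw [u1 i x hi, ← hs _ _ h3]
        exact hv₁.away i (fun h => h1 (r₀.trans h h3)) (fun h => h2 (r₀.trans h h3))
      · exact u2 x hx
    · rw [u3, u3]; exact hv₁.split h
    · rw [u3]; exact hv₁.merge h
    · by_cases hx : ∃ i, r₁ (m i) x
      · obtain ⟨i, hi⟩ := hx
        have h3 := h₂.away_ge h1 h2 hi
        rw [u1 i x hi, ← ht _ _ h3]
        exact hv₂.away i (fun h => h1 (r₁.trans h hi)) (fun h => h2 (r₁.trans h hi))
      · rw [u2 x hx]
        exact hst x (by rwa [← hM])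
    · rw [u3]; exact hv₂.split h
    · rw [u3, u3]; exact hv₂.merge h

theorem exists_fourPartitions (r : Setoid (Fin 4)) :
    ∃ f ∈ fourPartitions, ∀ x y, r x y ↔ f x = f y := by
  have key : ∀ g : Fin 4 → Fin 4, ∃ f ∈ fourPartitions, ∀ x y, g x = g y ↔ f x = f y := by
    decide +kernel
  -- A partition is the kernel of the choice of representatives.
  obtain ⟨f, hf, h⟩ := key fun x => (Quotient.mk r x).out
  refine ⟨f, hf, fun x y => ?_⟩
  rw [← h, Quotient.out_inj, Quotient.eq]

theorem card_fourLabels (p : (Fin 4 → Bool) → Prop) [DecidablePred p] :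
    Nat.card {v // p v} = fourLabels.countP p := by
  have h1 : (Finset.univ : Finset (Fin 4 → Bool)) = fourLabels.toFinset := by decide +kernel
  have h2 : fourLabels.Nodup := by decide +kernel
  rw [Nat.card_eq_fintype_card, Fintype.card_subtype, h1, List.countP_eq_length_filter,
    ← List.toFinset_card_of_nodup (h2.filter _)]
  congr 1
  ext v
  simp

theorem mem_fourLabels (s : Fin 4 → Bool) : s ∈ fourLabels := by
  revert s
  decide +kernel

theorem isSaddle_iff_ker {r r' : Setoid (Fin 4)} {f g : Fin 4 → Fin 4}
    (hf : ∀ x y, r x y ↔ f x = f y) (hg : ∀ x y, r' x y ↔ g x = g y) {p q : Fin 4}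
    (h : IsSaddle r r' p q) : kerSaddle f g p q := by
  obtain ⟨h1, h2, h3⟩ := h
  simp only [hf, hg] at h1 h2 h3
  exact ⟨h1, h2, h3⟩

theorem saddleStep_iff_ker {r r' : Setoid (Fin 4)} {f g : Fin 4 → Fin 4}
    (hf : ∀ x y, r x y ↔ f x = f y) (hg : ∀ x y, r' x y ↔ g x = g y) (p q : Fin 4)
    (s t : Fin 4 → Bool) : SaddleStep r r' p q s t ↔ kerStep f g p q s t := by
  constructor
  · rintro ⟨h1, h2, h3, h4, h5⟩
    simp only [hf, hg] at h1 h2 h3 h4 h5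
    exact ⟨h4, h5, h3, h1, h2⟩
  · rintro ⟨h4, h5, h3, h1, h2⟩
    simp only [← hf, ← hg] at h1 h2 h3 h4 h5
    exact ⟨h1, h2, h3, h4, h5⟩

/-- The maps assigned to two saddles commute. -/
theorem SaddleStep.card_comm {r₀₀ r₁₀ r₀₁ r₁₁ : Setoid P} {p q p' q' : P}
    (h₁ : IsSaddle r₀₀ r₁₀ p q) (h₂ : IsSaddle r₀₀ r₀₁ p' q') (h₃ : IsSaddle r₁₀ r₁₁ p' q')
    (h₄ : IsSaddle r₀₁ r₁₁ p q) {s t : P → Bool} (hs : ∀ x y, r₀₀ x y → s x = s y)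
    (ht : ∀ x y, r₁₁ x y → t x = t y) :
    Nat.card {u // SaddleStep r₀₀ r₁₀ p q s u ∧ SaddleStep r₁₀ r₁₁ p' q' u t} =
      Nat.card {u // SaddleStep r₀₀ r₀₁ p' q' s u ∧ SaddleStep r₀₁ r₁₁ p q u t} := by
  let m : Fin 4 → P := ![p, q, p', q']
  have h₁ : IsSaddle r₀₀ r₁₀ (m 0) (m 1) := h₁
  have h₂ : IsSaddle r₀₀ r₀₁ (m 2) (m 3) := h₂
  have h₃ : IsSaddle r₁₀ r₁₁ (m 2) (m 3) := h₃
  have h₄ : IsSaddle r₀₁ r₁₁ (m 0) (m 1) := h₄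
  change Nat.card {u // SaddleStep r₀₀ r₁₀ (m 0) (m 1) s u ∧
      SaddleStep r₁₀ r₁₁ (m 2) (m 3) u t} =
    Nat.card {u // SaddleStep r₀₀ r₀₁ (m 2) (m 3) s u ∧ SaddleStep r₀₁ r₁₁ (m 0) (m 1) u t}
  -- Both composites preserve labels away from the marked points. If `s` and `t` disagree there,
  -- both counts are zero; otherwise only the four marked points matter.
  by_cases hst : ∀ x, (¬ ∃ i, r₀₀ (m i) x) → t x = s x
  · rw [card_comap h₁ h₃ hs ht hst, card_comap h₂ h₄ hs ht hst]
    obtain ⟨f, hf, ef⟩ := exists_fourPartitions (r₀₀.comap m)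
    obtain ⟨g, hg, eg⟩ := exists_fourPartitions (r₁₀.comap m)
    obtain ⟨k, hk, ek⟩ := exists_fourPartitions (r₀₁.comap m)
    obtain ⟨l, hl, el⟩ := exists_fourPartitions (r₁₁.comap m)
    simp only [saddleStep_iff_ker ef eg, saddleStep_iff_ker ef ek, saddleStep_iff_ker eg el,
      saddleStep_iff_ker ek el]
    rw [card_fourLabels, card_fourLabels]
    exact kerStep_comm f hf g hg (isSaddle_iff_ker ef eg h₁.comap) k hk
      (isSaddle_iff_ker ef ek h₂.comap) l hl (isSaddle_iff_ker eg el h₃.comap)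
      (isSaddle_iff_ker ek el h₄.comap) _ (mem_fourLabels _)
      (fun x y h => hs _ _ ((ef x y).2 h)) _ (mem_fourLabels _)
      (fun x y h => ht _ _ ((el x y).2 h))
  · have key : ∀ {r₁ : Setoid P} {a b c d : Fin 4}, IsSaddle r₀₀ r₁ (m a) (m b) →
        IsEmpty {u // SaddleStep r₀₀ r₁ (m a) (m b) s u ∧ SaddleStep r₁ r₁₁ (m c) (m d) u t} := by
      intro r₁ a b c d h
      refine ⟨fun u => hst fun x hx => ?_⟩
      have hx' : ¬ ∃ i, r₁ (m i) x := fun h' => hx (h.exists_rel h')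
      rw [not_exists] at hx hx'
      rw [u.2.2.away x (hx' c) (hx' d), u.2.1.away x (hx a) (hx b)]
    have := key h₁ (c := 2) (d := 3)
    have := key h₂ (c := 0) (d := 1)
    rw [Nat.card_of_isEmpty, Nat.card_of_isEmpty]

end Saddle

/-! ## Circles of glued matchings, and surgery on an arc pair -/

section Circles

variable {P : Type}

theorem sameCircle_symm {u v : P → P} (hu : ∀ x, u (u x) = x) (hv : ∀ x, v (v x) = x) {x y : P}
    (h : SameCircle u v x y) : SameCircle u v y x := by
  induction h with
  | refl => exact Relation.ReflTransGen.refl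
  | @tail b c _ h ih =>
    refine Relation.ReflTransGen.head ?_ ih
    rcases h with rfl | rfl
    · exact Or.inl (hu b).symm
    · exact Or.inr (hv b).symm

/-- The partition of the points into the circles formed by the arcs of `u` and `v`. -/
def circleSetoid (u v : P → P) (hu : ∀ x, u (u x) = x) (hv : ∀ x, v (v x) = x) : Setoid P where
  r := SameCircle u v
  iseqv := ⟨fun _ => Relation.ReflTransGen.refl, sameCircle_symm hu hv,
    fun h h' => Relation.ReflTransGen.trans h h'⟩

theorem sameCircle_swap {u v : P → P} {x y : P} (h : SameCircle u v x y) : SameCircle v u x y := by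
  induction h with
  | refl => exact Relation.ReflTransGen.refl
  | tail _ h ih => exact ih.tail h.symm

theorem sameCircle_iff_of_invariant {u v : P → P} {R : P → P → Prop} (h0 : ∀ x, R x x)
    (hu : ∀ x y, R x y → R x (u y)) (hv : ∀ x y, R x y → R x (v y)) {x y : P}
    (h : SameCircle u v x y) : R x y := by
  induction h with
  | refl => exact h0 x
  | tail _ h ih =>
    rcases h with rfl | rfl
    · exact hu _ _ ih
    · exact hv _ _ ih

end Circles

/-! ### Cycles of a permutation multiplied by a transposition -/

namespace Equiv.Perm

variable {P : Type} [DecidableEq P]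

/-- Starting at `q`, the product with the transposition jumps to `τ p` and then follows the
`τ`-orbit of `p` for as long as that orbit avoids `p` and `q`. -/
theorem mul_swap_pow_apply (τ : Equiv.Perm P) (p q : P) (m : ℕ)
    (h : ∀ j, 0 < j → j < m → (τ ^ j) p ≠ p ∧ (τ ^ j) p ≠ q) :
    ∀ j, 0 < j → j ≤ m → ((τ * Equiv.swap p q) ^ j) q = (τ ^ j) p := by
  intro j
  induction j with
  | zero => intro h; exact absurd h (lt_irrefl 0)
  | succ j ih =>
    intro _ hj
    rcases Nat.eq_zero_or_pos j with rfl | hj0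
    · simp
    · rw [pow_succ', Equiv.Perm.mul_apply, ih hj0 (by omega), Equiv.Perm.mul_apply,
        Equiv.swap_apply_of_ne_of_ne (h j hj0 (by omega)).1 (h j hj0 (by omega)).2, pow_succ',
        Equiv.Perm.mul_apply]

/-- If the `τ`-orbit of `p` first meets `q` after `m` steps, the new orbit of `q` closes up after
`m` steps without meeting `p`. If the orbit of `p` never meets `q`, the new orbit of `q` runs along
it up to the first return and so reaches `p`. -/
theorem sameCycle_mul_swap_iff [Finite P] (τ : Equiv.Perm P) {p q : P} (hpq : p ≠ q) :
    (τ * Equiv.swap p q).SameCycle p q ↔ ¬ τ.SameCycle p q := by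
  constructor
  · intro h hs
    have ex : ∃ m, 0 < m ∧ (τ ^ m) p = q := by
      obtain ⟨m, hm⟩ := hs.exists_nat_pow_eq
      refine ⟨m, Nat.pos_of_ne_zero fun h0 => hpq ?_, hm⟩
      simpa [h0] using hm
    classical
    obtain ⟨hm0, hm⟩ := Nat.find_spec ex
    have hmin := fun j => Nat.find_min (H := ex) (m := j)
    set m := Nat.find ex
    have hne : ∀ j, 0 < j → j < m → (τ ^ j) p ≠ p ∧ (τ ^ j) p ≠ q := by
      refine fun j hj0 hj => ⟨fun hp => ?_, fun hq => hmin j hj ⟨hj0, hq⟩⟩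
      refine hmin (m - j) (by omega) ⟨by omega, ?_⟩
      rw [← hp, ← Equiv.Perm.mul_apply, ← pow_add, Nat.sub_add_cancel hj.le, hm]
    have key := mul_swap_pow_apply τ p q m hne
    obtain ⟨i, hi⟩ := h.symm.exists_nat_pow_eq
    have hfix : ∀ k, (((τ * Equiv.swap p q) ^ m) ^ k) q = q := by
      intro k
      induction k with
      | zero => simp
      | succ k ih => rw [pow_succ', Equiv.Perm.mul_apply, ih, key m hm0 le_rfl, hm]
    have hi' : ((τ * Equiv.swap p q) ^ (i % m)) q = p := by
      rwa [← Nat.mod_add_div i m, pow_add, pow_mul, Equiv.Perm.mul_apply, hfix] at hi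
    rcases Nat.eq_zero_or_pos (i % m) with h0 | h0
    · rw [h0] at hi'
      exact hpq hi'.symm
    · have hlt := Nat.mod_lt i hm0
      rw [key _ h0 hlt.le] at hi'
      exact (hne _ h0 hlt).1 hi'
  · intro hs
    have ex : ∃ m, 0 < m ∧ (τ ^ m) p = p := ⟨orderOf τ, orderOf_pos τ, by simp [pow_orderOf_eq_one]⟩
    classical
    obtain ⟨hm0, hm⟩ := Nat.find_spec ex
    have hmin := fun j => Nat.find_min (H := ex) (m := j)
    set m := Nat.find ex
    have key := mul_swap_pow_apply τ p q m fun j hj0 hj =>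
      ⟨fun hp => hmin j hj ⟨hj0, hp⟩, fun hq => hs ⟨j, by simpa using hq⟩⟩
    exact Equiv.Perm.SameCycle.symm ⟨m, by rw [zpow_natCast, key m hm0 le_rfl, hm]⟩

end Equiv.Perm

/-! ### Parity, surgeries and circles of crossingless matchings -/

namespace Matching

variable {n : ℕ}

/-- No arc crosses the arc of `i`, so the points strictly between its ends are matched among
themselves, and their number is even. -/
theorem parity (a : Matching n) (i : Fin (2 * n)) : Even (a.partner i).val ↔ ¬ Even i.val := by
  have key : ∀ i, i < a.partner i → (Even (a.partner i).val ↔ ¬ Even i.val) := by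
    intro i hi
    have hmem : ∀ j ∈ Finset.Ioo i (a.partner i), a.partner j ∈ Finset.Ioo i (a.partner i) := by
      intro j hj
      rw [Finset.mem_Ioo] at hj ⊢
      constructor
      · by_contra h
        rcases lt_or_eq_of_le (not_lt.1 h) with h | h
        · exact a.noncrossing (a.partner j) i ⟨h, by rw [a.invol]; exact hj.1,
            by rw [a.invol]; exact hj.2⟩
        · have := a.invol j
          rw [h] at this
          exact absurd this hj.2.ne'
      · by_contra h
        rcases lt_or_eq_of_le (not_lt.1 h) with h | h
        · exact a.noncrossing i j ⟨hj.1, hj.2, h⟩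
        · have := congrArg a.partner h
          rw [a.invol, a.invol] at this
          exact absurd this hj.1.ne
    have hsum : ∑ _j ∈ Finset.Ioo i (a.partner i), (1 : ZMod 2) = 0 :=
      Finset.sum_involution (fun j _ => a.partner j) (fun _ _ => by decide)
        (fun j _ _ => a.no_fixed j) hmem (fun j _ => a.invol j)
    rw [Finset.sum_const, nsmul_one, ZMod.natCast_eq_zero_iff, Fin.card_Ioo] at hsum
    have : i.val < (a.partner i).val := hi
    rw [Nat.even_iff, Nat.even_iff]
    omega
  rcases lt_or_gt_of_ne (a.no_fixed i) with h | h
  · have := key (a.partner i) (by rw [a.invol]; exact h)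
    rw [a.invol] at this
    tauto
  · exact key i h

/-- `b` is obtained from `a` by the surgery of the arcs with even endpoints `p` and `q`. -/
structure SurgeryAt (a b : Matching n) (p q : Fin (2 * n)) : Prop where
  even_left : Even p.val
  even_right : Even q.val
  ne : p ≠ q
  left : b.partner p = a.partner q
  right : b.partner q = a.partner p
  away : ∀ x, x ≠ p → x ≠ q → x ≠ a.partner p → x ≠ a.partner q → b.partner x = a.partner x

theorem SurgeryAt.symm {a b : Matching n} {p q : Fin (2 * n)} (h : SurgeryAt a b p q) :
    SurgeryAt b a p q := by
  obtain ⟨h1, h2, h3, h4, h5, h6⟩ := h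
  refine ⟨h1, h2, h3, h5.symm, h4.symm, fun x e1 e2 e3 e4 => ?_⟩
  rw [h4] at e3
  rw [h5] at e4
  exact (h6 x e1 e2 e4 e3).symm

/-- The four points where `a` and `b` differ are closed under both involutions. Take an even one,
`p`; two steps lead to another even one, `q = a (b p)`. The points `p`, `q` and their `a`-partners
exhaust the four, and by parity `b` can match `q` only with the partner of `p`. -/
theorem exists_surgeryAt {a b : Matching n} (h : IsSurgery a b) : ∃ p q, SurgeryAt a b p q := by
  set D := Finset.univ.filter (fun i => a.partner i ≠ b.partner i)
  have hD : D.card = 4 := h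
  have mem : ∀ x, x ∈ D ↔ a.partner x ≠ b.partner x := fun x => by simp [D]
  have memA : ∀ x ∈ D, a.partner x ∈ D := by
    intro x hx
    rw [mem] at hx ⊢
    rw [a.invol]
    intro h
    have := congrArg b.partner h
    rw [b.invol] at this
    exact hx this.symm
  obtain ⟨x, hx⟩ : D.Nonempty := by rw [← Finset.card_pos, hD]; norm_num
  obtain ⟨p, hp, hpe⟩ : ∃ p ∈ D, Even p.val := by
    by_cases hxe : Even x.val
    · exact ⟨x, hx, hxe⟩
    · exact ⟨a.partner x, memA x hx, (a.parity x).2 hxe⟩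
  have hpD := (mem p).1 hp
  set q := a.partner (b.partner p) with hq
  have haq : a.partner q = b.partner p := a.invol _
  have hqe : Even q.val := by rw [hq, a.parity, b.parity]; simpa using hpe
  have hqp : p ≠ q := fun h => hpD (by rw [← haq, ← h])
  have hqD : q ∈ D := by
    rw [mem, haq]
    intro h
    have := congrArg b.partner h
    rw [b.invol, b.invol] at this
    exact hqp this
  have odd : ∀ x : Fin (2 * n), Even x.val → ¬ Even (a.partner x).val := fun x hx h =>
    (a.parity x).1 h hx
  have ne_odd : ∀ x y : Fin (2 * n), Even x.val → ¬ Even y.val → x ≠ y := fun x y hx hy h =>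
    hy (h ▸ hx)
  have inj : a.partner p ≠ a.partner q := fun h => hqp (by rw [← a.invol p, h, a.invol])
  have hsub : ({p, q, a.partner p, a.partner q} : Finset (Fin (2 * n))) = D := by
    refine Finset.eq_of_subset_of_card_le ?_ ?_
    · intro x hx
      simp only [Finset.mem_insert, Finset.mem_singleton] at hx
      rcases hx with rfl | rfl | rfl | rfl
      exacts [hp, hqD, memA _ hp, memA _ hqD]
    · rw [hD, Finset.card_insert_of_notMem, Finset.card_insert_of_notMem,
        Finset.card_insert_of_notMem, Finset.card_singleton]
      · simpa using inj
      · simp only [Finset.mem_insert, Finset.mem_singleton, not_or]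
        exact ⟨ne_odd _ _ hqe (odd _ hpe), ne_odd _ _ hqe (odd _ hqe)⟩
      · simp only [Finset.mem_insert, Finset.mem_singleton, not_or]
        exact ⟨hqp, ne_odd _ _ hpe (odd _ hpe), ne_odd _ _ hpe (odd _ hqe)⟩
  refine ⟨p, q, hpe, hqe, hqp, haq.symm, ?_, fun x e1 e2 e3 e4 => ?_⟩
  · have hbq : b.partner q ∈ D := by
      rw [mem] at hqD ⊢
      rw [b.invol]
      intro h
      have := congrArg a.partner h
      rw [a.invol] at this
      exact hqD this.symm
    rw [← hsub] at hbq
    simp only [Finset.mem_insert, Finset.mem_singleton] at hbq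
    have ho : ¬ Even (b.partner q).val := fun h => (b.parity q).1 h hqe
    rcases hbq with h | h | h | h
    · rw [h] at ho; exact absurd hpe ho
    · rw [h] at ho; exact absurd hqe ho
    · exact h
    · exact absurd h.symm ((mem q).1 hqD)
  · have : x ∉ D := by rw [← hsub]; simp [e1, e2, e3, e4]
    rw [mem, not_not] at this
    exact this.symm

theorem partner_ne {a : Matching n} {p q : Fin (2 * n)} (hp : Even p.val) (hq : Even q.val) :
    p ≠ a.partner q := fun h => (a.parity q).1 (h ▸ hp) hq

theorem SurgeryAt.isSurgery {a b : Matching n} {p q : Fin (2 * n)} (h : SurgeryAt a b p q) :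
    IsSurgery a b := by
  have hp := h.even_left
  have hq := h.even_right
  have inj : a.partner p ≠ a.partner q := fun h' => h.ne (by rw [← a.invol p, h', a.invol])
  have e1 : b.partner (a.partner p) = q := by rw [← h.right, b.invol]
  have e2 : b.partner (a.partner q) = p := by rw [← h.left, b.invol]
  have hD : Finset.univ.filter (fun i => a.partner i ≠ b.partner i) =
      {p, q, a.partner p, a.partner q} := by
    ext x
    simp only [Finset.mem_filter, Finset.mem_univ, true_and, Finset.mem_insert,
      Finset.mem_singleton]
    constructor
    · intro hx
      by_contra hn
      simp only [not_or] at hn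
      exact hx (h.away x hn.1 hn.2.1 hn.2.2.1 hn.2.2.2).symm
    · rintro (rfl | rfl | rfl | rfl)
      · rw [h.left]; exact inj
      · rw [h.right]; exact inj.symm
      · rw [a.invol, e1]; exact h.ne
      · rw [a.invol, e2]; exact h.ne.symm
  rw [IsSurgery, hD, Finset.card_insert_of_notMem, Finset.card_insert_of_notMem,
    Finset.card_insert_of_notMem, Finset.card_singleton]
  · simpa using inj
  · simp only [Finset.mem_insert, Finset.mem_singleton, not_or]
    exact ⟨partner_ne hq hp, partner_ne hq hq⟩
  · simp only [Finset.mem_insert, Finset.mem_singleton, not_or]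
    exact ⟨h.ne, partner_ne hp hp, partner_ne hp hq⟩

/-- The circles of `W(c)a`. -/
def circ (c a : Matching n) : Setoid (Fin (2 * n)) :=
  circleSetoid c.partner a.partner c.invol a.invol

theorem circ_iff {c a : Matching n} {x y : Fin (2 * n)} :
    circ c a x y ↔ SameCircle c.partner a.partner x y := Iff.rfl

theorem circ_left (c a : Matching n) (x : Fin (2 * n)) : circ c a x (c.partner x) :=
  Relation.ReflTransGen.single (Or.inl rfl)

theorem circ_right (c a : Matching n) (x : Fin (2 * n)) : circ c a x (a.partner x) :=
  Relation.ReflTransGen.single (Or.inr rfl)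

theorem circ_comm (c a : Matching n) : circ c a = circ a c :=
  Setoid.ext fun _ _ => ⟨sameCircle_swap, sameCircle_swap⟩

/-- Going around the circles of `W(c)a`, from even points to even points. -/
noncomputable def turn (c a : Matching n) : Equiv.Perm (Fin (2 * n)) where
  toFun x := if Even x.val then c.partner (a.partner x) else x
  invFun x := if Even x.val then a.partner (c.partner x) else x
  left_inv x := by
    by_cases h : Even x.val
    · have : Even (c.partner (a.partner x)).val := by rw [c.parity, a.parity]; simpa using h
      simp [h, this, c.invol, a.invol]
    · simp [h]
  right_inv x := by
    by_cases h : Even x.val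
    · have : Even (a.partner (c.partner x)).val := by rw [a.parity, c.parity]; simpa using h
      simp [h, this, c.invol, a.invol]
    · simp [h]

theorem turn_apply (c a : Matching n) {x : Fin (2 * n)} (h : Even x.val) :
    turn c a x = c.partner (a.partner x) := if_pos h

/-- Parity orients every circle: passing along an arc of `a` and then one of `c` leads from an even
point to the next even point in one direction, so the even points of a circle form one cycle of
`turn`. -/
theorem circ_iff_sameCycle (c a : Matching n) {x y : Fin (2 * n)} (hx : Even x.val)
    (hy : Even y.val) : circ c a x y ↔ (turn c a).SameCycle x y := by
  constructor
  · intro h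
    -- An odd point met on the way is represented by the even point at the other end of its arc of
    -- `a`.
    have key : (turn c a).SameCycle x (if Even y.val then y else a.partner y) := by
      clear hy
      induction (circ_iff.1 h) with
      | refl => rw [if_pos hx]
      | @tail y z h1 h2 ih =>
        have ih := ih h1
        by_cases hy : Even y.val
        · rw [if_pos hy] at ih
          rcases h2 with rfl | rfl
          · have h3 : ¬ Even (c.partner y).val := by rw [c.parity]; simpa using hy
            rw [if_neg h3]
            have h4 : turn c a (a.partner (c.partner y)) = y := by
              rw [turn_apply, a.invol, c.invol]
              rw [a.parity]; exact h3
            rwa [← h4, Equiv.Perm.sameCycle_apply_right] at ih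
          · have h3 : ¬ Even (a.partner y).val := by rw [a.parity]; simpa using hy
            rwa [if_neg h3, a.invol]
        · rw [if_neg hy] at ih
          rcases h2 with rfl | rfl
          · rw [if_pos ((c.parity y).2 hy)]
            have h4 : turn c a (a.partner y) = c.partner y := by
              rw [turn_apply, a.invol]
              exact (a.parity y).2 hy
            rwa [← h4, Equiv.Perm.sameCycle_apply_right]
          · rwa [if_pos ((a.parity y).2 hy)]
    rwa [if_pos hy] at key
  · have h1 : ∀ x, circ c a x (turn c a x) := by
      intro x
      by_cases h : Even x.val
      · rw [turn_apply c a h]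
        exact (circ c a).trans (circ_right c a x) (circ_left c a _)
      · have : turn c a x = x := if_neg h
        rw [this]
    have h2 : ∀ (k : ℕ) x, circ c a x ((turn c a ^ k) x) := by
      intro k x
      induction k with
      | zero => exact (circ c a).refl x
      | succ k ih => rw [pow_succ']; exact (circ c a).trans ih (h1 _)
    intro h
    obtain ⟨k, hk⟩ := h.exists_nat_pow_eq
    rw [← hk]
    exact h2 k x

/-- The right-hand side is stable under single steps: away from the four surgered points an arc of
`b` is an arc of `a`, and the new arcs only pass between the circles of `p` and `q`. -/
theorem SurgeryAt.circ_le {a b : Matching n} {p q : Fin (2 * n)} (h : SurgeryAt a b p q)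
    (c : Matching n) (x y : Fin (2 * n)) (hxy : circ c b x y) :
    circ c a x y ∨ (circ c a x p ∧ circ c a q y) ∨ (circ c a x q ∧ circ c a p y) := by
  have tr := fun x y z => @Setoid.trans' _ (circ c a) x y z
  have ca := circ_right c a
  refine sameCircle_iff_of_invariant (R := fun x y => circ c a x y ∨
    (circ c a x p ∧ circ c a q y) ∨ (circ c a x q ∧ circ c a p y)) (fun x => Or.inl ?_)
    (fun x y hxy => ?_) (fun x y hxy => ?_) hxy
  · exact (circ c a).refl x
  · have := circ_left c a y
    rcases hxy with h | h | h
    · exact Or.inl (tr _ _ _ h this)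
    · exact Or.inr (Or.inl ⟨h.1, tr _ _ _ h.2 this⟩)
    · exact Or.inr (Or.inr ⟨h.1, tr _ _ _ h.2 this⟩)
  · have e1 : b.partner (a.partner p) = q := by rw [← h.right, b.invol]
    have e2 : b.partner (a.partner q) = p := by rw [← h.left, b.invol]
    have sy := fun x y => @Setoid.symm' _ (circ c a) x y
    by_cases hp : circ c a p y
    · have hxy' : circ c a x p ∨ circ c a x q := by
        rcases hxy with h | h | h
        · exact Or.inl (tr _ _ _ h (sy _ _ hp))
        · exact Or.inl h.1
        · exact Or.inr h.1
      by_cases hbp : circ c a p (b.partner y)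
      · rcases hxy' with h | h
        · exact Or.inl (tr _ _ _ h hbp)
        · exact Or.inr (Or.inr ⟨h, hbp⟩)
      · have : circ c a q (b.partner y) := by
          by_cases y1 : y = p
          · rw [y1, h.left]; exact ca q
          by_cases y2 : y = q
          · rw [y2, h.right] at hbp; exact absurd (ca p) hbp
          by_cases y3 : y = a.partner p
          · rw [y3, e1]
          by_cases y4 : y = a.partner q
          · rw [y4, e2] at hbp; exact absurd ((circ c a).refl p) hbp
          rw [h.away y y1 y2 y3 y4] at hbp
          exact absurd (tr _ _ _ hp (ca y)) hbp
        rcases hxy' with h | h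
        · exact Or.inr (Or.inl ⟨h, this⟩)
        · exact Or.inl (tr _ _ _ h this)
    by_cases hq : circ c a q y
    · have hxy' : circ c a x p ∨ circ c a x q := by
        rcases hxy with h | h | h
        · exact Or.inr (tr _ _ _ h (sy _ _ hq))
        · exact Or.inl h.1
        · exact Or.inr h.1
      by_cases hbp : circ c a q (b.partner y)
      · rcases hxy' with h | h
        · exact Or.inr (Or.inl ⟨h, hbp⟩)
        · exact Or.inl (tr _ _ _ h hbp)
      · have : circ c a p (b.partner y) := by
          by_cases y1 : y = p
          · rw [y1, h.left] at hbp; exact absurd (ca q) hbp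
          by_cases y2 : y = q
          · rw [y2, h.right]; exact ca p
          by_cases y3 : y = a.partner p
          · rw [y3, e1] at hbp; exact absurd ((circ c a).refl q) hbp
          by_cases y4 : y = a.partner q
          · rw [y4, e2]
          rw [h.away y y1 y2 y3 y4] at hbp
          exact absurd (tr _ _ _ hq (ca y)) hbp
        rcases hxy' with h | h
        · exact Or.inl (tr _ _ _ h this)
        · exact Or.inr (Or.inr ⟨h, this⟩)
    · have : b.partner y = a.partner y := by
        refine h.away y ?_ ?_ ?_ ?_ <;> rintro rfl
        · exact hp ((circ c a).refl _)
        · exact hq ((circ c a).refl _)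
        · exact hp (ca _)
        · exact hq (ca _)
      rw [this]
      rcases hxy with h | h | h
      · exact Or.inl (tr _ _ _ h (ca y))
      · exact absurd h.2 hq
      · exact absurd h.2 hp

/-- The permutations `turn c a` and `turn c b` differ by the transposition of `p` and `q`, so the
surgery really joins or splits. The orientation by parity is essential: an unoriented surgery could
turn one circle into one circle. -/
theorem SurgeryAt.isSaddle {a b : Matching n} {p q : Fin (2 * n)} (h : SurgeryAt a b p q)
    (c : Matching n) : IsSaddle (circ c a) (circ c b) p q := by
  refine ⟨?_, h.circ_le c, h.symm.circ_le c⟩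
  rw [circ_iff_sameCycle c a h.even_left h.even_right,
    circ_iff_sameCycle c b h.even_left h.even_right]
  have : turn c b = turn c a * Equiv.swap p q := by
    ext1 x
    rw [Equiv.Perm.mul_apply]
    by_cases hx : Even x.val
    · by_cases hxp : x = p
      · rw [hxp, Equiv.swap_apply_left, turn_apply _ _ h.even_left, turn_apply _ _ h.even_right,
          h.left]
      by_cases hxq : x = q
      · rw [hxq, Equiv.swap_apply_right, turn_apply _ _ h.even_left, turn_apply _ _ h.even_right,
          h.right]
      rw [Equiv.swap_apply_of_ne_of_ne hxp hxq, turn_apply _ _ hx, turn_apply _ _ hx,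
        h.away x hxp hxq (partner_ne hx h.even_left) (partner_ne hx h.even_right)]
    · rw [Equiv.swap_apply_of_ne_of_ne]
      · exact (if_neg hx : turn c b x = x).trans (if_neg hx : turn c a x = x).symm
      · rintro rfl; exact hx h.even_left
      · rintro rfl; exact hx h.even_right
  rw [this, Equiv.Perm.sameCycle_mul_swap_iff _ h.ne, not_not]

end Matching

/-! ## The multiplication of `H^n` by multiplicative generators -/

section SaddleMaps

variable {P : Type}

open Classical in
theorem saddle_nonneg (u v v' : P → P) (p q : P) (s t : P → Bool) :
    0 ≤ saddle u v v' p q s t := by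
  unfold saddle
  exact ite_nonneg zero_le_one le_rfl

theorem sameCircle_const {u v : P → P} {t : P → Bool} (hu : ∀ x, t (u x) = t x)
    (hv : ∀ x, t (v x) = t x) {x y : P} (h : SameCircle u v x y) : t x = t y :=
  sameCircle_iff_of_invariant (R := fun x y => t x = t y) (fun _ => rfl)
    (fun x y h => by rw [hu, h]) (fun x y h => by rw [hv, h]) h

open Classical in
theorem saddle_ne_zero_iff {u v v' : P → P} {r r' : Setoid P}
    (hr : ∀ x y, SameCircle u v x y ↔ r x y) (hr' : ∀ x y, SameCircle u v' x y ↔ r' x y)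
    {p q : P} {s t : P → Bool} (hs : ∀ x y, r x y → s x = s y) :
    saddle u v v' p q s t ≠ 0 ↔ SaddleStep r r' p q s t := by
  unfold saddle
  constructor
  · intro h
    obtain ⟨h1, h2, h3⟩ := (ite_ne_right_iff.1 h).1
    refine ⟨hs, fun x y hxy => ?_, fun x hp hq => h2 x (mt (hr _ _).1 hp) (mt (hr _ _).1 hq),
      fun h => ?_, fun h => ?_⟩
    · exact sameCircle_const (fun x => (h1 x).1) (fun x => (h1 x).2) ((hr' x y).2 hxy)
    · rwa [if_pos ((hr _ _).2 h)] at h3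
    · rwa [if_neg (mt (hr _ _).1 h)] at h3
  · rintro ⟨-, h1, h2, h3, h4⟩
    have e1 : ∀ x, r' x (u x) := fun x => (hr' _ _).1 (Relation.ReflTransGen.single (Or.inl rfl))
    have e2 : ∀ x, r' x (v' x) := fun x => (hr' _ _).1 (Relation.ReflTransGen.single (Or.inr rfl))
    refine ite_ne_right_iff.2 ⟨⟨fun x => ⟨(h1 _ _ (e1 x)).symm, (h1 _ _ (e2 x)).symm⟩,
      fun x hp hq => h2 x (mt (hr _ _).2 hp) (mt (hr _ _).2 hq), ?_⟩, one_ne_zero⟩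
    by_cases h : r p q
    · rw [if_pos ((hr _ _).2 h)]; exact h3 h
    · rw [if_neg (mt (hr _ _).1 h)]; exact h4 h

variable {n : ℕ}

theorem saddles_nonneg (u : Bool × Fin (2 * n) → Bool × Fin (2 * n)) (b : Matching n)
    (l : List (Fin (2 * n))) (S : Finset (Fin (2 * n))) (s t : Bool × Fin (2 * n) → Bool) :
    0 ≤ saddles u b l S s t := by
  induction l generalizing S s with
  | nil => unfold saddles; split_ifs <;> simp
  | cons i l ih =>
    exact Finset.sum_nonneg fun r _ => mul_nonneg (saddle_nonneg _ _ _ _ _ _ _) (ih _ _)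

/-- All entries are nonnegative, so nothing cancels: an entry of a composite is nonzero as soon as
one path of labelings contributes. This turns products in the arc algebra into reachability
statements. -/
theorem saddles_cons_ne_zero (u : Bool × Fin (2 * n) → Bool × Fin (2 * n)) (b : Matching n)
    (i : Fin (2 * n)) (l : List (Fin (2 * n))) (S : Finset (Fin (2 * n)))
    (s t : Bool × Fin (2 * n) → Bool) :
    saddles u b (i :: l) S s t ≠ 0 ↔
      ∃ r, saddle u (innerArcs b S) (innerArcs b (insert i (insert (b.partner i) S)))
          (false, i) (true, b.partner i) s r ≠ 0 ∧
        saddles u b l (insert i (insert (b.partner i) S)) r t ≠ 0 := by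
  rw [saddles, Ne, Finset.sum_eq_zero_iff_of_nonneg
    (fun r _ => mul_nonneg (saddle_nonneg _ _ _ _ _ _ _) (saddles_nonneg _ _ _ _ _ _))]
  simp

theorem saddles_nil_ne_zero (u : Bool × Fin (2 * n) → Bool × Fin (2 * n)) (b : Matching n)
    (S : Finset (Fin (2 * n))) (s t : Bool × Fin (2 * n) → Bool) :
    saddles u b [] S s t ≠ 0 ↔ s = t := by
  rw [saddles]
  simp

end SaddleMaps

/-! ### Partial surgeries: a model for circles and labels -/

namespace Matching

variable {n : ℕ}

/-- The outer arcs of `W(c)b ⊔ W(b)d`. -/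
def outerArcs (c d : Matching n) (x : Bool × Fin (2 * n)) : Bool × Fin (2 * n) :=
  (x.1, if x.1 then d.partner x.2 else c.partner x.2)

/-- The points of `W(c)b` are kept; a point `i` of `W(b)d` is moved to the point `A i` of `W(c)b`
on its circle, if there is any. -/
def collapse (A : Fin (2 * n) → Option (Fin (2 * n))) (x : Bool × Fin (2 * n)) :
    Fin (2 * n) ⊕ Fin (2 * n) :=
  if x.1 then (A x.2).elim (Sum.inr x.2) Sum.inl else Sum.inl x.2

/-- Disjoint union of two partitions. -/
def sumSetoid {X Y : Type} (r : Setoid X) (r' : Setoid Y) : Setoid (X ⊕ Y) where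
  r := Sum.LiftRel r r'
  iseqv :=
    { refl := by rintro (x | x) <;> simp
      symm := by
        rintro (x | x) (y | y) <;> simp
        · exact fun h => r.symm h
        · exact fun h => r'.symm h
      trans := by
        rintro (x | x) (y | y) (z | z) <;> simp
        · exact fun h => r.trans h
        · exact fun h => r'.trans h }

/-- The expected circles of a partial surgery of `W(c)b ⊔ W(b)d`, where `W(c)e` are the circles
which are formed by the points of `W(c)b`. -/
def model (c e b d : Matching n) (A : Fin (2 * n) → Option (Fin (2 * n))) :
    Setoid (Bool × Fin (2 * n)) :=
  (sumSetoid (circ c e) (circ b d)).comap (collapse A)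

/-- The labeling with labels `σ` on the circles that meet `W(c)b` and labels `g` on the others. -/
def state (σ g : Fin (2 * n) → Bool) (A : Fin (2 * n) → Option (Fin (2 * n)))
    (x : Bool × Fin (2 * n)) : Bool :=
  Sum.elim σ g (collapse A x)

section

variable {c e b d : Matching n} {A A' : Fin (2 * n) → Option (Fin (2 * n))} {i j a a' : Fin (2 * n)}

theorem model_iff {x y : Bool × Fin (2 * n)} : model c e b d A x y ↔
    Sum.LiftRel (circ c e) (circ b d) (collapse A x) (collapse A y) := Iff.rfl

theorem collapse_some (h : A i = some a) : collapse A (true, i) = Sum.inl a := by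
  simp [collapse, h]

theorem collapse_none (h : A i = none) : collapse A (true, i) = Sum.inr i := by
  simp [collapse, h]

theorem model_ff : model c e b d A (false, i) (false, j) ↔ circ c e i j := Sum.liftRel_inl_inl

theorem model_ft (h : A j = some a) : model c e b d A (false, i) (true, j) ↔ circ c e i a := by
  rw [model_iff, collapse_some h]; exact Sum.liftRel_inl_inl

theorem model_tf (h : A j = some a) : model c e b d A (true, j) (false, i) ↔ circ c e a i := by
  rw [model_iff, collapse_some h]; exact Sum.liftRel_inl_inl

theorem model_ft_none (h : A j = none) : ¬ model c e b d A (false, i) (true, j) := by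
  rw [model_iff, collapse_none h]; exact Sum.not_liftRel_inl_inr

theorem model_tf_none (h : A j = none) : ¬ model c e b d A (true, j) (false, i) := by
  rw [model_iff, collapse_none h]; exact Sum.not_liftRel_inr_inl

theorem model_tt_some (h : A i = some a) (h' : A j = some a') :
    model c e b d A (true, i) (true, j) ↔ circ c e a a' := by
  rw [model_iff, collapse_some h, collapse_some h']; exact Sum.liftRel_inl_inl

theorem model_tt_none (h : A i = none) (h' : A j = none) :
    model c e b d A (true, i) (true, j) ↔ circ b d i j := by
  rw [model_iff, collapse_none h, collapse_none h']; exact Sum.liftRel_inr_inr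

theorem model_tt_none_some (h : A i = none) (h' : A j = some a') :
    ¬ model c e b d A (true, i) (true, j) := by
  rw [model_iff, collapse_none h, collapse_some h']; exact Sum.not_liftRel_inr_inl

theorem state_false (σ g : Fin (2 * n) → Bool) : state σ g A (false, i) = σ i := rfl

theorem state_some (σ g : Fin (2 * n) → Bool) (h : A i = some a) :
    state σ g A (true, i) = σ a := by
  rw [state, collapse_some h]; rfl

theorem state_none (σ g : Fin (2 * n) → Bool) (h : A i = none) :
    state σ g A (true, i) = g i := by
  rw [state, collapse_none h]; rfl

theorem state_const {σ g : Fin (2 * n) → Bool} (hσ : ∀ x y, circ c e x y → σ x = σ y)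
    (hg : ∀ x y, circ b d x y → g x = g y) (x y : Bool × Fin (2 * n))
    (h : model c e b d A x y) : state σ g A x = state σ g A y := by
  rw [model_iff] at h
  rw [state, state]
  generalize collapse A x = x' at h
  generalize collapse A y = y' at h
  cases h with
  | inl h => exact hσ _ _ h
  | inr h => exact hg _ _ h

/-- The circles of the surgery of `W(c)b ⊔ W(b)d` along the arcs with endpoints in `S` are as
described by `e` and `A`. -/
structure IsState (c e b d : Matching n) (S : Finset (Fin (2 * n)))
    (A : Fin (2 * n) → Option (Fin (2 * n))) : Prop where
  closed : ∀ i ∈ S, b.partner i ∈ S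
  arc : ∀ i ∉ S, circ c e i (b.partner i)
  mem : ∀ i ∈ S, ∃ a, A i = some a ∧ circ c e i a
  none_right : ∀ i, A i = none → A (d.partner i) = none
  some_right : ∀ i a, A i = some a → ∃ a', A (d.partner i) = some a' ∧ circ c e a a'
  none_left : ∀ i ∉ S, A i = none → A (b.partner i) = none
  some_left : ∀ i ∉ S, ∀ a, A i = some a → ∃ a', A (b.partner i) = some a' ∧ circ c e a a'
  joined : ∀ i, SameCircle (outerArcs c d) (innerArcs b S) (false, i) (false, e.partner i)
  joined_some : ∀ i a, A i = some a →
    SameCircle (outerArcs c d) (innerArcs b S) (true, i) (false, a)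

theorem outerArcs_invol (x : Bool × Fin (2 * n)) : outerArcs c d (outerArcs c d x) = x := by
  obtain ⟨_ | _, i⟩ := x <;> simp [outerArcs, c.invol, d.invol]

theorem innerArcs_invol {S : Finset (Fin (2 * n))} (hS : ∀ i ∈ S, b.partner i ∈ S)
    (x : Bool × Fin (2 * n)) : innerArcs b S (innerArcs b S x) = x := by
  obtain ⟨y, i⟩ := x
  by_cases h : i ∈ S
  · simp [innerArcs, h]
  · have : b.partner i ∉ S := fun h' => h (by simpa [b.invol] using hS _ h')
    simp [innerArcs, h, this, b.invol]

theorem innerArcs_mem {S : Finset (Fin (2 * n))} (h : i ∈ S) (y : Bool) :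
    innerArcs b S (y, i) = (!y, i) := if_pos h

theorem innerArcs_not_mem {S : Finset (Fin (2 * n))} (h : i ∉ S) (y : Bool) :
    innerArcs b S (y, i) = (y, b.partner i) := if_neg h

theorem step_left {S : Finset (Fin (2 * n))} (i : Fin (2 * n)) :
    SameCircle (outerArcs c d) (innerArcs b S) (false, i) (false, c.partner i) :=
  Relation.ReflTransGen.single (Or.inl rfl)

theorem step_right {S : Finset (Fin (2 * n))} (i : Fin (2 * n)) :
    SameCircle (outerArcs c d) (innerArcs b S) (true, i) (true, d.partner i) :=
  Relation.ReflTransGen.single (Or.inl rfl)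

theorem step_mem {S : Finset (Fin (2 * n))} (h : i ∈ S) (y : Bool) :
    SameCircle (outerArcs c d) (innerArcs b S) (y, i) (!y, i) :=
  Relation.ReflTransGen.single (Or.inr (innerArcs_mem h y).symm)

theorem step_not_mem {S : Finset (Fin (2 * n))} (h : i ∉ S) (y : Bool) :
    SameCircle (outerArcs c d) (innerArcs b S) (y, i) (y, b.partner i) :=
  Relation.ReflTransGen.single (Or.inr (innerArcs_not_mem h y).symm)

/-- In one direction, the model relation absorbs every single arc. In the other, paths are traced:
`joined` realizes the arcs of `e`, and `joined_some` leads from the right copy back to the left one.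
-/
theorem IsState.sameCircle_iff {S : Finset (Fin (2 * n))} (h : IsState c e b d S A)
    (x y : Bool × Fin (2 * n)) :
    SameCircle (outerArcs c d) (innerArcs b S) x y ↔ model c e b d A x y := by
  have tr := fun x y z => @Setoid.trans' _ (model c e b d A) x y z
  constructor
  · refine sameCircle_iff_of_invariant (R := model c e b d A)
      (fun x => (model c e b d A).refl x) (fun x y hxy => tr _ _ _ hxy ?_)
      (fun x y hxy => tr _ _ _ hxy ?_)
    · obtain ⟨_ | _, i⟩ := y
      · exact model_ff.2 (circ_left c e i)
      · change model c e b d A (true, i) (true, d.partner i)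
        rcases hi : A i with _ | a
        · exact (model_tt_none hi (h.none_right i hi)).2 (circ_right b d i)
        · obtain ⟨a', ha', hc⟩ := h.some_right i a hi
          exact (model_tt_some hi ha').2 hc
    · obtain ⟨z, i⟩ := y
      by_cases hi : i ∈ S
      · rw [innerArcs_mem hi]
        obtain ⟨a, ha, hc⟩ := h.mem i hi
        cases z
        · exact (model_ft ha).2 hc
        · exact (model_tf ha).2 ((circ c e).symm hc)
      · rw [innerArcs_not_mem hi]
        cases z
        · exact model_ff.2 (h.arc i hi)
        · rcases hA : A i with _ | a
          · exact (model_tt_none hA (h.none_left i hi hA)).2 (circ_left b d i)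
          · obtain ⟨a', ha', hc⟩ := h.some_left i hi a hA
            exact (model_tt_some hA ha').2 hc
  · have tr' := fun x y z => @Relation.ReflTransGen.trans _
      (fun x y => y = outerArcs c d x ∨ y = innerArcs b S x) x y z
    have hff : ∀ i j, circ c e i j →
        SameCircle (outerArcs c d) (innerArcs b S) (false, i) (false, j) := fun i j hij =>
      sameCircle_iff_of_invariant
        (R := fun i j => SameCircle (outerArcs c d) (innerArcs b S) (false, i) (false, j))
        (fun x => Relation.ReflTransGen.refl) (fun x y hxy => tr' _ _ _ hxy (step_left y))
        (fun x y hxy => tr' _ _ _ hxy (h.joined y)) (circ_iff.1 hij)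
    -- A circle of the right copy on which `A` is undefined never meets a surgered arc, so it is
    -- still intact.
    have htt : ∀ i j, circ b d i j → A i = none → A j = none ∧
        SameCircle (outerArcs c d) (innerArcs b S) (true, i) (true, j) := fun i j hij =>
      sameCircle_iff_of_invariant (R := fun i j => A i = none → A j = none ∧
          SameCircle (outerArcs c d) (innerArcs b S) (true, i) (true, j))
        (fun x hx => ⟨hx, Relation.ReflTransGen.refl⟩)
        (fun x y hxy hx => by
          obtain ⟨h1, h2⟩ := hxy hx
          have hy : y ∉ S := fun hy => by
            obtain ⟨a, ha, -⟩ := h.mem y hy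
            simp [h1] at ha
          exact ⟨h.none_left y hy h1, tr' _ _ _ h2 (step_not_mem hy true)⟩)
        (fun x y hxy hx => ⟨h.none_right y (hxy hx).1, tr' _ _ _ (hxy hx).2 (step_right y)⟩)
        (circ_iff.1 hij)
    have sy := fun x y => @sameCircle_symm _ (outerArcs c d) (innerArcs b S)
      outerArcs_invol (innerArcs_invol h.closed) x y
    obtain ⟨_ | _, i⟩ := x <;> obtain ⟨_ | _, j⟩ := y
    · rw [model_ff]; exact hff i j
    · rcases hj : A j with _ | a
      · exact fun h' => absurd h' (model_ft_none hj)
      · rw [model_ft hj]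
        exact fun h' => tr' _ _ _ (hff _ _ h') (sy _ _ (h.joined_some j a hj))
    · rcases hi : A i with _ | a
      · exact fun h' => absurd h' (model_tf_none hi)
      · rw [model_tf hi]
        exact fun h' => tr' _ _ _ (h.joined_some i a hi) (hff _ _ h')
    · rcases hi : A i with _ | a <;> rcases hj : A j with _ | a'
      · rw [model_tt_none hi hj]; exact fun h' => (htt i j h' hi).2
      · exact fun h' => absurd h' (model_tt_none_some hi hj)
      · exact fun h' => absurd ((model c e b d A).symm h') (model_tt_none_some hj hi)
      · rw [model_tt_some hi hj]
        exact fun h' => tr' _ _ _ (tr' _ _ _ (h.joined_some i a hi) (hff _ _ h'))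
          (sy _ _ (h.joined_some j a' hj))

/-- Merging a circle of `W(b)d` with a circle which meets `W(c)b`. -/
theorem merge_step {i' : Fin (2 * n)} (hnone : ∀ k, circ b d i k → A k = none)
    (hsome : ∀ k, circ b d i k → ∃ a, A' k = some a ∧ circ c e i a)
    (haway : ∀ k, ¬ circ b d i k → A' k = A k) (hi' : circ b d i i')
    {σ g : Fin (2 * n) → Bool} (hσ : ∀ x y, circ c e x y → σ x = σ y)
    (hg : ∀ x y, circ b d x y → g x = g y) (τ : Bool × Fin (2 * n) → Bool) :
    SaddleStep (model c e b d A) (model c e b d A') (false, i) (true, i') (state σ g A) τ ↔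
      ¬ (σ i = true ∧ g i = true) ∧
        τ = state (if g i = true then relabel (circ c e) i true σ else σ) g A' := by
  set σ' := if g i = true then relabel (circ c e) i true σ else σ with hσ'
  have s1 : ∀ a, circ c e i a → σ' a = (σ i || g i) := by
    intro a ha
    rcases hgi : g i with _ | _
    · rw [hσ', hgi, if_neg (by simp), ← hσ _ _ ha]; simp
    · rw [hσ', hgi, if_pos rfl, relabel_of_rel ha]; simp
  have s2 : ∀ a, ¬ circ c e i a → σ' a = σ a := by
    intro a ha
    rcases hgi : g i with _ | _
    · rw [hσ', hgi]; simp
    · rw [hσ', hgi, if_pos rfl, relabel_of_not_rel ha]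
  have s3 : ∀ x y, circ c e x y → σ' x = σ' y := by
    rw [hσ']
    split_ifs
    · exact relabel_const _ _ hσ
    · exact hσ
  have hm : ¬ model c e b d A (false, i) (true, i') := model_ft_none (hnone _ hi')
  have aw : ∀ x, ¬ model c e b d A (false, i) x → ¬ model c e b d A (true, i') x →
      state σ' g A' x = state σ g A x := by
    rintro ⟨_ | _, k⟩ h1 h2
    · rw [model_ff] at h1
      exact s2 k h1
    · rcases hk : A k with _ | a
      · rw [model_tt_none (hnone _ hi') hk] at h2
        have : ¬ circ b d i k := fun h => h2 ((circ b d).trans ((circ b d).symm hi') h)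
        rw [state_none _ _ hk, state_none _ _ ((haway k this).trans hk)]
      · rw [model_ft hk] at h1
        have : ¬ circ b d i k := fun h => by simp [hnone k h] at hk
        rw [state_some _ _ hk, state_some _ _ ((haway k this).trans hk), s2 a h1]
  constructor
  · rintro ⟨-, h1, h2, -, h3⟩
    obtain ⟨h3, h4⟩ := h3 hm
    rw [state_false, state_none _ _ (hnone _ hi'), ← hg _ _ hi'] at h3 h4
    refine ⟨h3, funext fun x => ?_⟩
    by_cases hx : model c e b d A' (false, i) x
    · rw [← h1 _ _ hx, h4, ← state_const s3 hg _ _ hx, state_false, s1 i ((circ c e).refl i)]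
    · have hx1 : ¬ model c e b d A (false, i) x := by
        obtain ⟨_ | _, k⟩ := x
        · exact hx
        · rcases hk : A k with _ | a
          · exact model_ft_none hk
          · have : ¬ circ b d i k := fun h => by simp [hnone k h] at hk
            rwa [model_ft hk, ← model_ft (b := b) (d := d) ((haway k this).trans hk)]
      have hx2 : ¬ model c e b d A (true, i') x := by
        obtain ⟨_ | _, k⟩ := x
        · exact model_tf_none (hnone _ hi')
        · rcases hk : A k with _ | a
          · rw [model_tt_none (hnone _ hi') hk]
            intro h
            obtain ⟨a, ha, hc⟩ := hsome k ((circ b d).trans hi' h)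
            exact hx ((model_ft ha).2 hc)
          · exact model_tt_none_some (hnone _ hi') hk
      rw [h2 x hx1 hx2, aw x hx1 hx2]
  · rintro ⟨h1, rfl⟩
    refine ⟨state_const hσ hg, state_const s3 hg, aw, fun h => absurd h hm, fun _ => ?_⟩
    rw [state_false, state_none _ _ (hnone _ hi'), ← hg _ _ hi', state_false]
    exact ⟨h1, s1 i ((circ c e).refl i)⟩

/-- The surgery which changes `W(c)b` to `W(c)d`. -/
theorem surgery_step {i' j₁ j₂ : Fin (2 * n)} (h₁ : A i' = some j₁) (hj₁ : circ c b j₁ j)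
    (h₂ : A' i' = some j₂) (hj₂ : circ c d j₂ j) (hnone : ∀ k, A k = none → A' k = none)
    (hsome : ∀ k a, A k = some a →
      ∃ a', A' k = some a' ∧ (circ c b i a ∨ circ c b j a ∨ a' = a))
    {σ g : Fin (2 * n) → Bool} (hσ : ∀ x y, circ c b x y → σ x = σ y)
    (hg : ∀ x y, circ b d x y → g x = g y) (τ : Bool × Fin (2 * n) → Bool) :
    SaddleStep (model c b b d A) (model c d b d A') (false, i) (true, i') (state σ g A) τ ↔
      ∃ σ', SaddleStep (circ c b) (circ c d) i j σ σ' ∧ τ = state σ' g A' := by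
  have hm : model c b b d A (false, i) (true, i') ↔ circ c b i j := by
    rw [model_ft h₁]
    exact ⟨fun h => (circ c b).trans h hj₁,
      fun h => (circ c b).trans h ((circ c b).symm hj₁)⟩
  constructor
  · rintro ⟨a1, a2, a3, a4, a5⟩
    have e2 : τ (true, i') = τ (false, j) := a2 _ _ ((model_tf h₂).2 hj₂)
    have e1 : state σ g A (true, i') = σ j := by rw [state_some _ _ h₁, hσ _ _ hj₁]
    refine ⟨fun k => τ (false, k), ⟨hσ, fun x y h => a2 _ _ (model_ff.2 h), fun x hx hx' => ?_,
      fun h => ?_, fun h => ?_⟩, funext fun x => ?_⟩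
    · refine a3 (false, x) (mt model_ff.1 hx) ?_
      rw [model_tf h₁]
      exact fun h => hx' ((circ c b).trans ((circ c b).symm hj₁) h)
    · have := a4 (hm.2 h)
      rwa [e2] at this
    · have := a5 (mt hm.1 h)
      rwa [e1] at this
    · obtain ⟨_ | _, k⟩ := x
      · rfl
      · rcases hk : A k with _ | a
        · rw [a3 _ (model_ft_none hk) (fun h => model_tt_none_some hk h₁
            ((model c b b d A).symm h)), state_none _ _ hk, state_none _ _ (hnone k hk)]
        · obtain ⟨a', ha', -⟩ := hsome k a hk
          rw [state_some _ _ ha']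
          exact a2 _ _ ((model_tf ha').2 ((circ c d).refl a'))
  · rintro ⟨σ', ⟨a1, a2, a3, a4, a5⟩, rfl⟩
    have e2 : state σ' g A' (true, i') = σ' j := by rw [state_some _ _ h₂, a2 _ _ hj₂]
    have e1 : state σ g A (true, i') = σ j := by rw [state_some _ _ h₁, hσ _ _ hj₁]
    refine ⟨state_const hσ hg, state_const a2 hg, ?_, fun h => ?_, fun h => ?_⟩
    · rintro ⟨_ | _, k⟩ hx hx'
      · rw [model_ff] at hx
        rw [model_tf h₁] at hx'
        exact a3 k hx fun h => hx' ((circ c b).trans hj₁ h)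
      · rcases hk : A k with _ | a
        · rw [state_none _ _ hk, state_none _ _ (hnone k hk)]
        · rw [model_ft hk] at hx
          rw [model_tt_some h₁ hk] at hx'
          obtain ⟨a', ha', h | h | h⟩ := hsome k a hk
          · exact absurd h hx
          · exact absurd ((circ c b).trans hj₁ h) hx'
          · rw [state_some _ _ hk, state_some _ _ ha', h]
            exact a3 a hx fun h => hx' ((circ c b).trans hj₁ h)
    · rw [e2]; exact a4 (hm.1 h)
    · rw [e1]; exact a5 (mt hm.2 h)

end

end Matching

/-! ### Changing the marked points of a saddle -/

section

variable {P : Type}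

theorem SaddleStep.swap {r r' : Setoid P} {p q : P} {s t : P → Bool} (hx : IsSaddle r r' p q)
    (h : SaddleStep r r' p q s t) : SaddleStep r r' q p s t := by
  obtain ⟨a1, a2, a3, a4, a5⟩ := h
  refine ⟨a1, a2, fun x h1 h2 => a3 x h2 h1, fun h => ?_, fun h => ?_⟩
  · have h' := r.symm h
    have := a4 h'
    rw [← a1 _ _ h']
    by_cases hs : s p = true
    · rw [if_pos hs] at this ⊢; exact this.symm
    · rw [if_neg hs] at this ⊢; exact this.symm
  · have h' : ¬ r p q := fun h' => h (r.symm h')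
    have ht : t p = t q := a2 _ _ (not_not.1 fun h'' => h' (hx.xor.2 h''))
    have := a5 h'
    rw [← ht, Bool.or_comm, and_comm (a := s q = true)]
    exact this

/-- In the application `p'` and `q'` are the opposite ends of the two arcs; the saddle exchanges the
arcs' ends, so that afterwards `p` is joined to `q'` and `q` to `p'`. The saddle may be read at
either pair of ends. -/
theorem SaddleStep.cross {r r' : Setoid P} {p q p' q' : P} {s t : P → Bool}
    (hx : IsSaddle r r' p q) (h : SaddleStep r r' p q s t) (hp : r p p') (hq : r q q')
    (hp' : r' p q') (hq' : r' q p') : SaddleStep r r' p' q' s t := by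
  have hx' := hx.symm
  obtain ⟨a1, a2, a3, a4, a5⟩ := h.swap hx
  have e : r q p ↔ r p' q' :=
    ⟨fun h => r.trans (r.symm hp) (r.trans (r.symm h) hq),
      fun h => r.trans hq (r.trans (r.symm h) (r.symm hp))⟩
  refine ⟨a1, a2, fun x h1 h2 => a3 x (fun h => h2 (r.trans (r.symm hq) h))
    (fun h => h1 (r.trans (r.symm hp) h)), fun h => ?_, fun h => ?_⟩
  · have := a4 (e.2 h)
    rwa [← a1 _ _ hp, ← a2 _ _ hp', ← a2 _ _ hq', a1 _ _ (r.symm (e.2 h))]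
  · have := a5 (mt e.1 h)
    rwa [← a1 _ _ hp, ← a1 _ _ hq, ← a2 _ _ hq', Bool.or_comm, and_comm (a := s p = true)]

end

/-! ### The circles of W(b)d for a surgery from b to d, and the intermediate states -/

namespace Matching

variable {n : ℕ} {b c d e : Matching n} {p q i j k : Fin (2 * n)}

theorem SurgeryAt.swap (h : SurgeryAt b d p q) : SurgeryAt b d q p :=
  ⟨h.even_right, h.even_left, h.ne.symm, h.right, h.left,
    fun x h1 h2 h3 h4 => h.away x h2 h1 h4 h3⟩

theorem SurgeryAt.left' (h : SurgeryAt b d p q) : d.partner (b.partner p) = q := by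
  rw [← h.right, d.invol]

theorem SurgeryAt.right' (h : SurgeryAt b d p q) : d.partner (b.partner q) = p := by
  rw [← h.left, d.invol]

theorem SurgeryAt.ne_iff (h : SurgeryAt b d p q) (k : Fin (2 * n)) :
    d.partner k ≠ b.partner k ↔ k = p ∨ k = q ∨ k = b.partner p ∨ k = b.partner q := by
  constructor
  · intro hk
    by_contra hn
    simp only [not_or] at hn
    exact hk (h.away k hn.1 hn.2.1 hn.2.2.1 hn.2.2.2)
  · have inj : ∀ x y, b.partner x = b.partner y → x = y := fun x y h => by
      rw [← b.invol x, h, b.invol]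
    rintro (rfl | rfl | rfl | rfl)
    · rw [h.left]; exact fun h' => h.ne (inj _ _ h').symm
    · rw [h.right]; exact fun h' => h.ne (inj _ _ h')
    · rw [h.left', b.invol]; exact h.ne.symm
    · rw [h.right', b.invol]; exact h.ne

/-- The four endpoints of the surgered arcs. -/
theorem SurgeryAt.four (h : SurgeryAt b d p q) (hj : d.partner j ≠ b.partner j)
    (hi : d.partner i ≠ b.partner i) :
    i = j ∨ i = b.partner j ∨ d.partner i = j ∨ d.partner i = b.partner j := by
  rw [h.ne_iff] at hi hj
  have := h.left; have := h.right; have := h.left'; have := h.right'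
  rcases hi with rfl | rfl | rfl | rfl <;> rcases hj with rfl | rfl | rfl | rfl <;>
    simp_all [b.invol]

theorem ne_left (h : d.partner i ≠ b.partner i) :
    d.partner (b.partner i) ≠ b.partner (b.partner i) := by
  rw [b.invol]
  intro h'
  have := congrArg d.partner h'
  rw [d.invol] at this
  exact h this.symm

theorem ne_right (h : d.partner i ≠ b.partner i) :
    d.partner (d.partner i) ≠ b.partner (d.partner i) := by
  rw [d.invol]
  intro h'
  have := congrArg b.partner h'
  rw [b.invol] at this
  exact h this.symm

/-- Alternating steps of `b` and `d` run through all four surgered points. Together with `circ_ne`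
and `circ_eq` this describes W(b)d: one large circle on these four points, and a small circle for
each arc common to `b` and `d`. -/
theorem SurgeryAt.circ_four (h : SurgeryAt b d p q) (hj : d.partner j ≠ b.partner j)
    (hi : d.partner i ≠ b.partner i) : circ b d i j := by
  have tr := fun x y z => @Setoid.trans' _ (circ b d) x y z
  have sy := fun x y => @Setoid.symm' _ (circ b d) x y
  rcases h.four hj hi with rfl | rfl | h | h
  · exact (circ b d).refl i
  · exact sy _ _ (circ_left b d j)
  · rw [← h]; exact circ_right b d i
  · exact tr _ _ _ (circ_right b d i) (by rw [h]; exact sy _ _ (circ_left b d j))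

theorem circ_ne (hi : d.partner i ≠ b.partner i) (h : circ b d i k) :
    d.partner k ≠ b.partner k :=
  sameCircle_iff_of_invariant
    (R := fun i k => d.partner i ≠ b.partner i → d.partner k ≠ b.partner k)
    (fun _ h => h) (fun _ _ h h' => ne_left (h h')) (fun _ _ h h' => ne_right (h h'))
    (circ_iff.1 h) hi

theorem circ_eq (hi : d.partner i = b.partner i) (h : circ b d i k) :
    k = i ∨ k = b.partner i :=
  sameCircle_iff_of_invariant
    (R := fun i k => d.partner i = b.partner i → k = i ∨ k = b.partner i)
    (fun _ _ => Or.inl rfl)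
    (fun x y h h' => by rcases h h' with rfl | rfl <;> simp [b.invol])
    (fun x y h h' => by
      rcases h h' with rfl | rfl
      · exact Or.inr h'
      · rw [← h', d.invol]; exact Or.inl rfl)
    (circ_iff.1 h) hi

theorem circ_eq_iff (hi : d.partner i = b.partner i) :
    circ b d i k ↔ k = i ∨ k = b.partner i := by
  refine ⟨circ_eq hi, ?_⟩
  rintro (rfl | rfl)
  · exact (circ b d).refl _
  · exact circ_left b d i

/-- Surgered points of `W(b)d` are moved to the opposite points. -/
def stdCollapse (S : Finset (Fin (2 * n))) (i : Fin (2 * n)) : Option (Fin (2 * n)) :=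
  if i ∈ S then some i else none

/-- Surgered points of `W(b)d` are moved to the opposite points, except that those on the large
circle are moved to `j`. -/
def midCollapse (b d : Matching n) (j : Fin (2 * n)) (S : Finset (Fin (2 * n)))
    (i : Fin (2 * n)) : Option (Fin (2 * n)) :=
  if d.partner i ≠ b.partner i then some j else stdCollapse S i

/-- The surgeries along the arcs of `b` in the list `l` are still to be done. -/
structure ToDo (b : Matching n) (l : List (Fin (2 * n))) (S : Finset (Fin (2 * n))) : Prop where
  nodup : l.Nodup
  not_mem : ∀ i ∈ l, i ∉ S
  lt : ∀ i ∈ l, i < b.partner i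
  closed : ∀ i ∈ S, b.partner i ∈ S
  all : ∀ i, i ∈ S ∨ i ∈ l ∨ b.partner i ∈ l

theorem ToDo.tail {l : List (Fin (2 * n))} {S : Finset (Fin (2 * n))} (h : ToDo b (i :: l) S) :
    ToDo b l (insert i (insert (b.partner i) S)) := by
  obtain ⟨h1, h2, h3, h4, h5⟩ := h
  refine ⟨h1.of_cons, fun k hk hk' => ?_, fun k hk => h3 k (List.mem_cons_of_mem _ hk),
    fun k hk => ?_, fun k => ?_⟩
  · rw [Finset.mem_insert, Finset.mem_insert] at hk'
    rcases hk' with rfl | rfl | h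
    · exact (List.nodup_cons.1 h1).1 hk
    · have e1 := h3 _ (List.mem_cons_of_mem _ hk)
      have e2 := h3 i List.mem_cons_self
      rw [b.invol] at e1
      exact lt_asymm e1 e2
    · exact h2 k (List.mem_cons_of_mem _ hk) h
  · rw [Finset.mem_insert, Finset.mem_insert] at hk ⊢
    rcases hk with rfl | rfl | h
    · exact Or.inr (Or.inl rfl)
    · exact Or.inl (b.invol i)
    · exact Or.inr (Or.inr (h4 k h))
  · rw [Finset.mem_insert, Finset.mem_insert]
    rcases h5 k with h | h | h
    · exact Or.inl (Or.inr (Or.inr h))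
    · rcases List.mem_cons.1 h with rfl | h
      · exact Or.inl (Or.inl rfl)
      · exact Or.inr (Or.inl h)
    · rcases List.mem_cons.1 h with h | h
      · exact Or.inl (Or.inr (Or.inl (by rw [← h, b.invol])))
      · exact Or.inr (Or.inr h)

/-- The two alternatives are the stages before the first and after the second arc of the large
circle has been surgered. In both, each point of `S` is joined to its opposite copy, and `S` is also
closed under `d`. -/
theorem isState_std {S : Finset (Fin (2 * n))} (hS : ∀ i ∈ S, b.partner i ∈ S)
    (h : (e = b ∧ ∀ i ∈ S, d.partner i = b.partner i) ∨
      (e = d ∧ ∀ i ∉ S, d.partner i = b.partner i)) :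
    IsState c e b d S (stdCollapse S) := by
  have hb : ∀ i ∉ S, b.partner i ∉ S := fun i hi h' => hi (by simpa [b.invol] using hS _ h')
  have hd : ∀ i ∈ S, d.partner i ∈ S := by
    intro i hi
    rcases h with ⟨-, h⟩ | ⟨-, h⟩
    · rw [h i hi]; exact hS i hi
    · by_contra hn
      have h1 := h _ hn
      rw [d.invol] at h1
      exact hb _ hn (by rwa [← h1])
  have hd' : ∀ i ∉ S, d.partner i ∉ S := fun i hi h' => hi (by simpa [d.invol] using hd _ h')
  have std1 : ∀ i ∈ S, stdCollapse S i = some i := fun i hi => if_pos hi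
  have std2 : ∀ i ∉ S, stdCollapse S i = none := fun i hi => if_neg hi
  have std3 : ∀ i a, stdCollapse S i = some a → i ∈ S ∧ i = a := by
    intro i a h
    by_cases hi : i ∈ S
    · rw [std1 i hi] at h; exact ⟨hi, Option.some.inj h⟩
    · rw [std2 i hi] at h; cases h
  have std4 : ∀ i, stdCollapse S i = none → i ∉ S := by
    intro i h hi
    rw [std1 i hi] at h; cases h
  have tr := fun x y z => @Relation.ReflTransGen.trans _
      (fun x y => y = outerArcs c d x ∨ y = innerArcs b S x) x y z
  refine ⟨hS, fun i hi => ?_, fun i hi => ⟨i, std1 i hi, (circ c e).refl i⟩,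
    fun i hi => std2 _ (hd' i (std4 i hi)), fun i a ha => ?_,
    fun i hi _ => std2 _ (hb i hi), fun i hi a ha => absurd (std3 i a ha).1 hi, fun i => ?_,
    fun i a ha => ?_⟩
  · rcases h with ⟨rfl, h⟩ | ⟨rfl, h⟩
    · exact circ_right c e i
    · rw [← h i hi]; exact circ_right c e i
  · obtain ⟨hi, rfl⟩ := std3 i a ha
    refine ⟨_, std1 _ (hd i hi), ?_⟩
    rcases h with ⟨rfl, h⟩ | ⟨rfl, h⟩
    · rw [h i hi]; exact circ_right c e i
    · exact circ_right c e i
  · by_cases hi : i ∈ S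
    · have e1 : e.partner i = d.partner i := by
        rcases h with ⟨rfl, h⟩ | ⟨rfl, h⟩
        · rw [h i hi]
        · rfl
      rw [e1]
      exact tr _ _ _ (tr _ _ _ (step_mem hi false) (step_right i)) (step_mem (hd i hi) true)
    · have e1 : e.partner i = b.partner i := by
        rcases h with ⟨rfl, h⟩ | ⟨rfl, h⟩
        · rfl
        · rw [h i hi]
      rw [e1]
      exact step_not_mem hi false
  · obtain ⟨hi, rfl⟩ := std3 i a ha
    exact step_mem hi true

/-- The stage where just one of the two arcs of the large circle, that of `j`, has been surgered. On
the left this arc is replaced by a detour around the large circle, so the circles on the left are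
still those of W(c)b, and the whole large circle hangs on the circle of `j`. -/
theorem isState_mid {S : Finset (Fin (2 * n))} (hS : ∀ i ∈ S, b.partner i ∈ S)
    (h : SurgeryAt b d p q) (hj : d.partner j ≠ b.partner j)  (hjS : j ∈ S)
    (hF : ∀ i ∈ S, d.partner i ≠ b.partner i → i = j ∨ i = b.partner j) :
    IsState c b b d S (midCollapse b d j S) := by
  have hb : ∀ i ∉ S, b.partner i ∉ S := fun i hi h' => hi (by simpa [b.invol] using hS _ h')
  have mid1 : ∀ i, d.partner i ≠ b.partner i → midCollapse b d j S i = some j :=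
    fun i hi => if_pos hi
  have mid2 : ∀ i, d.partner i = b.partner i → i ∈ S → midCollapse b d j S i = some i :=
    fun i hi h => by rw [midCollapse, if_neg (not_not.2 hi), stdCollapse, if_pos h]
  have mid3 : ∀ i, d.partner i = b.partner i → i ∉ S → midCollapse b d j S i = none :=
    fun i hi h => by rw [midCollapse, if_neg (not_not.2 hi), stdCollapse, if_neg h]
  have mid4 : ∀ i, midCollapse b d j S i = none → d.partner i = b.partner i ∧ i ∉ S := by
    intro i hi
    by_cases h1 : d.partner i = b.partner i
    · refine ⟨h1, fun h2 => ?_⟩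
      rw [mid2 i h1 h2] at hi; cases hi
    · rw [mid1 i h1] at hi; cases hi
  have tr := fun x y z => @Relation.ReflTransGen.trans _
      (fun x y => y = outerArcs c d x ∨ y = innerArcs b S x) x y z
  have sy := fun x y => @Setoid.symm' _ (circ c b) x y
  have hdS : ∀ i ∉ S, d.partner i ≠ b.partner i →
      d.partner i ∈ S ∧ (d.partner i = j ∨ d.partner i = b.partner j) := by
    intro i hi hi'
    rcases h.four hj hi' with rfl | rfl | h | h
    · exact absurd hjS hi
    · exact absurd (hS j hjS) hi
    · rw [h]; exact ⟨hjS, Or.inl rfl⟩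
    · rw [h]; exact ⟨hS j hjS, Or.inr rfl⟩
  have hdS' : ∀ i ∈ S, d.partner i ≠ b.partner i → d.partner i ∉ S := by
    intro i hi hi' hdi
    have h1 := hF i hi hi'
    have h2 := hF _ hdi (ne_right hi')
    rcases h1 with rfl | rfl
    · rcases h2 with h | h
      · exact d.no_fixed _ h
      · exact hi' h
    · rcases h2 with h | h
      · exact hi' (by rw [h, b.invol])
      · exact d.no_fixed _ h
  have joined : ∀ i, SameCircle (outerArcs c d) (innerArcs b S) (false, i) (false, b.partner i) := by
    intro i
    by_cases hi : i ∈ S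
    · by_cases hi' : d.partner i = b.partner i
      · refine tr _ _ _ (tr _ _ _ (step_mem hi false) (step_right i)) ?_
        rw [hi']
        exact step_mem (hS i hi) true
      · have h1 := hdS' i hi hi'
        -- The detour runs around the four points of the large circle and returns at the other end
        -- of the surgered arc.
        have h2 : d.partner (b.partner (d.partner i)) = b.partner i := by
          have h3 := (hdS _ (hb _ h1) (ne_left (ne_right hi'))).2
          have h4 : d.partner (b.partner (d.partner i)) ≠ i := fun h => by
            have := congrArg d.partner h
            rw [d.invol] at this
            exact b.no_fixed _ this
          rcases hF i hi hi' with rfl | rfl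
          · rcases h3 with h3 | h3
            · exact absurd h3 h4
            · exact h3
          · rw [b.invol]
            rcases h3 with h3 | h3
            · exact h3
            · exact absurd h3 h4
        refine tr _ _ _ (tr _ _ _ (step_mem hi false) (step_right i)) ?_
        refine tr _ _ _ (tr _ _ _ (step_not_mem h1 true) (step_right _)) ?_
        rw [h2]
        exact step_mem (hS i hi) true
    · exact step_not_mem hi false
  have toj : ∀ i, i = j ∨ i = b.partner j →
      SameCircle (outerArcs c d) (innerArcs b S) (true, i) (false, j) := by
    rintro i (rfl | rfl)
    · exact step_mem hjS true
    · refine tr _ _ _ (step_mem (hS j hjS) true) ?_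
      have := joined (b.partner j)
      rwa [b.invol] at this
  refine ⟨hS, fun i _ => circ_right c b i, fun i hi => ?_, fun i hi => ?_, fun i a hi => ?_,
    fun i hi hA => ?_, fun i hi a hA => ?_, joined, fun i a hi => ?_⟩
  · by_cases hi' : d.partner i = b.partner i
    · exact ⟨i, mid2 i hi' hi, (circ c b).refl i⟩
    · refine ⟨j, mid1 i hi', ?_⟩
      rcases hF i hi hi' with rfl | rfl
      · exact (circ c b).refl _
      · exact sy _ _ (circ_right c b j)
  · obtain ⟨h1, h2⟩ := mid4 i hi
    rw [h1]
    exact mid3 _ (not_not.1 fun h' => by have := ne_left h'; rw [b.invol] at this; exact this h1)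
      (hb i h2)
  · by_cases hi' : d.partner i = b.partner i
    · have hiS : i ∈ S := by
        by_contra hn
        rw [mid3 i hi' hn] at hi; cases hi
      rw [mid2 i hi' hiS] at hi
      cases hi
      refine ⟨b.partner i, ?_, circ_right c b i⟩
      rw [hi']
      exact mid2 _ (not_not.1 fun h' => by
        have := ne_left h'; rw [b.invol] at this; exact this hi') (hS i hiS)
    · rw [mid1 i hi'] at hi
      cases hi
      exact ⟨j, mid1 _ (ne_right hi'), (circ c b).refl j⟩
  · obtain ⟨h1, h2⟩ := mid4 i hA
    exact mid3 _ (not_not.1 fun h' => by have := ne_left h'; rw [b.invol] at this; exact this h1)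
      (hb i h2)
  · by_cases hi' : d.partner i = b.partner i
    · rw [mid3 i hi' hi] at hA; cases hA
    · rw [mid1 i hi'] at hA
      cases hA
      exact ⟨j, mid1 _ (ne_left hi'), (circ c b).refl j⟩
  · by_cases hi' : d.partner i = b.partner i
    · have hiS : i ∈ S := by
        by_contra hn
        rw [mid3 i hi' hn] at hi; cases hi
      rw [mid2 i hi' hiS] at hi
      cases hi
      exact step_mem hiS true
    · rw [mid1 i hi'] at hi
      cases hi
      by_cases hiS : i ∈ S
      · exact toj i (hF i hiS hi')
      · exact tr _ _ _ (step_right i) (toj _ (hdS i hiS hi').2)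

end Matching

/-! ### Evaluating the chain of saddles for a multiplicative generator -/

namespace Matching

variable {n : ℕ} {b c d e : Matching n} {p q i j k : Fin (2 * n)}

theorem stdCollapse_of_mem {S : Finset (Fin (2 * n))} (h : i ∈ S) :
    stdCollapse S i = some i := if_pos h

theorem stdCollapse_of_not_mem {S : Finset (Fin (2 * n))} (h : i ∉ S) :
    stdCollapse S i = none := if_neg h

theorem state_full (σ g : Fin (2 * n) → Bool) {S : Finset (Fin (2 * n))} (hS : ∀ i, i ∈ S) :
    state σ g (stdCollapse S) = fun x => σ x.2 := by
  funext x
  obtain ⟨_ | _, i⟩ := x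
  · rfl
  · exact state_some _ _ (stdCollapse_of_mem (hS i))

theorem circ_ne_iff (h : SurgeryAt b d p q) (hi : d.partner i ≠ b.partner i) :
    circ b d i k ↔ d.partner k ≠ b.partner k :=
  ⟨circ_ne hi, fun hk => h.circ_four hk hi⟩

/-- Merging a small circle of `W(b)d`. -/
theorem merge_std {S : Finset (Fin (2 * n))} (hi : d.partner i = b.partner i)
    (hiS : i ∉ S) (hbS : b.partner i ∉ S) (he : circ c e i (b.partner i))
    {σ g : Fin (2 * n) → Bool} (hσ : ∀ x y, circ c e x y → σ x = σ y)
    (hg : ∀ x y, circ b d x y → g x = g y) (τ : Bool × Fin (2 * n) → Bool) :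
    SaddleStep (model c e b d (stdCollapse S))
      (model c e b d (stdCollapse (insert i (insert (b.partner i) S))))
      (false, i) (true, b.partner i) (state σ g (stdCollapse S)) τ ↔
      ¬ (σ i = true ∧ g i = true) ∧
        τ = state (if g i = true then relabel (circ c e) i true σ else σ) g
          (stdCollapse (insert i (insert (b.partner i) S))) := by
  refine merge_step (fun k hk => ?_) (fun k hk => ?_) (fun k hk => ?_) (circ_left b d i) hσ hg τ
  · rcases circ_eq hi hk with rfl | rfl
    · exact stdCollapse_of_not_mem hiS
    · exact stdCollapse_of_not_mem hbS
  · rcases circ_eq hi hk with rfl | rfl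
    · exact ⟨_, stdCollapse_of_mem (by simp), (circ c e).refl _⟩
    · exact ⟨_, stdCollapse_of_mem (by simp), he⟩
  · rw [circ_eq_iff hi, not_or] at hk
    simp [stdCollapse, hk]

theorem merge_mid {S : Finset (Fin (2 * n))} (hi : d.partner i = b.partner i)
    (hiS : i ∉ S) (hbS : b.partner i ∉ S)
    {σ g : Fin (2 * n) → Bool} (hσ : ∀ x y, circ c b x y → σ x = σ y)
    (hg : ∀ x y, circ b d x y → g x = g y) (τ : Bool × Fin (2 * n) → Bool) :
    SaddleStep (model c b b d (midCollapse b d j S))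
      (model c b b d (midCollapse b d j (insert i (insert (b.partner i) S))))
      (false, i) (true, b.partner i) (state σ g (midCollapse b d j S)) τ ↔
      ¬ (σ i = true ∧ g i = true) ∧
        τ = state (if g i = true then relabel (circ c b) i true σ else σ) g
          (midCollapse b d j (insert i (insert (b.partner i) S))) := by
  have hbi : d.partner (b.partner i) = b.partner (b.partner i) := not_not.1 fun h' => by
    have := ne_left h'; rw [b.invol] at this; exact this hi
  refine merge_step (fun k hk => ?_) (fun k hk => ?_) (fun k hk => ?_) (circ_left b d i) hσ hg τ
  · rcases circ_eq hi hk with rfl | rfl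
    · simp [midCollapse, stdCollapse, hi, hiS]
    · simp [midCollapse, stdCollapse, hbi, hbS]
  · rcases circ_eq hi hk with rfl | rfl
    · exact ⟨k, by simp [midCollapse, stdCollapse, hi], (circ c b).refl _⟩
    · exact ⟨b.partner i, by simp [midCollapse, stdCollapse, hbi], circ_right c b i⟩
  · rw [circ_eq_iff hi, not_or] at hk
    simp [midCollapse, stdCollapse, hk]

/-- Merging the large circle of `W(b)d`. -/
theorem merge_large {S : Finset (Fin (2 * n))} (h : SurgeryAt b d p q)
    (hi : d.partner i ≠ b.partner i) (hS : ∀ i ∈ S, d.partner i = b.partner i)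
    {σ : Fin (2 * n) → Bool} (hσ : ∀ x y, circ c b x y → σ x = σ y)
    (τ : Bool × Fin (2 * n) → Bool) :
    SaddleStep (model c b b d (stdCollapse S))
      (model c b b d (midCollapse b d i (insert i (insert (b.partner i) S))))
      (false, i) (true, b.partner i) (state σ (fun _ => false) (stdCollapse S)) τ ↔
        τ = state σ (fun _ => false) (midCollapse b d i (insert i (insert (b.partner i) S))) := by
  rw [merge_step (fun k hk => ?_) (fun k hk => ?_) (fun k hk => ?_) (circ_left b d i) hσ
    (fun _ _ _ => rfl)]
  · simp
  · exact stdCollapse_of_not_mem fun h' => circ_ne hi hk (hS k h')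
  · exact ⟨i, if_pos (circ_ne hi hk), (circ c b).refl i⟩
  · rw [circ_ne_iff h hi, not_not] at hk
    have h1 : k ≠ i := fun h => hi (h ▸ hk)
    have h2 : k ≠ b.partner i := fun h => ne_left hi (h ▸ hk)
    simp [midCollapse, stdCollapse, hk, h1, h2]

/-- The surgery along the second arc of the large circle of `W(b)d`. -/
theorem surgery_mid {S : Finset (Fin (2 * n))} (h : SurgeryAt b d p q)
    (hi : d.partner i ≠ b.partner i) (hj : d.partner j ≠ b.partner j) (hjS : j ∈ S)
    (hiS : i ∉ S) (hS : ∀ i ∈ S, b.partner i ∈ S)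
    {σ : Fin (2 * n) → Bool} (hσ : ∀ x y, circ c b x y → σ x = σ y)
    (τ : Bool × Fin (2 * n) → Bool) :
    SaddleStep (model c b b d (midCollapse b d j S))
      (model c d b d (stdCollapse (insert i (insert (b.partner i) S))))
      (false, i) (true, b.partner i) (state σ (fun _ => false) (midCollapse b d j S)) τ ↔
        ∃ σ', SaddleStep (circ c b) (circ c d) p q σ σ' ∧
          τ = state σ' (fun _ => false) (stdCollapse (insert i (insert (b.partner i) S))) := by
  have sy := fun x y => @Setoid.symm' _ (circ c b) x y
  have hbS : b.partner i ∉ S := fun h' => hiS (by simpa [b.invol] using hS _ h')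
  have hbi := ne_left hi
  have hj' : d.partner (b.partner i) = j ∨ d.partner (b.partner i) = b.partner j := by
    rcases h.four hj hbi with h1 | h1 | h1 | h1
    · exact absurd (h1 ▸ hjS) hbS
    · exact absurd (h1 ▸ hS j hjS) hbS
    · exact Or.inl h1
    · exact Or.inr h1
  have hjj' : circ c b j (d.partner (b.partner i)) := by
    rcases hj' with h1 | h1
    · rw [h1]
    · rw [h1]; exact circ_right c b j
  have hFS : ∀ k, d.partner k ≠ b.partner k → k ∈ insert i (insert (b.partner i) S) := by
    intro k hk
    simp only [Finset.mem_insert]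
    rcases h.four hi hk with h1 | h1 | h1 | h1
    · exact Or.inl h1
    · exact Or.inr (Or.inl h1)
    · rcases h.four hj hk with h2 | h2 | h2 | h2
      · exact Or.inr (Or.inr (h2 ▸ hjS))
      · exact Or.inr (Or.inr (h2 ▸ hS j hjS))
      · exact absurd (h1 ▸ h2 ▸ hjS) hiS
      · exact absurd (h1 ▸ h2 ▸ hS j hjS) hiS
    · rcases h.four hj hk with h2 | h2 | h2 | h2
      · exact Or.inr (Or.inr (h2 ▸ hjS))
      · exact Or.inr (Or.inr (h2 ▸ hS j hjS))
      · exact absurd (h1 ▸ h2 ▸ hjS) hbS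
      · exact absurd (h1 ▸ h2 ▸ hS j hjS) hbS
  rw [surgery_step (j := d.partner (b.partner i)) (if_pos hbi) hjj'
    (stdCollapse_of_mem (by simp)) (circ_right c d _) (fun k hk => ?_) (fun k a hk => ?_) hσ
    (fun _ _ _ => rfl)]
  · refine exists_congr fun σ' => and_congr_left fun _ => ?_
    have hx := h.isSaddle c
    have hx' := h.swap.isSaddle c
    have e1 := h.left; have e2 := h.right; have e3 := h.left'; have e4 := h.right'
    -- The point `i` may be either end of either surgered arc, hence also odd, so the saddle has to
    -- be compared with the one read at the partners of `p` and `q`.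
    have key : ∀ {p q}, SurgeryAt b d p q →
        (SaddleStep (circ c b) (circ c d) (b.partner p) (b.partner q) σ σ' ↔
          SaddleStep (circ c b) (circ c d) p q σ σ') := by
      intro p q h
      have hx := h.isSaddle c
      have a1 := circ_right c b p
      have a2 := circ_right c b q
      have a3 : circ c d p (b.partner q) := by rw [← h.left]; exact circ_right c d p
      have a4 : circ c d q (b.partner p) := by rw [← h.right]; exact circ_right c d q
      have xor : circ c b (b.partner p) (b.partner q) ↔ circ c b p q :=
        ⟨fun h' => (circ c b).trans a1 ((circ c b).trans h' ((circ c b).symm a2)),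
          fun h' => (circ c b).trans ((circ c b).symm a1) ((circ c b).trans h' a2)⟩
      have xor' : circ c d (b.partner p) (b.partner q) ↔ circ c d p q :=
        ⟨fun h' => (circ c d).trans a3 ((circ c d).symm ((circ c d).trans a4 h')),
          fun h' => (circ c d).trans ((circ c d).symm a4)
            ((circ c d).trans ((circ c d).symm h') a3)⟩
      refine ⟨fun hs => ?_, fun hs => hs.cross hx a1 a2 a3 a4⟩
      by_cases hpq : circ c b p q
      · have b1 : circ c b p (b.partner q) := (circ c b).trans hpq a2
        refine ⟨hs.const, hs.const', fun x h1 h2 => hs.away x ?_ ?_, fun h' => ?_,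
          fun h' => absurd hpq h'⟩
        · exact fun h' => h1 ((circ c b).trans a1 h')
        · exact fun h' => h2 ((circ c b).trans a2 h')
        · have := hs.split (xor.2 hpq)
          rw [← hs.const _ _ a1, ← hs.const' _ _ a3, ← hs.const' _ _ a4] at this
          by_cases hp : σ p = true
          · rw [if_pos hp] at this ⊢; exact this.symm
          · rw [if_neg hp] at this ⊢; exact this.symm
      · refine ⟨hs.const, hs.const', fun x h1 h2 => hs.away x ?_ ?_, fun h' => absurd h' hpq,
          fun h' => ?_⟩
        · exact fun h' => h1 ((circ c b).trans a1 h')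
        · exact fun h' => h2 ((circ c b).trans a2 h')
        · have := hs.merge (mt xor.1 h')
          have ht : circ c d p q := not_not.1 fun h'' => h' (hx.xor.2 h'')
          rwa [← hs.const _ _ a1, ← hs.const _ _ a2, ← hs.const' _ _ a4,
            ← hs.const' _ _ ht] at this
    rcases (h.ne_iff i).1 hi with rfl | rfl | rfl | rfl
    · rw [e3]
    · rw [e4]; exact ⟨fun hs => hs.swap hx', fun hs => hs.swap hx⟩
    · rw [b.invol, e1]; exact key h
    · rw [b.invol, e2, key h.swap]; exact ⟨fun hs => hs.swap hx', fun hs => hs.swap hx⟩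
  · by_cases hk' : d.partner k = b.partner k
    · rw [midCollapse, if_neg (not_not.2 hk')] at hk
      have h1 : k ≠ i := fun h => hi (h ▸ hk')
      have h2 : k ≠ b.partner i := fun h => hbi (h ▸ hk')
      have h3 : k ∉ S := fun h => by rw [stdCollapse_of_mem h] at hk; cases hk
      exact stdCollapse_of_not_mem (by simp [h1, h2, h3])
    · rw [midCollapse, if_pos hk'] at hk; cases hk
  · by_cases hk' : d.partner k = b.partner k
    · rw [midCollapse, if_neg (not_not.2 hk')] at hk
      have h3 : k ∈ S := by
        by_contra hn
        rw [stdCollapse_of_not_mem hn] at hk; cases hk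
      rw [stdCollapse_of_mem h3] at hk
      cases hk
      exact ⟨k, stdCollapse_of_mem (by simp [h3]), Or.inr (Or.inr rfl)⟩
    · rw [midCollapse, if_pos hk'] at hk
      cases hk
      exact ⟨k, stdCollapse_of_mem (hFS k hk'), Or.inr (Or.inl (sy _ _ hjj'))⟩

theorem const_false (b d : Matching n) (x y : Fin (2 * n)) (_ : circ b d x y) :
    (fun _ : Fin (2 * n) => false) x = (fun _ => false) y := rfl

/-- Every remaining saddle merges a small circle labeled plus, the unit of the multiplication, so it
changes no label. -/
theorem saddles_plain (l : List (Fin (2 * n))) {S : Finset (Fin (2 * n))} (hl : ToDo b l S)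
    (h : (e = b ∧ ∀ i ∈ S, d.partner i = b.partner i) ∨
      (e = d ∧ ∀ i ∉ S, d.partner i = b.partner i))
    {σ g : Fin (2 * n) → Bool} (hσ : ∀ x y, circ c e x y → σ x = σ y)
    (hg : ∀ x y, circ b d x y → g x = g y)
    (hplain : ∀ i ∈ l, d.partner i = b.partner i ∧ g i = false) (t : Bool × Fin (2 * n) → Bool) :
    saddles (outerArcs c d) b l S (state σ g (stdCollapse S)) t ≠ 0 ↔ t = fun x => σ x.2 := by
  induction l generalizing S with
  | nil =>
    rw [saddles_nil_ne_zero, state_full, eq_comm]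
    intro i
    have := hl.all i
    simpa using this
  | cons i l ih =>
    obtain ⟨hi, hgi⟩ := hplain i List.mem_cons_self
    have hiS := hl.not_mem i List.mem_cons_self
    have hbS : b.partner i ∉ S := fun h' => hiS (by simpa [b.invol] using hl.closed _ h')
    have hs := isState_std (c := c) hl.closed h
    have hbi : d.partner (b.partner i) = b.partner (b.partner i) := not_not.1 fun h' => by
      have := ne_left h'; rw [b.invol] at this; exact this hi
    have h' : (e = b ∧ ∀ k ∈ insert i (insert (b.partner i) S), d.partner k = b.partner k) ∨
        (e = d ∧ ∀ k ∉ insert i (insert (b.partner i) S), d.partner k = b.partner k) := by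
      rcases h with ⟨h1, h2⟩ | ⟨h1, h2⟩
      · refine Or.inl ⟨h1, fun k hk => ?_⟩
        simp only [Finset.mem_insert] at hk
        rcases hk with rfl | rfl | hk
        exacts [hi, hbi, h2 k hk]
      · exact Or.inr ⟨h1, fun k hk => h2 k (by simp at hk; tauto)⟩
    have hs' := isState_std (c := c) hl.tail.closed h'
    rw [saddles_cons_ne_zero]
    simp only [saddle_ne_zero_iff hs.sameCircle_iff hs'.sameCircle_iff (state_const hσ hg),
      merge_std hi hiS hbS (hs.arc i hiS) hσ hg, hgi]
    simp only [Bool.false_eq_true, and_false, not_false_eq_true, true_and, if_false,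
      exists_eq_left]
    exact ih hl.tail h' fun k hk => hplain k (List.mem_cons_of_mem _ hk)

/-- Exactly one of the circles of W(b)b carries a minus. Until its arc is reached, units are merged;
that arc multiplies by the variable of the circle through `j`, which is zero if the circle is
already minus; afterwards only units remain. -/
theorem saddles_decoration (l : List (Fin (2 * n))) {S : Finset (Fin (2 * n))}
    (hl : ToDo b l S) {σ g : Fin (2 * n) → Bool} (hσ : ∀ x y, circ c b x y → σ x = σ y)
    (hg : ∀ k, g k = true ↔ k = j ∨ k = b.partner j) (hj : j ∉ S)
    (t : Bool × Fin (2 * n) → Bool) :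
    saddles (outerArcs c b) b l S (state σ g (stdCollapse S)) t ≠ 0 ↔
      σ j = false ∧ t = fun x => relabel (circ c b) j true σ x.2 := by
  have hg' : ∀ x y, circ b b x y → g x = g y := fun x y hxy => by
    rw [Bool.eq_iff_iff, hg, hg]
    rcases circ_eq rfl hxy with rfl | rfl
    · exact Iff.rfl
    · constructor
      · rintro (rfl | rfl)
        · exact Or.inr rfl
        · exact Or.inl (b.invol _)
      · rintro (rfl | h)
        · exact Or.inr (b.invol _).symm
        · exact Or.inl (by rw [← b.invol x, h, b.invol])
  induction l generalizing S with
  | nil => exact absurd (by simpa using hl.all j) hj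
  | cons i l ih =>
    have hiS := hl.not_mem i List.mem_cons_self
    have hbS : b.partner i ∉ S := fun h' => hiS (by simpa [b.invol] using hl.closed _ h')
    have hs := isState_std (c := c) (d := b) hl.closed (Or.inl ⟨rfl, fun _ _ => rfl⟩)
    have hs' := isState_std (c := c) (d := b) hl.tail.closed (Or.inl ⟨rfl, fun _ _ => rfl⟩)
    rw [saddles_cons_ne_zero]
    simp only [saddle_ne_zero_iff hs.sameCircle_iff hs'.sameCircle_iff (state_const hσ hg'),
      merge_std rfl hiS hbS (hs.arc i hiS) hσ hg']
    by_cases hgi : g i = true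
    · have hij : circ c b i j := by
        rcases (hg i).1 hgi with rfl | rfl
        · exact (circ c b).refl _
        · exact (circ c b).symm (circ_right c b j)
      simp only [hgi, and_true, if_true, and_assoc, exists_and_left, exists_eq_left,
        hσ _ _ hij, Bool.not_eq_true]
      refine and_congr_right fun _ => ?_
      rw [relabel_congr hij, saddles_plain l hl.tail (Or.inl ⟨rfl, fun _ _ => rfl⟩)
        (relabel_const _ _ hσ) hg']
      intro k hk
      refine ⟨rfl, ?_⟩
      rw [← Bool.not_eq_true, hg]
      intro hk'
      refine hl.tail.not_mem k hk ?_
      rw [Finset.mem_insert, Finset.mem_insert]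
      rcases (hg i).1 hgi with rfl | rfl
      · rcases hk' with rfl | rfl <;> simp
      · rcases hk' with rfl | rfl <;> simp [b.invol]
    · simp only [hgi, and_false, not_false_eq_true, true_and, exists_eq_left, if_neg,
        Bool.false_eq_true]
      refine ih hl.tail ?_
      rw [hg, not_or] at hgi
      simp only [Finset.mem_insert, not_or]
      exact ⟨fun h => hgi.1 h.symm, fun h => hgi.2 (by rw [h, b.invol]), hj⟩

/-- The second arc of the large circle still has to come. Until it does, small unit circles are
merged; at that arc the saddle is exactly the one from W(c)b to W(c)d. -/
theorem saddles_mid (h : SurgeryAt b d p q) (l : List (Fin (2 * n))) {S : Finset (Fin (2 * n))}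
    (hl : ToDo b l S) {σ : Fin (2 * n) → Bool} (hσ : ∀ x y, circ c b x y → σ x = σ y)
    (hj : d.partner j ≠ b.partner j) (hjS : j ∈ S)
    (hF : ∀ i ∈ S, d.partner i ≠ b.partner i → i = j ∨ i = b.partner j)
    (t : Bool × Fin (2 * n) → Bool) :
    saddles (outerArcs c d) b l S (state σ (fun _ => false) (midCollapse b d j S)) t ≠ 0 ↔
      ∃ σ', SaddleStep (circ c b) (circ c d) p q σ σ' ∧ t = fun x => σ' x.2 := by
  induction l generalizing S with
  | nil =>
    -- The list cannot be exhausted yet: the other arc of the large circle, at `d.partner j`, has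
    -- not been surgered.
    have hall : ∀ i, i ∈ S := by simpa using hl.all
    rcases hF _ (hall _) (ne_right hj) with h | h
    · exact absurd h (d.no_fixed j)
    · exact absurd h hj
  | cons i l ih =>
    have hiS := hl.not_mem i List.mem_cons_self
    have hbS : b.partner i ∉ S := fun h' => hiS (by simpa [b.invol] using hl.closed _ h')
    have hs := isState_mid (c := c) hl.closed h hj hjS hF
    have hjS' : j ∈ insert i (insert (b.partner i) S) := by simp [hjS]
    rw [saddles_cons_ne_zero]
    by_cases hi : d.partner i = b.partner i
    · have hbi : d.partner (b.partner i) = b.partner (b.partner i) := not_not.1 fun h' => by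
        have := ne_left h'; rw [b.invol] at this; exact this hi
      have hF' : ∀ k ∈ insert i (insert (b.partner i) S), d.partner k ≠ b.partner k →
          k = j ∨ k = b.partner j := by
        intro k hk hk'
        simp only [Finset.mem_insert] at hk
        rcases hk with rfl | rfl | hk
        exacts [absurd hi hk', absurd hbi hk', hF k hk hk']
      have hs' := isState_mid (c := c) hl.tail.closed h hj hjS' hF'
      simp only [saddle_ne_zero_iff hs.sameCircle_iff hs'.sameCircle_iff
        (state_const hσ (const_false b d)), merge_mid hi hiS hbS hσ (const_false b d)]
      simp only [Bool.false_eq_true, and_false, not_false_eq_true, true_and, if_false,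
        exists_eq_left]
      exact ih hl.tail hjS' hF'
    · have hFS : ∀ k ∉ insert i (insert (b.partner i) S), d.partner k = b.partner k := by
        intro k hk
        by_contra hk'
        simp only [Finset.mem_insert, not_or] at hk
        rcases h.four hi hk' with h1 | h1 | h1 | h1
        · exact hk.1 h1
        · exact hk.2.1 h1
        · rcases h.four hj hk' with h2 | h2 | h2 | h2
          · exact hk.2.2 (h2 ▸ hjS)
          · exact hk.2.2 (h2 ▸ hl.closed j hjS)
          · exact hiS (h1 ▸ h2 ▸ hjS)
          · exact hiS (h1 ▸ h2 ▸ hl.closed j hjS)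
        · rcases h.four hj hk' with h2 | h2 | h2 | h2
          · exact hk.2.2 (h2 ▸ hjS)
          · exact hk.2.2 (h2 ▸ hl.closed j hjS)
          · exact hbS (h1 ▸ h2 ▸ hjS)
          · exact hbS (h1 ▸ h2 ▸ hl.closed j hjS)
      have hs' := isState_std (c := c) hl.tail.closed (Or.inr ⟨rfl, hFS⟩)
      simp only [saddle_ne_zero_iff hs.sameCircle_iff hs'.sameCircle_iff
        (state_const hσ (const_false b d)), surgery_mid h hi hj hjS hiS hl.closed hσ]
      constructor
      · rintro ⟨r, ⟨σ', h1, rfl⟩, h2⟩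
        refine ⟨σ', h1, ?_⟩
        rwa [saddles_plain l hl.tail (Or.inr ⟨rfl, hFS⟩) h1.const' (const_false b d)
          fun k hk => ⟨hFS k (hl.tail.not_mem k hk), rfl⟩] at h2
      · rintro ⟨σ', h1, h2⟩
        refine ⟨_, ⟨σ', h1, rfl⟩, ?_⟩
        rwa [saddles_plain l hl.tail (Or.inr ⟨rfl, hFS⟩) h1.const' (const_false b d)
          fun k hk => ⟨hFS k (hl.tail.not_mem k hk), rfl⟩]

/-- Of the two arcs of the large circle, the first only merges a circle labeled plus into W(c)b,
with no effect on labels, and the second performs the surgery; all other arcs merge units. -/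
theorem saddles_bridge (h : SurgeryAt b d p q) (l : List (Fin (2 * n)))
    {S : Finset (Fin (2 * n))} (hl : ToDo b l S) {σ : Fin (2 * n) → Bool}
    (hσ : ∀ x y, circ c b x y → σ x = σ y) (hS : ∀ i ∈ S, d.partner i = b.partner i)
    (t : Bool × Fin (2 * n) → Bool) :
    saddles (outerArcs c d) b l S (state σ (fun _ => false) (stdCollapse S)) t ≠ 0 ↔
      ∃ σ', SaddleStep (circ c b) (circ c d) p q σ σ' ∧ t = fun x => σ' x.2 := by
  induction l generalizing S with
  | nil =>
    have hall : ∀ i, i ∈ S := by simpa using hl.all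
    exact absurd (hS p (hall p)) ((h.ne_iff p).2 (Or.inl rfl))
  | cons i l ih =>
    have hiS := hl.not_mem i List.mem_cons_self
    have hbS : b.partner i ∉ S := fun h' => hiS (by simpa [b.invol] using hl.closed _ h')
    have hs := isState_std (c := c) hl.closed (Or.inl ⟨rfl, hS⟩)
    rw [saddles_cons_ne_zero]
    by_cases hi : d.partner i = b.partner i
    · have hbi : d.partner (b.partner i) = b.partner (b.partner i) := not_not.1 fun h' => by
        have := ne_left h'; rw [b.invol] at this; exact this hi
      have hS' : ∀ k ∈ insert i (insert (b.partner i) S), d.partner k = b.partner k := by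
        intro k hk
        simp only [Finset.mem_insert] at hk
        rcases hk with rfl | rfl | hk
        exacts [hi, hbi, hS k hk]
      have hs' := isState_std (c := c) hl.tail.closed (Or.inl ⟨rfl, hS'⟩)
      simp only [saddle_ne_zero_iff hs.sameCircle_iff hs'.sameCircle_iff
        (state_const hσ (const_false b d)),
        merge_std hi hiS hbS (hs.arc i hiS) hσ (const_false b d)]
      simp only [Bool.false_eq_true, and_false, not_false_eq_true, true_and, if_false,
        exists_eq_left]
      exact ih hl.tail hS'
    · have hF : ∀ k ∈ insert i (insert (b.partner i) S), d.partner k ≠ b.partner k →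
          k = i ∨ k = b.partner i := by
        intro k hk hk'
        simp only [Finset.mem_insert] at hk
        rcases hk with hk | hk | hk
        exacts [Or.inl hk, Or.inr hk, absurd (hS k hk) hk']
      have hs' := isState_mid (c := c) hl.tail.closed h hi (Finset.mem_insert_self _ _) hF
      simp only [saddle_ne_zero_iff hs.sameCircle_iff hs'.sameCircle_iff
        (state_const hσ (const_false b d)), merge_large h hi hS hσ, exists_eq_left]
      exact saddles_mid h l hl.tail hσ hi (Finset.mem_insert_self _ _) hF t

end Matching

/-! ### Bridges and decorations as relations on basis elements -/

namespace ArcBasis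

variable {n : ℕ}

/-- The partition of the points into the circles of `h`. -/
def circ (h : ArcBasis n) : Setoid (Fin (2 * n)) := Matching.circ h.left h.right

theorem minus_const (h : ArcBasis n) (x y : Fin (2 * n)) (hxy : h.circ x y) :
    h.minus x = h.minus y :=
  sameCircle_const h.minus_left h.minus_right (Matching.circ_iff.1 hxy)

/-- The label `σ` on the circles of `W(a)b`. -/
def ofConst (a b : Matching n) (σ : Fin (2 * n) → Bool)
    (h : ∀ x y, Matching.circ a b x y → σ x = σ y) : ArcBasis n where
  left := a
  right := b
  minus := σ
  minus_left x := (h _ _ (Matching.circ_left a b x)).symm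
  minus_right x := (h _ _ (Matching.circ_right a b x)).symm

/-- `k` occurs in the product of `h` with the generator of a bridge between right matchings. -/
structure BridgeTo (h k : ArcBasis n) : Prop where
  left_eq : h.left = k.left
  exists_step : ∃ p q, Matching.SurgeryAt h.right k.right p q ∧
    SaddleStep h.circ k.circ p q h.minus k.minus

/-- `k` is obtained from `h` by changing the label of one circle from plus to minus. -/
structure DecorTo (h k : ArcBasis n) : Prop where
  left_eq : h.left = k.left
  right_eq : h.right = k.right
  exists_flip : ∃ z, h.minus z = false ∧ k.minus = relabel h.circ z true h.minus

theorem toDo (b : Matching n) :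
    Matching.ToDo b ((List.finRange (2 * n)).filter (fun i => i < b.partner i)) ∅ := by
  refine ⟨(List.nodup_finRange _).filter _, by simp, fun i hi => by simpa using hi, by simp,
    fun i => Or.inr ?_⟩
  simp only [List.mem_filter, List.mem_finRange, decide_eq_true_eq, true_and, b.invol]
  exact (lt_or_gt_of_ne (b.no_fixed i)).symm

theorem mulCoeff_ne_zero_iff (h g k : ArcBasis n) : mulCoeff h g k ≠ 0 ↔
    (h.right = g.left ∧ k.left = h.left ∧ k.right = g.right) ∧
      saddles (Matching.outerArcs h.left g.right) h.right
        ((List.finRange (2 * n)).filter (fun i => i < h.right.partner i)) ∅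
        (Matching.state h.minus g.minus (Matching.stdCollapse ∅)) (fun x => k.minus x.2) ≠ 0 := by
  have e : Matching.state h.minus g.minus (Matching.stdCollapse ∅) =
      fun x => if x.1 then g.minus x.2 else h.minus x.2 := by
    funext x
    obtain ⟨_ | _, i⟩ := x
    · rfl
    · exact Matching.state_none _ _ (Matching.stdCollapse_of_not_mem (by simp))
  rw [e, mulCoeff, ite_ne_right_iff]
  rfl

theorem comp_snd_inj {σ τ : Fin (2 * n) → Bool}
    (h : (fun x : Bool × Fin (2 * n) => σ x.2) = fun x => τ x.2) : σ = τ :=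
  funext fun i => congrFun h (false, i)

/-- The pairs of basis elements which are related by multiplicative generators. -/
theorem exists_multGen_iff (h k : ArcBasis n) :
    (∃ g, IsMultGen g ∧ mulCoeff h g k ≠ 0) ↔ h.BridgeTo k ∨ h.DecorTo k := by
  have hc := h.minus_const
  constructor
  · rintro ⟨g, hg, hm⟩
    obtain ⟨⟨e1, e2, e3⟩, hm⟩ := (mulCoeff_ne_zero_iff h g k).1 hm
    rcases hg with ⟨hs, hg⟩ | ⟨hs, i, hg⟩
    · left
      obtain ⟨p, q, hpq⟩ := Matching.exists_surgeryAt hs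
      rw [← e1] at hpq
      have eg : g.minus = fun _ => false := funext hg
      rw [eg, Matching.saddles_bridge hpq _ (toDo _) hc (by simp)] at hm
      obtain ⟨σ', h1, h2⟩ := hm
      refine ⟨e2.symm, p, q, by rw [e3]; exact hpq, ?_⟩
      rw [comp_snd_inj h2, circ, circ, e2, e3]
      exact h1
    · right
      rw [← hs, ← e1] at hm e3
      rw [Matching.saddles_decoration (j := i) _ (toDo _) hc (by rw [e1]; exact hg)
        (by simp)] at hm
      exact ⟨e2.symm, e3.symm, i, hm.1, comp_snd_inj hm.2⟩
  · rintro (⟨e1, p, q, hpq, hs⟩ | ⟨e1, e2, z, hz, hk⟩)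
    · refine ⟨ofConst h.right k.right (fun _ => false) (fun _ _ _ => rfl),
        Or.inl ⟨hpq.isSurgery, fun _ => rfl⟩, (mulCoeff_ne_zero_iff _ _ _).2
        ⟨⟨rfl, e1.symm, rfl⟩, ?_⟩⟩
      refine (Matching.saddles_bridge hpq _ (toDo _) hc (by simp) _).2 ⟨k.minus, ?_, rfl⟩
      rw [circ, circ, ← e1] at hs
      exact hs
    · let g : ArcBasis n := ofConst h.right h.right
        (fun i => decide (i = z ∨ i = h.right.partner z)) (by
          intro x y hxy
          rw [decide_eq_decide]
          rcases Matching.circ_eq rfl hxy with rfl | rfl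
          · rfl
          · constructor
            · rintro (rfl | rfl)
              · exact Or.inr rfl
              · exact Or.inl (h.right.invol _)
            · rintro (rfl | hx)
              · exact Or.inr (h.right.invol _).symm
              · exact Or.inl (by rw [← h.right.invol x, hx, h.right.invol]))
      refine ⟨g, Or.inr ⟨rfl, z, fun j => by simp [g, ofConst]⟩,
        (mulCoeff_ne_zero_iff _ _ _).2 ⟨⟨rfl, e1.symm, e2.symm⟩, ?_⟩⟩
      refine (Matching.saddles_decoration (j := z) _ (toDo _) hc (fun j => by simp [g, ofConst])
        (by simp) _).2 ⟨hz, ?_⟩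
      rw [hk]
      rfl

end ArcBasis

/-! ## Degrees -/

section Weight

variable {P : Type} [Fintype P]

open Classical in
/-- The class of `i`. -/
noncomputable def classOf (r : Setoid P) (i : P) : Finset P := Finset.univ.filter (r i)

open Classical in
/-- The classes of a partition. -/
noncomputable def classes (r : Setoid P) : Finset (Finset P) := Finset.univ.image (classOf r)

open Classical in
/-- The number of minus signs minus the number of plus signs. -/
noncomputable def weight (r : Setoid P) (s : P → Bool) : ℤ :=
  ∑ C ∈ classes r, if ∃ i ∈ C, s i = true then 1 else -1

theorem mem_classOf {r : Setoid P} {i x : P} : x ∈ classOf r i ↔ r i x := by simp [classOf]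

theorem classOf_eq_iff {r : Setoid P} {i j : P} : classOf r i = classOf r j ↔ r i j := by
  constructor
  · intro h
    exact r.symm (mem_classOf.1 (h ▸ mem_classOf.2 (r.refl i)))
  · intro h
    ext x
    rw [mem_classOf, mem_classOf]
    exact ⟨fun h' => r.trans (r.symm h) h', fun h' => r.trans h h'⟩

theorem mem_classes {r : Setoid P} {C : Finset P} : C ∈ classes r ↔ ∃ i, classOf r i = C := by
  simp [classes]

theorem classOf_mem_classes (r : Setoid P) (i : P) : classOf r i ∈ classes r :=
  mem_classes.2 ⟨i, rfl⟩

theorem exists_classOf {r : Setoid P} {s : P → Bool} (hs : ∀ x y, r x y → s x = s y) (i : P) :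
    (∃ x ∈ classOf r i, s x = true) ↔ s i = true := by
  constructor
  · rintro ⟨x, hx, h⟩
    rwa [hs _ _ (mem_classOf.1 hx)]
  · exact fun h => ⟨i, mem_classOf.2 (r.refl i), h⟩

open Classical in
theorem sum_classes_congr {r r' : Setoid P} {s t : P → Bool} {A : Finset (Finset P)}
    (hs : ∀ x y, r x y → s x = s y) (ht : ∀ x y, r' x y → t x = t y)
    (h : ∀ C ∈ A, ∃ x, classOf r x = C ∧ classOf r' x = C ∧ t x = s x) :
    (∑ C ∈ A, if ∃ i ∈ C, t i = true then (1 : ℤ) else -1) =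
      ∑ C ∈ A, if ∃ i ∈ C, s i = true then (1 : ℤ) else -1 := by
  refine Finset.sum_congr rfl fun C hC => ?_
  obtain ⟨x, h1, h2, h3⟩ := h C hC
  have : (∃ i ∈ C, t i = true) ↔ ∃ i ∈ C, s i = true := by
    conv_lhs => rw [← h2, exists_classOf ht, h3]
    rw [← h1, exists_classOf hs]
  by_cases hc : ∃ i ∈ C, s i = true
  · rw [if_pos hc, if_pos (this.2 hc)]
  · rw [if_neg hc, if_neg (mt this.1 hc)]

open Classical in
theorem weight_eq_add_erase {r : Setoid P} {s : P → Bool} (hs : ∀ x y, r x y → s x = s y)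
    (p : P) : weight r s = (if s p = true then 1 else -1) +
      ∑ C ∈ (classes r).erase (classOf r p), if ∃ i ∈ C, s i = true then (1 : ℤ) else -1 := by
  rw [weight, ← Finset.add_sum_erase _ _ (classOf_mem_classes r p)]
  congr 1
  exact if_congr (exists_classOf hs p) rfl rfl

theorem weight_relabel {r : Setoid P} {s : P → Bool} (hs : ∀ x y, r x y → s x = s y) {z : P}
    (hz : s z = false) : weight r (relabel r z true s) = weight r s + 2 := by
  classical
  have hs' := relabel_const z true hs
  rw [weight_eq_add_erase hs z, weight_eq_add_erase hs' z, relabel_apply_self, hz,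
    sum_classes_congr hs hs']
  · simp
    ring
  · intro C hC
    obtain ⟨h1, h2⟩ := Finset.mem_erase.1 hC
    obtain ⟨x, rfl⟩ := mem_classes.1 h2
    exact ⟨x, rfl, rfl, relabel_of_not_rel (fun h => h1 (classOf_eq_iff.2 (r.symm h))) _ _⟩

open Classical in
-- The classes other than that of `p` are the same sets before and after, so one summand is
-- exchanged for two.
theorem IsSaddle.weight_split {r r' : Setoid P} {p q : P} (h : IsSaddle r r' p q) (hpq : r p q)
    {s t : P → Bool} (hs : ∀ x y, r x y → s x = s y) (ht : ∀ x y, r' x y → t x = t y)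
    (away : ∀ x, ¬ r p x → t x = s x) :
    weight r' t = weight r s - (if s p = true then 1 else -1) +
      (if t p = true then 1 else -1) + (if t q = true then 1 else -1) := by
  have hn : ¬ r' p q := h.xor.1 hpq
  have hc := h.class_iff hpq
  have hsame : ∀ x, ¬ r p x → classOf r x = classOf r' x := by
    intro x hx
    ext y
    rw [mem_classOf, mem_classOf, h.away_iff hpq hx]
  have key : ((classes r').erase (classOf r' p)).erase (classOf r' q) =
      (classes r).erase (classOf r p) := by
    ext C
    simp only [Finset.mem_erase, mem_classes]
    constructor
    · rintro ⟨h1, h2, x, rfl⟩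
      have hx : ¬ r p x := by
        rw [hc]
        rintro (h | h)
        · exact h2 (classOf_eq_iff.2 (r'.symm h))
        · exact h1 (classOf_eq_iff.2 (r'.symm h))
      refine ⟨?_, x, hsame x hx⟩
      rw [← hsame x hx, Ne, classOf_eq_iff]
      exact fun h => hx (r.symm h)
    · rintro ⟨h1, x, rfl⟩
      have hx : ¬ r p x := fun h => h1 (classOf_eq_iff.2 (r.symm h))
      rw [hsame x hx]
      rw [hc, not_or] at hx
      refine ⟨?_, ?_, x, rfl⟩
      · rw [Ne, classOf_eq_iff]; exact fun h => hx.2 (r'.symm h)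
      · rw [Ne, classOf_eq_iff]; exact fun h => hx.1 (r'.symm h)
  have hq : classOf r' q ∈ (classes r').erase (classOf r' p) :=
    Finset.mem_erase.2 ⟨by rw [Ne, classOf_eq_iff]; exact fun h => hn (r'.symm h),
      classOf_mem_classes _ _⟩
  rw [weight_eq_add_erase ht p, weight_eq_add_erase hs p, ← Finset.add_sum_erase _ _ hq, key,
    sum_classes_congr hs ht]
  · have e := exists_classOf ht q
    by_cases htq : t q = true
    · rw [if_pos (e.2 htq), if_pos htq]; ring
    · rw [if_neg (mt e.1 htq), if_neg htq]; ring
  · intro C hC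
    obtain ⟨h1, h2⟩ := Finset.mem_erase.1 hC
    obtain ⟨x, rfl⟩ := mem_classes.1 h2
    have hx : ¬ r p x := fun h => h1 (classOf_eq_iff.2 (r.symm h))
    exact ⟨x, rfl, (hsame x hx).symm, away x hx⟩

/-- A saddle has Euler characteristic -1, so its TQFT map raises the degree by one. The merge is
computed as a split of the reversed saddle. -/
theorem SaddleStep.weight_eq {r r' : Setoid P} {p q : P} {s t : P → Bool}
    (h : IsSaddle r r' p q) (hst : SaddleStep r r' p q s t) : weight r' t = weight r s + 1 := by
  by_cases hpq : r p q
  · have a := hst.split hpq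
    rw [h.weight_split hpq hst.const hst.const' fun x hx => hst.away x hx fun h' =>
      hx (r.trans hpq h')]
    revert a
    cases s p <;> cases t p <;> cases t q <;> simp
  · have hpq' : r' p q := not_not.1 fun h' => hpq (h.xor.2 h')
    have a := hst.merge hpq
    have hc := h.symm.class_iff hpq'
    have := h.symm.weight_split hpq' hst.const' hst.const fun x hx => by
      rw [hc, not_or] at hx
      exact (hst.away x hx.1 hx.2).symm
    rw [this]
    revert a
    cases s p <;> cases t p <;> cases s q <;> simp

end Weight

namespace ArcBasis

variable {n : ℕ}

theorem circle_eq (h : ArcBasis n) (i : Fin (2 * n)) : h.circle i = classOf h.circ i := by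
  ext x
  simp only [mem_classOf, circle, Finset.mem_filter, Finset.mem_univ, true_and]
  rfl

theorem circles_eq (h : ArcBasis n) : h.circles = classes h.circ := by
  ext C
  simp [circles, mem_classes, circle_eq]

theorem degree_eq (h : ArcBasis n) : h.degree = n + weight h.circ h.minus := by
  rw [degree, weight, circles_eq]
  congr!

theorem BridgeTo.degree_eq {h k : ArcBasis n} (hk : h.BridgeTo k) : k.degree = h.degree + 1 := by
  obtain ⟨e, p, q, hpq, hs⟩ := hk
  have hx := hpq.isSaddle h.left
  rw [ArcBasis.degree_eq, ArcBasis.degree_eq, hs.weight_eq, add_assoc]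
  rw [circ, circ, ← e]
  exact hx

theorem DecorTo.degree_eq {h k : ArcBasis n} (hk : h.DecorTo k) : k.degree = h.degree + 2 := by
  obtain ⟨e, e', z, hz, hs⟩ := hk
  have : k.circ = h.circ := by rw [circ, circ, e, e']
  rw [ArcBasis.degree_eq, ArcBasis.degree_eq, hs, this, weight_relabel h.minus_const hz, add_assoc]

theorem mirror_circ (h : ArcBasis n) : h.mirror.circ = h.circ := Matching.circ_comm _ _

theorem mirror_degree (h : ArcBasis n) : h.mirror.degree = h.degree := by
  rw [degree_eq, degree_eq, mirror_circ]; rfl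

end ArcBasis

/-! ## Squares of bridges and decorations -/

/-- Among the four points where the matchings differ, only `p` and `q` are even, and each determines
the other. -/
theorem Matching.SurgeryAt.eq_or_eq {n : ℕ} {a b : Matching n} {p q p' q' : Fin (2 * n)}
    (h : SurgeryAt a b p q) (h' : SurgeryAt a b p' q') :
    (p' = p ∧ q' = q) ∨ (p' = q ∧ q' = p) := by
  have e : ∀ {p q}, SurgeryAt a b p q → q = a.partner (b.partner p) := fun h => by
    rw [h.left, a.invol]
  have hp : b.partner p' ≠ a.partner p' := (h'.ne_iff p').2 (Or.inl rfl)
  rcases (h.ne_iff p').1 hp with rfl | rfl | hp | hp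
  · exact Or.inl ⟨rfl, by rw [e h, ← e h']⟩
  · exact Or.inr ⟨rfl, by rw [e h.swap, ← e h']⟩
  · exact absurd hp (partner_ne h'.even_left h.even_left)
  · exact absurd hp (partner_ne h'.even_left h.even_right)

namespace ArcBasis

variable {n : ℕ} {h k k' k₁ k₂ m : ArcBasis n} {z p q : Fin (2 * n)}

theorem circ_congr (h₁ : h.left = k.left) (h₂ : h.right = k.right) : h.circ = k.circ := by
  rw [circ, circ, h₁, h₂]

theorem ext_minus (h₁ : h.left = k.left) (h₂ : h.right = k.right) (h₃ : h.minus = k.minus) :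
    h = k := ArcBasis.ext h₁ h₂ h₃

/-- The basis element `h` with the circle through `z` relabeled by `b`. -/
noncomputable def relabelAt (h : ArcBasis n) (z : Fin (2 * n)) (b : Bool) : ArcBasis n :=
  ofConst h.left h.right (relabel h.circ z b h.minus) (relabel_const z b h.minus_const)

theorem circ_relabelAt (z : Fin (2 * n)) (b : Bool) : (h.relabelAt z b).circ = h.circ := rfl

theorem minus_relabelAt (z : Fin (2 * n)) (b : Bool) :
    (h.relabelAt z b).minus = relabel h.circ z b h.minus := rfl

theorem relabelAt_relabelAt (z : Fin (2 * n)) (b c : Bool) :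
    (h.relabelAt z c).relabelAt z b = h.relabelAt z b :=
  ext_minus rfl rfl (relabel_relabel _ _ _ _ _)

theorem relabelAt_self {b : Bool} (hz : h.minus z = b) : h.relabelAt z b = h :=
  ext_minus rfl rfl (relabel_self h.minus_const hz)

theorem relabelAt_congr {w : Fin (2 * n)} (hw : h.circ z w) (b : Bool) :
    h.relabelAt z b = h.relabelAt w b :=
  ext_minus rfl rfl (relabel_congr hw _ _)

theorem minus_relabelAt_self (z : Fin (2 * n)) (b : Bool) : (h.relabelAt z b).minus z = b :=
  relabel_apply_self _ _ _ _

theorem decorTo_iff : h.DecorTo k ↔ ∃ z, h.minus z = false ∧ k = h.relabelAt z true := by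
  constructor
  · rintro ⟨e1, e2, z, hz, e3⟩
    exact ⟨z, hz, ext_minus e1.symm e2.symm e3⟩
  · rintro ⟨z, hz, rfl⟩
    exact ⟨rfl, rfl, z, hz, rfl⟩

theorem decorTo_relabelAt (hz : h.minus z = false) : h.DecorTo (h.relabelAt z true) :=
  decorTo_iff.2 ⟨z, hz, rfl⟩

theorem relabelAt_decorTo (hz : h.minus z = true) : (h.relabelAt z false).DecorTo h :=
  decorTo_iff.2 ⟨z, minus_relabelAt_self _ _, by
    rw [relabelAt_relabelAt, relabelAt_self hz]⟩

theorem DecorTo.eq_relabelAt (hk : h.DecorTo k) (h₁ : h.minus z = false) (h₂ : k.minus z = true) :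
    k = h.relabelAt z true := by
  obtain ⟨w, hw, rfl⟩ := decorTo_iff.1 hk
  refine relabelAt_congr ?_ _
  by_contra hn
  rw [minus_relabelAt, relabel_of_not_rel hn, h₁] at h₂
  cases h₂

theorem DecorTo.eq_relabelAt' (hk : h.DecorTo k) (h₁ : h.minus z = false)
    (h₂ : k.minus z = true) : h = k.relabelAt z false := by
  rw [hk.eq_relabelAt h₁ h₂, relabelAt_relabelAt, relabelAt_self h₁]

theorem DecorTo.mirror (hk : h.DecorTo k) : h.mirror.DecorTo k.mirror := by
  obtain ⟨e1, e2, z, hz, e3⟩ := hk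
  exact ⟨e2, e1, z, hz, by rw [mirror_circ]; exact e3⟩

theorem DecorTo.of_mirror (hk : h.mirror.DecorTo k.mirror) : h.DecorTo k := hk.mirror

theorem BridgeTo.right_ne (hk : h.BridgeTo k) : h.right ≠ k.right := by
  obtain ⟨-, p, q, hpq, -⟩ := hk
  intro e
  rw [e] at hpq
  exact (hpq.ne_iff p).2 (Or.inl rfl) rfl

theorem bridgeTo_iff (hpq : Matching.SurgeryAt h.right k.right p q) :
    h.BridgeTo k ↔ h.left = k.left ∧ SaddleStep h.circ k.circ p q h.minus k.minus := by
  constructor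
  · rintro ⟨e, p', q', hpq', hs⟩
    refine ⟨e, ?_⟩
    rcases hpq.eq_or_eq hpq' with ⟨rfl, rfl⟩ | ⟨rfl, rfl⟩
    · exact hs
    · have hx := hpq'.isSaddle h.left
      refine hs.swap ?_
      rw [circ, circ, ← e]
      exact hx
  · rintro ⟨e, hs⟩
    exact ⟨e, p, q, hpq, hs⟩

theorem isSaddle_circ (hpq : Matching.SurgeryAt h.right k.right p q) (e : h.left = k.left) :
    IsSaddle h.circ k.circ p q := by
  rw [circ, circ, ← e]
  exact hpq.isSaddle h.left

/-- Bridges commute with relabeling a circle. -/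
theorem relabelAt_bridgeTo_iff (z : Fin (2 * n)) :
    (h.minus z = false ∧ (h.relabelAt z true).BridgeTo k) ↔
      (k.minus z = true ∧ h.BridgeTo (k.relabelAt z false)) := by
  by_cases hk : h.left = k.left ∧ ∃ p q, Matching.SurgeryAt h.right k.right p q
  · obtain ⟨e, p, q, hpq⟩ := hk
    have hpq1 : Matching.SurgeryAt (h.relabelAt z true).right k.right p q := hpq
    have hpq2 : Matching.SurgeryAt h.right (k.relabelAt z false).right p q := hpq
    have e1 : (h.relabelAt z true).left = k.left := e
    have e2 : h.left = (k.relabelAt z false).left := e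
    rw [bridgeTo_iff hpq1, bridgeTo_iff hpq2, and_iff_right e1, and_iff_right e2]
    exact SaddleStep.relabel_iff (isSaddle_circ hpq e) h.minus_const k.minus_const z
  · refine ⟨fun h' => absurd ?_ hk, fun h' => absurd ?_ hk⟩
    · obtain ⟨-, e, p, q, hpq, -⟩ := h'
      exact ⟨e, p, q, hpq⟩
    · obtain ⟨-, e, p, q, hpq, -⟩ := h'
      exact ⟨e, p, q, hpq⟩

/-- Going along a bridge between left matchings. -/
def LeftBridgeTo (h k : ArcBasis n) : Prop := h.mirror.BridgeTo k.mirror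

theorem leftBridgeTo_iff (hpq : Matching.SurgeryAt h.left k.left p q) :
    h.LeftBridgeTo k ↔ h.right = k.right ∧ SaddleStep h.circ k.circ p q h.minus k.minus := by
  have hpq' : Matching.SurgeryAt h.mirror.right k.mirror.right p q := hpq
  rw [LeftBridgeTo, bridgeTo_iff hpq', mirror_circ, mirror_circ]
  rfl

theorem LeftBridgeTo.right_eq (hk : h.LeftBridgeTo k) : h.right = k.right := hk.left_eq

theorem relabelAt_mirror (z : Fin (2 * n)) (b : Bool) :
    (h.relabelAt z b).mirror = h.mirror.relabelAt z b := by
  refine ext_minus rfl rfl ?_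
  rw [minus_relabelAt, mirror_circ]
  rfl

theorem relabelAt_leftBridgeTo_iff (z : Fin (2 * n)) :
    (h.minus z = false ∧ (h.relabelAt z true).LeftBridgeTo k) ↔
      (k.minus z = true ∧ h.LeftBridgeTo (k.relabelAt z false)) := by
  rw [LeftBridgeTo, LeftBridgeTo, relabelAt_mirror, relabelAt_mirror]
  exact relabelAt_bridgeTo_iff (h := h.mirror) (k := k.mirror) z

/-- The numbers of paths along a left and a right bridge do not depend on the order. -/
theorem card_bridge_comm (h m : ArcBasis n) :
    Nat.card {k : ArcBasis n // h.BridgeTo k ∧ k.LeftBridgeTo m} =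
      Nat.card {k : ArcBasis n // h.LeftBridgeTo k ∧ k.BridgeTo m} := by
  by_cases hr : ∃ p q, Matching.SurgeryAt h.right m.right p q
  swap
  · have : IsEmpty {k : ArcBasis n // h.BridgeTo k ∧ k.LeftBridgeTo m} :=
      ⟨fun ⟨k, ⟨_, p, q, hpq, _⟩, h2⟩ => hr ⟨p, q, h2.right_eq ▸ hpq⟩⟩
    have : IsEmpty {k : ArcBasis n // h.LeftBridgeTo k ∧ k.BridgeTo m} :=
      ⟨fun ⟨k, h2, ⟨_, p, q, hpq, _⟩⟩ => hr ⟨p, q, h2.right_eq ▸ hpq⟩⟩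
    rw [Nat.card_of_isEmpty, Nat.card_of_isEmpty]
  by_cases hl : ∃ p q, Matching.SurgeryAt h.left m.left p q
  swap
  · have : IsEmpty {k : ArcBasis n // h.BridgeTo k ∧ k.LeftBridgeTo m} :=
      ⟨fun ⟨k, h1, ⟨_, p, q, hpq, _⟩⟩ => hl ⟨p, q, h1.left_eq ▸ hpq⟩⟩
    have : IsEmpty {k : ArcBasis n // h.LeftBridgeTo k ∧ k.BridgeTo m} :=
      ⟨fun ⟨k, ⟨_, p, q, hpq, _⟩, h1⟩ => hl ⟨p, q, h1.left_eq ▸ hpq⟩⟩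
    rw [Nat.card_of_isEmpty, Nat.card_of_isEmpty]
  obtain ⟨p, q, hpq⟩ := hr
  obtain ⟨p', q', hpq'⟩ := hl
  have x1 : IsSaddle h.circ (Matching.circ h.left m.right) p q := hpq.isSaddle h.left
  have x2 : IsSaddle h.circ (Matching.circ m.left h.right) p' q' := by
    rw [circ, Matching.circ_comm h.left, Matching.circ_comm m.left]
    exact hpq'.isSaddle h.right
  have x3 : IsSaddle (Matching.circ h.left m.right) m.circ p' q' := by
    rw [circ, Matching.circ_comm h.left, Matching.circ_comm m.left]
    exact hpq'.isSaddle m.right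
  have x4 : IsSaddle (Matching.circ m.left h.right) m.circ p q := hpq.isSaddle m.left
  have key := SaddleStep.card_comm x1 x2 x3 x4 h.minus_const m.minus_const
  -- The matchings of the middle element are forced, its left one by `h` and its right one by `m`,
  -- so a path is the same as an intermediate labeling.
  have c1 : Nat.card {k : ArcBasis n // h.BridgeTo k ∧ k.LeftBridgeTo m} =
      Nat.card {u // SaddleStep h.circ (Matching.circ h.left m.right) p q h.minus u ∧
        SaddleStep (Matching.circ h.left m.right) m.circ p' q' u m.minus} := by
    have conv : ∀ k : ArcBasis n, h.left = k.left → k.right = m.right →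
        ((h.BridgeTo k ∧ k.LeftBridgeTo m) ↔
          (SaddleStep h.circ (Matching.circ h.left m.right) p q h.minus k.minus ∧
            SaddleStep (Matching.circ h.left m.right) m.circ p' q' k.minus m.minus)) := by
      intro k e1 e2
      rw [bridgeTo_iff (e2 ▸ hpq), leftBridgeTo_iff (e1 ▸ hpq'), and_iff_right e1,
        and_iff_right e2, circ.eq_def k, ← e1, e2]
    refine Nat.card_eq_of_bijective (fun k => ⟨k.1.minus, ?_⟩) ⟨?_, ?_⟩
    · exact (conv k.1 k.2.1.left_eq k.2.2.right_eq).1 k.2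
    · rintro ⟨k, hk⟩ ⟨k', hk'⟩ e
      refine Subtype.ext (ext_minus ?_ ?_ (congrArg Subtype.val e))
      · exact hk.1.left_eq.symm.trans hk'.1.left_eq
      · exact hk.2.right_eq.trans hk'.2.right_eq.symm
    · rintro ⟨u, hu⟩
      exact ⟨⟨ofConst h.left m.right u hu.1.const', (conv (ofConst _ _ u _) rfl rfl).2 hu⟩, rfl⟩
  have c2 : Nat.card {k : ArcBasis n // h.LeftBridgeTo k ∧ k.BridgeTo m} =
      Nat.card {u // SaddleStep h.circ (Matching.circ m.left h.right) p' q' h.minus u ∧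
        SaddleStep (Matching.circ m.left h.right) m.circ p q u m.minus} := by
    have conv : ∀ k : ArcBasis n, h.right = k.right → k.left = m.left →
        ((h.LeftBridgeTo k ∧ k.BridgeTo m) ↔
          (SaddleStep h.circ (Matching.circ m.left h.right) p' q' h.minus k.minus ∧
            SaddleStep (Matching.circ m.left h.right) m.circ p q k.minus m.minus)) := by
      intro k e1 e2
      rw [bridgeTo_iff (e1 ▸ hpq), leftBridgeTo_iff (e2 ▸ hpq'), and_iff_right e1,
        and_iff_right e2, circ.eq_def k, ← e1, e2]
    refine Nat.card_eq_of_bijective (fun k => ⟨k.1.minus, ?_⟩) ⟨?_, ?_⟩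
    · exact (conv k.1 k.2.1.right_eq k.2.2.left_eq).1 k.2
    · rintro ⟨k, hk⟩ ⟨k', hk'⟩ e
      refine Subtype.ext (ext_minus ?_ ?_ (congrArg Subtype.val e))
      · exact hk.2.left_eq.trans hk'.2.left_eq.symm
      · exact hk.1.right_eq.symm.trans hk'.1.right_eq
    · rintro ⟨u, hu⟩
      exact ⟨⟨ofConst m.left h.right u hu.1.const', (conv (ofConst _ _ u _) rfl rfl).2 hu⟩, rfl⟩
  rw [c1, c2, key]

/-- A decoration is multiplication by the variable of the circle through a point `z`; keeping the
point `z`, it can be moved across the bridge. -/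
theorem exists_decorTo_bridgeTo_iff (h m : ArcBasis n) :
    (∃ k, h.DecorTo k ∧ k.BridgeTo m) ↔ ∃ k, h.BridgeTo k ∧ k.DecorTo m := by
  constructor
  · rintro ⟨k, h1, h2⟩
    obtain ⟨z, hz, rfl⟩ := decorTo_iff.1 h1
    obtain ⟨h3, h4⟩ := (relabelAt_bridgeTo_iff z).1 ⟨hz, h2⟩
    exact ⟨_, h4, relabelAt_decorTo h3⟩
  · rintro ⟨k, h1, h2⟩
    obtain ⟨z, hz, rfl⟩ := decorTo_iff.1 h2
    obtain ⟨h3, h4⟩ := (relabelAt_bridgeTo_iff (h := h) (k := k.relabelAt z true) z).2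
      ⟨minus_relabelAt_self _ _, by rwa [relabelAt_relabelAt, relabelAt_self hz]⟩
    exact ⟨_, decorTo_relabelAt h3, h4⟩

end ArcBasis

/-! ### The three types of squares formed by a bridge and a decoration -/

namespace ArcBasis

variable {n : ℕ} {h k k' k₁ k₂ m j : ArcBasis n} {z p q : Fin (2 * n)}

/-- The points at which the labels of two basis elements differ. -/
def diff (h k : ArcBasis n) : Finset (Fin (2 * n)) :=
  Finset.univ.filter (fun i => h.minus i ≠ k.minus i)

open Classical in
/-- The points at which the right matchings of two basis elements differ. -/
noncomputable def ends (h k : ArcBasis n) : Finset (Fin (2 * n)) :=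
  Finset.univ.filter (fun i => h.right.partner i ≠ k.right.partner i)

theorem mem_diff {i : Fin (2 * n)} : i ∈ diff h k ↔ h.minus i ≠ k.minus i := by simp [diff]

theorem diff_relabelAt_true (hz : h.minus z = false) :
    diff h (h.relabelAt z true) = classOf h.circ z := by
  ext i
  rw [mem_diff, mem_classOf, minus_relabelAt]
  by_cases hi : h.circ z i
  · rw [relabel_of_rel hi, ← h.minus_const _ _ hi, hz]
    simp [hi]
  · rw [relabel_of_not_rel hi]
    simp [hi]

theorem diff_relabelAt_false (hz : h.minus z = true) :
    diff (h.relabelAt z false) h = classOf h.circ z := by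
  ext i
  rw [mem_diff, mem_classOf, minus_relabelAt]
  by_cases hi : h.circ z i
  · rw [relabel_of_rel hi, ← h.minus_const _ _ hi, hz]
    simp [hi]
  · rw [relabel_of_not_rel hi]
    simp [hi]

theorem DecorTo.diff_eq (hk : h.DecorTo k) (hz : z ∈ diff h k) : h.minus z = false ∧
    k.minus z = true ∧ diff h k = classOf h.circ z ∧ k = h.relabelAt z true ∧
    h = k.relabelAt z false := by
  obtain ⟨w, hw, rfl⟩ := decorTo_iff.1 hk
  rw [diff_relabelAt_true hw, mem_classOf] at hz
  have h1 : h.minus z = false := by rw [← h.minus_const _ _ hz, hw]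
  have h2 : (h.relabelAt w true).minus z = true := relabel_of_rel hz _ _
  exact ⟨h1, h2, by rw [diff_relabelAt_true hw, classOf_eq_iff.2 hz], hk.eq_relabelAt h1 h2,
    hk.eq_relabelAt' h1 h2⟩

theorem DecorTo.exists_mem_diff (hk : h.DecorTo k) : ∃ z, z ∈ diff h k := by
  obtain ⟨w, hw, rfl⟩ := decorTo_iff.1 hk
  exact ⟨w, by rw [diff_relabelAt_true hw]; exact mem_classOf.2 (h.circ.refl w)⟩

theorem DecorTo.circ_eq (hk : h.DecorTo k) : h.circ = k.circ := circ_congr hk.left_eq hk.right_eq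

theorem DecorTo.eq_of_mem_diff (hk : h.DecorTo m) (hj : j.DecorTo m) (h₁ : z ∈ diff h m)
    (h₂ : z ∈ diff j m) : h = j := by
  rw [(hk.diff_eq h₁).2.2.2.2, (hj.diff_eq h₂).2.2.2.2]

theorem DecorTo.eq_of_mem_diff' (hk : h.DecorTo k) (hj : h.DecorTo j) (h₁ : z ∈ diff h k)
    (h₂ : z ∈ diff h j) : k = j := by
  rw [(hk.diff_eq h₁).2.2.2.1, (hj.diff_eq h₂).2.2.2.1]

/-- A bridge and a decoration of a circle which is not involved in it. -/
structure AwaySquare (h k k' m : ArcBasis n) : Prop where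
  bridge : h.BridgeTo k
  decor : k.DecorTo m
  decor' : h.DecorTo k'
  bridge' : k'.BridgeTo m
  diff_eq : diff k m = diff h k'
  disjoint : Disjoint (diff k m) (ends h k)

/-- A bridge joining two circles, and decorations of these circles. -/
structure JoinSquare (h k k₁ k₂ m : ArcBasis n) : Prop where
  bridge : h.BridgeTo k
  decor : k.DecorTo m
  decor₁ : h.DecorTo k₁
  bridge₁ : k₁.BridgeTo m
  decor₂ : h.DecorTo k₂
  bridge₂ : k₂.BridgeTo m
  mem₁ : diff h k₁ ∈ h.circles
  mem₂ : diff h k₂ ∈ h.circles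
  mem : diff k m ∈ k.circles
  ne : diff h k₁ ≠ diff h k₂
  union : diff k m = diff h k₁ ∪ diff h k₂

/-- A bridge splitting a circle, and decorations of the two new circles. -/
structure SplitSquare (h k₁ k₂ k m : ArcBasis n) : Prop where
  decor : h.DecorTo k
  bridge : k.BridgeTo m
  bridge₁ : h.BridgeTo k₁
  decor₁ : k₁.DecorTo m
  bridge₂ : h.BridgeTo k₂
  decor₂ : k₂.DecorTo m
  mem : diff h k ∈ k.circles
  mem₁ : diff k₁ m ∈ m.circles
  mem₂ : diff k₂ m ∈ m.circles
  ne : diff k₁ m ≠ diff k₂ m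
  union : diff h k = diff k₁ m ∪ diff k₂ m

theorem mem_circles {C : Finset (Fin (2 * n))} : C ∈ h.circles ↔ ∃ i, classOf h.circ i = C := by
  rw [circles_eq, mem_classes]

/-- The surgery from `h.right` to `m.right` is fixed, and its saddle does not touch the circle of
`z`. So `j` is still plus at `z`, its decoration is at `z`, and `j` can be recovered from `m`. -/
theorem AwaySquare.unique (hs : AwaySquare h k k' m) (h₁ : h.BridgeTo j) (h₂ : j.DecorTo m) :
    j = k := by
  obtain ⟨z, hz⟩ := hs.decor.exists_mem_diff
  have hz' := hs.diff_eq ▸ hz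
  obtain ⟨e1, p, q, hpq, hst⟩ := h₁
  have hr : j.right = k.right := h₂.right_eq.trans hs.decor.right_eq.symm
  have hne := hpq.ne_iff
  have hd : ∀ i, i ∈ ends h k → ¬ h.circ z i := fun i hi hzi => by
    refine Finset.disjoint_left.1 hs.disjoint ?_ hi
    rw [hs.diff_eq, (hs.decor'.diff_eq hz').2.2.1]
    exact mem_classOf.2 hzi
  have hp : p ∈ ends h k := by
    simpa [ends, ← hr] using fun e => (hne p).2 (Or.inl rfl) e.symm
  have hq : q ∈ ends h k := by
    simpa [ends, ← hr] using fun e => (hne q).2 (Or.inr (Or.inl rfl)) e.symm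
  have haw := hst.away z (fun e => hd p hp (h.circ.symm e)) (fun e => hd q hq (h.circ.symm e))
  refine h₂.eq_of_mem_diff hs.decor (z := z) ?_ hz
  rw [mem_diff, haw, (hs.decor'.diff_eq hz').1, (hs.decor.diff_eq hz).2.1]
  simp

theorem AwaySquare.unique' (hs : AwaySquare h k k' m) (h₁ : h.DecorTo j) (h₂ : j.BridgeTo m) :
    j = k' := by
  obtain ⟨z, hz⟩ := hs.decor.exists_mem_diff
  have hz' := hs.diff_eq ▸ hz
  obtain ⟨e1, p, q, hpq, hst⟩ := h₂
  rw [← h₁.right_eq, ← hs.decor.right_eq] at hpq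
  rw [← h₁.circ_eq] at hst
  have hne := hpq.ne_iff
  have hd : ∀ i, i ∈ ends h k → ¬ h.circ z i := fun i hi hzi => by
    refine Finset.disjoint_left.1 hs.disjoint ?_ hi
    rw [hs.diff_eq, (hs.decor'.diff_eq hz').2.2.1]
    exact mem_classOf.2 hzi
  have hp : p ∈ ends h k := by
    simpa [ends] using fun e => (hne p).2 (Or.inl rfl) e.symm
  have hq : q ∈ ends h k := by
    simpa [ends] using fun e => (hne q).2 (Or.inr (Or.inl rfl)) e.symm
  have haw := hst.away z (fun e => hd p hp (h.circ.symm e)) (fun e => hd q hq (h.circ.symm e))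
  refine h₁.eq_of_mem_diff' hs.decor' (z := z) ?_ hz'
  rw [mem_diff, ← haw, (hs.decor'.diff_eq hz').1, (hs.decor.diff_eq hz).2.1]
  simp

end ArcBasis

/-! ### Uniqueness of paths in join and split squares, and existence of squares -/

namespace ArcBasis

variable {n : ℕ} {h k k' k₁ k₂ m j : ArcBasis n} {z p q : Fin (2 * n)}

/-- Two points taken on the two decorated circles of `h` are separated in `h` and together in `k`,
so the saddle must have one of its feet on each of these circles. The labels at the feet then decide
which paths are possible. -/
theorem JoinSquare.exists_points (hs : JoinSquare h k k₁ k₂ m) : ∃ p q,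
    Matching.SurgeryAt h.right m.right p q ∧ ¬ h.circ p q ∧ h.minus p = false ∧
      h.minus q = false ∧ p ∈ diff k m ∧ q ∈ diff k m ∧
      ((p ∈ diff h k₁ ∧ q ∈ diff h k₂) ∨ (p ∈ diff h k₂ ∧ q ∈ diff h k₁)) := by
  obtain ⟨z₁, hz₁⟩ := hs.decor₁.exists_mem_diff
  obtain ⟨z₂, hz₂⟩ := hs.decor₂.exists_mem_diff
  have hz₁' : z₁ ∈ diff k m := by rw [hs.union]; exact Finset.mem_union_left _ hz₁
  have hz₂' : z₂ ∈ diff k m := by rw [hs.union]; exact Finset.mem_union_right _ hz₂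
  obtain ⟨d1, -, d3, -⟩ := hs.decor₁.diff_eq hz₁
  obtain ⟨e1, -, e3, -⟩ := hs.decor₂.diff_eq hz₂
  obtain ⟨f1, f2, f3, -⟩ := hs.decor.diff_eq hz₁'
  have hk : k.circ z₁ z₂ := by rw [f3] at hz₂'; exact mem_classOf.1 hz₂'
  have hh : ¬ h.circ z₁ z₂ := fun e => hs.ne (by rw [d3, e3, classOf_eq_iff.2 e])
  obtain ⟨a1, p, q, hpq, hst⟩ := hs.bridge
  have hx := isSaddle_circ hpq a1
  rw [hs.decor.right_eq] at hpq
  have main : ∀ p q, h.circ z₁ p → h.circ q z₂ → ¬ h.circ p q ∧ h.minus p = false ∧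
      h.minus q = false ∧ p ∈ diff k m ∧ q ∈ diff k m ∧ p ∈ diff h k₁ ∧ q ∈ diff h k₂ := by
    intro p q b1 b2
    have c1 : p ∈ diff h k₁ := by rw [d3]; exact mem_classOf.2 b1
    have c2 : q ∈ diff h k₂ := by rw [e3]; exact mem_classOf.2 (h.circ.symm b2)
    refine ⟨fun b => hh (h.circ.trans (h.circ.trans b1 b) b2), ?_, ?_, ?_, ?_, c1, c2⟩
    · rw [← h.minus_const _ _ b1, d1]
    · rw [h.minus_const _ _ b2, e1]
    · rw [hs.union]; exact Finset.mem_union_left _ c1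
    · rw [hs.union]; exact Finset.mem_union_right _ c2
  rcases hx.le _ _ hk with b | b | b
  · exact absurd b hh
  · obtain ⟨c1, c2, c3, c4, c5, c6, c7⟩ := main p q b.1 b.2
    exact ⟨p, q, hpq, c1, c2, c3, c4, c5, Or.inl ⟨c6, c7⟩⟩
  · obtain ⟨c1, c2, c3, c4, c5, c6, c7⟩ := main q p b.1 b.2
    exact ⟨p, q, hpq, fun e => c1 (h.circ.symm e), c3, c2, c5, c4, Or.inr ⟨c7, c6⟩⟩

theorem JoinSquare.unique (hs : JoinSquare h k k₁ k₂ m) (h₁ : h.BridgeTo j) (h₂ : j.DecorTo m) :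
    j = k := by
  obtain ⟨p, q, hpq, hn, hp, hq, hp', -, -⟩ := hs.exists_points
  have hpq' : Matching.SurgeryAt h.right j.right p q := h₂.right_eq ▸ hpq
  obtain ⟨e, hst⟩ := (bridgeTo_iff hpq').1 h₁
  have hj := (hst.merge hn).2
  rw [hp, hq] at hj
  refine h₂.eq_of_mem_diff hs.decor (z := p) ?_ hp'
  rw [mem_diff, hj, (hs.decor.diff_eq hp').2.1]
  simp

theorem JoinSquare.unique' (hs : JoinSquare h k k₁ k₂ m) (h₁ : h.DecorTo j) (h₂ : j.BridgeTo m) :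
    j = k₁ ∨ j = k₂ := by
  obtain ⟨p, q, hpq, hn, hp, hq, hp', hq', hc⟩ := hs.exists_points
  have hpq' : Matching.SurgeryAt j.right m.right p q := h₁.right_eq ▸ hpq
  obtain ⟨e, hst⟩ := (bridgeTo_iff hpq').1 h₂
  rw [← h₁.circ_eq] at hst
  have hj := (hst.merge hn).2
  rw [(hs.decor.diff_eq hp').2.1] at hj
  have key : p ∈ diff h j ∨ q ∈ diff h j := by
    rw [mem_diff, mem_diff, hp, hq]
    cases hjp : j.minus p <;> simp_all
  rcases hc with ⟨c1, c2⟩ | ⟨c1, c2⟩ <;> rcases key with b | b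
  · exact Or.inl (h₁.eq_of_mem_diff' hs.decor₁ b c1)
  · exact Or.inr (h₁.eq_of_mem_diff' hs.decor₂ b c2)
  · exact Or.inr (h₁.eq_of_mem_diff' hs.decor₂ b c1)
  · exact Or.inl (h₁.eq_of_mem_diff' hs.decor₁ b c2)

/-- The counterpart for splits: points on the two new circles are together in `h` and separated in
`m`, so each of the new circles contains one foot of the saddle. -/
theorem SplitSquare.exists_points (hs : SplitSquare h k₁ k₂ k m) : ∃ p q,
    Matching.SurgeryAt h.right m.right p q ∧ h.circ p q ∧ m.minus p = true ∧
      m.minus q = true ∧ p ∈ diff h k ∧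
      ((p ∈ diff k₁ m ∧ q ∈ diff k₂ m) ∨ (p ∈ diff k₂ m ∧ q ∈ diff k₁ m)) := by
  obtain ⟨z₁, hz₁⟩ := hs.decor₁.exists_mem_diff
  obtain ⟨z₂, hz₂⟩ := hs.decor₂.exists_mem_diff
  have hz₁' : z₁ ∈ diff h k := by rw [hs.union]; exact Finset.mem_union_left _ hz₁
  have hz₂' : z₂ ∈ diff h k := by rw [hs.union]; exact Finset.mem_union_right _ hz₂
  obtain ⟨-, d1, d3, -⟩ := hs.decor₁.diff_eq hz₁
  obtain ⟨-, e1, e3, -⟩ := hs.decor₂.diff_eq hz₂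
  rw [hs.decor₁.circ_eq] at d3
  rw [hs.decor₂.circ_eq] at e3
  obtain ⟨f1, f2, f3, -⟩ := hs.decor.diff_eq hz₁'
  have hk : h.circ z₁ z₂ := by rw [f3] at hz₂'; exact mem_classOf.1 hz₂'
  have hh : ¬ m.circ z₁ z₂ := fun e => hs.ne (by rw [d3, e3, classOf_eq_iff.2 e])
  obtain ⟨a1, p, q, hpq, hst⟩ := hs.bridge
  have hx := isSaddle_circ hpq a1
  rw [← hs.decor.right_eq] at hpq
  rw [← hs.decor.circ_eq] at hx
  have main : ∀ p q, m.circ z₁ p → m.circ q z₂ → ¬ m.circ p q ∧ m.minus p = true ∧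
      m.minus q = true ∧ p ∈ diff h k ∧ q ∈ diff h k ∧ p ∈ diff k₁ m ∧ q ∈ diff k₂ m := by
    intro p q b1 b2
    have c1 : p ∈ diff k₁ m := by rw [d3]; exact mem_classOf.2 b1
    have c2 : q ∈ diff k₂ m := by rw [e3]; exact mem_classOf.2 (m.circ.symm b2)
    refine ⟨fun b => hh (m.circ.trans (m.circ.trans b1 b) b2), ?_, ?_, ?_, ?_, c1, c2⟩
    · rw [← m.minus_const _ _ b1, d1]
    · rw [m.minus_const _ _ b2, e1]
    · rw [hs.union]; exact Finset.mem_union_left _ c1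
    · rw [hs.union]; exact Finset.mem_union_right _ c2
  rcases hx.ge _ _ hk with b | b | b
  · exact absurd b hh
  · obtain ⟨c1, c2, c3, c4, c5, c6, c7⟩ := main p q b.1 b.2
    exact ⟨p, q, hpq, hx.xor.2 c1, c2, c3, c4, Or.inl ⟨c6, c7⟩⟩
  · obtain ⟨c1, c2, c3, c4, c5, c6, c7⟩ := main q p b.1 b.2
    exact ⟨p, q, hpq, hx.xor.2 fun e => c1 (m.circ.symm e), c3, c2, c5, Or.inr ⟨c7, c6⟩⟩

theorem SplitSquare.unique' (hs : SplitSquare h k₁ k₂ k m) (h₁ : h.DecorTo j)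
    (h₂ : j.BridgeTo m) : j = k := by
  obtain ⟨p, q, hpq, hn, hp, hq, hp', -⟩ := hs.exists_points
  have hpq' : Matching.SurgeryAt j.right m.right p q := h₁.right_eq ▸ hpq
  obtain ⟨e, hst⟩ := (bridgeTo_iff hpq').1 h₂
  rw [← h₁.circ_eq] at hst
  have hj := hst.split hn
  rw [hp, hq] at hj
  refine h₁.eq_of_mem_diff' hs.decor (z := p) ?_ hp'
  rw [mem_diff, (hs.decor.diff_eq hp').1]
  simpa using hj

theorem SplitSquare.unique (hs : SplitSquare h k₁ k₂ k m) (h₁ : h.BridgeTo j)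
    (h₂ : j.DecorTo m) : j = k₁ ∨ j = k₂ := by
  obtain ⟨p, q, hpq, hn, hp, hq, hp', hc⟩ := hs.exists_points
  have hpq' : Matching.SurgeryAt h.right j.right p q := h₂.right_eq ▸ hpq
  obtain ⟨e, hst⟩ := (bridgeTo_iff hpq').1 h₁
  have hj := hst.split hn
  rw [(hs.decor.diff_eq hp').1] at hj
  have key : p ∈ diff j m ∨ q ∈ diff j m := by
    rw [mem_diff, mem_diff, hp, hq]
    cases hjp : j.minus p <;> simp_all
  rcases hc with ⟨c1, c2⟩ | ⟨c1, c2⟩ <;> rcases key with b | b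
  · exact Or.inl (h₂.eq_of_mem_diff hs.decor₁ b c1)
  · exact Or.inr (h₂.eq_of_mem_diff hs.decor₂ b c2)
  · exact Or.inr (h₂.eq_of_mem_diff hs.decor₂ b c1)
  · exact Or.inl (h₂.eq_of_mem_diff hs.decor₁ b c2)

/-- A bridge followed by a decoration lies in a square of one of three types. -/
theorem exists_square (h₁ : h.BridgeTo k) (h₂ : k.DecorTo m) :
    (∃ k', AwaySquare h k k' m) ∨ (∃ k₁ k₂, JoinSquare h k k₁ k₂ m) ∨
      ∃ k₂ k', SplitSquare h k k₂ k' m := by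
  obtain ⟨z, hz⟩ := h₂.exists_mem_diff
  obtain ⟨kz, mz, hd, hm, hk⟩ := h₂.diff_eq hz
  have h₁' := h₁
  obtain ⟨e, p, q, hpq, hst⟩ := h₁'
  have hx := isSaddle_circ hpq e
  -- The decoration can be performed before the bridge at any point `w` of the decorated circle that
  -- is labeled plus in `h`.
  have cross : ∀ w, k.circ z w → h.minus w = false →
      h.DecorTo (h.relabelAt w true) ∧ (h.relabelAt w true).BridgeTo m := by
    intro w hw hw'
    refine ⟨decorTo_relabelAt hw', ((relabelAt_bridgeTo_iff w).2 ⟨?_, ?_⟩).2⟩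
    · rw [← m.minus_const z w (h₂.circ_eq ▸ hw), mz]
    · rwa [← relabelAt_congr (h₂.circ_eq ▸ hw), ← hk]
  have hmem : diff k m ∈ k.circles := mem_circles.2 ⟨z, hd.symm⟩
  -- The decorated circle either contains a foot of the saddle or is away from it.
  by_cases hp : k.circ p z ∨ k.circ q z
  · by_cases hkpq : k.circ p q
    · refine Or.inr (Or.inl ?_)
      have zp : k.circ z p := by
        rcases hp with hp | hp
        · exact k.circ.symm hp
        · exact k.circ.symm (k.circ.trans hkpq hp)
      have zq : k.circ z q := k.circ.trans zp hkpq
      have hh : ¬ h.circ p q := hx.symm.xor.1 hkpq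
      have hj := (hst.merge hh).2
      rw [← k.minus_const _ _ zp, kz] at hj
      have hj' : h.minus p = false ∧ h.minus q = false := Bool.or_eq_false_iff.1 hj.symm
      have d1 := diff_relabelAt_true hj'.1
      have d2 := diff_relabelAt_true hj'.2
      refine ⟨_, _, h₁, h₂, (cross p zp hj'.1).1, (cross p zp hj'.1).2, (cross q zq hj'.2).1,
        (cross q zq hj'.2).2, mem_circles.2 ⟨p, d1.symm⟩, mem_circles.2 ⟨q, d2.symm⟩, hmem, ?_, ?_⟩
      · rw [d1, d2, Ne, classOf_eq_iff]
        exact hh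
      · rw [d1, d2, hd]
        ext x
        rw [Finset.mem_union, mem_classOf, mem_classOf, mem_classOf, ← hx.symm.class_iff hkpq]
        exact ⟨fun h' => k.circ.trans (k.circ.symm zp) h', fun h' => k.circ.trans zp h'⟩
    · refine Or.inr (Or.inr ?_)
      have hh : h.circ p q := hx.xor.2 hkpq
      -- The feet `p` and `q` play symmetric roles; let `p` lie on the decorated circle. It is plus
      -- in `k`, so the circle of `h` was plus and the other new circle is minus.
      have main : ∀ p q, IsSaddle h.circ k.circ p q → h.circ p q → ¬ k.circ p q →
          SaddleStep h.circ k.circ p q h.minus k.minus → k.circ p z →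
          ∃ k₂ k', SplitSquare h k k₂ k' m := by
        intro p q hx hh hkpq hst hp
        have zp := k.circ.symm hp
        have kp : k.minus p = false := by rw [k.minus_const _ _ hp, kz]
        have hj := hst.split hh
        rw [kp] at hj
        have hhp : h.minus p = false := by
          by_contra a
          rw [if_pos (by simpa using a)] at hj
          exact absurd hj.1 (by decide)
        have kq : k.minus q = true := by
          rw [hhp] at hj
          simpa using hj
        have hhq : h.minus q = false := by rw [← h.minus_const _ _ hh, hhp]
        have c := cross p zp hhp
        have nzq : ¬ k.circ z q := fun e => hkpq (k.circ.trans hp e)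
        have mq : m.minus q = true := by
          rw [hm, minus_relabelAt, relabel_of_not_rel nzq, kq]
        -- In `m` both new circles are minus. The second path comes from the other term of the split
        -- of a plus circle: removing the minus at `q` instead of the one at `p`.
        have c2 : h.BridgeTo (m.relabelAt q false) := by
          refine ((relabelAt_bridgeTo_iff q).1 ⟨hhq, ?_⟩).2
          rw [← relabelAt_congr hh]
          exact c.2
        have d1 := diff_relabelAt_true hhp
        have d2 := diff_relabelAt_false mq
        rw [← h₂.circ_eq] at d2
        refine ⟨_, _, c.1, c.2, h₁, h₂, c2, relabelAt_decorTo mq,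
          mem_circles.2 ⟨p, by rw [circ_relabelAt, d1]⟩,
          mem_circles.2 ⟨z, by rw [← h₂.circ_eq, hd]⟩,
          mem_circles.2 ⟨q, by rw [← h₂.circ_eq, d2]⟩, ?_, ?_⟩
        · rw [hd, d2, Ne, classOf_eq_iff]
          exact nzq
        · rw [d1, d2, hd]
          ext x
          rw [Finset.mem_union, mem_classOf, mem_classOf, mem_classOf, hx.class_iff hh]
          exact or_congr_left
            ⟨fun h' => k.circ.trans zp h', fun h' => k.circ.trans hp h'⟩
      rcases hp with hp | hp
      · exact main p q hx hh hkpq hst hp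
      · exact main q p (isSaddle_circ hpq.swap e) (h.circ.symm hh)
          (fun h' => hkpq (k.circ.symm h')) (hst.swap hx) hp
  · refine Or.inl ?_
    push Not at hp
    have hp' : ¬ h.circ p z ∧ ¬ h.circ q z := by
      constructor <;> intro h' <;> rcases hx.ge _ _ h' with h | h | h
      all_goals first | exact hp.1 h | exact hp.2 h | exact hp.2 h.2 | exact hp.1 h.2
    have hcl : classOf k.circ z = classOf h.circ z := by
      ext x
      rw [mem_classOf, mem_classOf]
      exact ⟨fun h' => h.circ.symm (hx.away_le hp'.1 hp'.2 (k.circ.symm h')),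
        fun h' => k.circ.symm (hx.away_ge hp'.1 hp'.2 (h.circ.symm h'))⟩
    have hhz : h.minus z = false := by
      rw [← hst.away z hp'.1 hp'.2, kz]
    have c := cross z (k.circ.refl z) hhz
    refine ⟨_, h₁, h₂, c.1, c.2, ?_, ?_⟩
    · rw [hd, diff_relabelAt_true hhz, hcl]
    · rw [Finset.disjoint_right, hd, hcl]
      intro i hi hzi
      rw [mem_classOf] at hzi
      have hi' : k.right.partner i ≠ h.right.partner i := by
        simpa [ends, eq_comm] using hi
      rcases (hpq.ne_iff i).1 hi' with rfl | rfl | rfl | rfl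
      · exact hp'.1 (h.circ.symm hzi)
      · exact hp'.2 (h.circ.symm hzi)
      · exact hp'.1 (h.circ.trans (Matching.circ_right _ _ _) (h.circ.symm hzi))
      · exact hp'.2 (h.circ.trans (Matching.circ_right _ _ _) (h.circ.symm hzi))

end ArcBasis

/-! ## Generators and their matrices -/

namespace Gen

variable {n : ℕ} {h k : ArcBasis n} {g : Gen n}

theorem bridgeTo_or_decorTo (g : Gen n) : g.src.BridgeTo g.tgt ∨ g.src.DecorTo g.tgt :=
  (ArcBasis.exists_multGen_iff _ _).1 g.2

/-- The bridge generator `e(h, k)`. -/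
def ofBridge (H : h.BridgeTo k) : Gen n := ⟨(h, k), (ArcBasis.exists_multGen_iff _ _).2 (Or.inl H)⟩

/-- The decoration generator `e(h, k)`. -/
def ofDecor (H : h.DecorTo k) : Gen n := ⟨(h, k), (ArcBasis.exists_multGen_iff _ _).2 (Or.inr H)⟩

theorem ext_ends {g g' : Gen n} (h₁ : g.src = g'.src) (h₂ : g.tgt = g'.tgt) : g = g' :=
  Subtype.ext (Prod.ext h₁ h₂)

theorem isBridge_iff : g.IsBridge ↔ g.src.BridgeTo g.tgt :=
  ⟨fun H => g.bridgeTo_or_decorTo.resolve_right fun H' => H H'.right_eq, fun H => H.right_ne⟩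

theorem isDecoration_iff : g.IsDecoration ↔ g.src.DecorTo g.tgt :=
  ⟨fun H => g.bridgeTo_or_decorTo.resolve_left fun H' => H'.right_ne H, fun H => H.right_eq⟩

theorem IsBridge.tgt_degree (hg : g.IsBridge) : g.tgt.degree = g.src.degree + 1 :=
  (isBridge_iff.1 hg).degree_eq

theorem IsDecoration.tgt_degree (hg : g.IsDecoration) : g.tgt.degree = g.src.degree + 2 :=
  (isDecoration_iff.1 hg).degree_eq

theorem IsBridge.intrinsic_eq (hg : g.IsBridge) : g.intrinsic = -1 / 2 := by
  rw [intrinsic, hg.tgt_degree]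
  push_cast
  ring

theorem IsDecoration.intrinsic_eq (hg : g.IsDecoration) : g.intrinsic = -1 := by
  rw [intrinsic, hg.tgt_degree]
  push_cast
  ring

theorem isBridge_or_isDecoration (g : Gen n) : g.IsBridge ∨ g.IsDecoration :=
  ne_or_eq _ _

theorem isBridge_ofBridge (H : h.BridgeTo k) : (ofBridge H).IsBridge := isBridge_iff.2 H

theorem isDecoration_ofDecor (H : h.DecorTo k) : (ofDecor H).IsDecoration := isDecoration_iff.2 H

theorem intrinsic_neg (g : Gen n) : g.intrinsic < 0 := by
  rcases g.isBridge_or_isDecoration with h | h <;> rw [h.intrinsic_eq] <;> norm_num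

end Gen

section Matrices

variable {n : ℕ} {R : Type} [Ring R] (a b : Gen n → R) {h k m : ArcBasis n}

open Classical in
/-- The matrix whose entries are the values of `a` on the bridge generators. -/
noncomputable def bridgeMatrix : Matrix (ArcBasis n) (ArcBasis n) R :=
  fun h k => if H : h.BridgeTo k then a (Gen.ofBridge H) else 0

open Classical in
/-- The matrix whose entries are the values of `a` on the decoration generators. -/
noncomputable def decorMatrix : Matrix (ArcBasis n) (ArcBasis n) R :=
  fun h k => if H : h.DecorTo k then a (Gen.ofDecor H) else 0

theorem bridgeMatrix_of (H : h.BridgeTo k) : bridgeMatrix a h k = a (Gen.ofBridge H) := dif_pos H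

theorem bridgeMatrix_of_not (H : ¬ h.BridgeTo k) : bridgeMatrix a h k = 0 := dif_neg H

theorem decorMatrix_of (H : h.DecorTo k) : decorMatrix a h k = a (Gen.ofDecor H) := dif_pos H

theorem decorMatrix_of_not (H : ¬ h.DecorTo k) : decorMatrix a h k = 0 := dif_neg H

/-- The matrix whose entries are the values of `a` on the generators. -/
noncomputable def genMatrix : Matrix (ArcBasis n) (ArcBasis n) R := bridgeMatrix a + decorMatrix a

theorem genMatrix_of_bridge (H : h.BridgeTo k) : genMatrix a h k = bridgeMatrix a h k := by
  rw [genMatrix, Matrix.add_apply, decorMatrix_of_not _ fun H' => H.right_ne H'.right_eq, add_zero]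

theorem genMatrix_of_decor (H : h.DecorTo k) : genMatrix a h k = decorMatrix a h k := by
  rw [genMatrix, Matrix.add_apply, bridgeMatrix_of_not _ fun H' => H'.right_ne H.right_eq, zero_add]

theorem genMatrix_apply (g : Gen n) : genMatrix a g.src g.tgt = a g := by
  rcases g.bridgeTo_or_decorTo with H | H
  · rw [genMatrix_of_bridge a H, bridgeMatrix_of a H]; rfl
  · rw [genMatrix_of_decor a H, decorMatrix_of a H]; rfl

theorem genMatrix_eq_zero (H : ¬ ∃ g : Gen n, g.src = h ∧ g.tgt = k) : genMatrix a h k = 0 := by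
  rw [genMatrix, Matrix.add_apply,
    bridgeMatrix_of_not _ fun H' => H ⟨Gen.ofBridge H', rfl, rfl⟩,
    decorMatrix_of_not _ fun H' => H ⟨Gen.ofDecor H', rfl, rfl⟩, add_zero]

theorem exists_gen_of_genMatrix_ne_zero (H : genMatrix a h k ≠ 0) :
    ∃ g : Gen n, g.src = h ∧ g.tgt = k := by
  by_contra H'
  exact H (genMatrix_eq_zero a H')

/-- The sum over the generators as a sum over pairs of idempotents. -/
theorem sum_gen {M : Type} [AddCommMonoid M] (F : ArcBasis n → ArcBasis n → M)
    (hF : ∀ h k, (¬ ∃ g : Gen n, g.src = h ∧ g.tgt = k) → F h k = 0) :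
    ∑ g : Gen n, F g.src g.tgt = ∑ h, ∑ k, F h k := by
  rw [← Fintype.sum_prod_type' F]
  refine Finset.sum_of_injOn (fun g => (g.src, g.tgt)) ?_ (fun _ _ => Finset.mem_coe.2
    (Finset.mem_univ _)) ?_ (fun _ _ => rfl)
  · intro g _ g' _ e
    exact Gen.ext_ends (congrArg Prod.fst e) (congrArg Prod.snd e)
  · rintro ⟨h, k⟩ - hn
    refine hF h k fun ⟨g, e1, e2⟩ => hn ⟨g, Finset.mem_coe.2 (Finset.mem_univ _), ?_⟩
    simp [e1, e2]

namespace GenPair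

/-- The left idempotent of a word of two generators. -/
def src (p : GenPair n) : ArcBasis n := p.1.1.src

/-- The right idempotent of a word of two generators. -/
def tgt (p : GenPair n) : ArcBasis n := p.1.2.tgt

end GenPair

/-- A word of two generators with given ends is determined by its middle idempotent, so sums over
words are entries of matrix products. -/
theorem sum_genPair_eq : ∑ p : GenPair n with p.src = h ∧ p.tgt = m, a p.1.1 * b p.1.2 =
    (genMatrix a * genMatrix b) h m := by
  rw [Matrix.mul_apply]
  refine Finset.sum_of_injOn (fun p => p.1.1.tgt) ?_ (fun _ _ => Finset.mem_coe.2
    (Finset.mem_univ _)) ?_ ?_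
  · intro p hp p' hp' e
    simp only [Finset.coe_filter, Finset.mem_univ, true_and, Set.mem_ofPred_eq] at hp hp'
    refine Subtype.ext (Prod.ext (Gen.ext_ends ?_ e) (Gen.ext_ends ?_ ?_))
    · exact hp.1.trans hp'.1.symm
    · rw [← p.2, ← p'.2]; exact e
    · exact hp.2.trans hp'.2.symm
  · rintro k - hn
    by_contra hne
    obtain ⟨g, e1, e2⟩ := exists_gen_of_genMatrix_ne_zero a (left_ne_zero_of_mul hne)
    obtain ⟨g', e3, e4⟩ := exists_gen_of_genMatrix_ne_zero b (right_ne_zero_of_mul hne)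
    refine hn ⟨⟨(g, g'), e2.trans e3.symm⟩, ?_, e2⟩
    simp only [Finset.coe_filter, Finset.mem_univ, true_and]
    exact ⟨e1, e4⟩
  · intro p hp
    obtain ⟨e1, e2⟩ := (Finset.mem_filter.1 hp).2
    have : genMatrix a h p.1.1.tgt = a p.1.1 := by rw [← e1]; exact genMatrix_apply a p.1.1
    rw [this]
    have : genMatrix b p.1.1.tgt m = b p.1.2 := by rw [← e2, p.2]; exact genMatrix_apply b p.1.2
    rw [this]

end Matrices

/-! ## The relations of `B` and of its quadratic dual -/

section Relations

variable {n : ℕ} {M : Type} [AddCommGroup M]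

/-- A generator and a product of two composable generators are both matrix units determined by their
ends. A relation between them therefore persists when the matrix units are replaced by arbitrary
values `F`. -/
theorem linQuadRelations_sum {z : (Gen n → ℤ) × (GenPair n → ℤ)} (hz : z ∈ linQuadRelations n)
    (F : ArcBasis n → ArcBasis n → M) :
    ∑ g, z.1 g • F g.src g.tgt + ∑ p, z.2 p • F p.src p.tgt = 0 := by
  -- The additive map sending the matrix unit at `(h, k)` to `F h k`.
  let Φ : Matrix (ArcBasis n) (ArcBasis n) ℤ →+ M :=
    { toFun := fun A => ∑ h, ∑ k, A h k • F h k
      map_zero' := by simp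
      map_add' := fun A B => by simp [add_smul, Finset.sum_add_distrib] }
  have hΦ : ∀ h k, Φ (Matrix.single h k 1) = F h k := by
    intro h k
    change ∑ h', ∑ k', Matrix.single h k (1 : ℤ) h' k' • F h' k' = _
    rw [Finset.sum_eq_single h, Finset.sum_eq_single k]
    · simp
    · intro k' _ hk
      rw [Matrix.single_apply, if_neg fun h => hk h.2.symm, zero_smul]
    · simp
    · intro h' _ hh
      refine Finset.sum_eq_zero fun k' _ => ?_
      rw [Matrix.single_apply, if_neg fun h => hh h.1.symm, zero_smul]
    · simp
  have h0 : ∑ g, z.1 g • g.toBR + ∑ p : GenPair n, z.2 p • (p.1.1.toBR * p.1.2.toBR) = 0 := hz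
  have h1 := congrArg Φ (congrArg (BR n).val h0)
  simp only [map_add, map_sum, map_zsmul, map_mul, Subalgebra.coe_val, Gen.toBR, map_zero] at h1
  rw [← h1]
  congr 1
  · exact Finset.sum_congr rfl fun g _ => by rw [hΦ]
  · refine Finset.sum_congr rfl fun p _ => ?_
    rw [p.2, Matrix.single_mul_single_same, one_mul, hΦ]
    rfl

theorem toBR_mul_toBR (p : GenPair n) :
    ((p.1.1.toBR * p.1.2.toBR : BR n) : Matrix (ArcBasis n) (ArcBasis n) ℤ) =
      Matrix.single p.src p.tgt 1 := by
  change Matrix.single p.1.1.src p.1.1.tgt (1 : ℤ) * Matrix.single p.1.2.src p.1.2.tgt 1 = _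
  rw [p.2, Matrix.single_mul_single_same, one_mul]
  rfl

theorem mem_linQuadRelations {z : (Gen n → ℤ) × (GenPair n → ℤ)} : z ∈ linQuadRelations n ↔
    ∑ g, z.1 g • g.toBR + ∑ p : GenPair n, z.2 p • (p.1.1.toBR * p.1.2.toBR) = 0 := Iff.rfl

open Classical in
theorem gen_pair_mem {g : Gen n} {p : GenPair n} (h₁ : p.src = g.src) (h₂ : p.tgt = g.tgt) :
    ((-Pi.single g 1, Pi.single p 1) : (Gen n → ℤ) × (GenPair n → ℤ)) ∈ linQuadRelations n := by
  have e : p.1.1.toBR * p.1.2.toBR = g.toBR := Subtype.ext (by rw [toBR_mul_toBR, h₁, h₂]; rfl)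
  rw [mem_linQuadRelations]
  simp [Pi.single_apply, ite_smul, e]

open Classical in
theorem pair_pair_mem {p p' : GenPair n} (h₁ : p.src = p'.src) (h₂ : p.tgt = p'.tgt) :
    ((0, Pi.single p 1 - Pi.single p' 1) : (Gen n → ℤ) × (GenPair n → ℤ)) ∈
      linQuadRelations n := by
  have e : p.1.1.toBR * p.1.2.toBR = p'.1.1.toBR * p'.1.2.toBR :=
    Subtype.ext (by rw [toBR_mul_toBR, toBR_mul_toBR, h₁, h₂])
  rw [mem_linQuadRelations]
  simp [Pi.single_apply, sub_smul, ite_smul, Finset.sum_sub_distrib, e]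

theorem dualRelations_of_gen {f : GenPair n → ℤ} (hf : f ∈ dualRelations n) {g : Gen n}
    {p : GenPair n} (h₁ : p.src = g.src) (h₂ : p.tgt = g.tgt) : f p = 0 := by
  classical
  have := hf _ (Submodule.mem_map.2 ⟨_, gen_pair_mem h₁ h₂, rfl⟩)
  simpa [Pi.single_apply] using this

theorem dualRelations_congr {f : GenPair n → ℤ} (hf : f ∈ dualRelations n)
    {p p' : GenPair n} (h₁ : p.src = p'.src) (h₂ : p.tgt = p'.tgt) : f p = f p' := by
  classical
  have := hf _ (Submodule.mem_map.2 ⟨_, pair_pair_mem h₁ h₂, rfl⟩)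
  simpa [Pi.single_apply, mul_sub, Finset.sum_sub_distrib, sub_eq_zero] using this

/-- Since words with the same ends are equal in `B`, an element of `I^⊥` is constant on them, and it
vanishes on them if their ends are also those of a generator. So only the full sums of words between
ends not joined by a generator have to be tested. -/
theorem dualRelations_sum {f : GenPair n → ℤ} (hf : f ∈ dualRelations n) (G : GenPair n → M)
    (hG : ∀ h m, (¬ ∃ g : Gen n, g.src = h ∧ g.tgt = m) →
      ∑ p : GenPair n with p.src = h ∧ p.tgt = m, G p = 0) : ∑ p, f p • G p = 0 := by
  rw [← Finset.sum_fiberwise Finset.univ (fun p : GenPair n => (p.src, p.tgt))]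
  refine Finset.sum_eq_zero fun e _ => ?_
  obtain ⟨h, m⟩ := e
  simp only [Prod.mk.injEq]
  by_cases H : ∃ g : Gen n, g.src = h ∧ g.tgt = m
  · obtain ⟨g, e1, e2⟩ := H
    refine Finset.sum_eq_zero fun p hp => ?_
    obtain ⟨e3, e4⟩ := (Finset.mem_filter.1 hp).2
    rw [dualRelations_of_gen hf (e3.trans e1.symm) (e4.trans e2.symm), zero_smul]
  · by_cases H' : ∃ p : GenPair n, p.src = h ∧ p.tgt = m
    · obtain ⟨p, e1, e2⟩ := H'
      rw [← smul_zero (f p), ← hG h m H, Finset.smul_sum]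
      refine Finset.sum_congr rfl fun p' hp => ?_
      obtain ⟨e3, e4⟩ := (Finset.mem_filter.1 hp).2
      rw [dualRelations_congr hf (e3.trans e1.symm) (e4.trans e2.symm)]
    · refine Finset.sum_eq_zero fun p hp => absurd ⟨p, (Finset.mem_filter.1 hp).2⟩ H'

open Classical in
/-- The indicator function of the words with given idempotents. -/
noncomputable def endsIndicator (h m : ArcBasis n) : GenPair n → ℤ :=
  fun p => if p.src = h ∧ p.tgt = m then 1 else 0

theorem endsIndicator_sum {h m : ArcBasis n} {z : (Gen n → ℤ) × (GenPair n → ℤ)}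
    (hz : z ∈ linQuadRelations n) :
    ∑ p, endsIndicator h m p * z.2 p = -∑ g with g.src = h ∧ g.tgt = m, z.1 g := by
  classical
  have := linQuadRelations_sum hz (fun a b => if a = h ∧ b = m then (1 : ℤ) else 0)
  rw [eq_neg_iff_add_eq_zero, add_comm, ← this]
  congr 1
  · rw [Finset.sum_filter]
    exact Finset.sum_congr rfl fun g _ => by split_ifs <;> simp
  · exact Finset.sum_congr rfl fun p _ => by rw [endsIndicator, smul_eq_mul, mul_comm]

theorem endsIndicator_mem {h m : ArcBasis n} (H : ¬ ∃ g : Gen n, g.src = h ∧ g.tgt = m) :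
    endsIndicator h m ∈ dualRelations n := by
  rintro _ hz
  obtain ⟨z, hz', rfl⟩ := Submodule.mem_map.1 hz
  change ∑ p, endsIndicator h m p * z.2 p = 0
  rw [endsIndicator_sum hz', Finset.filter_false_of_mem fun g _ hg => H ⟨g, hg⟩]
  simp

/-- No other generator has the ends of `b`. So in a linear-quadratic relation the coefficient of `b`
is minus the sum of the coefficients of the words with these ends, and minus their indicator also
represents `φ^*(b^*)`. -/
theorem dualDifferential_add_mem (b : Gen n) :
    dualDifferential b + endsIndicator b.src b.tgt ∈ dualRelations n := by
  rintro _ hz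
  obtain ⟨z, hz', rfl⟩ := Submodule.mem_map.1 hz
  change ∑ p, (dualDifferential b p + endsIndicator b.src b.tgt p) * z.2 p = 0
  have h1 : ∑ p, dualDifferential b p * z.2 p = z.1 b :=
    (exists_representsDual b).choose_spec z hz'
  simp_rw [add_mul]
  rw [Finset.sum_add_distrib, h1, endsIndicator_sum hz']
  have : (Finset.univ.filter fun g : Gen n => g.src = b.src ∧ g.tgt = b.tgt) = {b} := by
    ext g
    simp only [Finset.mem_filter, Finset.mem_univ, true_and, Finset.mem_singleton]
    exact ⟨fun e => Gen.ext_ends e.1 e.2, fun e => by rw [e]; exact ⟨rfl, rfl⟩⟩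
  rw [this]
  simp

theorem endsIndicator_smul_sum (h m : ArcBasis n) (G : GenPair n → M) :
    ∑ p, endsIndicator h m p • G p = ∑ p : GenPair n with p.src = h ∧ p.tgt = m, G p := by
  rw [Finset.sum_filter]
  refine Finset.sum_congr rfl fun p _ => ?_
  rw [endsIndicator]
  split_ifs <;> simp

end Relations

/-! ## Matrices over the product algebra -/

namespace FullAlg

variable {n : ℕ} {h k k' m : ArcBasis n}

theorem mk_eq {x y : FreeAlgebra ℤ (Letter n)} (h : FullRel n x y) : mk n x = mk n y :=
  RingQuot.mkRingHom_rel h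

theorem idem_mul_idem (h k : ArcBasis n) : idem h * idem k = if h = k then idem h else 0 := by
  have := mk_eq (FullRel.idem_mul h k)
  rw [map_mul] at this
  refine this.trans ?_
  split_ifs
  · rfl
  · exact map_zero _

theorem sum_idem : ∑ h : ArcBasis n, idem h = 1 := by
  have := mk_eq (FullRel.idem_sum (n := n))
  rwa [map_sum, map_one] at this

theorem idem_mul_right (b : Gen n) : idem b.src * right b = right b := by
  have := mk_eq (FullRel.right_src b)
  rwa [map_mul] at this

theorem right_mul_idem (b : Gen n) : right b * idem b.tgt = right b := by
  have := mk_eq (FullRel.right_tgt b)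
  rwa [map_mul] at this

theorem idem_mul_left (b : Gen n) : idem b.src.mirror * left b = left b := by
  have := mk_eq (FullRel.left_src b)
  rwa [map_mul] at this

theorem left_mul_idem (b : Gen n) : left b * idem b.tgt.mirror = left b := by
  have := mk_eq (FullRel.left_tgt b)
  rwa [map_mul] at this

theorem lin_quad {z : (Gen n → ℤ) × (GenPair n → ℤ)} (hz : z ∈ linQuadRelations n) :
    ∑ g, z.1 g • right g + ∑ p : GenPair n, z.2 p • (right p.1.1 * right p.1.2) = 0 := by
  have := mk_eq (FullRel.lin_quad z hz)
  simp only [map_add, map_sum, map_zsmul, map_mul, map_zero] at this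
  exact this

theorem dual {f : GenPair n → ℤ} (hf : f ∈ dualRelations n) :
    ∑ p : GenPair n, f p • (left p.1.1 * left p.1.2) = 0 := by
  have := mk_eq (FullRel.dual f hf)
  simp only [map_sum, map_zsmul, map_mul, map_zero] at this
  exact this

theorem right_mul_right_eq_right {g : Gen n} {p : GenPair n} (h₁ : p.src = g.src)
    (h₂ : p.tgt = g.tgt) : right p.1.1 * right p.1.2 = right g := by
  classical
  have := lin_quad (gen_pair_mem h₁ h₂)
  rw [← sub_eq_zero, ← this]
  simp [Pi.single_apply, ite_smul, neg_add_eq_sub]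

theorem right_mul_right_congr {p p' : GenPair n} (h₁ : p.src = p'.src) (h₂ : p.tgt = p'.tgt) :
    right p.1.1 * right p.1.2 = right p'.1.1 * right p'.1.2 := by
  classical
  have := lin_quad (pair_pair_mem h₁ h₂)
  rw [← sub_eq_zero, ← this]
  simp [Pi.single_apply, ite_smul, sub_smul, Finset.sum_sub_distrib]

/-- A word of at most two generators of `B` depends only on its idempotents. -/
theorem exists_rightWord (n : ℕ) : ∃ F : ArcBasis n → ArcBasis n → FullAlg n,
    (∀ g, right g = F g.src g.tgt) ∧
      ∀ p : GenPair n, right p.1.1 * right p.1.2 = F p.src p.tgt := by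
  classical
  let F : ArcBasis n → ArcBasis n → FullAlg n := fun h k =>
    if H : ∃ g : Gen n, g.src = h ∧ g.tgt = k then right H.choose
    else if H : ∃ p : GenPair n, p.src = h ∧ p.tgt = k then
      right H.choose.1.1 * right H.choose.1.2 else 0
  refine ⟨F, fun g => ?_, fun p => ?_⟩
  · have H : ∃ g' : Gen n, g'.src = g.src ∧ g'.tgt = g.tgt := ⟨g, rfl, rfl⟩
    change _ = dite _ _ _
    rw [dif_pos H, Gen.ext_ends H.choose_spec.1 H.choose_spec.2]
  · change _ = dite _ _ _
    by_cases H : ∃ g : Gen n, g.src = p.src ∧ g.tgt = p.tgt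
    · rw [dif_pos H]
      exact right_mul_right_eq_right H.choose_spec.1.symm H.choose_spec.2.symm
    · have H' : ∃ p' : GenPair n, p'.src = p.src ∧ p'.tgt = p.tgt := ⟨p, rfl, rfl⟩
      rw [dif_neg H, dif_pos H']
      exact right_mul_right_congr H'.choose_spec.1.symm H'.choose_spec.2.symm

/-- The sums of the words `m(b^*) m(c^*)` with given idempotents. -/
noncomputable def leftSq (n : ℕ) : Matrix (ArcBasis n) (ArcBasis n) (FullAlg n) :=
  genMatrix left * genMatrix left

theorem leftSq_eq_zero (H : ¬ ∃ g : Gen n, g.src = h ∧ g.tgt = m) :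
    leftSq n h m = 0 := by
  rw [leftSq, ← sum_genPair_eq, ← endsIndicator_smul_sum]
  exact dual (endsIndicator_mem H)

/-- The Maurer-Cartan form `dY = -Y²` of the differential, free of the chosen lift. -/
theorem sum_dualDifferential (b : Gen n) :
    ∑ p : GenPair n, dualDifferential b p • (left p.1.1 * left p.1.2) =
      -leftSq n b.src b.tgt := by
  have := dual (dualDifferential_add_mem b)
  simp only [Pi.add_apply, add_smul, Finset.sum_add_distrib] at this
  rw [endsIndicator_smul_sum, sum_genPair_eq, ← leftSq] at this
  exact eq_neg_of_add_eq_zero_left this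

/-- The letters `m(b^*)` of bridges, between the idempotents of the product algebra. -/
noncomputable def leftB (n : ℕ) : Matrix (ArcBasis n) (ArcBasis n) (FullAlg n) :=
  (bridgeMatrix left).submatrix ArcBasis.mirror ArcBasis.mirror

/-- The letters `m(b^*)` of decorations, between the idempotents of the product algebra. -/
noncomputable def leftD (n : ℕ) : Matrix (ArcBasis n) (ArcBasis n) (FullAlg n) :=
  (decorMatrix left).submatrix ArcBasis.mirror ArcBasis.mirror

/-- The letters `b` of bridges. -/
noncomputable def rightB (n : ℕ) : Matrix (ArcBasis n) (ArcBasis n) (FullAlg n) :=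
  bridgeMatrix right

/-- The letters `b` of decorations. -/
noncomputable def rightD (n : ℕ) : Matrix (ArcBasis n) (ArcBasis n) (FullAlg n) :=
  decorMatrix right

theorem leftB_of (H : h.LeftBridgeTo k) : leftB n h k = left (Gen.ofBridge H) :=
  bridgeMatrix_of _ H

theorem leftB_of_not (H : ¬ h.LeftBridgeTo k) : leftB n h k = 0 := bridgeMatrix_of_not _ H

theorem leftD_of (H : h.DecorTo k) : leftD n h k = left (Gen.ofDecor H.mirror) :=
  decorMatrix_of _ H.mirror

theorem leftD_of_not (H : ¬ h.DecorTo k) : leftD n h k = 0 :=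
  decorMatrix_of_not _ fun H' => H H'.mirror

theorem rightB_of (H : h.BridgeTo k) : rightB n h k = right (Gen.ofBridge H) :=
  bridgeMatrix_of _ H

theorem rightB_of_not (H : ¬ h.BridgeTo k) : rightB n h k = 0 := bridgeMatrix_of_not _ H

theorem rightD_of (H : h.DecorTo k) : rightD n h k = right (Gen.ofDecor H) := decorMatrix_of _ H

theorem rightD_of_not (H : ¬ h.DecorTo k) : rightD n h k = 0 := decorMatrix_of_not _ H

theorem extra {x y : FreeAlgebra ℤ (Letter n)} (h : ExtraRel n x y) : mk n x = mk n y :=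
  mk_eq (FullRel.extra x y h)

theorem rightB_mul_leftB_apply (h₁ : h.BridgeTo k) (h₂ : k.LeftBridgeTo m)
    (h₃ : h.LeftBridgeTo k') (h₄ : k'.BridgeTo m) :
    rightB n h k * leftB n k m = leftB n h k' * rightB n k' m := by
  rw [rightB_of h₁, leftB_of h₂, leftB_of h₃, rightB_of h₄]
  have := extra (ExtraRel.bridge_bridge (Gen.ofBridge h₁) (Gen.ofBridge h₂) (Gen.ofBridge h₃)
    (Gen.ofBridge h₄) ⟨rfl, rfl, rfl, rfl⟩ (Gen.isBridge_ofBridge _) (Gen.isBridge_ofBridge _)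
    (Gen.isBridge_ofBridge _) (Gen.isBridge_ofBridge _))
  rwa [map_mul, map_mul] at this

theorem rightD_mul_leftB_apply (h₁ : h.DecorTo k) (h₂ : k.LeftBridgeTo m)
    (h₃ : h.LeftBridgeTo k') (h₄ : k'.DecorTo m) :
    rightD n h k * leftB n k m = leftB n h k' * rightD n k' m := by
  rw [rightD_of h₁, leftB_of h₂, leftB_of h₃, rightD_of h₄]
  have := extra (ExtraRel.decoration_bridge (Gen.ofDecor h₁) (Gen.ofBridge h₂) (Gen.ofBridge h₃)
    (Gen.ofDecor h₄) ⟨rfl, rfl, rfl, rfl⟩ (Gen.isDecoration_ofDecor _) (Gen.isBridge_ofBridge _)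
    (Gen.isBridge_ofBridge _) (Gen.isDecoration_ofDecor _))
  rwa [map_mul, map_mul] at this

theorem rightB_mul_leftD_of_away (hs : h.AwaySquare k k' m) :
    rightB n h k * leftD n k m = leftD n h k' * rightB n k' m := by
  rw [rightB_of hs.bridge, leftD_of hs.decor, leftD_of hs.decor', rightB_of hs.bridge']
  have := extra (ExtraRel.bridge_decoration (Gen.ofBridge hs.bridge) (Gen.ofDecor hs.decor.mirror)
    (Gen.ofDecor hs.decor'.mirror) (Gen.ofBridge hs.bridge') ⟨rfl, rfl, rfl, rfl⟩
    (Gen.isBridge_ofBridge _) (Gen.isDecoration_ofDecor _) (Gen.isDecoration_ofDecor _)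
    (Gen.isBridge_ofBridge _) hs.diff_eq hs.disjoint)
  rwa [map_mul, map_mul] at this

theorem rightB_mul_leftD_of_join {k₁ k₂ : ArcBasis n} (hs : h.JoinSquare k k₁ k₂ m) :
    rightB n h k * leftD n k m = leftD n h k₁ * rightB n k₁ m + leftD n h k₂ * rightB n k₂ m := by
  rw [rightB_of hs.bridge, leftD_of hs.decor, leftD_of hs.decor₁, rightB_of hs.bridge₁,
    leftD_of hs.decor₂, rightB_of hs.bridge₂]
  have := extra (ExtraRel.join (Gen.ofBridge hs.bridge) (Gen.ofDecor hs.decor.mirror)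
    (Gen.ofDecor hs.decor₁.mirror) (Gen.ofBridge hs.bridge₁) (Gen.ofDecor hs.decor₂.mirror)
    (Gen.ofBridge hs.bridge₂) ⟨rfl, rfl, rfl, rfl⟩ ⟨rfl, rfl, rfl, rfl⟩
    (Gen.isBridge_ofBridge _) (Gen.isBridge_ofBridge _) (Gen.isBridge_ofBridge _)
    (Gen.isDecoration_ofDecor _) (Gen.isDecoration_ofDecor _) (Gen.isDecoration_ofDecor _)
    ⟨hs.mem₁, hs.mem₂, hs.mem, hs.ne, hs.union⟩)
  rwa [map_mul, map_add, map_mul, map_mul] at this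

theorem rightB_mul_leftD_of_split {k₁ k₂ : ArcBasis n} (hs : h.SplitSquare k₁ k₂ k m) :
    rightB n h k₁ * leftD n k₁ m + rightB n h k₂ * leftD n k₂ m = leftD n h k * rightB n k m := by
  rw [rightB_of hs.bridge, leftD_of hs.decor, leftD_of hs.decor₁, rightB_of hs.bridge₁,
    leftD_of hs.decor₂, rightB_of hs.bridge₂]
  have := extra (ExtraRel.split (Gen.ofBridge hs.bridge₁) (Gen.ofDecor hs.decor₁.mirror)
    (Gen.ofBridge hs.bridge₂) (Gen.ofDecor hs.decor₂.mirror) (Gen.ofDecor hs.decor.mirror)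
    (Gen.ofBridge hs.bridge) ⟨rfl, rfl, rfl, rfl⟩ ⟨rfl, rfl, rfl, rfl⟩
    (Gen.isBridge_ofBridge _) (Gen.isBridge_ofBridge _) (Gen.isBridge_ofBridge _)
    (Gen.isDecoration_ofDecor _) (Gen.isDecoration_ofDecor _) (Gen.isDecoration_ofDecor _)
    ⟨hs.mem, hs.mem₁, hs.mem₂, hs.ne, hs.union⟩)
  rwa [map_mul, map_add, map_mul, map_mul] at this

end FullAlg

/-! ### Matrix products with few nonzero terms, and sums over equinumerous sets -/

theorem Matrix.mul_apply_eq_single {ι R : Type} [Fintype ι] [DecidableEq ι] [Ring R]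
    {A B : Matrix ι ι R} {h m k : ι} (H : ∀ j, A h j ≠ 0 → B j m ≠ 0 → j = k) :
    (A * B) h m = A h k * B k m := by
  rw [Matrix.mul_apply]
  refine Finset.sum_eq_single k (fun j _ hj => ?_) (by simp)
  by_contra hne
  exact hj (H j (left_ne_zero_of_mul hne) (right_ne_zero_of_mul hne))

theorem Matrix.mul_apply_eq_pair {ι R : Type} [Fintype ι] [DecidableEq ι] [Ring R]
    {A B : Matrix ι ι R} {h m k₁ k₂ : ι} (hne : k₁ ≠ k₂)
    (H : ∀ j, A h j ≠ 0 → B j m ≠ 0 → j = k₁ ∨ j = k₂) :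
    (A * B) h m = A h k₁ * B k₁ m + A h k₂ * B k₂ m := by
  rw [Matrix.mul_apply, ← Finset.sum_pair (f := fun k => A h k * B k m) hne]
  refine (Finset.sum_subset (Finset.subset_univ _) fun j _ hj => ?_).symm
  by_contra hne
  exact hj (by simpa using H j (left_ne_zero_of_mul hne) (right_ne_zero_of_mul hne))

theorem Matrix.mul_apply_eq_zero {ι R : Type} [Fintype ι] [Ring R]
    {A B : Matrix ι ι R} {h m : ι} (H : ∀ j, A h j ≠ 0 → B j m ≠ 0 → False) :
    (A * B) h m = 0 := by
  rw [Matrix.mul_apply]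
  refine Finset.sum_eq_zero fun j _ => ?_
  by_contra hne
  exact H j (left_ne_zero_of_mul hne) (right_ne_zero_of_mul hne)

namespace ArcBasis

variable {n : ℕ} {h k m : ArcBasis n}

theorem LeftBridgeTo.degree_eq (H : h.LeftBridgeTo k) : k.degree = h.degree + 1 := by
  have := BridgeTo.degree_eq H
  rwa [mirror_degree, mirror_degree] at this

/-- Decorations of two circles may be performed in the other order. -/
theorem DecorTo.exists_swap (h₁ : h.DecorTo k) (h₂ : k.DecorTo m) :
    ∃ k', h.DecorTo k' ∧ k'.DecorTo m ∧ diff h k = diff k' m ∧ diff k m = diff h k' := by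
  obtain ⟨z, hz⟩ := h₁.exists_mem_diff
  obtain ⟨w, hw⟩ := h₂.exists_mem_diff
  obtain ⟨a1, a2, a3, a4, a5⟩ := h₁.diff_eq hz
  obtain ⟨b1, b2, b3, b4, b5⟩ := h₂.diff_eq hw
  rw [← h₁.circ_eq] at b3
  have hn : ¬ h.circ z w := fun e => by
    rw [← k.minus_const z w (h₁.circ_eq ▸ e), a2] at b1
    cases b1
  have hw' : h.minus w = false := by
    rw [a4, minus_relabelAt, relabel_of_not_rel hn] at b1
    exact b1
  have hz' : (h.relabelAt w true).minus z = false := by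
    rw [minus_relabelAt, relabel_of_not_rel (fun e => hn (h.circ.symm e)), a1]
  have hm : m = (h.relabelAt w true).relabelAt z true := by
    refine ext_minus (h₁.left_eq.trans h₂.left_eq).symm (h₁.right_eq.trans h₂.right_eq).symm ?_
    rw [b4, a4]
    funext x
    by_cases hx : h.circ z x
    · have hx' : ¬ h.circ w x := fun e => hn (h.circ.trans hx (h.circ.symm e))
      rw [minus_relabelAt, minus_relabelAt, minus_relabelAt, minus_relabelAt, circ_relabelAt,
        circ_relabelAt, relabel_of_not_rel hx', relabel_of_rel hx, relabel_of_rel hx]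
    · by_cases hx' : h.circ w x
      · rw [minus_relabelAt, minus_relabelAt, minus_relabelAt, minus_relabelAt, circ_relabelAt,
          circ_relabelAt, relabel_of_rel hx', relabel_of_not_rel hx, relabel_of_rel hx']
      · rw [minus_relabelAt, minus_relabelAt, minus_relabelAt, minus_relabelAt, circ_relabelAt,
          circ_relabelAt, relabel_of_not_rel hx', relabel_of_not_rel hx, relabel_of_not_rel hx,
          relabel_of_not_rel hx']
  refine ⟨h.relabelAt w true, decorTo_relabelAt hw', ?_, ?_, ?_⟩
  · rw [hm]
    exact decorTo_relabelAt hz'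
  · rw [hm, diff_relabelAt_true hz', a3, circ_relabelAt]
  · rw [diff_relabelAt_true hw', b3]

end ArcBasis

/-- Sums of constants over equinumerous supports agree. -/
theorem sum_eq_sum_of_card_eq {ι M : Type} [Fintype ι] [AddCommMonoid M] {P Q : ι → Prop}
    {a b : ι → M} (ha : ∀ i, ¬ P i → a i = 0) (hb : ∀ i, ¬ Q i → b i = 0)
    (hab : ∀ i j, P i → Q j → a i = b j)
    (hc : Nat.card {i // P i} = Nat.card {i // Q i}) : ∑ i, a i = ∑ i, b i := by
  classical
  rw [← Finset.sum_filter_of_ne (p := P) fun i _ h => not_not.1 fun h' => h (ha i h'),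
    ← Finset.sum_filter_of_ne (p := Q) fun i _ h => not_not.1 fun h' => h (hb i h')]
  rw [Nat.card_eq_fintype_card, Nat.card_eq_fintype_card, Fintype.card_subtype,
    Fintype.card_subtype] at hc
  by_cases hP : ∃ i, P i
  · obtain ⟨i, hi⟩ := hP
    have hpos : 0 < (Finset.univ.filter Q).card := by
      rw [← hc]
      exact Finset.card_pos.2 ⟨i, by simpa using hi⟩
    obtain ⟨j, hj⟩ := Finset.card_pos.1 hpos
    have hj := (Finset.mem_filter.1 hj).2
    rw [Finset.sum_congr rfl (g := fun _ => a i), Finset.sum_const,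
      Finset.sum_congr (s₁ := Finset.univ.filter Q) rfl (g := fun _ => a i), Finset.sum_const, hc]
    · exact fun j hj => (hab i j hi (Finset.mem_filter.1 hj).2).symm
    · exact fun i' hi' => (hab i' j (Finset.mem_filter.1 hi').2 hj).trans (hab i j hi hj).symm
  · have h1 : Finset.univ.filter P = ∅ :=
      Finset.filter_false_of_mem fun i _ hi => hP ⟨i, hi⟩
    rw [h1, Finset.card_empty] at hc
    rw [h1, Finset.card_eq_zero.1 hc.symm, Finset.sum_empty, Finset.sum_empty]

/-! ### Commutation of the matrices of letters, and of the differentials of letters -/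

namespace FullAlg

variable {n : ℕ} {h k k' m : ArcBasis n}

theorem bridgeTo_of_ne (H : rightB n h k ≠ 0) : h.BridgeTo k :=
  not_not.1 fun H' => H (rightB_of_not H')

theorem leftBridgeTo_of_ne (H : leftB n h k ≠ 0) : h.LeftBridgeTo k :=
  not_not.1 fun H' => H (leftB_of_not H')

theorem decorTo_of_ne (H : leftD n h k ≠ 0) : h.DecorTo k :=
  not_not.1 fun H' => H (leftD_of_not H')

/-- By the bridge relations, all terms of the two sums with given ends are equal whenever both
orders occur, and by commutation of saddles both sums have the same number of terms. -/
theorem rightB_mul_leftB : rightB n * leftB n = leftB n * rightB n := by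
  ext h m
  rw [Matrix.mul_apply, Matrix.mul_apply]
  refine sum_eq_sum_of_card_eq (P := fun k => h.BridgeTo k ∧ k.LeftBridgeTo m)
    (Q := fun k => h.LeftBridgeTo k ∧ k.BridgeTo m) ?_ ?_ ?_ (ArcBasis.card_bridge_comm h m)
  · intro k hk
    by_contra hne
    exact hk ⟨bridgeTo_of_ne (left_ne_zero_of_mul hne),
      leftBridgeTo_of_ne (right_ne_zero_of_mul hne)⟩
  · intro k hk
    by_contra hne
    exact hk ⟨leftBridgeTo_of_ne (left_ne_zero_of_mul hne),
      bridgeTo_of_ne (right_ne_zero_of_mul hne)⟩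
  · exact fun k k' hk hk' => rightB_mul_leftB_apply hk.1 hk.2 hk'.1 hk'.2

/-- The paths in the square provided by `ArcBasis.exists_square` are all the paths between its ends,
so the equation of entries is one defining relation. If there is no path in one order, there is none
in the other. -/
theorem rightB_mul_leftD : rightB n * leftD n = leftD n * rightB n := by
  ext h m
  by_cases H : ∃ k, h.BridgeTo k ∧ k.DecorTo m
  · obtain ⟨k, h1, h2⟩ := H
    rcases ArcBasis.exists_square h1 h2 with ⟨k', hs⟩ | ⟨k₁, k₂, hs⟩ | ⟨k₂, k', hs⟩
    · rw [Matrix.mul_apply_eq_single (k := k) fun j a b =>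
          hs.unique (bridgeTo_of_ne a) (decorTo_of_ne b),
        Matrix.mul_apply_eq_single (k := k') fun j a b =>
          hs.unique' (decorTo_of_ne a) (bridgeTo_of_ne b), rightB_mul_leftD_of_away hs]
    · rw [Matrix.mul_apply_eq_single (k := k) fun j a b =>
          hs.unique (bridgeTo_of_ne a) (decorTo_of_ne b),
        Matrix.mul_apply_eq_pair (k₁ := k₁) (k₂ := k₂) (fun e => hs.ne (by rw [e])) fun j a b =>
          hs.unique' (decorTo_of_ne a) (bridgeTo_of_ne b), rightB_mul_leftD_of_join hs]
    · rw [Matrix.mul_apply_eq_pair (k₁ := k) (k₂ := k₂) (fun e => hs.ne (by rw [e])) fun j a b =>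
          hs.unique (bridgeTo_of_ne a) (decorTo_of_ne b),
        Matrix.mul_apply_eq_single (k := k') fun j a b =>
          hs.unique' (decorTo_of_ne a) (bridgeTo_of_ne b), rightB_mul_leftD_of_split hs]
  · rw [Matrix.mul_apply_eq_zero fun j a b => H ⟨j, bridgeTo_of_ne a, decorTo_of_ne b⟩,
      Matrix.mul_apply_eq_zero fun j a b => H ((ArcBasis.exists_decorTo_bridgeTo_iff h m).1
        ⟨j, decorTo_of_ne a, bridgeTo_of_ne b⟩)]

theorem rightD_mul_leftD_apply (h₁ : h.DecorTo k) (h₂ : k.DecorTo m) (h₃ : h.DecorTo k')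
    (h₄ : k'.DecorTo m) (e₁ : ArcBasis.diff h k = ArcBasis.diff k' m)
    (e₂ : ArcBasis.diff k m = ArcBasis.diff h k') :
    rightD n h k * leftD n k m = leftD n h k' * rightD n k' m := by
  rw [rightD_of h₁, leftD_of h₂, leftD_of h₃, rightD_of h₄]
  have := extra (ExtraRel.decoration_decoration (Gen.ofDecor h₁) (Gen.ofDecor h₂.mirror)
    (Gen.ofDecor h₃.mirror) (Gen.ofDecor h₄) ⟨rfl, rfl, rfl, rfl⟩ (Gen.isDecoration_ofDecor _)
    (Gen.isDecoration_ofDecor _) (Gen.isDecoration_ofDecor _) (Gen.isDecoration_ofDecor _) e₁ e₂)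
  rwa [map_mul, map_mul] at this

open Classical in
/-- The decorations of the circle through `z`. -/
noncomputable def rightAt (n : ℕ) (z : Fin (2 * n)) : Matrix (ArcBasis n) (ArcBasis n) (FullAlg n) :=
  fun h k => if h.minus z = false ∧ k = h.relabelAt z true then rightD n h k else 0

theorem rightAt_of {z : Fin (2 * n)} (h₁ : h.minus z = false) :
    rightAt n z h (h.relabelAt z true) = rightD n h (h.relabelAt z true) := if_pos ⟨h₁, rfl⟩

theorem of_rightAt_ne {z : Fin (2 * n)} (H : rightAt n z h k ≠ 0) :
    h.minus z = false ∧ k = h.relabelAt z true :=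
  not_not.1 fun H' => H (if_neg H')

/-- The relation needed later concerns a single circle, so decorations are separated by a point `z`
of their circle. For fixed `z` each side has at most one term, and a defining relation identifies
the two. -/
theorem rightAt_mul_leftB (z : Fin (2 * n)) : rightAt n z * leftB n = leftB n * rightAt n z := by
  ext h m
  have hr : ∀ j : ArcBasis n, j.minus z = false ∧ m = j.relabelAt z true →
      j = m.relabelAt z false ∧ m.minus z = true := by
    rintro j ⟨a, rfl⟩
    rw [ArcBasis.relabelAt_relabelAt, ArcBasis.relabelAt_self a]
    exact ⟨rfl, ArcBasis.minus_relabelAt_self _ _⟩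
  by_cases H : h.minus z = false ∧ (h.relabelAt z true).LeftBridgeTo m
  · obtain ⟨h3, h4⟩ := (ArcBasis.relabelAt_leftBridgeTo_iff z).1 H
    have h5 : (m.relabelAt z false).minus z = false := ArcBasis.minus_relabelAt_self _ _
    have h6 : m = (m.relabelAt z false).relabelAt z true := by
      rw [ArcBasis.relabelAt_relabelAt, ArcBasis.relabelAt_self h3]
    rw [Matrix.mul_apply_eq_single (k := h.relabelAt z true) fun j a b => (of_rightAt_ne a).2,
      Matrix.mul_apply_eq_single (k := m.relabelAt z false) fun j a b => (hr j (of_rightAt_ne b)).1,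
      rightAt_of H.1]
    have h7 : rightAt n z (m.relabelAt z false) m = rightD n (m.relabelAt z false) m :=
      if_pos ⟨h5, h6⟩
    rw [h7]
    exact rightD_mul_leftB_apply (ArcBasis.decorTo_relabelAt H.1) H.2 h4
      (ArcBasis.relabelAt_decorTo h3)
  · rw [Matrix.mul_apply_eq_zero fun j a b => ?_, Matrix.mul_apply_eq_zero fun j a b => ?_]
    · obtain ⟨e, e'⟩ := hr j (of_rightAt_ne b)
      exact H ((ArcBasis.relabelAt_leftBridgeTo_iff z).2 ⟨e', e ▸ leftBridgeTo_of_ne a⟩)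
    · obtain ⟨e, e'⟩ := of_rightAt_ne a
      exact H ⟨e, e' ▸ leftBridgeTo_of_ne b⟩

theorem exists_gens_of_leftSq_term (H : genMatrix (left (n := n)) h k ≠ 0)
    (H' : genMatrix (left (n := n)) k m ≠ 0) : ∃ g g' : Gen n, g.src = h ∧ g.tgt = k ∧
      g'.src = k ∧ g'.tgt = m := by
  obtain ⟨g, a, b⟩ := exists_gen_of_genMatrix_ne_zero _ H
  obtain ⟨g', a', b'⟩ := exists_gen_of_genMatrix_ne_zero _ H'
  exact ⟨g, g', a, b, a', b'⟩

/-- A bridge raises the degree by one, a word of two generators by at least two. Hence bridge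
letters are cycles. -/
theorem leftSq_of_isBridge {g : Gen n} (hg : g.IsBridge) : leftSq n g.src g.tgt = 0 := by
  refine Matrix.mul_apply_eq_zero fun j a b => ?_
  obtain ⟨g₁, g₂, e1, e2, e3, e4⟩ := exists_gens_of_leftSq_term a b
  have d := hg.tgt_degree
  rcases g₁.isBridge_or_isDecoration with c1 | c1 <;>
  rcases g₂.isBridge_or_isDecoration with c2 | c2 <;>
  · have d1 := c1.tgt_degree
    have d2 := c2.tgt_degree
    rw [e1, e2] at d1
    rw [e3, e4] at d2
    omega

/-- The matrix of minus the differentials of the letters `m(b^*)`. -/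
noncomputable def leftBSq (n : ℕ) : Matrix (ArcBasis n) (ArcBasis n) (FullAlg n) :=
  leftB n * leftB n

/-- A degree difference of two leaves room only for two bridges. -/
theorem leftSq_of_degree_eq (H : m.degree = h.degree + 2) :
    leftSq n h.mirror m.mirror = leftBSq n h m := by
  have e : ∀ g g' : Gen n, g.src = h.mirror → g.tgt = g'.src → g'.tgt = m.mirror →
      g.IsBridge ∧ g'.IsBridge := by
    intro g g' e1 e2 e3
    rw [← ArcBasis.mirror_degree h, ← ArcBasis.mirror_degree m, ← e1, ← e3] at H
    rcases g.isBridge_or_isDecoration with c1 | c1 <;>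
    rcases g'.isBridge_or_isDecoration with c2 | c2
    · exact ⟨c1, c2⟩
    all_goals
      have d1 := c1.tgt_degree
      have d2 := c2.tgt_degree
      rw [e2] at d1
      omega
  rw [leftSq, leftBSq, Matrix.mul_apply, Matrix.mul_apply, ← Equiv.sum_comp (mirrorPerm n)]
  refine Finset.sum_congr rfl fun j _ => ?_
  change genMatrix left h.mirror j.mirror * genMatrix left j.mirror m.mirror =
    bridgeMatrix left h.mirror j.mirror * bridgeMatrix left j.mirror m.mirror
  by_cases H1 : genMatrix left h.mirror j.mirror = (0 : FullAlg n)
  · by_cases H2 : h.mirror.BridgeTo j.mirror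
    · rw [genMatrix_of_bridge _ H2] at H1 ⊢
      rw [H1, zero_mul, zero_mul]
    · rw [H1, bridgeMatrix_of_not _ H2, zero_mul, zero_mul]
  by_cases H2 : genMatrix left j.mirror m.mirror = (0 : FullAlg n)
  · by_cases H3 : j.mirror.BridgeTo m.mirror
    · rw [genMatrix_of_bridge _ H3] at H2 ⊢
      rw [H2, mul_zero, mul_zero]
    · rw [H2, bridgeMatrix_of_not _ H3, mul_zero, mul_zero]
  obtain ⟨g₁, g₂, e1, e2, e3, e4⟩ := exists_gens_of_leftSq_term H1 H2
  obtain ⟨b1, b2⟩ := e g₁ g₂ e1 (e2.trans e3.symm) e4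
  rw [Gen.isBridge_iff, e1, e2] at b1
  rw [Gen.isBridge_iff, e3, e4] at b2
  rw [genMatrix_of_bridge _ b1, genMatrix_of_bridge _ b2]

theorem leftSq_of_decorTo (H : h.DecorTo m) : leftSq n h.mirror m.mirror = leftBSq n h m :=
  leftSq_of_degree_eq H.degree_eq

/-- Two bridges raise the degree by two, so the entry is one of `Y²`; the relations of the dual kill
it unless a generator has the same ends, and by degree this generator is a decoration. -/
theorem decorTo_of_leftBSq_ne (H : leftBSq n h m ≠ 0) : h.DecorTo m := by
  have hd : m.degree = h.degree + 2 := by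
    by_contra hd
    refine H (Matrix.mul_apply_eq_zero fun j a b => ?_)
    have d1 := (leftBridgeTo_of_ne a).degree_eq
    have d2 := (leftBridgeTo_of_ne b).degree_eq
    omega
  have hg : ∃ g : Gen n, g.src = h.mirror ∧ g.tgt = m.mirror := by
    by_contra hg
    rw [← leftSq_of_degree_eq hd, leftSq_eq_zero hg] at H
    exact H rfl
  obtain ⟨g, e1, e2⟩ := hg
  rcases g.isBridge_or_isDecoration with c | c
  · have d := c.tgt_degree
    rw [e1, e2, ArcBasis.mirror_degree, ArcBasis.mirror_degree] at d
    omega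
  · rw [Gen.isDecoration_iff, e1, e2] at c
    exact c.of_mirror

/-- Up to sign `Y_B²` collects the differentials of the decoration letters. As it is supported on
decorations, an entry of this identity involves the same paths as the corresponding relation between
bridges and decorations, which is how the differential is seen to respect that relation. -/
theorem rightB_mul_leftBSq : rightB n * leftBSq n = leftBSq n * rightB n := by
  rw [leftBSq, ← mul_assoc, rightB_mul_leftB, mul_assoc, rightB_mul_leftB, mul_assoc]

theorem rightAt_mul_leftBSq (z : Fin (2 * n)) :
    rightAt n z * leftBSq n = leftBSq n * rightAt n z := by
  rw [leftBSq, ← mul_assoc, rightAt_mul_leftB, mul_assoc, rightAt_mul_leftB, mul_assoc]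

theorem rightB_mul_leftBSq_of_away (hs : h.AwaySquare k k' m) :
    rightB n h k * leftBSq n k m = leftBSq n h k' * rightB n k' m := by
  have := congrFun (congrFun (rightB_mul_leftBSq (n := n)) h) m
  rwa [Matrix.mul_apply_eq_single (k := k) fun j a b =>
      hs.unique (bridgeTo_of_ne a) (decorTo_of_leftBSq_ne b),
    Matrix.mul_apply_eq_single (k := k') fun j a b =>
      hs.unique' (decorTo_of_leftBSq_ne a) (bridgeTo_of_ne b)] at this

theorem rightB_mul_leftBSq_of_join {k₁ k₂ : ArcBasis n} (hs : h.JoinSquare k k₁ k₂ m) :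
    rightB n h k * leftBSq n k m =
      leftBSq n h k₁ * rightB n k₁ m + leftBSq n h k₂ * rightB n k₂ m := by
  have := congrFun (congrFun (rightB_mul_leftBSq (n := n)) h) m
  rwa [Matrix.mul_apply_eq_single (k := k) fun j a b =>
      hs.unique (bridgeTo_of_ne a) (decorTo_of_leftBSq_ne b),
    Matrix.mul_apply_eq_pair (k₁ := k₁) (k₂ := k₂) (fun e => hs.ne (by rw [e])) fun j a b =>
      hs.unique' (decorTo_of_leftBSq_ne a) (bridgeTo_of_ne b)] at this

theorem rightB_mul_leftBSq_of_split {k₁ k₂ : ArcBasis n} (hs : h.SplitSquare k₁ k₂ k m) :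
    rightB n h k₁ * leftBSq n k₁ m + rightB n h k₂ * leftBSq n k₂ m =
      leftBSq n h k * rightB n k m := by
  have := congrFun (congrFun (rightB_mul_leftBSq (n := n)) h) m
  rwa [Matrix.mul_apply_eq_pair (k₁ := k₁) (k₂ := k₂) (fun e => hs.ne (by rw [e])) fun j a b =>
      hs.unique (bridgeTo_of_ne a) (decorTo_of_leftBSq_ne b),
    Matrix.mul_apply_eq_single (k := k) fun j a b =>
      hs.unique' (decorTo_of_leftBSq_ne a) (bridgeTo_of_ne b)] at this

/-- Both decorations are of the circle through one point `z`, so this is an entry of the commutation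
of `rightAt n z` with `Y_B²`. -/
theorem rightD_mul_leftBSq (h₁ : h.DecorTo k) (h₄ : k'.DecorTo m)
    (e : ArcBasis.diff h k = ArcBasis.diff k' m) :
    rightD n h k * leftBSq n k m = leftBSq n h k' * rightD n k' m := by
  obtain ⟨z, hz⟩ := h₁.exists_mem_diff
  obtain ⟨a1, a2, a3, a4, a5⟩ := h₁.diff_eq hz
  obtain ⟨b1, b2, b3, b4, b5⟩ := h₄.diff_eq (e ▸ hz)
  have h1 : rightAt n z h k = rightD n h k := if_pos ⟨a1, a4⟩
  have h2 : rightAt n z k' m = rightD n k' m := if_pos ⟨b1, b4⟩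
  have := congrFun (congrFun (rightAt_mul_leftBSq (n := n) z) h) m
  rwa [Matrix.mul_apply_eq_single (k := k) fun j a b => (of_rightAt_ne a).2.trans a4.symm,
    Matrix.mul_apply_eq_single (k := k') fun j a b => ?_, h1, h2] at this
  obtain ⟨c1, c2⟩ := of_rightAt_ne b
  rw [b5, c2, ArcBasis.relabelAt_relabelAt, ArcBasis.relabelAt_self c1]

end FullAlg

/-! ## Homomorphisms from the product algebra -/

namespace FullAlg

variable {n : ℕ} {R : Type} [Ring R]

/-- The homomorphism of the free ring with given values on the letters. -/
noncomputable def liftFree (e : ArcBasis n → R) (x y : Gen n → R) :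
    FreeAlgebra ℤ (Letter n) →ₐ[ℤ] R :=
  FreeAlgebra.lift ℤ fun l => match l with
    | .idem h => e h
    | .right b => x b
    | .left b => y b

section

variable (e : ArcBasis n → R) (x y : Gen n → R)

theorem liftFree_E (h : ArcBasis n) : liftFree e x y (Letter.E h) = e h :=
  FreeAlgebra.lift_ι_apply _ _

theorem liftFree_X (b : Gen n) : liftFree e x y (Letter.X b) = x b := FreeAlgebra.lift_ι_apply _ _

theorem liftFree_Y (b : Gen n) : liftFree e x y (Letter.Y b) = y b := FreeAlgebra.lift_ι_apply _ _

/-- Values on the letters which satisfy the relations of the product algebra. -/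
structure IsRep : Prop where
  idem_mul : ∀ h k, e h * e k = if h = k then e h else 0
  idem_sum : ∑ h, e h = 1
  right_src : ∀ b, e b.src * x b = x b
  right_tgt : ∀ b, x b * e b.tgt = x b
  left_src : ∀ b, e b.src.mirror * y b = y b
  left_tgt : ∀ b, y b * e b.tgt.mirror = y b
  lin_quad : ∃ F : ArcBasis n → ArcBasis n → R, (∀ g, x g = F g.src g.tgt) ∧
    ∀ p : GenPair n, x p.1.1 * x p.1.2 = F p.src p.tgt
  dual : ∀ h m, (¬ ∃ g : Gen n, g.src = h ∧ g.tgt = m) →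
    ∑ p : GenPair n with p.src = h ∧ p.tgt = m, y p.1.1 * y p.1.2 = 0
  -- The relation is assumed in the form in which it holds in the product algebra itself, because
  -- the values to be tested are built from the images of the letters there. The cases record what
  -- is needed to compare bidegrees and differentials.
  square : ∀ b c c' b' : Gen n, mk n (Letter.X b * Letter.Y c) = mk n (Letter.Y c' * Letter.X b') →
    ((b.IsBridge ∧ c.IsBridge ∧ c'.IsBridge ∧ b'.IsBridge) ∨
      (b.IsDecoration ∧ c.IsBridge ∧ c'.IsBridge ∧ b'.IsDecoration) ∨
      (b.IsDecoration ∧ b'.IsDecoration ∧ c.IsDecoration ∧ c'.IsDecoration ∧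
        b.flipped = b'.flipped ∧ IsWordSquare b c c' b')) → x b * y c = y c' * x b'
  away : ∀ h k k' m : ArcBasis n, ∀ hs : h.AwaySquare k k' m,
    x (Gen.ofBridge hs.bridge) * y (Gen.ofDecor hs.decor.mirror) =
      y (Gen.ofDecor hs.decor'.mirror) * x (Gen.ofBridge hs.bridge')
  join : ∀ h k k₁ k₂ m : ArcBasis n, ∀ hs : h.JoinSquare k k₁ k₂ m,
    x (Gen.ofBridge hs.bridge) * y (Gen.ofDecor hs.decor.mirror) =
      y (Gen.ofDecor hs.decor₁.mirror) * x (Gen.ofBridge hs.bridge₁) +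
      y (Gen.ofDecor hs.decor₂.mirror) * x (Gen.ofBridge hs.bridge₂)
  split : ∀ h k₁ k₂ k m : ArcBasis n, ∀ hs : h.SplitSquare k₁ k₂ k m,
    x (Gen.ofBridge hs.bridge₁) * y (Gen.ofDecor hs.decor₁.mirror) +
      x (Gen.ofBridge hs.bridge₂) * y (Gen.ofDecor hs.decor₂.mirror) =
      y (Gen.ofDecor hs.decor.mirror) * x (Gen.ofBridge hs.bridge)

end

variable {e : ArcBasis n → R} {x y : Gen n → R}

theorem eq_ofBridge {b : Gen n} {h k : ArcBasis n} (H : h.BridgeTo k) (h₁ : b.src = h)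
    (h₂ : b.tgt = k) : b = Gen.ofBridge H := Gen.ext_ends h₁ h₂

theorem eq_ofDecor {b : Gen n} {h k : ArcBasis n} (H : h.DecorTo k) (h₁ : b.src = h)
    (h₂ : b.tgt = k) : b = Gen.ofDecor H := Gen.ext_ends h₁ h₂

theorem IsRep.extra (H : IsRep e x y) {u v : FreeAlgebra ℤ (Letter n)} (huv : ExtraRel n u v) :
    liftFree e x y u = liftFree e x y v := by
  have hmk := FullAlg.extra huv
  cases huv with
  | bridge_bridge b c c' b' hs hb hc hc' hb' =>
    simp only [map_mul, liftFree_X, liftFree_Y]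
    exact H.square b c c' b' hmk (Or.inl ⟨hb, hc, hc', hb'⟩)
  | decoration_bridge b c c' b' hs hb hc hc' hb' =>
    simp only [map_mul, liftFree_X, liftFree_Y]
    exact H.square b c c' b' hmk (Or.inr (Or.inl ⟨hb, hc, hc', hb'⟩))
  | decoration_decoration b c c' b' hs hb hc hc' hb' hB hC =>
    simp only [map_mul, liftFree_X, liftFree_Y]
    exact H.square b c c' b' hmk (Or.inr (Or.inr ⟨hb, hb', hc, hc', hB, hs⟩))
  | bridge_decoration b c c' b' hs hb hc hc' hb' hC hdisj =>
    simp only [map_mul, liftFree_X, liftFree_Y]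
    obtain ⟨s1, s2, s3, s4⟩ := hs
    have hq : b.src.AwaySquare b.tgt b'.src b'.tgt := by
      rw [Gen.isBridge_iff] at hb hb'
      rw [Gen.isDecoration_iff] at hc hc'
      have d : ArcBasis.diff b.tgt b'.tgt = c.flipped := by rw [s2, ← s4]; rfl
      refine ⟨hb, ?_, ?_, hb', ?_, by rw [d]; exact hdisj⟩
      · rw [s2, ← s4]; exact hc.mirror
      · rw [s1, ← s3]; exact hc'.mirror
      · rw [d, s1, ← s3]; exact hC
    have := H.away _ _ _ _ hq
    rwa [← eq_ofBridge hq.bridge rfl rfl, ← eq_ofBridge hq.bridge' rfl rfl,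
      ← eq_ofDecor hq.decor.mirror (b := c) (by rw [s2]; rfl) (by rw [← s4]; rfl),
      ← eq_ofDecor hq.decor'.mirror (b := c') (by rw [s1]; rfl) (by rw [← s3]; rfl)] at this
  | join b c c₁ b₁ c₂ b₂ hs₁ hs₂ hb hb₁ hb₂ hc hc₁ hc₂ hj =>
    simp only [map_mul, map_add, liftFree_X, liftFree_Y]
    obtain ⟨s1, s2, s3, s4⟩ := hs₁
    obtain ⟨t1, t2, t3, t4⟩ := hs₂
    have hq : b.src.JoinSquare b.tgt b₁.src b₂.src b₁.tgt := by
      rw [Gen.isBridge_iff] at hb hb₁ hb₂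
      rw [Gen.isDecoration_iff] at hc hc₁ hc₂
      obtain ⟨j1, j2, j3, j4, j5⟩ := hj
      have d : ArcBasis.diff b.tgt b₁.tgt = c.flipped := by rw [s2, ← s4]; rfl
      have d₁ : ArcBasis.diff b.src b₁.src = c₁.flipped := by rw [s1, ← s3]; rfl
      have d₂ : ArcBasis.diff b.src b₂.src = c₂.flipped := by rw [t1, ← t3]; rfl
      refine ⟨hb, ?_, ?_, hb₁, ?_, ?_, by rwa [d₁], by rwa [d₂], by rwa [d], by rwa [d₁, d₂],
        by rwa [d, d₁, d₂]⟩
      · rw [s2, ← s4]; exact hc.mirror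
      · rw [s1, ← s3]; exact hc₁.mirror
      · rw [t1, ← t3]; exact hc₂.mirror
      · rw [← s4, t4]; exact hb₂
    have := H.join _ _ _ _ _ hq
    rwa [← eq_ofBridge hq.bridge rfl rfl, ← eq_ofBridge hq.bridge₁ rfl rfl,
      ← eq_ofBridge hq.bridge₂ (b := b₂) rfl (by rw [← t4, s4]),
      ← eq_ofDecor hq.decor.mirror (b := c) (by rw [s2]; rfl) (by rw [← s4]; rfl),
      ← eq_ofDecor hq.decor₁.mirror (b := c₁) (by rw [s1]; rfl) (by rw [← s3]; rfl),
      ← eq_ofDecor hq.decor₂.mirror (b := c₂) (by rw [t1]; rfl) (by rw [← t3]; rfl)] at this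
  | split b₁ c₁ b₂ c₂ c b hs₁ hs₂ hb hb₁ hb₂ hc hc₁ hc₂ hj =>
    simp only [map_mul, map_add, liftFree_X, liftFree_Y]
    obtain ⟨s1, s2, s3, s4⟩ := hs₁
    obtain ⟨t1, t2, t3, t4⟩ := hs₂
    have hq : b₁.src.SplitSquare b₁.tgt b₂.tgt b.src b.tgt := by
      rw [Gen.isBridge_iff] at hb hb₁ hb₂
      rw [Gen.isDecoration_iff] at hc hc₁ hc₂
      obtain ⟨j1, j2, j3, j4, j5⟩ := hj
      have d : ArcBasis.diff b₁.src b.src = c.flipped := by rw [s1, ← s3]; rfl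
      have d₁ : ArcBasis.diff b₁.tgt b.tgt = c₁.flipped := by rw [s2, ← s4]; rfl
      have d₂ : ArcBasis.diff b₂.tgt b.tgt = c₂.flipped := by rw [t2, ← t4]; rfl
      refine ⟨?_, hb, hb₁, ?_, ?_, ?_, by rwa [d], by rwa [d₁], by rwa [d₂], by rwa [d₁, d₂],
        by rwa [d, d₁, d₂]⟩
      · rw [s1, ← s3]; exact hc.mirror
      · rw [s2, ← s4]; exact hc₁.mirror
      · rw [s1, ← t1]; exact hb₂
      · rw [t2, ← t4]; exact hc₂.mirror
    have := H.split _ _ _ _ _ hq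
    rwa [← eq_ofBridge hq.bridge rfl rfl, ← eq_ofBridge hq.bridge₁ rfl rfl,
      ← eq_ofBridge hq.bridge₂ (b := b₂) (by rw [t1, s1]) rfl,
      ← eq_ofDecor hq.decor.mirror (b := c) (by rw [s1]; rfl) (by rw [← s3]; rfl),
      ← eq_ofDecor hq.decor₁.mirror (b := c₁) (by rw [s2]; rfl) (by rw [← s4]; rfl),
      ← eq_ofDecor hq.decor₂.mirror (b := c₂) (by rw [t2]; rfl) (by rw [← t4]; rfl)] at this

theorem IsRep.liftFree_eq (H : IsRep e x y) {u v : FreeAlgebra ℤ (Letter n)}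
    (huv : FullRel n u v) : liftFree e x y u = liftFree e x y v := by
  cases huv with
  | idem_mul h k =>
    rw [map_mul, apply_ite (liftFree e x y), map_zero, liftFree_E, liftFree_E]
    exact H.idem_mul h k
  | idem_sum =>
    simp only [map_sum, map_one, liftFree_E]
    exact H.idem_sum
  | right_src b => simpa only [map_mul, liftFree_E, liftFree_X] using H.right_src b
  | right_tgt b => simpa only [map_mul, liftFree_E, liftFree_X] using H.right_tgt b
  | left_src b => simpa only [map_mul, liftFree_E, liftFree_Y] using H.left_src b
  | left_tgt b => simpa only [map_mul, liftFree_E, liftFree_Y] using H.left_tgt b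
  | lin_quad z hz =>
    obtain ⟨F, h1, h2⟩ := H.lin_quad
    simp only [map_add, map_sum, map_zsmul, map_mul, map_zero, liftFree_X]
    rw [← linQuadRelations_sum hz F]
    exact congrArg₂ _ (Finset.sum_congr rfl fun g _ => by rw [h1])
      (Finset.sum_congr rfl fun p _ => by rw [h2])
  | dual f hf =>
    simp only [map_sum, map_zsmul, map_mul, map_zero, liftFree_Y]
    exact dualRelations_sum hf _ H.dual
  | extra _ _ h => exact H.extra h

/-- The homomorphism of the product algebra with given values on the letters. -/
noncomputable def lift (H : IsRep e x y) : FullAlg n →+* R :=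
  RingQuot.lift ⟨(liftFree e x y).toRingHom, fun _ _ h => H.liftFree_eq h⟩

theorem lift_mk (H : IsRep e x y) (u : FreeAlgebra ℤ (Letter n)) :
    lift H (mk n u) = liftFree e x y u :=
  RingQuot.lift_mkRingHom_apply _ _ _

theorem lift_idem (H : IsRep e x y) (h : ArcBasis n) : lift H (idem h) = e h := by
  rw [idem, lift_mk, liftFree_E]

theorem lift_right (H : IsRep e x y) (b : Gen n) : lift H (right b) = x b := by
  rw [right, lift_mk, liftFree_X]

theorem lift_left (H : IsRep e x y) (b : Gen n) : lift H (left b) = y b := by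
  rw [left, lift_mk, liftFree_Y]

end FullAlg

/-! ### Bigrading, sign automorphism and augmentation as homomorphisms -/

namespace FullAlg

variable {n : ℕ} {R : Type} [Ring R]

theorem rightB_mul_leftD_gens_of_away {h k k' m : ArcBasis n} (hs : h.AwaySquare k k' m) :
    right (Gen.ofBridge hs.bridge) * left (Gen.ofDecor hs.decor.mirror) =
      left (Gen.ofDecor hs.decor'.mirror) * right (Gen.ofBridge hs.bridge') := by
  have := rightB_mul_leftD_of_away hs
  rwa [rightB_of hs.bridge, leftD_of hs.decor, leftD_of hs.decor', rightB_of hs.bridge'] at this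

theorem rightB_mul_leftD_gens_of_join {h k k₁ k₂ m : ArcBasis n} (hs : h.JoinSquare k k₁ k₂ m) :
    right (Gen.ofBridge hs.bridge) * left (Gen.ofDecor hs.decor.mirror) =
      left (Gen.ofDecor hs.decor₁.mirror) * right (Gen.ofBridge hs.bridge₁) +
      left (Gen.ofDecor hs.decor₂.mirror) * right (Gen.ofBridge hs.bridge₂) := by
  have := rightB_mul_leftD_of_join hs
  rwa [rightB_of hs.bridge, leftD_of hs.decor, leftD_of hs.decor₁, rightB_of hs.bridge₁,
    leftD_of hs.decor₂, rightB_of hs.bridge₂] at this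

theorem rightB_mul_leftD_gens_of_split {h k₁ k₂ k m : ArcBasis n}
    (hs : h.SplitSquare k₁ k₂ k m) :
    right (Gen.ofBridge hs.bridge₁) * left (Gen.ofDecor hs.decor₁.mirror) +
      right (Gen.ofBridge hs.bridge₂) * left (Gen.ofDecor hs.decor₂.mirror) =
      left (Gen.ofDecor hs.decor.mirror) * right (Gen.ofBridge hs.bridge) := by
  have := rightB_mul_leftD_of_split hs
  rwa [rightB_of hs.bridge, leftD_of hs.decor, leftD_of hs.decor₁, rightB_of hs.bridge₁,
    leftD_of hs.decor₂, rightB_of hs.bridge₂] at this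

/-- The relations are homogeneous: rescaling the letters according to their bidegrees preserves
them. -/
theorem isRep_weight (ψ : FullAlg n →+* R) (u : Multiplicative (ℚ × ℤ) →* R)
    (hu : ∀ p r, Commute (u p) r) :
    IsRep (fun h => ψ (idem h))
      (fun b : Gen n => u (Multiplicative.ofAdd (b.intrinsic, 0)) * ψ (right b))
      (fun b => u (Multiplicative.ofAdd (-b.intrinsic, 1)) * ψ (left b)) := by
  have hmul : ∀ p q a b, u p * ψ a * (u q * ψ b) = u (p * q) * ψ (a * b) := fun p q a b => by
    rw [map_mul, map_mul, mul_assoc, mul_assoc, ← mul_assoc (ψ a), ← (hu q (ψ a)).eq, mul_assoc]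
  have hdec : ∀ {h k : ArcBasis n} (H : h.DecorTo k), (Gen.ofDecor H).intrinsic = -1 :=
    fun H => (Gen.isDecoration_ofDecor H).intrinsic_eq
  have hbri : ∀ {h k : ArcBasis n} (H : h.BridgeTo k), (Gen.ofBridge H).intrinsic = -1 / 2 :=
    fun H => (Gen.isBridge_ofBridge H).intrinsic_eq
  refine ⟨fun h k => ?_, ?_, fun b => ?_, fun b => ?_, fun b => ?_, fun b => ?_, ?_, ?_, ?_, ?_, ?_,
    ?_⟩
  · rw [← map_mul, idem_mul_idem, apply_ite ψ, map_zero]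
  · rw [← map_sum, sum_idem, map_one]
  · rw [← mul_assoc, ← (hu _ _).eq, mul_assoc, ← map_mul, idem_mul_right]
  · rw [mul_assoc, ← map_mul, right_mul_idem]
  · rw [← mul_assoc, ← (hu _ _).eq, mul_assoc, ← map_mul, idem_mul_left]
  · rw [mul_assoc, ← map_mul, left_mul_idem]
  · obtain ⟨F, h1, h2⟩ := exists_rightWord n
    -- Intrinsic degrees telescope, so a rescaled word of `B` still depends only on its ends.
    refine ⟨fun h k => u (Multiplicative.ofAdd (((h.degree - k.degree : ℤ) : ℚ) / 2, 0)) *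
      ψ (F h k), fun g => ?_, fun p => ?_⟩
    · change _ = _ * ψ (F g.src g.tgt)
      rw [← h1]; rfl
    · rw [hmul, h2, ← ofAdd_add]
      have e : ((p.1.1.intrinsic, 0) + (p.1.2.intrinsic, 0) : ℚ × ℤ) =
          (((p.src.degree - p.tgt.degree : ℤ) : ℚ) / 2, 0) := by
        rw [Prod.mk_add_mk, Gen.intrinsic, Gen.intrinsic, p.2, add_zero]
        congr 1
        change _ = (((p.1.1.src.degree - p.1.2.tgt.degree : ℤ) : ℚ)) / 2
        push_cast
        ring
      rw [e]
  · intro h m H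
    have h0 : ψ (leftSq n h m) = 0 := by rw [leftSq_eq_zero H, map_zero]
    rw [leftSq, ← sum_genPair_eq, map_sum] at h0
    -- All words of two letters from `h` to `m` have the same bidegree, so the scalar factors out of
    -- the sum.
    rw [← mul_zero (u (Multiplicative.ofAdd (-(((h.degree - m.degree : ℤ) : ℚ) / 2), 2))), ← h0,
      Finset.mul_sum]
    refine Finset.sum_congr rfl fun p hp => ?_
    obtain ⟨e1, e2⟩ := (Finset.mem_filter.1 hp).2
    rw [hmul, ← ofAdd_add]
    have e : ((-p.1.1.intrinsic, 1) + (-p.1.2.intrinsic, 1) : ℚ × ℤ) =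
        (-(((h.degree - m.degree : ℤ) : ℚ) / 2), 2) := by
      rw [Prod.mk_add_mk, Gen.intrinsic, Gen.intrinsic, p.2, ← e1, ← e2]
      congr 1
      change _ = -((((p.1.1.src.degree - p.1.2.tgt.degree : ℤ) : ℚ)) / 2)
      push_cast
      ring
    rw [e]
  · intro b c c' b' hmk hcases
    rw [map_mul, map_mul] at hmk
    change right b * left c = left c' * right b' at hmk
    have hb : b.intrinsic = b'.intrinsic := by
      rcases hcases with ⟨h1, h2, h3, h4⟩ | ⟨h1, h2, h3, h4⟩ | ⟨h1, h2, h3, h4, -⟩ <;>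
      rw [h1.intrinsic_eq]
      · rw [h4.intrinsic_eq]
      · rw [h4.intrinsic_eq]
      · rw [h2.intrinsic_eq]
    have hc : c.intrinsic = c'.intrinsic := by
      rcases hcases with ⟨h1, h2, h3, h4⟩ | ⟨h1, h2, h3, h4⟩ | ⟨h1, h2, h3, h4, -⟩
      · rw [h2.intrinsic_eq, h3.intrinsic_eq]
      · rw [h2.intrinsic_eq, h3.intrinsic_eq]
      · rw [h3.intrinsic_eq, h4.intrinsic_eq]
    rw [hmul, hmul, hmk, hb, hc, mul_comm (Multiplicative.ofAdd _)]
  · intro h k k' m hs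
    simp only [hmul, hdec, hbri]
    rw [rightB_mul_leftD_gens_of_away hs, mul_comm (Multiplicative.ofAdd _)]
  · intro h k k₁ k₂ m hs
    simp only [hmul, hdec, hbri]
    rw [rightB_mul_leftD_gens_of_join hs, mul_comm (Multiplicative.ofAdd _), ← mul_add, map_add]
  · intro h k₁ k₂ k m hs
    simp only [hmul, hdec, hbri]
    rw [← rightB_mul_leftD_gens_of_split hs, mul_comm (Multiplicative.ofAdd _), ← mul_add, map_add]

/-- The sign with which an element of given bidegree is multiplied by `|id|`. -/
def signHom (R : Type) [Ring R] : Multiplicative (ℚ × ℤ) →* R where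
  toFun p := (((Multiplicative.toAdd p).2.negOnePow : ℤ) : R)
  map_one' := by simp
  map_mul' p q := by simp [Int.negOnePow_add]

/-- The automorphism `|id|`. -/
noncomputable def parity (n : ℕ) : FullAlg n →+* FullAlg n :=
  lift (isRep_weight (RingHom.id _) (signHom _) fun _ _ => Int.cast_commute _ _)

/-- The group elements of the group ring of bidegrees. -/
noncomputable def degHom (R : Type) [Ring R] :
    Multiplicative (ℚ × ℤ) →* AddMonoidAlgebra R (ℚ × ℤ) where
  toFun p := AddMonoidAlgebra.single (Multiplicative.toAdd p) 1
  map_one' := rfl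
  map_mul' p q := by rw [AddMonoidAlgebra.single_mul_single, one_mul]; rfl

theorem degHom_commute (p : Multiplicative (ℚ × ℤ)) (r : AddMonoidAlgebra R (ℚ × ℤ)) :
    Commute (degHom R p) r :=
  AddMonoidAlgebra.single_commute (fun _ => AddCommute.all _ _) (fun _ => Commute.one_left _) r

/-- The coaction corresponding to the bigrading. -/
noncomputable def coact (n : ℕ) : FullAlg n →+* AddMonoidAlgebra (FullAlg n) (ℚ × ℤ) :=
  lift (isRep_weight AddMonoidAlgebra.singleZeroRingHom (degHom (FullAlg n)) degHom_commute)

theorem coact_idem (h : ArcBasis n) : coact n (idem h) = AddMonoidAlgebra.single 0 (idem h) :=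
  lift_idem _ _

theorem coact_right (b : Gen n) :
    coact n (right b) = AddMonoidAlgebra.single (b.intrinsic, 0) (right b) := by
  refine (lift_right _ _).trans ?_
  change AddMonoidAlgebra.single _ _ * AddMonoidAlgebra.single _ _ = _
  rw [AddMonoidAlgebra.single_mul_single]
  simp

theorem coact_left (b : Gen n) :
    coact n (left b) = AddMonoidAlgebra.single (-b.intrinsic, 1) (left b) := by
  refine (lift_left _ _).trans ?_
  change AddMonoidAlgebra.single _ _ * AddMonoidAlgebra.single _ _ = _
  rw [AddMonoidAlgebra.single_mul_single]
  simp

theorem parity_idem (h : ArcBasis n) : parity n (idem h) = idem h := lift_idem _ _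

theorem parity_right (b : Gen n) : parity n (right b) = right b := by
  refine (lift_right _ _).trans ?_
  simp [signHom]

theorem parity_left (b : Gen n) : parity n (left b) = -left b := by
  refine (lift_left _ _).trans ?_
  simp [signHom]

/-- The augmentation to the idempotent ring. -/
theorem isRep_augmentation (n : ℕ) : IsRep (fun h : ArcBasis n => (Pi.single h 1 : ArcBasis n → ℤ))
    (fun _ => 0) (fun _ => 0) where
  idem_mul h k := by
    ext i
    by_cases hk : h = k
    · subst hk; by_cases hi : i = h <;> simp [hi]
    · by_cases hi : i = h
      · subst hi; simp [hk]
      · simp [Pi.single_apply, hi, hk]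
  idem_sum := Finset.univ_sum_single (fun _ : ArcBasis n => (1 : ℤ))
  right_src b := mul_zero _
  right_tgt b := zero_mul _
  left_src b := mul_zero _
  left_tgt b := zero_mul _
  lin_quad := ⟨fun _ _ => 0, fun _ => rfl, fun _ => mul_zero _⟩
  dual h m _ := Finset.sum_eq_zero fun _ _ => mul_zero _
  square _ _ _ _ _ _ := by rw [mul_zero]
  away _ _ _ _ _ := by rw [mul_zero]
  join _ _ _ _ _ _ := by rw [mul_zero, add_zero]
  split _ _ _ _ _ _ := by rw [mul_zero, add_zero]

end FullAlg

/-! ## The differential of the product algebra -/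

/-- The lower triangular matrix with the given entries. -/
def tri {R : Type} [Ring R] (a d b : R) : Matrix (Fin 2) (Fin 2) R := !![a, 0; d, b]

section Tri

variable {R : Type} [Ring R]

/-- The middle entry is the Leibniz rule with the sign on the right-hand factor: multiplicativity of
`x ↦ tri |x| (dx) x` says precisely that `d` is such a derivation. -/
theorem tri_mul (a d b a' d' b' : R) :
    tri a d b * tri a' d' b' = tri (a * a') (d * a' + b * d') (b * b') := by
  simp [tri]

theorem tri_add (a d b a' d' b' : R) :
    tri a d b + tri a' d' b' = tri (a + a') (d + d') (b + b') := by
  ext i j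
  fin_cases i <;> fin_cases j <;> simp [tri]

theorem tri_zero : tri (0 : R) 0 0 = 0 := by
  ext i j
  fin_cases i <;> fin_cases j <;> simp [tri]

theorem tri_one : tri (1 : R) 0 1 = 1 := by
  ext i j
  fin_cases i <;> fin_cases j <;> simp [tri]

theorem sum_tri {ι : Type} (s : Finset ι) (a d b : ι → R) :
    ∑ i ∈ s, tri (a i) (d i) (b i) = tri (∑ i ∈ s, a i) (∑ i ∈ s, d i) (∑ i ∈ s, b i) := by
  ext i j
  fin_cases i <;> fin_cases j <;> simp [tri, Matrix.sum_apply]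

end Tri

/-! ### The differential as a homomorphism to triangular matrices -/

namespace FullAlg

variable {n : ℕ}

/-- The relations of the dual make `Y²` vanish off the ends of generators, so no entry is lost by
restricting it to them. -/
theorem genMatrix_leftSq : genMatrix (fun b : Gen n => leftSq n b.src b.tgt) = leftSq n := by
  ext h k
  by_cases H : ∃ g : Gen n, g.src = h ∧ g.tgt = k
  · obtain ⟨g, rfl, rfl⟩ := H
    exact genMatrix_apply _ g
  · rw [genMatrix_eq_zero _ H, leftSq_eq_zero H]

theorem leftSq_mul_comm (n : ℕ) : leftSq n * genMatrix left = genMatrix left * leftSq n := by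
  rw [leftSq, Matrix.mul_assoc]

theorem idem_mul_genMatrix_left (h k : ArcBasis n) :
    idem h.mirror * genMatrix left h k = genMatrix left h k := by
  by_cases H : ∃ g : Gen n, g.src = h ∧ g.tgt = k
  · obtain ⟨g, rfl, rfl⟩ := H
    rw [genMatrix_apply, idem_mul_left]
  · rw [genMatrix_eq_zero _ H, mul_zero]

theorem genMatrix_left_mul_idem (h k : ArcBasis n) :
    genMatrix left h k * idem k.mirror = genMatrix left h k := by
  by_cases H : ∃ g : Gen n, g.src = h ∧ g.tgt = k
  · obtain ⟨g, rfl, rfl⟩ := H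
    rw [genMatrix_apply, left_mul_idem]
  · rw [genMatrix_eq_zero _ H, zero_mul]

theorem idem_mul_leftSq (h k : ArcBasis n) : idem h.mirror * leftSq n h k = leftSq n h k := by
  rw [leftSq, Matrix.mul_apply, Finset.mul_sum]
  exact Finset.sum_congr rfl fun j _ => by rw [← mul_assoc, idem_mul_genMatrix_left]

theorem leftSq_mul_idem (h k : ArcBasis n) : leftSq n h k * idem k.mirror = leftSq n h k := by
  rw [leftSq, Matrix.mul_apply, Finset.sum_mul]
  exact Finset.sum_congr rfl fun j _ => by rw [mul_assoc, genMatrix_left_mul_idem]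

theorem leftSq_ofDecor {h m : ArcBasis n} (H : h.DecorTo m) :
    leftSq n (Gen.ofDecor H.mirror).src (Gen.ofDecor H.mirror).tgt = leftBSq n h m :=
  leftSq_of_decorTo H

/-- The matrices `(|x|, 0; d x, x)` of the letters satisfy the relations. -/
theorem isRep_differential (n : ℕ) : IsRep
    (fun h : ArcBasis n => tri (idem h) 0 (idem h))
    (fun b : Gen n => tri (right b) 0 (right b))
    (fun b : Gen n => tri (-left b) (-leftSq n b.src b.tgt) (left b)) := by
  refine ⟨fun h k => ?_, ?_, fun b => ?_, fun b => ?_, fun b => ?_, fun b => ?_, ?_, ?_, ?_, ?_, ?_,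
    ?_⟩
  · simp only [tri_mul, idem_mul_idem, zero_mul, mul_zero, add_zero]
    split_ifs
    · rfl
    · exact tri_zero
  · rw [sum_tri, sum_idem, Finset.sum_const_zero, tri_one]
  · simp only [tri_mul, idem_mul_right, zero_mul, mul_zero, add_zero]
  · simp only [tri_mul, right_mul_idem, zero_mul, mul_zero, add_zero]
  · simp only [tri_mul, idem_mul_left, mul_neg, idem_mul_leftSq, zero_mul, neg_zero, zero_add]
  · simp only [tri_mul, left_mul_idem, neg_mul, leftSq_mul_idem, mul_zero, add_zero]
  · obtain ⟨F, h1, h2⟩ := exists_rightWord n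
    refine ⟨fun h k => tri (F h k) 0 (F h k), fun g => by rw [h1], fun p => ?_⟩
    simp only [tri_mul, h2, zero_mul, mul_zero, add_zero]
  · intro h m H
    have h0 := leftSq_eq_zero H
    -- The off-diagonal entry to be killed is an entry of `Y²·Y - Y·Y²`.
    have h1 := congrFun (congrFun (leftSq_mul_comm n) h) m
    rw [leftSq, ← sum_genPair_eq] at h0
    conv at h1 =>
      rw [← genMatrix_leftSq, ← sum_genPair_eq, ← sum_genPair_eq]
    simp only [tri_mul, mul_neg, neg_mul, neg_neg, sum_tri]
    rw [h0, Finset.sum_add_distrib, h1, Finset.sum_neg_distrib, add_neg_cancel, tri_zero]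
  · intro b c c' b' hmk hcases
    rw [map_mul, map_mul] at hmk
    change right b * left c = left c' * right b' at hmk
    simp only [tri_mul, zero_mul, neg_zero, zero_add, mul_zero, add_zero, mul_neg, neg_mul, hmk]
    congr 2
    rcases hcases with ⟨h1, h2, h3, h4⟩ | ⟨h1, h2, h3, h4⟩ | ⟨h1, h2, h3, h4, h5, s1, s2, s3, s4⟩
    -- Bridge letters have zero differential, so both off-diagonal entries vanish.
    · rw [leftSq_of_isBridge h2, leftSq_of_isBridge h3, mul_zero, zero_mul]
    · rw [leftSq_of_isBridge h2, leftSq_of_isBridge h3, mul_zero, zero_mul]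
    · rw [Gen.isDecoration_iff] at h1 h2 h3 h4
      have k1 : b.tgt.DecorTo b'.tgt := by rw [s2, ← s4]; exact h3.mirror
      have k2 : b.src.DecorTo b'.src := by rw [s1, ← s3]; exact h4.mirror
      -- For two decorations the off-diagonal entries are products with `Y_B²`, taken at the circle
      -- that both `b` and `b'` decorate.
      have := rightD_mul_leftBSq h1 h2 h5
      rw [← leftSq_of_decorTo k1, ← leftSq_of_decorTo k2, rightD_of h1, rightD_of h2] at this
      have q1 : b.tgt.mirror = c.src := by rw [s2]; rfl
      have q2 : b'.tgt.mirror = c.tgt := by rw [← s4]; rfl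
      have q3 : b.src.mirror = c'.src := by rw [s1]; rfl
      have q4 : b'.src.mirror = c'.tgt := by rw [← s3]; rfl
      change right b * _ = _ * right b' at this
      rw [q1, q2, q3, q4] at this
      rw [this]
  · intro h k k' m hs
    simp only [tri_mul, zero_mul, neg_zero, zero_add, mul_zero, add_zero, mul_neg, neg_mul,
      rightB_mul_leftD_gens_of_away hs, leftSq_ofDecor hs.decor, leftSq_ofDecor hs.decor']
    have := rightB_mul_leftBSq_of_away hs
    rw [rightB_of hs.bridge, rightB_of hs.bridge'] at this
    rw [this]
  · intro h k k₁ k₂ m hs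
    simp only [tri_mul, zero_mul, neg_zero, zero_add, mul_zero, add_zero, mul_neg, neg_mul, tri_add,
      rightB_mul_leftD_gens_of_join hs, leftSq_ofDecor hs.decor, leftSq_ofDecor hs.decor₁,
      leftSq_ofDecor hs.decor₂]
    have := rightB_mul_leftBSq_of_join hs
    rw [rightB_of hs.bridge, rightB_of hs.bridge₁, rightB_of hs.bridge₂] at this
    rw [this, neg_add, neg_add]
  · intro h k₁ k₂ k m hs
    simp only [tri_mul, zero_mul, neg_zero, zero_add, mul_zero, add_zero, mul_neg, neg_mul, tri_add,
      ← rightB_mul_leftD_gens_of_split hs, leftSq_ofDecor hs.decor, leftSq_ofDecor hs.decor₁,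
      leftSq_ofDecor hs.decor₂]
    have := rightB_mul_leftBSq_of_split hs
    rw [rightB_of hs.bridge, rightB_of hs.bridge₁, rightB_of hs.bridge₂] at this
    rw [← this, neg_add, neg_add]

/-- The homomorphism `x ↦ (|x|, 0; d x, x)`. -/
noncomputable def dHom (n : ℕ) : FullAlg n →+* Matrix (Fin 2) (Fin 2) (FullAlg n) :=
  lift (isRep_differential n)

/-- The differential. -/
noncomputable def diffl (n : ℕ) : FullAlg n →ₗ[ℤ] FullAlg n :=
  AddMonoidHom.toIntLinearMap
    { toFun := fun x => dHom n x 1 0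
      map_zero' := by rw [map_zero]; rfl
      map_add' := fun x y => by rw [map_add]; rfl }

theorem dHom_induction {P : FullAlg n → Prop} (hadd : ∀ x y, P x → P y → P (x + y))
    (hneg : ∀ x, P x → P (-x)) (hmul : ∀ x y, P x → P y → P (x * y)) (hone : P 1) (hzero : P 0)
    (hidem : ∀ h, P (idem h)) (hright : ∀ b, P (right b)) (hleft : ∀ b, P (left b)) (x) : P x := by
  obtain ⟨u, rfl⟩ := RingQuot.mkRingHom_surjective (FullRel n) x
  change P (mk n u)
  induction u with
  | grade0 r =>
    rw [eq_intCast, map_intCast]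
    induction r using Int.induction_on with
    | zero => rw [Int.cast_zero]; exact hzero
    | succ i hi => rw [Int.cast_add, Int.cast_one]; exact hadd _ _ hi hone
    | pred i hi => rw [Int.cast_sub, Int.cast_one, sub_eq_add_neg]; exact hadd _ _ hi (hneg _ hone)
  | grade1 l =>
    cases l with
    | idem h => exact hidem h
    | right b => exact hright b
    | left b => exact hleft b
  | add x y hx hy => rw [map_add]; exact hadd _ _ hx hy
  | mul x y hx hy => rw [map_mul]; exact hmul _ _ hx hy

/-- Triangular matrices with diagonal `|x|, x` are closed under sums and products, and the letters
have this form; only the off-diagonal entry carries new information. -/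
theorem dHom_eq (x : FullAlg n) : dHom n x = tri (parity n x) (diffl n x) x := by
  have key : ∃ d, dHom n x = tri (parity n x) d x := by
    induction x using dHom_induction with
    | hadd x y hx hy =>
      obtain ⟨d, hd⟩ := hx
      obtain ⟨d', hd'⟩ := hy
      exact ⟨d + d', by rw [map_add, map_add, hd, hd', tri_add]⟩
    | hneg x hx =>
      obtain ⟨d, hd⟩ := hx
      refine ⟨-d, ?_⟩
      rw [map_neg, map_neg, hd, neg_eq_iff_add_eq_zero, tri_add]
      simp [tri_zero]
    | hmul x y hx hy =>
      obtain ⟨d, hd⟩ := hx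
      obtain ⟨d', hd'⟩ := hy
      exact ⟨_, by rw [map_mul, map_mul, hd, hd', tri_mul]⟩
    | hone => exact ⟨0, by rw [map_one, map_one, tri_one]⟩
    | hzero => exact ⟨0, by rw [map_zero, map_zero, tri_zero]⟩
    | hidem h => exact ⟨0, by rw [parity_idem]; exact lift_idem _ _⟩
    | hright b => exact ⟨0, by rw [parity_right]; exact lift_right _ _⟩
    | hleft b => exact ⟨_, by rw [parity_left]; exact lift_left _ _⟩
  obtain ⟨d, hd⟩ := key
  have : diffl n x = d := by
    change dHom n x 1 0 = d
    rw [hd]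
    rfl
  rw [hd, this]

theorem diffl_mul (x y : FullAlg n) :
    diffl n (x * y) = diffl n x * parity n y + x * diffl n y := by
  change dHom n (x * y) 1 0 = _
  rw [map_mul, dHom_eq, dHom_eq, tri_mul]
  rfl

theorem diffl_idem (h : ArcBasis n) : diffl n (idem h) = 0 := by
  change dHom n (idem h) 1 0 = _
  rw [dHom, lift_idem]
  rfl

theorem diffl_right (b : Gen n) : diffl n (right b) = 0 := by
  change dHom n (right b) 1 0 = _
  rw [dHom, lift_right]
  rfl

theorem diffl_left (b : Gen n) : diffl n (left b) = -leftSq n b.src b.tgt := by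
  change dHom n (left b) 1 0 = _
  rw [dHom, lift_left]
  rfl

theorem diffl_genMatrix_left (h k : ArcBasis n) :
    diffl n (genMatrix left h k) = -leftSq n h k := by
  by_cases H : ∃ g : Gen n, g.src = h ∧ g.tgt = k
  · obtain ⟨g, rfl, rfl⟩ := H
    rw [genMatrix_apply, diffl_left]
  · rw [genMatrix_eq_zero _ H, map_zero, leftSq_eq_zero H, neg_zero]

theorem parity_genMatrix_left (h k : ArcBasis n) :
    parity n (genMatrix left h k) = -genMatrix left h k := by
  by_cases H : ∃ g : Gen n, g.src = h ∧ g.tgt = k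
  · obtain ⟨g, rfl, rfl⟩ := H
    rw [genMatrix_apply, parity_left]
  · rw [genMatrix_eq_zero _ H, map_zero, neg_zero]

/-- With `dY = -Y²` and `|Y| = -Y`, the Leibniz rule gives `d(Y²) = Y²·Y - Y·Y² = 0`. -/
theorem diffl_leftSq (h m : ArcBasis n) : diffl n (leftSq n h m) = 0 := by
  have h1 := congrFun (congrFun (leftSq_mul_comm n) h) m
  rw [Matrix.mul_apply, Matrix.mul_apply] at h1
  rw [leftSq, Matrix.mul_apply, map_sum]
  simp only [diffl_mul, diffl_genMatrix_left, parity_genMatrix_left, mul_neg, neg_mul, neg_neg]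
  rw [Finset.sum_add_distrib, h1, Finset.sum_neg_distrib, add_neg_cancel]

end FullAlg

/-! ## Bigraded structures from coactions -/

section Coaction

variable {ι A : Type} [Ring A]

/-- The coefficient of the coaction at `p` is the identity on the summand of bidegree `p` and kills
all the others, so the summands are independent. -/
theorem isInternal_of_coaction {gr : ℚ × ℤ → Submodule ℤ A}
    (Γ : A →+* AddMonoidAlgebra A (ℚ × ℤ))
    (hΓ : ∀ p, ∀ x ∈ gr p, Γ x = AddMonoidAlgebra.single p x) (hspan : iSup gr = ⊤) :
    DirectSum.IsInternal gr := by
  refine (DirectSum.isInternal_submodule_iff_iSupIndep_and_iSup_eq_top gr).2 ⟨?_, hspan⟩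
  rw [iSupIndep_def]
  intro p
  let π : A →ₗ[ℤ] A := AddMonoidHom.toIntLinearMap
    { toFun := fun x => (Γ x).coeff p
      map_zero' := by rw [map_zero]; rfl
      map_add' := fun x y => by rw [map_add]; rfl }
  have hπ : ∀ q, ∀ x ∈ gr q, π x = if q = p then x else 0 := by
    intro q x hx
    change (Γ x).coeff p = _
    rw [hΓ q x hx]
    exact Finsupp.single_apply
  rw [Submodule.disjoint_def]
  intro x hx hx'
  have hle : (⨆ j, ⨆ (_ : j ≠ p), gr j) ≤ LinearMap.ker π :=
    iSup₂_le fun j hj y hy => by rw [LinearMap.mem_ker, hπ j y hy, if_neg hj]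
  have h1 := hπ p x hx
  rw [if_pos rfl, LinearMap.mem_ker.1 (hle hx')] at h1
  exact h1.symm

/-- A differential bigraded algebra from a coaction which detects the bigrading and a twisted
derivation. -/
noncomputable def DGStructure.ofCoaction (coeff : (ι → ℤ) →+* A)
    (coeff_injective : Function.Injective coeff) (gr : ℚ × ℤ → Submodule ℤ A)
    (Γ : A →+* AddMonoidAlgebra A (ℚ × ℤ))
    (hΓ : ∀ p, ∀ x ∈ gr p, Γ x = AddMonoidAlgebra.single p x) (hspan : iSup gr = ⊤)
    (mul_mem : ∀ {p q x y}, x ∈ gr p → y ∈ gr q → x * y ∈ gr (p + q))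
    (mem_gr_zero : ∀ x, x ∈ gr 0 ↔ ∃ r, coeff r = x) (d : A →ₗ[ℤ] A) (ε : A →+* A)
    (hε : ∀ p, ∀ x ∈ gr p, ε x = (p.2.negOnePow : ℤ) • x)
    (d_mul : ∀ x y, d (x * y) = d x * ε y + x * d y) (d_coeff : ∀ r, d (coeff r) = 0)
    (d_mem : ∀ {p x}, x ∈ gr p → d x ∈ gr (p + (0, 1))) (d_d : ∀ x, d (d x) = 0) :
    DGStructure ι A where
  coeff := coeff
  coeff_injective := coeff_injective
  gr := gr
  internal := isInternal_of_coaction Γ hΓ hspan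
  mul_mem := mul_mem
  mem_gr_zero := mem_gr_zero
  d := d
  d_coeff_mul r x := by rw [d_mul, d_coeff, zero_mul, zero_add]
  d_mul_coeff r x := by
    rw [d_mul, d_coeff, mul_zero, add_zero, hε 0 _ ((mem_gr_zero _).2 ⟨r, rfl⟩)]
    simp
  d_mem := d_mem
  leibniz x q y hy := by rw [d_mul, hε q y hy, mul_smul_comm]
  d_d := d_d

end Coaction

namespace FullAlg

variable {n : ℕ}

/-! ### The bigrading of the product algebra -/

/-- The class of a word. -/
noncomputable def word (w : List (Letter n)) : FullAlg n := mk n ((w.map (FreeAlgebra.ι ℤ)).prod)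

theorem word_nil : word ([] : List (Letter n)) = 1 := map_one _

theorem word_cons (l : Letter n) (w : List (Letter n)) :
    word (l :: w) = mk n (FreeAlgebra.ι ℤ l) * word w := by
  rw [word, List.map_cons, List.prod_cons, map_mul, word]

theorem word_append (w w' : List (Letter n)) : word (w ++ w') = word w * word w' := by
  rw [word, List.map_append, List.prod_append, map_mul, word, word]

theorem word_mem (w : List (Letter n)) : word w ∈ gr n (w.map Letter.bidegree).sum :=
  Submodule.subset_span ⟨w, rfl, rfl⟩

theorem word_mem' {w : List (Letter n)} {p : ℚ × ℤ} (h : (w.map Letter.bidegree).sum = p) :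
    word w ∈ gr n p := h ▸ word_mem w

theorem gr_induction {p : ℚ × ℤ} {P : FullAlg n → Prop}
    (hword : ∀ w : List (Letter n), (w.map Letter.bidegree).sum = p → P (word w)) (hzero : P 0)
    (hadd : ∀ x y, P x → P y → P (x + y)) (hsmul : ∀ (c : ℤ) x, P x → P (c • x)) {x : FullAlg n}
    (hx : x ∈ gr n p) : P x := by
  induction hx using Submodule.span_induction with
  | mem x hx =>
    obtain ⟨w, hw, rfl⟩ := hx
    exact hword w hw
  | zero => exact hzero
  | add x y _ _ h h' => exact hadd x y h h'
  | smul c x _ h => exact hsmul c x h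

theorem mul_mem_gr {p q : ℚ × ℤ} {x y : FullAlg n} (hx : x ∈ gr n p) (hy : y ∈ gr n q) :
    x * y ∈ gr n (p + q) := by
  refine gr_induction (P := fun x => x * y ∈ gr n (p + q)) (fun w hw => ?_) ?_ ?_ ?_ hx
  · refine gr_induction (P := fun y => word w * y ∈ gr n (p + q)) (fun w' hw' => ?_) ?_ ?_ ?_ hy
    · rw [← word_append]
      exact word_mem' (by rw [List.map_append, List.sum_append, hw, hw'])
    · rw [mul_zero]; exact zero_mem _
    · intro a b ha hb; rw [mul_add]; exact add_mem ha hb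
    · intro c a ha; rw [mul_smul_comm]; exact Submodule.smul_mem _ c ha
  · rw [zero_mul]; exact zero_mem _
  · intro a b ha hb; rw [add_mul]; exact add_mem ha hb
  · intro c a ha; rw [smul_mul_assoc]; exact Submodule.smul_mem _ c ha

theorem letter_mem (l : Letter n) : mk n (FreeAlgebra.ι ℤ l) ∈ gr n l.bidegree := by
  have := word_mem' (w := [l]) (p := l.bidegree) (by simp)
  rwa [word_cons, word_nil, mul_one] at this

theorem idem_mem (h : ArcBasis n) : idem h ∈ gr n 0 := letter_mem (Letter.idem h)

theorem right_mem (b : Gen n) : right b ∈ gr n (b.intrinsic, 0) := letter_mem (Letter.right b)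

theorem left_mem (b : Gen n) : left b ∈ gr n (-b.intrinsic, 1) := letter_mem (Letter.left b)

theorem one_mem_gr : (1 : FullAlg n) ∈ gr n 0 := by
  rw [← word_nil]
  exact word_mem' rfl

theorem iSup_gr (n : ℕ) : iSup (gr n) = ⊤ := by
  refine eq_top_iff.2 fun x _ => ?_
  have hle := fun p => le_iSup (gr n) p
  induction x using dHom_induction with
  | hadd x y hx hy => exact add_mem (hx trivial) (hy trivial)
  | hneg x hx => exact neg_mem (hx trivial)
  | hmul x y hx hy =>
    refine Submodule.iSup_induction (gr n) (motive := fun x => x * y ∈ iSup (gr n)) (hx trivial)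
      (fun p x hx => ?_) (by rw [zero_mul]; exact zero_mem _)
      (fun a b ha hb => by rw [add_mul]; exact add_mem ha hb)
    exact Submodule.iSup_induction (gr n) (motive := fun y => x * y ∈ iSup (gr n)) (hy trivial)
      (fun q y hy => hle _ (mul_mem_gr hx hy)) (by rw [mul_zero]; exact zero_mem _)
      (fun a b ha hb => by rw [mul_add]; exact add_mem ha hb)
  | hone => exact hle _ one_mem_gr
  | hzero => exact zero_mem _
  | hidem h => exact hle _ (idem_mem h)
  | hright b => exact hle _ (right_mem b)
  | hleft b => exact hle _ (left_mem b)

theorem coact_letter (l : Letter n) : coact n (mk n (FreeAlgebra.ι ℤ l)) =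
    AddMonoidAlgebra.single l.bidegree (mk n (FreeAlgebra.ι ℤ l)) := by
  cases l with
  | idem h => exact coact_idem h
  | right b => exact coact_right b
  | left b => exact coact_left b

theorem coact_of_mem {p : ℚ × ℤ} {x : FullAlg n} (hx : x ∈ gr n p) :
    coact n x = AddMonoidAlgebra.single p x := by
  refine gr_induction (P := fun x => coact n x = AddMonoidAlgebra.single p x) ?_ ?_ ?_ ?_ hx
  · rintro w rfl
    clear hx
    induction w with
    | nil => rw [word_nil, map_one]; rfl
    | cons l w ih =>
      rw [word_cons, map_mul, ih, coact_letter, AddMonoidAlgebra.single_mul_single, List.map_cons,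
        List.sum_cons]
  · rw [map_zero, AddMonoidAlgebra.single_zero]
  · intro a b ha hb
    rw [map_add, ha, hb, AddMonoidAlgebra.single_add]
  · intro c a ha
    rw [map_zsmul, ha]
    exact (map_zsmul (AddMonoidAlgebra.singleAddHom p) c a).symm

theorem parity_letter (l : Letter n) : parity n (mk n (FreeAlgebra.ι ℤ l)) =
    (l.bidegree.2.negOnePow : ℤ) • mk n (FreeAlgebra.ι ℤ l) := by
  cases l with
  | idem h => exact (parity_idem h).trans (by simp [Letter.bidegree, idem, Letter.E])
  | right b => exact (parity_right b).trans (by simp [Letter.bidegree, right, Letter.X])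
  | left b => exact (parity_left b).trans (by simp [Letter.bidegree, left, Letter.Y])

theorem parity_of_mem {p : ℚ × ℤ} {x : FullAlg n} (hx : x ∈ gr n p) :
    parity n x = (p.2.negOnePow : ℤ) • x := by
  refine gr_induction (P := fun x => parity n x = (p.2.negOnePow : ℤ) • x) ?_ ?_ ?_ ?_ hx
  · rintro w rfl
    clear hx
    induction w with
    | nil => rw [word_nil, map_one]; simp
    | cons l w ih =>
      rw [word_cons, map_mul, ih, parity_letter, List.map_cons, List.sum_cons, Prod.snd_add,
        Int.negOnePow_add, smul_mul_smul_comm, Units.val_mul]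
  · rw [map_zero, smul_zero]
  · intro a b ha hb
    rw [map_add, ha, hb, smul_add]
  · intro c a ha
    rw [map_zsmul, ha, smul_comm]

/-- The inclusion of the idempotent ring. -/
noncomputable def coeffHom (n : ℕ) : (ArcBasis n → ℤ) →+* FullAlg n where
  toFun r := ∑ h, r h • idem h
  map_zero' := by simp
  map_one' := by simpa using sum_idem
  map_add' r s := by simp [add_smul, Finset.sum_add_distrib]
  map_mul' r s := by
    rw [Finset.sum_mul]
    refine Finset.sum_congr rfl fun h _ => ?_
    rw [Finset.mul_sum, Finset.sum_eq_single h]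
    · rw [smul_mul_smul_comm, idem_mul_idem, if_pos rfl, Pi.mul_apply]
    · intro k _ hk
      rw [smul_mul_smul_comm, idem_mul_idem, if_neg hk.symm, smul_zero]
    · simp

theorem coeffHom_apply (r : ArcBasis n → ℤ) : coeffHom n r = ∑ h, r h • idem h := rfl

theorem coeffHom_single (h : ArcBasis n) : coeffHom n (Pi.single h 1) = idem h := by
  rw [coeffHom_apply, Finset.sum_eq_single h]
  · simp
  · intro k _ hk
    rw [Pi.single_eq_of_ne hk, zero_smul]
  · simp

/-- The augmentation to the idempotent ring. -/
noncomputable def augmentation (n : ℕ) : FullAlg n →+* (ArcBasis n → ℤ) :=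
  lift (isRep_augmentation n)

theorem augmentation_coeffHom (r : ArcBasis n → ℤ) : augmentation n (coeffHom n r) = r := by
  rw [coeffHom_apply, map_sum]
  simp only [map_zsmul]
  have : ∀ h : ArcBasis n, augmentation n (idem h) = Pi.single h 1 := lift_idem _
  simp only [this]
  exact (pi_eq_sum_univ' r).symm ▸ (by
    refine Finset.sum_congr rfl fun h _ => ?_
    ext i
    simp [Pi.single_apply, eq_comm])

theorem coeffHom_injective (n : ℕ) : Function.Injective (coeffHom n) :=
  Function.LeftInverse.injective augmentation_coeffHom

/-- Homological degree is tested first: it is never negative and is 1 for each letter `m(b^*)`,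
whose positive intrinsic degree could otherwise cancel. Without these letters, each letter `b` makes
the intrinsic degree strictly negative, so only idempotents remain in bidegree zero. -/
theorem all_idem_of_bidegree (w : List (Letter n)) : 0 ≤ (w.map Letter.bidegree).sum.2 ∧
    ((w.map Letter.bidegree).sum.2 = 0 → (w.map Letter.bidegree).sum.1 ≤ 0 ∧
      ((w.map Letter.bidegree).sum.1 = 0 → ∀ l ∈ w, ∃ h, l = Letter.idem h)) := by
  induction w with
  | nil => simp
  | cons l w ih =>
    obtain ⟨h1, h2⟩ := ih
    rw [List.map_cons, List.sum_cons, Prod.snd_add, Prod.fst_add]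
    cases l with
    | idem h =>
      simp only [Letter.bidegree, zero_add]
      refine ⟨h1, fun h3 => ⟨(h2 h3).1, fun h4 l hl => ?_⟩⟩
      rcases List.mem_cons.1 hl with rfl | hl
      · exact ⟨h, rfl⟩
      · exact (h2 h3).2 h4 l hl
    | right b =>
      simp only [Letter.bidegree, zero_add]
      have hb := b.intrinsic_neg
      refine ⟨h1, fun h3 => ⟨by linarith [(h2 h3).1], fun h4 => ?_⟩⟩
      linarith [(h2 h3).1]
    | left b =>
      simp only [Letter.bidegree]
      exact ⟨by omega, fun h3 => by omega⟩

theorem mem_gr_zero_iff (x : FullAlg n) : x ∈ gr n 0 ↔ ∃ r, coeffHom n r = x := by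
  constructor
  · intro hx
    refine gr_induction (P := fun x => x ∈ (coeffHom n).range) ?_ (zero_mem _)
      (fun _ _ => add_mem) (fun c x hx => zsmul_mem hx c) hx
    intro w hw
    have hall := ((all_idem_of_bidegree w).2 (by rw [hw]; rfl)).2 (by rw [hw]; rfl)
    clear hw hx
    induction w with
    | nil => rw [word_nil]; exact one_mem _
    | cons l w ih =>
      rw [word_cons]
      refine mul_mem ?_ (ih fun l hl => hall l (List.mem_cons_of_mem _ hl))
      obtain ⟨h, rfl⟩ := hall l List.mem_cons_self
      exact ⟨Pi.single h 1, coeffHom_single h⟩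
  · rintro ⟨r, rfl⟩
    rw [coeffHom_apply]
    exact sum_mem fun h _ => Submodule.smul_mem _ _ (idem_mem h)

/-! ### The differential of the product algebra -/

theorem genMatrix_left_mem (h k : ArcBasis n) :
    genMatrix left h k ∈ gr n (-(((h.degree - k.degree : ℤ) : ℚ) / 2), 1) := by
  by_cases H : ∃ g : Gen n, g.src = h ∧ g.tgt = k
  · obtain ⟨g, rfl, rfl⟩ := H
    rw [genMatrix_apply]
    exact left_mem g
  · rw [genMatrix_eq_zero _ H]
    exact zero_mem _

theorem leftSq_mem (h m : ArcBasis n) :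
    leftSq n h m ∈ gr n (-(((h.degree - m.degree : ℤ) : ℚ) / 2), 2) := by
  rw [leftSq, Matrix.mul_apply]
  refine sum_mem fun k _ => ?_
  have := mul_mem_gr (genMatrix_left_mem h k) (genMatrix_left_mem k m)
  have e : ((-(((h.degree - k.degree : ℤ) : ℚ) / 2), 1) + (-(((k.degree - m.degree : ℤ) : ℚ) / 2), 1) :
      ℚ × ℤ) = (-(((h.degree - m.degree : ℤ) : ℚ) / 2), 2) := by
    rw [Prod.mk_add_mk]
    congr 1
    push_cast
    ring
  rwa [e] at this

theorem diffl_letter_mem (l : Letter n) :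
    diffl n (mk n (FreeAlgebra.ι ℤ l)) ∈ gr n (l.bidegree + (0, 1)) := by
  cases l with
  | idem h => exact (diffl_idem h).symm ▸ zero_mem _
  | right b => exact (diffl_right b).symm ▸ zero_mem _
  | left b =>
    have := neg_mem (leftSq_mem b.src b.tgt)
    rw [← diffl_left] at this
    have e : (Letter.left b).bidegree + (0, 1) =
        (-(((b.src.degree - b.tgt.degree : ℤ) : ℚ) / 2), 2) := by
      simp only [Letter.bidegree, Prod.mk_add_mk, add_zero, Gen.intrinsic]
      norm_num
    rw [e]
    exact this

theorem diffl_one : diffl n 1 = 0 := by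
  change dHom n 1 1 0 = 0
  rw [map_one]
  rfl

theorem diffl_mem {p : ℚ × ℤ} {x : FullAlg n} (hx : x ∈ gr n p) :
    diffl n x ∈ gr n (p + (0, 1)) := by
  refine gr_induction (P := fun x => diffl n x ∈ gr n (p + (0, 1))) ?_ ?_ ?_ ?_ hx
  · rintro w rfl
    clear hx
    induction w with
    | nil => rw [word_nil, diffl_one]; exact zero_mem _
    | cons l w ih =>
      rw [word_cons, diffl_mul, parity_of_mem (word_mem w), mul_smul_comm, List.map_cons,
        List.sum_cons]
      refine add_mem (Submodule.smul_mem _ _ ?_) ?_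
      · rw [add_right_comm]
        exact mul_mem_gr (diffl_letter_mem l) (word_mem w)
      · rw [add_assoc]
        exact mul_mem_gr (letter_mem l) ih
  · rw [map_zero]; exact zero_mem _
  · intro a b ha hb
    rw [map_add]; exact add_mem ha hb
  · intro c a ha
    rw [map_smul]; exact Submodule.smul_mem _ _ ha

/-- The differential is odd, so it anticommutes with the sign automorphism. This makes the cross
terms of `d²` on a product cancel. -/
theorem diffl_parity (x : FullAlg n) : diffl n (parity n x) = -parity n (diffl n x) := by
  induction x using dHom_induction with
  | hadd x y hx hy => simp only [map_add, hx, hy, neg_add]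
  | hneg x hx => simp only [map_neg, hx]
  | hmul x y hx hy =>
    simp only [map_mul, map_add, diffl_mul, hx, hy, neg_mul, mul_neg, neg_add]
  | hone => simp only [map_one, diffl_one, map_zero, neg_zero]
  | hzero => simp only [map_zero, neg_zero]
  | hidem h => simp only [parity_idem, diffl_idem, map_zero, neg_zero]
  | hright b => simp only [parity_right, diffl_right, map_zero, neg_zero]
  | hleft b =>
    rw [parity_left, map_neg, diffl_left, map_neg, parity_of_mem (leftSq_mem _ _)]
    simp [show Int.negOnePow 2 = 1 from rfl]

/-- Elements with `d² = 0` are closed under sums and products, by `diffl_parity`, so the letters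
suffice; for these it is `d(Y²) = 0`. -/
theorem diffl_diffl (x : FullAlg n) : diffl n (diffl n x) = 0 := by
  induction x using dHom_induction with
  | hadd x y hx hy => simp only [map_add, hx, hy, add_zero]
  | hneg x hx => simp only [map_neg, hx, neg_zero]
  | hmul x y hx hy =>
    simp only [map_add, diffl_mul, hx, hy, diffl_parity, zero_mul, mul_zero, mul_neg, zero_add,
      add_zero, neg_add_cancel]
  | hone => rw [diffl_one, map_zero]
  | hzero => rw [map_zero, map_zero]
  | hidem h => rw [diffl_idem, map_zero]
  | hright b => rw [diffl_right, map_zero]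
  | hleft b => rw [diffl_left, map_neg, diffl_leftSq, neg_zero]

theorem diffl_coeffHom (r : ArcBasis n → ℤ) : diffl n (coeffHom n r) = 0 := by
  rw [coeffHom_apply, map_sum]
  exact Finset.sum_eq_zero fun h _ => by rw [map_smul, diffl_idem, smul_zero]

/-- The differential bigraded algebra structure of the product algebra. -/
noncomputable def dgStructure (n : ℕ) : DGStructure (ArcBasis n) (FullAlg n) :=
  DGStructure.ofCoaction (coeffHom n) (coeffHom_injective n) (gr n) (coact n)
    (fun _ _ => coact_of_mem) (iSup_gr n) mul_mem_gr mem_gr_zero_iff (diffl n) (parity n)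
    (fun _ _ => parity_of_mem) diffl_mul diffl_coeffHom diffl_mem diffl_diffl

theorem isFullDG (n : ℕ) : IsFullDG (dgStructure n) where
  coeff_single := coeffHom_single
  gr_eq := rfl
  d_right := diffl_right
  d_left b := (diffl_left b).trans (sum_dualDifferential b).symm

end FullAlg

/-! ## The structure of the quotient algebra -/

section Functoriality

variable {A B : Type} [Ring A] [Ring B]

theorem mapMatrix_tri (π : A →+* B) (a d b : A) :
    π.mapMatrix (tri a d b) = tri (π a) (π d) (π b) := by
  ext i j
  fin_cases i <;> fin_cases j <;> simp [tri]

theorem ite_negOnePow_two : ((2 : ℤ).negOnePow : ℤ) = 1 := rfl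

end Functoriality

namespace GammaAlg

variable {n : ℕ}

theorem proj_surjective (n : ℕ) : Function.Surjective (proj n) :=
  RingQuot.mkRingHom_surjective _

/-- The reasons why every structure passes to the quotient: two bridge letters have bidegree `(1,
2)` in total, bridge letters are cycles, and the augmentation kills all letters `m(b^*)`. -/
theorem gammaRel_props {x y : FullAlg n} (h : GammaRel n x y) :
    y = 0 ∧ x ∈ FullAlg.gr n (1, 2) ∧ FullAlg.diffl n x = 0 ∧ FullAlg.augmentation n x = 0 := by
  have hl : ∀ b : Gen n, FullAlg.augmentation n (FullAlg.left b) = 0 := fun b =>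
    FullAlg.lift_left _ b
  have hd : ∀ b : Gen n, b.IsBridge → FullAlg.diffl n (FullAlg.left b) = 0 := fun b hb => by
    rw [FullAlg.diffl_left, FullAlg.leftSq_of_isBridge hb, neg_zero]
  have hg : ∀ b b' : Gen n, b.IsBridge → b'.IsBridge →
      FullAlg.left b * FullAlg.left b' ∈ FullAlg.gr n (1, 2) := fun b b' hb hb' => by
    have := FullAlg.mul_mem_gr (FullAlg.left_mem b) (FullAlg.left_mem b')
    rw [hb.intrinsic_eq, hb'.intrinsic_eq] at this
    have e : ((-(-1 / 2), 1) + (-(-1 / 2), 1) : ℚ × ℤ) = (1, 2) := by norm_num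
    rwa [e] at this
  cases h with
  | tetrahedron b₁ b₂ c₁ c₂ hb hc hsrc htgt hb₁ hb₂ hc₁ hc₂ =>
    refine ⟨rfl, add_mem (hg _ _ hb₁ hb₂) (hg _ _ hc₁ hc₂), ?_, ?_⟩
    · rw [map_add, FullAlg.diffl_mul, FullAlg.diffl_mul, hd _ hb₁, hd _ hb₂, hd _ hc₁, hd _ hc₂]
      simp
    · rw [map_add, map_mul, map_mul, hl, hl c₁, zero_mul, zero_mul, zero_add]

/-- The homomorphism `x ↦ (|x|, 0; d x, x)`. -/
noncomputable def dHom (n : ℕ) : GammaAlg n →+* Matrix (Fin 2) (Fin 2) (GammaAlg n) :=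
  RingQuot.lift ⟨(proj n).mapMatrix.comp (FullAlg.dHom n), fun x y h => by
    obtain ⟨rfl, h2, h3, -⟩ := gammaRel_props h
    have h0 : proj n x = 0 := (RingQuot.mkRingHom_rel h).trans (map_zero _)
    rw [map_zero, RingHom.comp_apply, FullAlg.dHom_eq, mapMatrix_tri, h3,
      FullAlg.parity_of_mem h2, ite_negOnePow_two, one_smul, h0, map_zero, tri_zero]⟩

theorem dHom_proj (x : FullAlg n) : dHom n (proj n x) =
    tri (proj n (FullAlg.parity n x)) (proj n (FullAlg.diffl n x)) (proj n x) := by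
  rw [← mapMatrix_tri, ← FullAlg.dHom_eq]
  exact RingQuot.lift_mkRingHom_apply _ _ _

/-- The differential. -/
noncomputable def diffl (n : ℕ) : GammaAlg n →ₗ[ℤ] GammaAlg n :=
  AddMonoidHom.toIntLinearMap
    { toFun := fun x => dHom n x 1 0
      map_zero' := by rw [map_zero]; rfl
      map_add' := fun x y => by rw [map_add]; rfl }

theorem diffl_proj (x : FullAlg n) : diffl n (proj n x) = proj n (FullAlg.diffl n x) := by
  change dHom n (proj n x) 1 0 = _
  rw [dHom_proj]
  rfl

/-- The automorphism `|id|`. -/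
noncomputable def parity (n : ℕ) : GammaAlg n →+* GammaAlg n :=
  RingQuot.lift ⟨(proj n).comp (FullAlg.parity n), fun x y h => by
    obtain ⟨rfl, h2, -, -⟩ := gammaRel_props h
    have h0 : proj n x = 0 := (RingQuot.mkRingHom_rel h).trans (map_zero _)
    rw [map_zero, RingHom.comp_apply, FullAlg.parity_of_mem h2, ite_negOnePow_two, one_smul, h0]⟩

theorem parity_proj (x : FullAlg n) : parity n (proj n x) = proj n (FullAlg.parity n x) :=
  RingQuot.lift_mkRingHom_apply _ _ _

/-- The augmentation to the idempotent ring. -/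
noncomputable def augmentation (n : ℕ) : GammaAlg n →+* (ArcBasis n → ℤ) :=
  RingQuot.lift ⟨FullAlg.augmentation n, fun x y h => by
    obtain ⟨rfl, -, -, h4⟩ := gammaRel_props h
    rw [h4, map_zero]⟩

theorem augmentation_proj (x : FullAlg n) :
    augmentation n (proj n x) = FullAlg.augmentation n x :=
  RingQuot.lift_mkRingHom_apply _ _ _

/-- The coaction corresponding to the bigrading. -/
noncomputable def coact (n : ℕ) : GammaAlg n →+* AddMonoidAlgebra (GammaAlg n) (ℚ × ℤ) :=
  RingQuot.lift ⟨(AddMonoidAlgebra.mapRingHom (ℚ × ℤ) (proj n)).comp (FullAlg.coact n),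
    fun x y h => by
      obtain ⟨rfl, h2, -, -⟩ := gammaRel_props h
      have h0 : proj n x = 0 := (RingQuot.mkRingHom_rel h).trans (map_zero _)
      rw [map_zero, RingHom.comp_apply, FullAlg.coact_of_mem h2, AddMonoidAlgebra.mapRingHom_single,
        h0, AddMonoidAlgebra.single_zero]⟩

theorem coact_proj (x : FullAlg n) : coact n (proj n x) =
    AddMonoidAlgebra.mapRingHom (ℚ × ℤ) (proj n) (FullAlg.coact n x) :=
  RingQuot.lift_mkRingHom_apply _ _ _

/-- The bigrading. -/
noncomputable def gr (n : ℕ) (p : ℚ × ℤ) : Submodule ℤ (GammaAlg n) :=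
  (FullAlg.gr n p).map (proj n).toAddMonoidHom.toIntLinearMap

theorem mem_gr {p : ℚ × ℤ} {x : GammaAlg n} : x ∈ gr n p ↔ ∃ y ∈ FullAlg.gr n p, proj n y = x :=
  Submodule.mem_map

theorem iSup_gr (n : ℕ) : iSup (gr n) = ⊤ := by
  change ⨆ p, (FullAlg.gr n p).map (proj n).toAddMonoidHom.toIntLinearMap = ⊤
  rw [← Submodule.map_iSup]
  have : (⨆ p, FullAlg.gr n p) = ⊤ := FullAlg.iSup_gr n
  rw [this, Submodule.map_top]
  exact LinearMap.range_eq_top.2 (proj_surjective n)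

/-- The inclusion of the idempotent ring. -/
noncomputable def coeffHom (n : ℕ) : (ArcBasis n → ℤ) →+* GammaAlg n :=
  (proj n).comp (FullAlg.coeffHom n)

theorem coeffHom_injective (n : ℕ) : Function.Injective (coeffHom n) :=
  Function.LeftInverse.injective (g := augmentation n) fun r =>
    (augmentation_proj _).trans (FullAlg.augmentation_coeffHom r)

/-- The differential bigraded algebra structure of the quotient algebra. -/
noncomputable def dgStructure (n : ℕ) : DGStructure (ArcBasis n) (GammaAlg n) :=
  DGStructure.ofCoaction (coeffHom n) (coeffHom_injective n) (gr n) (coact n)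
    (fun p x hx => by
      obtain ⟨y, hy, rfl⟩ := mem_gr.1 hx
      rw [coact_proj, FullAlg.coact_of_mem hy, AddMonoidAlgebra.mapRingHom_single])
    (iSup_gr n)
    (fun {p q x y} hx hy => by
      obtain ⟨x', hx', rfl⟩ := mem_gr.1 hx
      obtain ⟨y', hy', rfl⟩ := mem_gr.1 hy
      exact mem_gr.2 ⟨x' * y', FullAlg.mul_mem_gr hx' hy', map_mul _ _ _⟩)
    (fun x => by
      rw [mem_gr]
      constructor
      · rintro ⟨y, hy, rfl⟩
        obtain ⟨r, rfl⟩ := (FullAlg.mem_gr_zero_iff y).1 hy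
        exact ⟨r, rfl⟩
      · rintro ⟨r, rfl⟩
        exact ⟨_, (FullAlg.mem_gr_zero_iff _).2 ⟨r, rfl⟩, rfl⟩)
    (diffl n) (parity n)
    (fun p x hx => by
      obtain ⟨y, hy, rfl⟩ := mem_gr.1 hx
      rw [parity_proj, FullAlg.parity_of_mem hy, map_zsmul])
    (fun x y => by
      obtain ⟨x, rfl⟩ := proj_surjective n x
      obtain ⟨y, rfl⟩ := proj_surjective n y
      rw [← map_mul, diffl_proj, FullAlg.diffl_mul, map_add, map_mul, map_mul, diffl_proj,
        diffl_proj, parity_proj])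
    (fun r => (diffl_proj _).trans (by rw [FullAlg.diffl_coeffHom, map_zero]))
    (fun {p x} hx => by
      obtain ⟨y, hy, rfl⟩ := mem_gr.1 hx
      exact mem_gr.2 ⟨_, FullAlg.diffl_mem hy, (diffl_proj y).symm⟩)
    (fun x => by
      obtain ⟨x, rfl⟩ := proj_surjective n x
      rw [diffl_proj, diffl_proj, FullAlg.diffl_diffl, map_zero])

theorem isGammaDG (n : ℕ) : IsGammaDG (FullAlg.dgStructure n) (dgStructure n) where
  coeff_eq _ := rfl
  gr_eq _ := rfl
  d_proj := diffl_proj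

end GammaAlg

/-! ## Functoriality of Type DD bimodules -/

namespace DGStructure

variable {ι A A' B B' : Type} [Ring A] [Ring A'] [Ring B] [Ring B']

theorem ofHomogeneous_of_mem (S : DGStructure ι A) {M : Type} [AddCommMonoid M] [Module ℤ M]
    (f : ∀ p, S.gr p →ₗ[ℤ] M) {p : ℚ × ℤ} {x : A} (hx : x ∈ S.gr p) :
    S.ofHomogeneous f x = f p ⟨x, hx⟩ := by
  have h : (LinearEquiv.ofBijective (DirectSum.coeLinearMap S.gr) S.internal).symm x =
      DirectSum.lof ℤ (ℚ × ℤ) (fun p => S.gr p) p ⟨x, hx⟩ := by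
    rw [LinearEquiv.symm_apply_eq]
    exact (DirectSum.coeLinearMap_lof S.gr p ⟨x, hx⟩).symm
  change DirectSum.toModule ℤ (ℚ × ℤ) M f
    ((LinearEquiv.ofBijective (DirectSum.coeLinearMap S.gr) S.internal).symm x) = _
  rw [h, DirectSum.toModule_lof]

theorem absId_of_mem (S : DGStructure ι A) (j : ℤ) {p : ℚ × ℤ} {x : A} (hx : x ∈ S.gr p) :
    S.absId j x = ((j * p.2).negOnePow : ℤ) • x :=
  S.ofHomogeneous_of_mem _ hx

theorem homogeneous_induction (S : DGStructure ι A) {P : A → Prop}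
    (hmem : ∀ p, ∀ x ∈ S.gr p, P x) (hadd : ∀ x y, P x → P y → P (x + y)) (x : A) : P x := by
  have hx : x ∈ iSup S.gr := by
    rw [S.internal.submodule_iSup_eq_top]
    trivial
  exact Submodule.iSup_induction S.gr (motive := P) hx hmem (hmem 0 0 (zero_mem _)) hadd

theorem signFlip_tmul (S : DGStructure ι A) (S' : DGStructure ι A') (b₁ b₂ : A) (b₃ b₄ : A')
    {q : ℚ × ℤ} (h : b₄ ∈ S'.gr q) : signFlip S S' ((b₁ ⊗ₜ b₂) ⊗ₜ (b₃ ⊗ₜ b₄)) =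
      (b₁ ⊗ₜ S.absId q.2 b₂) ⊗ₜ (b₃ ⊗ₜ b₄) := by
  simp only [signFlip, TensorProduct.lift.tmul, LinearMap.flip_apply]
  rw [S'.ofHomogeneous_of_mem _ h]
  rfl

theorem idTensorId_tmul (t : A ⊗[ℤ] A') (b₁ : A) (b₄ : A') : idTensorId t (b₁ ⊗ₜ b₄) =
    TensorProduct.map (TensorProduct.mk ℤ A A b₁) ((TensorProduct.mk ℤ A' A').flip b₄) t := rfl

theorem idTensorId_tmul_tmul (b₁ b₂ : A) (b₃ b₄ : A') :
    idTensorId (b₂ ⊗ₜ b₃) (b₁ ⊗ₜ b₄) = (b₁ ⊗ₜ[ℤ] b₂) ⊗ₜ[ℤ] (b₃ ⊗ₜ[ℤ] b₄) := rfl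

/-- The quadratic term of the structure relation. -/
noncomputable def quadTerm (S : DGStructure ι A) (S' : DGStructure ι A') (t : A ⊗[ℤ] A') :
    A ⊗[ℤ] A' →ₗ[ℤ] A ⊗[ℤ] A' :=
  mulTensorMul ∘ₗ signFlip S S' ∘ₗ idTensorId t

theorem quadTerm_add (S : DGStructure ι A) (S' : DGStructure ι A') (t t' u : A ⊗[ℤ] A') :
    quadTerm S S' (t + t') u = quadTerm S S' t u + quadTerm S S' t' u := by
  have : idTensorId (t + t') u = idTensorId t u + idTensorId t' u := by
    induction u with
    | zero => simp
    | add x y hx hy => rw [map_add, map_add, map_add, hx, hy, add_add_add_comm]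
    | tmul a a' => rw [idTensorId_tmul, idTensorId_tmul, idTensorId_tmul, map_add]
  rw [quadTerm, LinearMap.comp_apply, LinearMap.comp_apply, this, map_add, map_add]
  rfl

theorem quadTerm_zero (S : DGStructure ι A) (S' : DGStructure ι A') (u : A ⊗[ℤ] A') :
    quadTerm S S' 0 u = 0 := by
  have := quadTerm_add S S' 0 0 u
  rwa [add_zero, eq_comm, add_eq_left] at this

theorem quadTerm_tmul (S : DGStructure ι A) (S' : DGStructure ι A') (b₁ b₂ : A) (b₃ b₄ : A')
    {q : ℚ × ℤ} (h : b₄ ∈ S'.gr q) : quadTerm S S' (b₂ ⊗ₜ b₃) (b₁ ⊗ₜ b₄) =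
      (b₁ * S.absId q.2 b₂) ⊗ₜ (b₄ * b₃) := by
  rw [quadTerm, LinearMap.comp_apply, LinearMap.comp_apply, idTensorId_tmul_tmul,
    signFlip_tmul S S' _ _ _ _ h]
  rfl

/-- Homomorphisms of differential bigraded algebras. -/
structure IsHom (S : DGStructure ι A) (T : DGStructure ι B) (π : A →+* B) : Prop where
  coeff : ∀ r, T.coeff r = π (S.coeff r)
  gr : ∀ p, ∀ x ∈ S.gr p, π x ∈ T.gr p
  d : ∀ x, T.d (π x) = π (S.d x)

/-- A ring homomorphism as a linear map. -/
abbrev linMap (π : A →+* B) : A →ₗ[ℤ] B := π.toAddMonoidHom.toIntLinearMap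

variable {S : DGStructure ι A} {S' : DGStructure ι A'} {T : DGStructure ι B}
  {T' : DGStructure ι B'} {π : A →+* B} {π' : A' →+* B'}

theorem IsHom.mirror (h : IsHom S T π) (m : Equiv.Perm ι) :
    IsHom (S.mirror m) (T.mirror m) π :=
  ⟨fun _ => h.coeff _, h.gr, h.d⟩

theorem IsHom.absId (h : IsHom S T π) (j : ℤ) (x : A) : T.absId j (π x) = π (S.absId j x) := by
  induction x using S.homogeneous_induction with
  | hmem p x hx => rw [S.absId_of_mem j hx, T.absId_of_mem j (h.gr p x hx), map_zsmul]
  | hadd x y hx hy => rw [map_add, map_add, map_add, map_add, hx, hy]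

theorem IsHom.quadTerm (h : IsHom S T π) (h' : IsHom S' T' π') (t u : A ⊗[ℤ] A') :
    quadTerm T T' (TensorProduct.map (linMap π) (linMap π') t)
      (TensorProduct.map (linMap π) (linMap π') u) =
      TensorProduct.map (linMap π) (linMap π') (DGStructure.quadTerm S S' t u) := by
  induction u with
  | zero => simp only [map_zero]
  | add x y hx hy => simp only [map_add, hx, hy]
  | tmul b₁ b₄ =>
    induction t with
    | zero => simp only [map_zero, quadTerm_zero]
    | add x y hx hy => simp only [map_add, quadTerm_add, hx, hy]
    | tmul b₂ b₃ =>
      induction b₄ using S'.homogeneous_induction with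
      | hadd x y hx hy => simp only [TensorProduct.tmul_add, map_add, hx, hy]
      | hmem q b₄ hq =>
        rw [quadTerm_tmul S S' _ _ _ _ hq, TensorProduct.map_tmul, TensorProduct.map_tmul,
          TensorProduct.map_tmul]
        have h1 := quadTerm_tmul T T' (π b₁) (π b₂) (π' b₃) (π' b₄) (h'.gr q b₄ hq)
        refine h1.trans ?_
        rw [h.absId, ← map_mul, ← map_mul]
        rfl

/-- Every operation entering the conditions commutes with the tensor product of the two
homomorphisms, which is checked on pure tensors; for the sign of the quadratic term, these are taken
with a homogeneous last factor. -/
theorem IsRankOneDD.map [Fintype ι] [DecidableEq ι] {δ : (ι → ℤ) →ₗ[ℤ] A ⊗[ℤ] A'}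
    (H : IsRankOneDD S S' δ) (h : IsHom S T π) (h' : IsHom S' T' π') :
    IsRankOneDD T T' (TensorProduct.map (linMap π) (linMap π') ∘ₗ δ) where
  mem_tensorR r := by
    obtain ⟨t, ht⟩ := H.mem_tensorR r
    refine ⟨TensorProduct.map (linMap π) (linMap π') t, ?_⟩
    rw [LinearMap.comp_apply, ← ht]
    clear ht
    induction t with
    | zero => simp only [map_zero]
    | add x y hx hy => simp only [map_add, hx, hy]
    | tmul a a' =>
      simp only [balance, LinearMap.sum_apply, TensorProduct.map_tmul, LinearMap.mulRight_apply,
        map_sum, h.coeff, h'.coeff]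
      refine Finset.sum_congr rfl fun i _ => ?_
      change (π a * π _) ⊗ₜ (π' a' * π' _) = π (a * _) ⊗ₜ π' (a' * _)
      rw [map_mul, map_mul]
  left_linear r s := by
    rw [LinearMap.comp_apply, LinearMap.comp_apply, H.left_linear]
    generalize δ s = t
    induction t with
    | zero => simp only [map_zero]
    | add x y hx hy => simp only [map_add, hx, hy]
    | tmul a a' =>
      simp only [TensorProduct.map_tmul, LinearMap.mulLeft_apply, h.coeff]
      change π (S.coeff r * a) ⊗ₜ _ = (π (S.coeff r) * π a) ⊗ₜ _
      rw [map_mul]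
      rfl
  right_linear r s := by
    rw [LinearMap.comp_apply, LinearMap.comp_apply, H.right_linear]
    generalize δ s = t
    induction t with
    | zero => simp only [map_zero]
    | add x y hx hy => simp only [map_add, hx, hy]
    | tmul a a' =>
      simp only [TensorProduct.map_tmul, LinearMap.mulLeft_apply, h'.coeff]
      change _ ⊗ₜ π' (S'.coeff r * a') = _ ⊗ₜ (π' (S'.coeff r) * π' a')
      rw [map_mul]
      rfl
  degree r := by
    rw [LinearMap.comp_apply]
    refine Submodule.span_induction (p := fun t _ => TensorProduct.map (linMap π) (linMap π') t ∈ _)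
      ?_ ?_ ?_ ?_ (H.degree r)
    · rintro _ ⟨p, q, x, y, hx, hy, hpq, rfl⟩
      exact Submodule.subset_span ⟨p, q, π x, π' y, h.gr p x hx, h'.gr q y hy, hpq, rfl⟩
    · rw [map_zero]; exact zero_mem _
    · intro x y _ _ hx hy
      rw [map_add]; exact add_mem hx hy
    · intro c x _ hx
      rw [map_smul]; exact Submodule.smul_mem _ c hx
  relation r := by
    have key := congrArg (TensorProduct.map (linMap π) (linMap π')) (H.relation r)
    rw [map_add, map_add, map_zero] at key
    rw [← key]
    congr 1
    · congr 1
      · rw [LinearMap.comp_apply]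
        generalize δ r = t
        induction t with
        | zero => simp only [map_zero]
        | add x y hx hy => simp only [map_add, hx, hy]
        | tmul a a' =>
          simp only [TensorProduct.map_tmul]
          change T.d (π a) ⊗ₜ T'.absId 1 (π' a') = π (S.d a) ⊗ₜ π' (S'.absId 1 a')
          rw [h.d, h'.absId]
      · rw [LinearMap.comp_apply]
        generalize δ r = t
        induction t with
        | zero => simp only [map_zero]
        | add x y hx hy => simp only [map_add, hx, hy]
        | tmul a a' =>
          simp only [TensorProduct.map_tmul]
          change π a ⊗ₜ T'.d (π' a') = π a ⊗ₜ π' (S'.d a')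
          rw [h'.d]
    · exact h.quadTerm h' (δ 1) (δ r)

end DGStructure

theorem GammaAlg.isHom_proj (n : ℕ) :
    DGStructure.IsHom (FullAlg.dgStructure n) (GammaAlg.dgStructure n) (GammaAlg.proj n) :=
  ⟨fun _ => rfl, fun _ _ hx => GammaAlg.mem_gr.2 ⟨_, hx, rfl⟩, GammaAlg.diffl_proj⟩

/-! ## The Type DD structure maps as matrices -/

namespace FullAlg

variable {n : ℕ} {h k m : ArcBasis n}

open Matrix

/-- The terms `b ⊗ (b^*)^op` of `δ₁`. -/
noncomputable def ddRight (n : ℕ) : Matrix (ArcBasis n) (ArcBasis n) (FullAlg n ⊗[ℤ] FullAlg n) :=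
  fun h k => genMatrix right h k ⊗ₜ genMatrix left h k

/-- The terms `m(b^*) ⊗ m(b)^op` of `δ₂`. -/
noncomputable def ddLeft (n : ℕ) : Matrix (ArcBasis n) (ArcBasis n) (FullAlg n ⊗[ℤ] FullAlg n) :=
  fun h k => genMatrix left h.mirror k.mirror ⊗ₜ genMatrix right h.mirror k.mirror

/-- The terms of `δ₁` for bridges. -/
noncomputable def ddRightB (n : ℕ) : Matrix (ArcBasis n) (ArcBasis n) (FullAlg n ⊗[ℤ] FullAlg n) :=
  fun h k => rightB n h k ⊗ₜ leftB n h.mirror k.mirror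

/-- The terms of `δ₁` for decorations. -/
noncomputable def ddRightD (n : ℕ) : Matrix (ArcBasis n) (ArcBasis n) (FullAlg n ⊗[ℤ] FullAlg n) :=
  fun h k => rightD n h k ⊗ₜ leftD n h.mirror k.mirror

/-- The terms of `δ₂` for bridges. -/
noncomputable def ddLeftB (n : ℕ) : Matrix (ArcBasis n) (ArcBasis n) (FullAlg n ⊗[ℤ] FullAlg n) :=
  fun h k => leftB n h k ⊗ₜ rightB n h.mirror k.mirror

/-- The terms of `δ₂` for decorations. -/
noncomputable def ddLeftD (n : ℕ) : Matrix (ArcBasis n) (ArcBasis n) (FullAlg n ⊗[ℤ] FullAlg n) :=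
  fun h k => leftD n h k ⊗ₜ rightD n h.mirror k.mirror

theorem ddRight_eq (n : ℕ) : ddRight n = ddRightB n + ddRightD n := by
  ext h k
  change _ = rightB n h k ⊗ₜ bridgeMatrix left h k + rightD n h k ⊗ₜ decorMatrix left h k
  change genMatrix right h k ⊗ₜ genMatrix left h k = _
  by_cases H : h.BridgeTo k
  · rw [genMatrix_of_bridge _ H, genMatrix_of_bridge _ H,
      rightD_of_not fun H' => H.right_ne H'.right_eq, TensorProduct.zero_tmul, add_zero]
    rfl
  by_cases H' : h.DecorTo k
  · rw [genMatrix_of_decor _ H', genMatrix_of_decor _ H', rightB_of_not H, TensorProduct.zero_tmul,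
      zero_add]
    rfl
  · rw [rightD_of_not H', rightB_of_not H, genMatrix, Matrix.add_apply, bridgeMatrix_of_not _ H,
      decorMatrix_of_not _ H', add_zero, TensorProduct.zero_tmul, TensorProduct.zero_tmul,
      TensorProduct.zero_tmul, add_zero]

/-- The exchange of the tensor factors. -/
noncomputable def swap (n : ℕ) : FullAlg n ⊗[ℤ] FullAlg n →+* FullAlg n ⊗[ℤ] FullAlg n :=
  (Algebra.TensorProduct.comm ℤ (FullAlg n) (FullAlg n)).toRingEquiv.toRingHom

theorem swap_tmul (x y : FullAlg n) : swap n (x ⊗ₜ y) = y ⊗ₜ x := rfl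

/-- Mirroring the idempotents and exchanging the tensor factors. -/
noncomputable def flipMatrix (A : Matrix (ArcBasis n) (ArcBasis n) (FullAlg n ⊗[ℤ] FullAlg n)) :
    Matrix (ArcBasis n) (ArcBasis n) (FullAlg n ⊗[ℤ] FullAlg n) :=
  fun h k => swap n (A h.mirror k.mirror)

theorem flipMatrix_mul (A B : Matrix (ArcBasis n) (ArcBasis n) (FullAlg n ⊗[ℤ] FullAlg n)) :
    flipMatrix (A * B) = flipMatrix A * flipMatrix B := by
  ext h m
  rw [Matrix.mul_apply]
  change swap n ((A * B) h.mirror m.mirror) = ∑ k : ArcBasis n, swap n (A h.mirror k.mirror) *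
    swap n (B k.mirror m.mirror)
  rw [Matrix.mul_apply, map_sum, ← Equiv.sum_comp (mirrorPerm n)]
  exact Finset.sum_congr rfl fun k _ => map_mul _ _ _

theorem flipMatrix_add (A B : Matrix (ArcBasis n) (ArcBasis n) (FullAlg n ⊗[ℤ] FullAlg n)) :
    flipMatrix (A + B) = flipMatrix A + flipMatrix B := by
  ext h m
  exact map_add _ _ _

theorem flipMatrix_ddRight (n : ℕ) : flipMatrix (ddRight n) = ddLeft n := rfl

theorem ddLeft_eq (n : ℕ) : ddLeft n = ddLeftB n + ddLeftD n := by
  rw [← flipMatrix_ddRight, ddRight_eq, flipMatrix_add]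
  rfl

/-- In each tensor factor the product does not depend on the path, in the second one by the same
relation between mirrored idempotents. So the two sums consist of equal terms, and they have equally
many of them. -/
theorem ddRightB_mul_ddLeftB (n : ℕ) : ddRightB n * ddLeftB n = ddLeftB n * ddRightB n := by
  ext h m
  rw [Matrix.mul_apply, Matrix.mul_apply]
  refine sum_eq_sum_of_card_eq (P := fun k => h.BridgeTo k ∧ k.LeftBridgeTo m)
    (Q := fun k => h.LeftBridgeTo k ∧ k.BridgeTo m) ?_ ?_ ?_ (ArcBasis.card_bridge_comm h m)
  · intro k hk
    rw [not_and_or] at hk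
    rcases hk with hk | hk
    · rw [ddRightB, rightB_of_not hk, TensorProduct.zero_tmul, zero_mul]
    · rw [ddLeftB, leftB_of_not hk, TensorProduct.zero_tmul, mul_zero]
  · intro k hk
    rw [not_and_or] at hk
    rcases hk with hk | hk
    · rw [ddLeftB, leftB_of_not hk, TensorProduct.zero_tmul, zero_mul]
    · rw [ddRightB, rightB_of_not hk, TensorProduct.zero_tmul, mul_zero]
  · rintro k k' ⟨h1, h2⟩ ⟨h3, h4⟩
    change (rightB n h k ⊗ₜ leftB n h.mirror k.mirror) * (leftB n k m ⊗ₜ rightB n k.mirror m.mirror) =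
      (leftB n h k' ⊗ₜ rightB n h.mirror k'.mirror) * (rightB n k' m ⊗ₜ leftB n k'.mirror m.mirror)
    rw [Algebra.TensorProduct.tmul_mul_tmul, Algebra.TensorProduct.tmul_mul_tmul,
      rightB_mul_leftB_apply h1 h2 h3 h4,
      rightB_mul_leftB_apply (h := h.mirror) (k := k'.mirror) (k' := k.mirror) (m := m.mirror)
        h3 h4 h1 h2]

/-- The second tensor factor is a product of a left bridge and a right decoration, which is the same
for all paths between `h` and `m` in either order. It can be taken out of the sums, and the first
factors satisfy the matrix identity `rightB_mul_leftD`. -/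
theorem ddRightB_mul_ddLeftD (n : ℕ) : ddRightB n * ddLeftD n = ddLeftD n * ddRightB n := by
  ext h m
  have e1 : ∀ k, ddRightB n h k * ddLeftD n k m = (rightB n h k * leftD n k m) ⊗ₜ
      (leftB n h.mirror k.mirror * rightD n k.mirror m.mirror) := fun k =>
    Algebra.TensorProduct.tmul_mul_tmul _ _ _ _
  have e2 : ∀ k, ddLeftD n h k * ddRightB n k m = (leftD n h k * rightB n k m) ⊗ₜ
      (rightD n h.mirror k.mirror * leftB n k.mirror m.mirror) := fun k =>
    Algebra.TensorProduct.tmul_mul_tmul _ _ _ _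
  rw [Matrix.mul_apply, Matrix.mul_apply]
  simp only [e1, e2]
  by_cases H : ∃ k, h.BridgeTo k ∧ k.DecorTo m
  · obtain ⟨k', a1, a2⟩ := (ArcBasis.exists_decorTo_bridgeTo_iff h m).2 H
    obtain ⟨k, b1, b2⟩ := H
    have c1 : ∀ j, (rightB n h j * leftD n j m) ⊗ₜ[ℤ]
        (leftB n h.mirror j.mirror * rightD n j.mirror m.mirror) = (rightB n h j * leftD n j m) ⊗ₜ[ℤ]
        (leftB n h.mirror k.mirror * rightD n k.mirror m.mirror) := by
      intro j
      by_cases hne : rightB n h j * leftD n j m = 0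
      · rw [hne, TensorProduct.zero_tmul, TensorProduct.zero_tmul]
      · have h1 := bridgeTo_of_ne (left_ne_zero_of_mul hne)
        have h2 := decorTo_of_ne (right_ne_zero_of_mul hne)
        rw [← rightD_mul_leftB_apply (h := h.mirror) (k := k'.mirror) (k' := j.mirror) (m := m.mirror)
            a1.mirror a2 h1 h2.mirror,
          ← rightD_mul_leftB_apply (h := h.mirror) (k := k'.mirror) (k' := k.mirror) (m := m.mirror)
            a1.mirror a2 b1 b2.mirror]
    have c2 : ∀ j, (leftD n h j * rightB n j m) ⊗ₜ[ℤ]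
        (rightD n h.mirror j.mirror * leftB n j.mirror m.mirror) = (leftD n h j * rightB n j m) ⊗ₜ[ℤ]
        (leftB n h.mirror k.mirror * rightD n k.mirror m.mirror) := by
      intro j
      by_cases hne : leftD n h j * rightB n j m = 0
      · rw [hne, TensorProduct.zero_tmul, TensorProduct.zero_tmul]
      · have h1 := decorTo_of_ne (left_ne_zero_of_mul hne)
        have h2 := bridgeTo_of_ne (right_ne_zero_of_mul hne)
        rw [rightD_mul_leftB_apply (h := h.mirror) (k := j.mirror) (k' := k.mirror) (m := m.mirror)
          h1.mirror h2 b1 b2.mirror]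
    simp only [c1, c2]
    rw [← TensorProduct.sum_tmul, ← TensorProduct.sum_tmul, ← Matrix.mul_apply, ← Matrix.mul_apply,
      rightB_mul_leftD]
  · rw [Finset.sum_eq_zero, Finset.sum_eq_zero]
    · intro k _
      by_cases hne : leftD n h k * rightB n k m = 0
      · rw [hne, TensorProduct.zero_tmul]
      · exact absurd ((ArcBasis.exists_decorTo_bridgeTo_iff h m).1
          ⟨k, decorTo_of_ne (left_ne_zero_of_mul hne), bridgeTo_of_ne (right_ne_zero_of_mul hne)⟩) H
    · intro k _
      by_cases hne : rightB n h k * leftD n k m = 0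
      · rw [hne, TensorProduct.zero_tmul]
      · exact absurd ⟨k, bridgeTo_of_ne (left_ne_zero_of_mul hne),
          decorTo_of_ne (right_ne_zero_of_mul hne)⟩ H

/-- This is the preceding identity with mirrored idempotents and exchanged tensor factors, an
operation compatible with matrix products. -/
theorem ddRightD_mul_ddLeftB (n : ℕ) : ddRightD n * ddLeftB n = ddLeftB n * ddRightD n := by
  have := congrArg flipMatrix (ddRightB_mul_ddLeftD n)
  rw [flipMatrix_mul, flipMatrix_mul] at this
  exact this.symm

/-- Performing the two decorations in the other order is an involution on the middle idempotents,
and it matches the terms of the two sums one by one. -/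
theorem ddRightD_mul_ddLeftD (n : ℕ) : ddRightD n * ddLeftD n = ddLeftD n * ddRightD n := by
  classical
  ext h m
  -- The middle idempotent of the path in the other order; where there is no path the value is
  -- irrelevant and `k` is kept, so that `f` is an involution everywhere.
  let f : ArcBasis n → ArcBasis n := fun k =>
    if H : h.DecorTo k ∧ k.DecorTo m then (H.1.exists_swap H.2).choose else k
  have hf : ∀ k, ∀ H : h.DecorTo k ∧ k.DecorTo m, h.DecorTo (f k) ∧ (f k).DecorTo m ∧
      ArcBasis.diff h k = ArcBasis.diff (f k) m ∧ ArcBasis.diff k m = ArcBasis.diff h (f k) := by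
    intro k H
    have : f k = (H.1.exists_swap H.2).choose := dif_pos H
    rw [this]
    exact (H.1.exists_swap H.2).choose_spec
  have hinv : Function.Involutive f := by
    intro k
    by_cases H : h.DecorTo k ∧ k.DecorTo m
    · obtain ⟨a1, a2, a3, a4⟩ := hf k H
      obtain ⟨b1, b2, b3, b4⟩ := hf (f k) ⟨a1, a2⟩
      obtain ⟨z, hz⟩ := H.1.exists_mem_diff
      refine (b1.eq_of_mem_diff' H.1 (z := z) ?_ hz)
      rw [← b4, ← a3]
      exact hz
    · have : f k = k := dif_neg H
      rw [this, this]
  rw [Matrix.mul_apply, Matrix.mul_apply, ← Equiv.sum_comp hinv.toPerm]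
  refine Finset.sum_congr rfl fun k _ => ?_
  change (rightD n h (f k) ⊗ₜ leftD n h.mirror (f k).mirror) *
    (leftD n (f k) m ⊗ₜ rightD n (f k).mirror m.mirror) =
      (leftD n h k ⊗ₜ rightD n h.mirror k.mirror) * (rightD n k m ⊗ₜ leftD n k.mirror m.mirror)
  rw [Algebra.TensorProduct.tmul_mul_tmul, Algebra.TensorProduct.tmul_mul_tmul]
  by_cases H : h.DecorTo k ∧ k.DecorTo m
  · obtain ⟨a1, a2, a3, a4⟩ := hf k H
    rw [rightD_mul_leftD_apply a1 a2 H.1 H.2 a4.symm a3.symm,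
      rightD_mul_leftD_apply (h := h.mirror) (k := k.mirror) (k' := (f k).mirror) (m := m.mirror)
        H.1.mirror H.2.mirror a1.mirror a2.mirror a3 a4]
  · have : f k = k := dif_neg H
    rw [this]
    rw [not_and_or] at H
    rcases H with H | H
    · rw [rightD_of_not H, leftD_of_not H, zero_mul, zero_mul, TensorProduct.zero_tmul,
        TensorProduct.zero_tmul]
    · rw [rightD_of_not H, leftD_of_not H, mul_zero, mul_zero, TensorProduct.zero_tmul,
        TensorProduct.zero_tmul]

theorem ddRight_mul_ddLeft (n : ℕ) : ddRight n * ddLeft n = ddLeft n * ddRight n := by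
  rw [ddRight_eq, ddLeft_eq]
  simp only [Matrix.add_mul, Matrix.mul_add, ddRightB_mul_ddLeftB, ddRightB_mul_ddLeftD,
    ddRightD_mul_ddLeftB, ddRightD_mul_ddLeftD]
  abel

/-- The first tensor factor is a word of `B`, the same for all middle idempotents, so the second
factors add up to an entry of `Y²`. If no generator has the ends `h` and `m`, this entry is zero;
otherwise the word of `B` equals that generator. -/
theorem ddRight_mul_ddRight (h m : ArcBasis n) : (ddRight n * ddRight n) h m =
    genMatrix right h m ⊗ₜ leftSq n h m := by
  obtain ⟨F, h1, h2⟩ := exists_rightWord n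
  have e1 : genMatrix right h m ⊗ₜ[ℤ] leftSq n h m = F h m ⊗ₜ leftSq n h m := by
    by_cases H : ∃ g : Gen n, g.src = h ∧ g.tgt = m
    · obtain ⟨g, rfl, rfl⟩ := H
      rw [genMatrix_apply, h1]
    · rw [leftSq_eq_zero H, TensorProduct.tmul_zero, TensorProduct.tmul_zero]
  rw [e1, leftSq, Matrix.mul_apply, Matrix.mul_apply, TensorProduct.tmul_sum]
  refine Finset.sum_congr rfl fun k _ => ?_
  refine (Algebra.TensorProduct.tmul_mul_tmul _ _ _ _).trans ?_
  by_cases H1 : genMatrix left h k = (0 : FullAlg n)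
  · rw [H1, zero_mul, TensorProduct.tmul_zero, TensorProduct.tmul_zero]
  by_cases H2 : genMatrix left k m = (0 : FullAlg n)
  · rw [H2, mul_zero, TensorProduct.tmul_zero, TensorProduct.tmul_zero]
  obtain ⟨g, g', e1, e2, e3, e4⟩ := exists_gens_of_leftSq_term H1 H2
  have e5 : genMatrix right h k = right g := by rw [← e1, ← e2, genMatrix_apply]
  have e6 : genMatrix right k m = right g' := by rw [← e3, ← e4, genMatrix_apply]
  rw [e5, e6, h2 ⟨(g, g'), e2.trans e3.symm⟩]
  change F g.src g'.tgt ⊗ₜ _ = _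
  rw [e1, e4]

theorem ddLeft_mul_ddLeft (h m : ArcBasis n) : (ddLeft n * ddLeft n) h m =
    leftSq n h.mirror m.mirror ⊗ₜ genMatrix right h.mirror m.mirror := by
  rw [← flipMatrix_ddRight, ← flipMatrix_mul]
  change swap n ((ddRight n * ddRight n) h.mirror m.mirror) = _
  rw [ddRight_mul_ddRight, swap_tmul]

end FullAlg

/-! ## The Type DD bimodule over the product algebra -/

namespace FullAlg

variable {n : ℕ} {h k m : ArcBasis n}

open DGStructure

theorem idem_mul_genMatrix_right (h k : ArcBasis n) :
    idem h * genMatrix right h k = genMatrix right h k := by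
  by_cases H : ∃ g : Gen n, g.src = h ∧ g.tgt = k
  · obtain ⟨g, rfl, rfl⟩ := H
    rw [genMatrix_apply, idem_mul_right]
  · rw [genMatrix_eq_zero _ H, mul_zero]

theorem genMatrix_right_mul_idem (h k : ArcBasis n) :
    genMatrix right h k * idem k = genMatrix right h k := by
  by_cases H : ∃ g : Gen n, g.src = h ∧ g.tgt = k
  · obtain ⟨g, rfl, rfl⟩ := H
    rw [genMatrix_apply, right_mul_idem]
  · rw [genMatrix_eq_zero _ H, zero_mul]

theorem genMatrix_right_mem (h k : ArcBasis n) :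
    genMatrix right h k ∈ gr n (((h.degree - k.degree : ℤ) : ℚ) / 2, 0) := by
  by_cases H : ∃ g : Gen n, g.src = h ∧ g.tgt = k
  · obtain ⟨g, rfl, rfl⟩ := H
    rw [genMatrix_apply]
    exact right_mem g
  · rw [genMatrix_eq_zero _ H]
    exact zero_mem _

theorem diffl_genMatrix_right (h k : ArcBasis n) : diffl n (genMatrix right h k) = 0 := by
  by_cases H : ∃ g : Gen n, g.src = h ∧ g.tgt = k
  · obtain ⟨g, rfl, rfl⟩ := H
    rw [genMatrix_apply, diffl_right]
  · rw [genMatrix_eq_zero _ H, map_zero]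

theorem delta₁_apply (r : ArcBasis n → ℤ) : delta₁ n r = ∑ h, ∑ k, r h • ddRight n h k := by
  rw [← sum_gen (fun h k => r h • ddRight n h k), delta₁, LinearMap.sum_apply]
  · refine Finset.sum_congr rfl fun b _ => ?_
    rw [ddRight, genMatrix_apply, genMatrix_apply]
    rfl
  · intro h k H
    rw [ddRight, genMatrix_eq_zero _ H, TensorProduct.zero_tmul, smul_zero]

theorem delta₂_apply (r : ArcBasis n → ℤ) : delta₂ n r = ∑ h, ∑ k, r h • ddLeft n h k := by
  have e : ∑ h, ∑ k, r h • ddLeft n h k = ∑ h, ∑ k, r h.mirror •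
      (genMatrix left h k ⊗ₜ[ℤ] genMatrix right h k) := by
    rw [← Equiv.sum_comp (mirrorPerm n)]
    refine Finset.sum_congr rfl fun h _ => ?_
    rw [← Equiv.sum_comp (mirrorPerm n)]
    rfl
  rw [e, ← sum_gen (fun h k => r h.mirror • (genMatrix left h k ⊗ₜ[ℤ] genMatrix right h k)), delta₂,
    LinearMap.sum_apply]
  · refine Finset.sum_congr rfl fun b _ => ?_
    rw [genMatrix_apply, genMatrix_apply]
    rfl
  · intro h k H
    rw [genMatrix_eq_zero _ H, TensorProduct.zero_tmul, smul_zero]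

theorem delta_apply (r : ArcBasis n → ℤ) : (delta₁ n + delta₂ n) r =
    ∑ h, ∑ k, r h • (ddRight n h k + ddLeft n h k) := by
  rw [LinearMap.add_apply, delta₁_apply, delta₂_apply, ← Finset.sum_add_distrib]
  refine Finset.sum_congr rfl fun h _ => ?_
  rw [← Finset.sum_add_distrib]
  exact Finset.sum_congr rfl fun k _ => (smul_add _ _ _).symm

/-- The structure of the mirrored product algebra. -/
noncomputable abbrev mirrorStructure (n : ℕ) : DGStructure (ArcBasis n) (FullAlg n) :=
  (dgStructure n).mirror (mirrorPerm n)

theorem mirrorStructure_coeff (r : ArcBasis n → ℤ) :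
    (mirrorStructure n).coeff r = ∑ h, r h • idem h.mirror := by
  rw [← Equiv.sum_comp (mirrorPerm n)]
  rfl

theorem coeff_mul_of_idem {h : ArcBasis n} {x : FullAlg n} (hx : idem h * x = x)
    (r : ArcBasis n → ℤ) : (dgStructure n).coeff r * x = r h • x := by
  change coeffHom n r * x = _
  rw [coeffHom_apply, Finset.sum_mul, Finset.sum_eq_single h]
  · rw [smul_mul_assoc, hx]
  · intro k _ hk
    rw [← hx, ← mul_assoc, smul_mul_assoc, idem_mul_idem, if_neg hk, smul_zero, zero_mul]
  · simp

theorem mirror_coeff_mul_of_idem {h : ArcBasis n} {x : FullAlg n} (hx : idem h.mirror * x = x)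
    (r : ArcBasis n → ℤ) : (mirrorStructure n).coeff r * x = r h • x := by
  rw [mirrorStructure_coeff, Finset.sum_mul, Finset.sum_eq_single h]
  · rw [smul_mul_assoc, hx]
  · intro k _ hk
    have hk' : k.mirror ≠ h.mirror := fun e => hk ((mirrorPerm n).injective e)
    rw [← hx, ← mul_assoc, smul_mul_assoc, idem_mul_idem, if_neg hk', smul_zero, zero_mul]
  · simp

theorem balance_tmul {k : ArcBasis n} {x y : FullAlg n} (hx : x * idem k = x)
    (hy : y * idem k.mirror = y) :
    balance (dgStructure n) (mirrorStructure n) (x ⊗ₜ y) = x ⊗ₜ y := by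
  have e : ∀ i, (mirrorStructure n).coeff (Pi.single i 1) = idem i.mirror := by
    intro i
    rw [mirrorStructure_coeff, Finset.sum_eq_single i]
    · simp
    · intro k _ hk
      rw [Pi.single_eq_of_ne hk, zero_smul]
    · simp
  have e' : ∀ i, (dgStructure n).coeff (Pi.single i 1) = idem i := coeffHom_single
  simp only [balance, LinearMap.sum_apply, TensorProduct.map_tmul, LinearMap.mulRight_apply, e, e']
  rw [Finset.sum_eq_single k]
  · rw [hx, hy]
  · intro i _ hi
    rw [← hx, mul_assoc, idem_mul_idem, if_neg hi.symm, mul_zero, TensorProduct.zero_tmul]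
  · simp

/-- The idempotents remove the terms that are not composable, so the quadratic term, which has
`δ(1)` inserted, becomes a matrix product. -/
theorem ddRight_mul_of_ne (A : Matrix (ArcBasis n) (ArcBasis n) (FullAlg n ⊗[ℤ] FullAlg n))
    (hA : A = ddRight n ∨ A = ddLeft n)
    (B : Matrix (ArcBasis n) (ArcBasis n) (FullAlg n ⊗[ℤ] FullAlg n))
    (hB : B = ddRight n ∨ B = ddLeft n) {h k k' m : ArcBasis n} (hk : k ≠ k') :
    A h k * B k' m = 0 := by
  have e1 : A h k * (idem k ⊗ₜ 1) = A h k := by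
    rcases hA with rfl | rfl
    · refine (Algebra.TensorProduct.tmul_mul_tmul _ _ _ _).trans ?_
      rw [genMatrix_right_mul_idem, mul_one]
      rfl
    · refine (Algebra.TensorProduct.tmul_mul_tmul _ _ _ _).trans ?_
      exact congrArg₂ (· ⊗ₜ[ℤ] ·) (genMatrix_left_mul_idem h.mirror k.mirror) (mul_one _)
  have e2 : (idem k' ⊗ₜ 1) * B k' m = B k' m := by
    rcases hB with rfl | rfl
    · refine (Algebra.TensorProduct.tmul_mul_tmul _ _ _ _).trans ?_
      rw [idem_mul_genMatrix_right, one_mul]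
      rfl
    · refine (Algebra.TensorProduct.tmul_mul_tmul _ _ _ _).trans ?_
      exact congrArg₂ (· ⊗ₜ[ℤ] ·) (idem_mul_genMatrix_left k'.mirror m.mirror) (one_mul _)
  rw [← e1, ← e2, mul_assoc, ← mul_assoc _ _ (B k' m), Algebra.TensorProduct.tmul_mul_tmul,
    idem_mul_idem, if_neg hk, TensorProduct.zero_tmul, zero_mul, mul_zero]

theorem absId_zero (x : FullAlg n) : (dgStructure n).absId 0 x = x := by
  induction x using (dgStructure n).homogeneous_induction with
  | hmem p x hx => rw [absId_of_mem _ _ hx]; simp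
  | hadd x y hx hy => rw [map_add, hx, hy]

theorem absId_one_right (h k : ArcBasis n) :
    (dgStructure n).absId 1 (genMatrix right h k) = genMatrix right h k := by
  rw [absId_of_mem _ _ (genMatrix_right_mem h k)]
  simp

theorem absId_one_left (h k : ArcBasis n) :
    (dgStructure n).absId 1 (genMatrix left h k) = -genMatrix left h k := by
  rw [absId_of_mem _ _ (genMatrix_left_mem h k)]
  simp

theorem quadTerm_ddLeft (x y : FullAlg n) (h k : ArcBasis n) :
    quadTerm (dgStructure n) (mirrorStructure n) (x ⊗ₜ y) (ddLeft n h k) =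
      ddLeft n h k * (x ⊗ₜ y) := by
  rw [ddLeft, quadTerm_tmul _ _ _ _ _ _ (genMatrix_right_mem h.mirror k.mirror), absId_zero]
  exact (Algebra.TensorProduct.tmul_mul_tmul _ _ _ _).symm

/-- The outer right factor is `b^*`, of homological degree 1, so `σ` puts the sign of `x` on the
inserted element. In `quadTerm_ddLeft` that factor is a letter of degree 0 and no sign appears; this
asymmetry makes the mixed terms cancel. -/
theorem quadTerm_ddRight (x y : FullAlg n) (h k : ArcBasis n) :
    quadTerm (dgStructure n) (mirrorStructure n) (x ⊗ₜ y) (ddRight n h k) =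
      ddRight n h k * ((dgStructure n).absId 1 x ⊗ₜ y) := by
  rw [ddRight, quadTerm_tmul _ _ _ _ _ _ (genMatrix_left_mem h k)]
  exact (Algebra.TensorProduct.tmul_mul_tmul _ _ _ _).symm

theorem quadTerm_sum (u : FullAlg n ⊗[ℤ] FullAlg n) {κ : Type} (s : Finset κ)
    (f : κ → FullAlg n ⊗[ℤ] FullAlg n) :
    quadTerm (dgStructure n) (mirrorStructure n) (∑ i ∈ s, f i) u =
      ∑ i ∈ s, quadTerm (dgStructure n) (mirrorStructure n) (f i) u := by
  classical
  induction s using Finset.induction_on with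
  | empty => exact quadTerm_zero _ _ _
  | insert a s ha ih => rw [Finset.sum_insert ha, Finset.sum_insert ha, quadTerm_add, ih]

theorem quadTerm_ddRight_ddRight (h k k' m : ArcBasis n) :
    quadTerm (dgStructure n) (mirrorStructure n) (ddRight n k' m) (ddRight n h k) =
      ddRight n h k * ddRight n k' m :=
  (quadTerm_ddRight _ _ h k).trans (by rw [absId_one_right]; rfl)

theorem quadTerm_ddLeft_ddRight (h k k' m : ArcBasis n) :
    quadTerm (dgStructure n) (mirrorStructure n) (ddLeft n k' m) (ddRight n h k) =
      -(ddRight n h k * ddLeft n k' m) :=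
  (quadTerm_ddRight _ _ h k).trans (by
    rw [absId_one_left, TensorProduct.neg_tmul]
    exact mul_neg (ddRight n h k) (ddLeft n k' m))

theorem quadTerm_delta_right (h k : ArcBasis n) :
    quadTerm (dgStructure n) (mirrorStructure n) ((delta₁ n + delta₂ n) 1) (ddRight n h k) =
      ∑ m, (ddRight n h k * ddRight n k m - ddRight n h k * ddLeft n k m) := by
  have e : ∀ k' m, quadTerm (dgStructure n) (mirrorStructure n) (ddRight n k' m + ddLeft n k' m)
      (ddRight n h k) = ddRight n h k * ddRight n k' m - ddRight n h k * ddLeft n k' m := by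
    intro k' m
    rw [quadTerm_add, quadTerm_ddRight_ddRight, quadTerm_ddLeft_ddRight, sub_eq_add_neg]
  rw [delta_apply]
  simp only [Pi.one_apply, one_smul, quadTerm_sum, e]
  rw [Finset.sum_eq_single k]
  · intro k' _ hk
    refine Finset.sum_eq_zero fun m _ => ?_
    rw [ddRight_mul_of_ne _ (Or.inl rfl) _ (Or.inl rfl) hk.symm,
      ddRight_mul_of_ne _ (Or.inl rfl) _ (Or.inr rfl) hk.symm, sub_zero]
  · simp

theorem quadTerm_delta_left (h k : ArcBasis n) :
    quadTerm (dgStructure n) (mirrorStructure n) ((delta₁ n + delta₂ n) 1) (ddLeft n h k) =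
      ∑ m, (ddLeft n h k * ddRight n k m + ddLeft n h k * ddLeft n k m) := by
  have e : ∀ k' m, quadTerm (dgStructure n) (mirrorStructure n) (ddRight n k' m + ddLeft n k' m)
      (ddLeft n h k) = ddLeft n h k * ddRight n k' m + ddLeft n h k * ddLeft n k' m := by
    intro k' m
    rw [quadTerm_add]
    exact congrArg₂ (· + ·) (quadTerm_ddLeft _ _ h k) (quadTerm_ddLeft _ _ h k)
  rw [delta_apply]
  simp only [Pi.one_apply, one_smul, quadTerm_sum, e]
  rw [Finset.sum_eq_single k]
  · intro k' _ hk
    refine Finset.sum_eq_zero fun m _ => ?_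
    rw [ddRight_mul_of_ne _ (Or.inr rfl) _ (Or.inl rfl) hk.symm,
      ddRight_mul_of_ne _ (Or.inr rfl) _ (Or.inr rfl) hk.symm, add_zero]
  · simp

/-- The mixed products occur with opposite signs in the two orders and cancel by
`ddRight_mul_ddLeft`. -/
theorem sum_quadTerm (h : ArcBasis n) :
    ∑ k, quadTerm (dgStructure n) (mirrorStructure n) ((delta₁ n + delta₂ n) 1)
      (ddRight n h k + ddLeft n h k) =
      ∑ m, ((ddRight n * ddRight n) h m + (ddLeft n * ddLeft n) h m) := by
  have e1 := ddRight_mul_ddLeft n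
  simp only [map_add, quadTerm_delta_right, quadTerm_delta_left, Finset.sum_add_distrib,
    Finset.sum_sub_distrib]
  have e : ∀ A B : Matrix (ArcBasis n) (ArcBasis n) (FullAlg n ⊗[ℤ] FullAlg n),
      ∑ k, ∑ m, A h k * B k m = ∑ m, (A * B) h m := by
    intro A B
    rw [Finset.sum_comm]
    rfl
  rw [e, e, e, e, e1]
  abel

theorem map_d_ddRight (h k : ArcBasis n) :
    TensorProduct.map (dgStructure n).d ((mirrorStructure n).absId 1) (ddRight n h k) = 0 := by
  rw [ddRight, TensorProduct.map_tmul]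
  change diffl n _ ⊗ₜ _ = _
  rw [diffl_genMatrix_right, TensorProduct.zero_tmul]

theorem map_d_ddLeft (h k : ArcBasis n) :
    TensorProduct.map (dgStructure n).d ((mirrorStructure n).absId 1) (ddLeft n h k) =
      -(ddLeft n * ddLeft n) h k := by
  rw [ddLeft_mul_ddLeft, ddLeft, TensorProduct.map_tmul]
  have e : (mirrorStructure n).absId 1 (genMatrix right h.mirror k.mirror) =
      genMatrix right h.mirror k.mirror := absId_one_right _ _
  rw [e]
  change diffl n _ ⊗ₜ _ = _
  rw [diffl_genMatrix_left, TensorProduct.neg_tmul]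

theorem map_id_d_ddRight (h k : ArcBasis n) :
    TensorProduct.map LinearMap.id (mirrorStructure n).d (ddRight n h k) =
      -(ddRight n * ddRight n) h k := by
  rw [ddRight_mul_ddRight, ddRight, TensorProduct.map_tmul]
  change _ ⊗ₜ diffl n _ = _
  rw [diffl_genMatrix_left, TensorProduct.tmul_neg]
  rfl

theorem map_id_d_ddLeft (h k : ArcBasis n) :
    TensorProduct.map LinearMap.id (mirrorStructure n).d (ddLeft n h k) = 0 := by
  rw [ddLeft, TensorProduct.map_tmul]
  change _ ⊗ₜ diffl n _ = _
  rw [diffl_genMatrix_right, TensorProduct.tmul_zero]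

/-- Letters `b` are cycles, so each linear term sees only one half of `δ`: the differential of the
first factor contributes minus the square of `ddLeft`, that of the second factor minus the square of
`ddRight`. These cancel what is left of the quadratic term. -/
theorem relation_apply (h : ArcBasis n) :
    (∑ k, TensorProduct.map (dgStructure n).d ((mirrorStructure n).absId 1)
      (ddRight n h k + ddLeft n h k)) +
    (∑ k, TensorProduct.map LinearMap.id (mirrorStructure n).d (ddRight n h k + ddLeft n h k)) +
    ∑ k, quadTerm (dgStructure n) (mirrorStructure n) ((delta₁ n + delta₂ n) 1)
      (ddRight n h k + ddLeft n h k) = 0 := by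
  rw [sum_quadTerm, ← Finset.sum_add_distrib, ← Finset.sum_add_distrib]
  refine Finset.sum_eq_zero fun k _ => ?_
  rw [map_add, map_add, map_d_ddRight, map_d_ddLeft, map_id_d_ddRight, map_id_d_ddLeft]
  abel

theorem linearMap_delta (f : FullAlg n ⊗[ℤ] FullAlg n →ₗ[ℤ] FullAlg n ⊗[ℤ] FullAlg n)
    (r : ArcBasis n → ℤ) : f ((delta₁ n + delta₂ n) r) =
      ∑ h, r h • ∑ k, f (ddRight n h k + ddLeft n h k) := by
  rw [delta_apply, map_sum]
  refine Finset.sum_congr rfl fun h _ => ?_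
  rw [← Finset.smul_sum, ← map_sum]
  exact f.map_smul _ _

theorem eq_linearMap_delta (f : FullAlg n ⊗[ℤ] FullAlg n →ₗ[ℤ] FullAlg n ⊗[ℤ] FullAlg n)
    (r s : ArcBasis n → ℤ) (hR : ∀ h k, f (ddRight n h k) = r h • ddRight n h k)
    (hL : ∀ h k, f (ddLeft n h k) = r h • ddLeft n h k) :
    (delta₁ n + delta₂ n) (r * s) = f ((delta₁ n + delta₂ n) s) := by
  rw [linearMap_delta, delta_apply]
  refine Finset.sum_congr rfl fun h _ => ?_
  rw [Finset.smul_sum]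
  refine Finset.sum_congr rfl fun k _ => ?_
  rw [map_add, hR, hL, ← smul_add, smul_smul, Pi.mul_apply, mul_comm]

theorem isRankOneDD (n : ℕ) :
    IsRankOneDD (dgStructure n) (mirrorStructure n) (delta₁ n + delta₂ n) where
  mem_tensorR r := by
    rw [delta_apply]
    refine sum_mem fun h _ => sum_mem fun k _ => Submodule.smul_mem _ _ (add_mem ?_ ?_)
    · exact ⟨_, balance_tmul (genMatrix_right_mul_idem h k) (genMatrix_left_mul_idem h k)⟩
    · exact ⟨_, balance_tmul (genMatrix_left_mul_idem h.mirror k.mirror)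
        (genMatrix_right_mul_idem h.mirror k.mirror)⟩
  left_linear r s := by
    refine eq_linearMap_delta _ r s (fun h k => ?_) fun h k => ?_
    · exact congrArg (· ⊗ₜ[ℤ] _) (coeff_mul_of_idem (idem_mul_genMatrix_right h k) r)
    · exact congrArg (· ⊗ₜ[ℤ] _)
        (coeff_mul_of_idem (h := h) (idem_mul_genMatrix_left h.mirror k.mirror) r)
  right_linear r s := by
    rw [mul_comm]
    refine eq_linearMap_delta _ r s (fun h k => ?_) fun h k => ?_
    · refine (congrArg (_ ⊗ₜ[ℤ] ·)
        (mirror_coeff_mul_of_idem (idem_mul_genMatrix_left h k) r)).trans ?_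
      exact TensorProduct.tmul_smul _ _ _
    · refine (congrArg (_ ⊗ₜ[ℤ] ·)
        (mirror_coeff_mul_of_idem (idem_mul_genMatrix_right h.mirror k.mirror) r)).trans ?_
      exact TensorProduct.tmul_smul _ _ _
  degree r := by
    rw [delta_apply]
    refine sum_mem fun h _ => sum_mem fun k _ => Submodule.smul_mem _ _ (add_mem ?_ ?_)
    · exact Submodule.subset_span ⟨_, _, _, _, genMatrix_right_mem h k, genMatrix_left_mem h k,
        by simp, rfl⟩
    · exact Submodule.subset_span ⟨_, _, _, _, genMatrix_left_mem h.mirror k.mirror,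
        genMatrix_right_mem h.mirror k.mirror, by simp, rfl⟩
  relation r := by
    change _ + _ + quadTerm (dgStructure n) (mirrorStructure n) ((delta₁ n + delta₂ n) 1) _ = 0
    rw [linearMap_delta, linearMap_delta, linearMap_delta]
    rw [← Finset.sum_add_distrib, ← Finset.sum_add_distrib]
    refine Finset.sum_eq_zero fun h _ => ?_
    rw [← smul_add, ← smul_add, relation_apply, smul_zero]

end FullAlg

theorem mainTheorem12 (n : ℕ) :
    ∃ S : DGStructure (ArcBasis n) (FullAlg n), IsFullDG S ∧
      DGStructure.IsRankOneDD S (S.mirror (mirrorPerm n)) (delta₁ n + delta₂ n) ∧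
      ∃ T : DGStructure (ArcBasis n) (GammaAlg n), IsGammaDG S T ∧
        DGStructure.IsRankOneDD T (T.mirror (mirrorPerm n))
          (projTensor n ∘ₗ (delta₁ n + delta₂ n)) :=
  ⟨FullAlg.dgStructure n, FullAlg.isFullDG n, FullAlg.isRankOneDD n,
    GammaAlg.dgStructure n, GammaAlg.isGammaDG n,
    (FullAlg.isRankOneDD n).map (GammaAlg.isHom_proj n) ((GammaAlg.isHom_proj n).mirror _)⟩
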